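/- **Setting.** Let $d\in\{2,3\}$, $\Omega=\mathbb T^d=(\mathbb R/\mathbb Z)^d$, $p>\frac{d+2}{2}$, $\nu_0>0$. For matrices put $A:B=\operatorname{tr}(AB)$ and $|A|=\sqrt{A:A}$; let $\mathbb S(d)$ be the space of symmetric $d\times d$ matrices and $e(v)=(\nabla v+\nabla v^T)/2$. Let $\tau^\pm:\mathbb S(d)\to\mathbb S(d)$ be locally Lipschitz with, for all $s,\hat s\in\mathbb S(d)$, $$\nu_0|s|^p\le\tau^\pm(s):s\le\nu_0^{-1}(1+|s|^p),\quad |\tau^\pm(s)|\le\nu_0^{-1}(1+|s|^{p-1}),\quad (\tau^\pm(s)-\tau^\pm(\hat s)):(s-\hat s)\ge0,$$ and put $\tau(\varphi,e)=\frac{1+\varphi}2\tau^+(e)+\frac{1-\varphi}2\tau^-(e)$. Let $\mathcal V$ be the set of smooth divergence-free vector fields on $\Omega$ and $V^{s,q}$ the closure of $\mathcal V$ in $W^{s,q}(\Omega)^d$; $(\cdot,\cdot)$ is the $L^2$ inner product. Let $W(r)=(1-r^2)^2/2$ and $\sigma=\int_{-1}^1\sqrt{2W}$. **Data.** Let $u_0\in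 V^{0,2}$. Let $s>\frac d2+1$ be an integer and let $\{\omega_k\}_{k\ge1}$ be a basis of $V^{s,2}$ (its linear span is dense) that is orthonormal in $V^{0,2}$; let $P_i$ be the $L^2$-orthogonal projection onto $V_i^{0,2}=\operatorname{span}\{\omega_1,\dots,\omega_i\}$. Let $\varepsilon_i>0$, $\varepsilon_i\to0$, $0<\gamma<\frac12$, let $\zeta\in C_c^\infty(\mathbb R^d)$ be radially symmetric and non-negative with $\operatorname{spt}\zeta\subset B_1(0)$ and $\int\zeta=1$, and put $\zeta^{\varepsilon_i}(x)=\varepsilon_i^{-\gamma}\zeta(x/\varepsilon_i^{\gamma/d})$. Let $\Omega^+(0)\subset\Omega$ be open with non-empty $C^1$ boundary, and let $\Omega^{i+}(0)$ be open sets with non-empty $C^3$ boundaries that converge to $\Omega^+(0)$ in the $C^1$ topology, that is, for all large $i$, $\Omega^{i+}(0)=(\mathrm{id}+\psi_i)(\Omega^+(0))$ with $\psi_i\in C^1(\Omega)^d$ and $\|\psi_i\|_{C^1}\to0$. Let $d^i$ be the signed distance to $\partial\Omega^{i+}(0)$, positive on $\Omega^{i+}(0)$, and let $b^i>0$ be such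 that $d^i$ is $C^3$ on the $b^i$-neighbourhood of $\partial\Omega^{i+}(0)$. Assume $\varepsilon_i/b^i\to0$, $\varepsilon_i^{-1}e^{-2b^i/\varepsilon_i}\to0$, and $\varepsilon_i^{j-1}\sup|\nabla^jd^i|\to0$ on these neighbourhoods for $j=2,3$. Let $h\in C^\infty(\mathbb R)$ be odd and monotone increasing with $h(r)=r$ for $0\le r\le\frac14$ and $h(r)=\frac12$ for $r>\frac12$, and put $\varphi_0^{\varepsilon_i}=\tanh\bigl(b^ih(d^i/b^i)/\varepsilon_i\bigr)$. **Approximate solutions.** For every $i\ge1$ let $(u^{\varepsilon_i},\varphi^{\varepsilon_i})$ be a weak solution on $\Omega\times[0,\infty)$ of $$\partial_tu^{\varepsilon_i}=P_i\Bigl(\operatorname{div}\tau(\varphi^{\varepsilon_i},e(u^{\varepsilon_i}))-u^{\varepsilon_i}\cdot\nabla u^{\varepsilon_i}-\tfrac{\varepsilon_i}{\sigma}\operatorname{div}\bigl((\nabla\varphi^{\varepsilon_i}\otimes\nabla\varphi^{\varepsilon_i})*\zeta^{\varepsilon_i}\bigr)\Bigr),\qquad u^{\varepsilon_i}(\cdot,t)\in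 V_i^{0,2},$$ $$\partial_t\varphi^{\varepsilon_i}+(u^{\varepsilon_i}*\zeta^{\varepsilon_i})\cdot\nabla\varphi^{\varepsilon_i}=\Delta\varphi^{\varepsilon_i}-\frac{W'(\varphi^{\varepsilon_i})}{\varepsilon_i^2},\qquad u^{\varepsilon_i}(\cdot,0)=P_iu_0,\quad\varphi^{\varepsilon_i}(\cdot,0)=\varphi_0^{\varepsilon_i},$$ with $u^{\varepsilon_i}\in L^\infty([0,\infty);V^{0,2})\cap L^p_{loc}([0,\infty);V^{1,p})$, $|\varphi^{\varepsilon_i}|\le1$, $\varphi^{\varepsilon_i}\in L^\infty([0,\infty);C^3(\Omega))$ and $\partial_t\varphi^{\varepsilon_i}\in L^\infty([0,\infty);C^1(\Omega))$. (The first equation means that, for each $j\le i$ and $t\ge0$, $(u^{\varepsilon_i}(t),\omega_j)-(u_0,\omega_j)$ is the integral over $[0,t]$ of the right-hand side tested with $\omega_j$, the divergences being integrated by parts; the second holds for a.e. $t$ and all $x$.) **Proposition.** There exist a subsequence (denoted by the same index) and $u\in L^\infty([0,\infty);V^{0,2})\cap L^p_{loc}([0,\infty);V^{1,p})$ such that for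 every $0<T<\infty$ $$u^{\varepsilon_i}*\zeta^{\varepsilon_i}\rightharpoonup u\ \text{ weakly in }L^p([0,T];W^{1,p}(\Omega)^d),\qquad u^{\varepsilon_i}*\zeta^{\varepsilon_i}\to u\ \text{ strongly in }L^2([0,T];L^2(\Omega)^d).$$ -/

import Mathlib

open MeasureTheory Filter Topology Set
open scoped ContDiff ENNReal Convolution

noncomputable section

namespace TwoPhaseFlow

/-! ### The flat torus

Functions on `𝕋ᵈ = (ℝ/ℤ)ᵈ` are functions on `ℝᵈ` with period one in every coordinate direction,
and integrals over `𝕋ᵈ` are integrals over the unit cell `[0,1)ᵈ`. -/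

abbrev Vec (d : ℕ) : Type := EuclideanSpace ℝ (Fin d)

/-- The `a`-th standard basis vector. -/
def unitVec {d : ℕ} (a : Fin d) : Vec d := EuclideanSpace.single a (1 : ℝ)

/-- Periodicity: `f` is a function on the torus. For a set `A`, use the function `x ↦ (x ∈ A)`. -/
def IsTorusFn {d : ℕ} {α : Type*} (f : Vec d → α) : Prop :=
  ∀ (a : Fin d) (x : Vec d), f (x + unitVec a) = f x

def unitCell (d : ℕ) : Set (Vec d) := {x | ∀ a, x a ∈ Ico (0 : ℝ) 1}

/-- Lebesgue measure on the torus. -/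
def cell (d : ℕ) : Measure (Vec d) := volume.restrict (unitCell d)

theorem unitCell_subset_compact (d : ℕ) : ∃ K : Set (Vec d), IsCompact K ∧ unitCell d ⊆ K := by
  refine ⟨Metric.closedBall 0 (√ (d : ℝ)), isCompact_closedBall _ _, fun x hx => ?_⟩
  rw [mem_closedBall_zero_iff, EuclideanSpace.norm_eq]
  refine Real.sqrt_le_sqrt ?_
  calc ∑ a, ‖x a‖ ^ 2 ≤ ∑ _a : Fin d, (1 : ℝ) := by
        refine Finset.sum_le_sum fun a _ => ?_
        have h := hx a
        rw [Real.norm_eq_abs, sq_abs]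
        nlinarith [h.1, h.2]
    _ = d := by simp

instance (d : ℕ) : IsFiniteMeasure (cell d) := by
  obtain ⟨K, hK, h⟩ := unitCell_subset_compact d
  exact ⟨by
    rw [cell, Measure.restrict_apply_univ]
    exact (measure_mono h).trans_lt hK.measure_lt_top⟩

/-! ### Sobolev spaces of vector fields on the torus -/

section Sobolev

variable (d s : ℕ) (q : ℝ≥0∞) [Fact (1 ≤ q)]

/-- Families `(G₀, …, G_s)` with `G_j` an `L^q` field of `j`-linear maps on the torus, normed by
`(∑ⱼ ‖G_j‖_{L^q}^q)^{1/q}`. -/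
abbrev JetSpace : Type :=
  PiLp q (fun j : Fin (s + 1) => Lp ((Vec d) [×(j : ℕ)]→L[ℝ] (Vec d)) q (cell d))

variable {d s q}

/-- `G_j` is the weak `j`-th derivative of `G₀` on the torus, for every `j ≤ s`. -/
def IsWeakJet (G : JetSpace d s q) : Prop :=
  ∀ (j : Fin (s + 1)) (m : Fin (j : ℕ) → Vec d) (η : Vec d → ℝ),
    ContDiff ℝ ∞ η → IsTorusFn η →
      ∫ x, η x • (G j x) m ∂(cell d)
        = (-1 : ℝ) ^ (j : ℕ) • ∫ x, (iteratedFDeriv ℝ (j : ℕ) η x m) • (G 0 x) 0 ∂(cell d)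

theorem integrable_smul_component (G : JetSpace d s q) (j : Fin (s + 1))
    (m : Fin (j : ℕ) → Vec d) {η : Vec d → ℝ} (hη : Continuous η) :
    Integrable (fun x => η x • (G j x) m) (cell d) := by
  have h1 : Integrable (fun x => G j x) (cell d) := (Lp.memLp (G j)).integrable Fact.out
  have h2 : Integrable (fun x => (G j x) m) (cell d) :=
    (ContinuousMultilinearMap.apply ℝ (fun _ : Fin (j : ℕ) => Vec d) (Vec d) m).integrable_comp h1
  obtain ⟨K, hK, hsub⟩ := unitCell_subset_compact d
  obtain ⟨C, hC⟩ := hK.exists_bound_of_continuousOn hη.continuousOn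
  refine h2.bdd_smul C hη.aestronglyMeasurable ?_
  have hms : MeasurableSet (unitCell d) := by
    have : unitCell d = ⋂ a, (fun x : Vec d => x a) ⁻¹' Ico (0 : ℝ) 1 := by
      ext x; simp [unitCell]
    rw [this]
    exact MeasurableSet.iInter fun a => (by fun_prop : Measurable fun x : Vec d => x a)
      measurableSet_Ico
  exact (ae_restrict_iff' hms).2 (Eventually.of_forall fun x hx => hC x (hsub hx))

variable (d s q)

/-- The Sobolev space `W^{s,q}(𝕋ᵈ)ᵈ`, an element being stored with its weak derivatives. -/
def sobolev : Submodule ℝ (JetSpace d s q) where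
  carrier := {G | IsWeakJet G}
  zero_mem' := by
    intro j m η hη _
    have h (i : Fin (s + 1)) := Lp.coeFn_zero ((Vec d) [×(i : ℕ)]→L[ℝ] (Vec d)) q (cell d)
    have e1 : ∫ x, η x • ((0 : JetSpace d s q) j x) m ∂(cell d) = 0 := by
      rw [← integral_zero (Vec d) (Vec d) (μ := cell d)]
      refine integral_congr_ae ?_
      filter_upwards [h j] with x hx
      simp only [PiLp.zero_apply, hx]
      simp
    have e2 : ∫ x, (iteratedFDeriv ℝ (j : ℕ) η x m) • ((0 : JetSpace d s q) 0 x) 0 ∂(cell d)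
        = 0 := by
      rw [← integral_zero (Vec d) (Vec d) (μ := cell d)]
      refine integral_congr_ae ?_
      filter_upwards [h 0] with x hx
      simp only [PiLp.zero_apply, hx, Pi.zero_apply]
      exact smul_zero _
    rw [e1, e2, smul_zero]
  add_mem' := by
    intro F G hF hG j m η hη hp
    have hc : Continuous fun x => iteratedFDeriv ℝ (j : ℕ) η x m :=
      (ContinuousMultilinearMap.apply ℝ (fun _ : Fin (j : ℕ) => Vec d) ℝ m).continuous.comp
        (hη.continuous_iteratedFDeriv (by exact_mod_cast le_top))
    have e1 : ∫ x, η x • ((F + G) j x) m ∂(cell d)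
        = ∫ x, (η x • (F j x) m + η x • (G j x) m) ∂(cell d) := by
      refine integral_congr_ae ?_
      filter_upwards [Lp.coeFn_add (F j) (G j)] with x hx
      simp only [PiLp.add_apply, hx, Pi.add_apply, add_apply, smul_add]
    have e2 : ∫ x, (iteratedFDeriv ℝ (j : ℕ) η x m) • ((F + G) 0 x) 0 ∂(cell d)
        = ∫ x, ((iteratedFDeriv ℝ (j : ℕ) η x m) • (F 0 x) 0
          + (iteratedFDeriv ℝ (j : ℕ) η x m) • (G 0 x) 0) ∂(cell d) := by
      refine integral_congr_ae ?_
      filter_upwards [Lp.coeFn_add (F 0) (G 0)] with x hx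
      simp only [PiLp.add_apply, hx, Pi.add_apply, add_apply, smul_add]
    rw [e1, e2, integral_add (integrable_smul_component F j m hη.continuous)
      (integrable_smul_component G j m hη.continuous),
      integral_add (integrable_smul_component F 0 0 hc) (integrable_smul_component G 0 0 hc),
      hF j m η hη hp, hG j m η hη hp, smul_add]
  smul_mem' := by
    intro c G hG j m η hη hp
    have e1 : ∫ x, η x • ((c • G) j x) m ∂(cell d) = c • ∫ x, η x • (G j x) m ∂(cell d) := by
      rw [← integral_smul]
      refine integral_congr_ae ?_
      filter_upwards [Lp.coeFn_smul c (G j)] with x hx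
      simp only [PiLp.smul_apply, hx, Pi.smul_apply, smul_apply]
      exact smul_comm _ _ _
    have e2 : ∫ x, (iteratedFDeriv ℝ (j : ℕ) η x m) • ((c • G) 0 x) 0 ∂(cell d)
        = c • ∫ x, (iteratedFDeriv ℝ (j : ℕ) η x m) • (G 0 x) 0 ∂(cell d) := by
      rw [← integral_smul]
      refine integral_congr_ae ?_
      filter_upwards [Lp.coeFn_smul c (G 0)] with x hx
      simp only [PiLp.smul_apply, hx, Pi.smul_apply, smul_apply]
      exact smul_comm _ _ _
    rw [e1, e2, hG j m η hη hp]
    exact smul_comm _ _ _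

abbrev SobolevSpace : Type := ↥(sobolev d s q)

variable {d s q}

/-- `w` is the class of the vector field `f`. -/
def Represents (w : SobolevSpace d s q) (f : Vec d → Vec d) : Prop :=
  ∀ᵐ x ∂(cell d), (w.1 0 x) 0 = f x

/-- The space `𝒱` of smooth divergence-free vector fields on the torus. -/
def SmoothSolenoidal (d : ℕ) : Set (Vec d → Vec d) :=
  {v | ContDiff ℝ ∞ v ∧ IsTorusFn v ∧ ∀ x, ∑ a, fderiv ℝ v x (unitVec a) a = 0}

variable (d s q)

/-- `V^{s,q}`: the closure of `𝒱` in the norm of `W^{s,q}(𝕋ᵈ)ᵈ`. -/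
def V : Set (SobolevSpace d s q) :=
  closure {w | ∃ v ∈ SmoothSolenoidal d, Represents w v}

/-- The vector field `f` belongs to `V^{s,q}`. -/
def MemV (f : Vec d → Vec d) : Prop := ∃ w ∈ V d s q, Represents w f

/-- The time-dependent vector field `f` belongs to the Bochner space `L^r(J; V^{s,q})`. -/
def MemBochnerV (r : ℝ≥0∞) (J : Set ℝ) (f : ℝ → Vec d → Vec d) : Prop :=
  ∃ U : ℝ → SobolevSpace d s q, MemLp U r (volume.restrict J) ∧
    ∀ᵐ t ∂(volume.restrict J), U t ∈ V d s q ∧ Represents (U t) (f t)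

variable {d s q}

/-- The element `F` of the Bochner space `L^r(J; W^{s,q})` is the class of `f`. -/
def BochnerRepresents {r : ℝ≥0∞} {J : Set ℝ} (F : Lp (SobolevSpace d s q) r (volume.restrict J))
    (f : ℝ → Vec d → Vec d) : Prop :=
  ∀ᵐ t ∂(volume.restrict J), Represents (F t) (f t)

variable (d s q)

/-- `fₙ → g` in the norm of `L^r(J; W^{s,q})`. -/
def TendstoStrongly (r : ℝ≥0∞) [Fact (1 ≤ r)] (J : Set ℝ) (f : ℕ → ℝ → Vec d → Vec d)
    (g : ℝ → Vec d → Vec d) : Prop :=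
  ∃ (F : ℕ → Lp (SobolevSpace d s q) r (volume.restrict J))
    (G : Lp (SobolevSpace d s q) r (volume.restrict J)),
    (∀ n, BochnerRepresents (F n) (f n)) ∧ BochnerRepresents G g ∧ Tendsto F atTop (𝓝 G)

/-- `fₙ ⇀ g` weakly in the Banach space `L^r(J; W^{s,q})`: convergence is tested against all
continuous linear functionals. -/
def TendstoWeakly (r : ℝ≥0∞) [Fact (1 ≤ r)] (J : Set ℝ) (f : ℕ → ℝ → Vec d → Vec d)
    (g : ℝ → Vec d → Vec d) : Prop :=
  ∃ (F : ℕ → Lp (SobolevSpace d s q) r (volume.restrict J))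
    (G : Lp (SobolevSpace d s q) r (volume.restrict J)),
    (∀ n, BochnerRepresents (F n) (f n)) ∧ BochnerRepresents G g ∧
      ∀ ℓ : StrongDual ℝ (Lp (SobolevSpace d s q) r (volume.restrict J)),
        Tendsto (fun n => ℓ (F n)) atTop (𝓝 (ℓ G))

end Sobolev

/-! ### Stress tensors -/

/-- Symmetric `d × d` matrices. -/
abbrev SymMat (d : ℕ) : Type := {A : Matrix (Fin d) (Fin d) ℝ // A.IsSymm}

/-- `A : B = tr (A B)`. -/
def dot {d : ℕ} (A B : Matrix (Fin d) (Fin d) ℝ) : ℝ := (A * B).trace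

/-- `|A| = √(A : A)` (used for symmetric matrices). -/
def matNorm {d : ℕ} (A : Matrix (Fin d) (Fin d) ℝ) : ℝ := √ (dot A A)

/-- The structural assumptions on the stress of one of the two fluids. -/
structure IsStressLaw {d : ℕ} (p ν₀ : ℝ) (τ : SymMat d → SymMat d) : Prop where
  locallyLipschitz : ∀ s₀ : SymMat d, ∃ r > 0, ∃ K : ℝ, ∀ s s' : SymMat d,
    matNorm (s.1 - s₀.1) < r → matNorm (s'.1 - s₀.1) < r →
      matNorm ((τ s).1 - (τ s').1) ≤ K * matNorm (s.1 - s'.1)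
  coercive : ∀ s, ν₀ * matNorm s.1 ^ p ≤ dot (τ s).1 s.1
  upper : ∀ s, dot (τ s).1 s.1 ≤ ν₀⁻¹ * (1 + matNorm s.1 ^ p)
  growth : ∀ s, matNorm (τ s).1 ≤ ν₀⁻¹ * (1 + matNorm s.1 ^ (p - 1))
  monotone : ∀ s s', 0 ≤ dot ((τ s).1 - (τ s').1) (s.1 - s'.1)

/-- `∇v(x)`, with entry `∂_a v_b` in position `(a, b)`. -/
def grad {d : ℕ} (v : Vec d → Vec d) (x : Vec d) : Matrix (Fin d) (Fin d) ℝ :=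
  Matrix.of fun a b => fderiv ℝ v x (unitVec a) b

/-- `e(v)(x) = (∇v + ∇vᵀ)/2`. -/
def symGrad {d : ℕ} (v : Vec d → Vec d) (x : Vec d) : SymMat d :=
  ⟨(1 / 2 : ℝ) • (grad v x + (grad v x).transpose), by
    rw [Matrix.IsSymm, Matrix.transpose_smul, Matrix.transpose_add, Matrix.transpose_transpose,
      add_comm]⟩

/-- `τ(φ, e) = (1+φ)/2 τ⁺(e) + (1-φ)/2 τ⁻(e)`. -/
def mixedStress {d : ℕ} (τp τm : SymMat d → SymMat d) (φ : ℝ) (e : SymMat d) :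
    Matrix (Fin d) (Fin d) ℝ :=
  ((1 + φ) / 2) • (τp e).1 + ((1 - φ) / 2) • (τm e).1

/-! ### Mollifier, double well, Galerkin basis -/

structure IsMollifier {d : ℕ} (ζ : Vec d → ℝ) : Prop where
  smooth : ContDiff ℝ ∞ ζ
  nonneg : ∀ x, 0 ≤ ζ x
  radial : ∀ x y, ‖x‖ = ‖y‖ → ζ x = ζ y
  compact : HasCompactSupport ζ
  support : tsupport ζ ⊆ Metric.ball 0 1
  integral_one : ∫ x, ζ x = 1

/-- `ζ^ε(x) = ε^{-γ} ζ(x / ε^{γ/d})`. -/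
def rescale {d : ℕ} (γ : ℝ) (ζ : Vec d → ℝ) (ε : ℝ) (x : Vec d) : ℝ :=
  (1 / ε ^ γ) * ζ ((1 / ε ^ (γ / (d : ℝ))) • x)

/-- `v * k`, convolution over `ℝᵈ` of a scalar kernel with a periodic vector field. -/
def mollify {d : ℕ} (k : Vec d → ℝ) (v : Vec d → Vec d) : Vec d → Vec d :=
  k ⋆[ContinuousLinearMap.lsmul ℝ ℝ, volume] v

/-- `W(r) = (1 - r²)²/2`. -/
def doubleWell (r : ℝ) : ℝ := (1 - r ^ 2) ^ 2 / 2

/-- `σ = ∫_{-1}^{1} √(2 W)`. -/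
def surfaceConst : ℝ := ∫ r in (-1 : ℝ)..1, √ (2 * doubleWell r)

/-- `(v, w)`, the `L²` inner product on the torus. -/
def innerL2 {d : ℕ} (v w : Vec d → Vec d) : ℝ := ∫ x, inner ℝ (v x) (w x) ∂(cell d)

/-- `om` is a basis of `V^{s,2}` which is orthonormal in `V^{0,2}`. Each basis element is given by
its continuously differentiable representative. -/
structure IsGalerkinBasis {d : ℕ} (s : ℕ) (om : ℕ → Vec d → Vec d) : Prop where
  periodic : ∀ k, IsTorusFn (om k)
  contDiff : ∀ k, ContDiff ℝ 1 (om k)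
  basis : ∃ w : ℕ → SobolevSpace d s 2, (∀ k, Represents (w k) (om k)) ∧
    closure (Submodule.span ℝ (range w) : Set (SobolevSpace d s 2)) = V d s 2
  orthonormal : ∀ k l, innerL2 (om k) (om l) = if k = l then 1 else 0

/-! ### Initial data of the phase field -/

/-- `A` has boundary of class `C^k`: near each boundary point `A` is the positivity set of a `C^k`
function with non-vanishing differential. -/
def HasCkBoundary {d : ℕ} (k : ℕ) (A : Set (Vec d)) : Prop :=
  ∀ x ∈ frontier A, ∃ U : Set (Vec d), IsOpen U ∧ x ∈ U ∧ ∃ g : Vec d → ℝ,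
    ContDiffOn ℝ k g U ∧ fderiv ℝ g x ≠ 0 ∧ A ∩ U = {y ∈ U | 0 < g y}

/-- (The lift to `ℝᵈ` of) an open subset of the torus with non-empty `C^k` boundary. -/
structure IsCkDomain {d : ℕ} (k : ℕ) (A : Set (Vec d)) : Prop where
  isOpen : IsOpen A
  periodic : IsTorusFn (fun x => x ∈ A)
  boundary_nonempty : (frontier A).Nonempty
  boundary : HasCkBoundary k A

/-- `Aᵢ → A` in the `C¹` topology: eventually `Aᵢ` is the image of `A` under a `C¹` map of the torus,
and these maps tend to the identity in `C¹`. -/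
def TendstoC1 {d : ℕ} (A : ℕ → Set (Vec d)) (A₀ : Set (Vec d)) : Prop :=
  ∃ ψ : ℕ → Vec d → Vec d, (∀ i, ContDiff ℝ 1 (ψ i) ∧ IsTorusFn (ψ i)) ∧
    (∀ η > 0, ∀ᶠ i in atTop, ∀ x, ‖ψ i x‖ ≤ η ∧ ‖fderiv ℝ (ψ i) x‖ ≤ η) ∧
    ∀ᶠ i in atTop, A i = (fun x => x + ψ i x) '' A₀

open Classical in
/-- The signed distance to the boundary of `A`, positive on `A`. -/
def signedDist {d : ℕ} (A : Set (Vec d)) (x : Vec d) : ℝ :=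
  if x ∈ A then Metric.infDist x (frontier A) else -Metric.infDist x (frontier A)

/-- The cut-off profile `h` of the signed distance. -/
structure IsProfile (h : ℝ → ℝ) : Prop where
  smooth : ContDiff ℝ ∞ h
  monotone : Monotone h
  eq_self : ∀ r, 0 ≤ r → r ≤ 1 / 4 → h r = r
  eq_half : ∀ r, 1 / 2 < r → h r = 1 / 2
  odd : ∀ r, h (-r) = -h r

/-- `φ₀ = tanh (b h(dist/b) / ε)`. -/
def initialPhase {d : ℕ} (h : ℝ → ℝ) (ε b : ℝ) (A : Set (Vec d)) (x : Vec d) : ℝ :=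
  Real.tanh (b * h (signedDist A x / b) / ε)

/-- The domains `Aᵢ` with `C³` boundary approximate `A₀` in the `C¹` topology, the signed distance
to `∂Aᵢ` is `C³` in the `bᵢ`-neighbourhood of `∂Aᵢ`, and `εᵢ` tends to `0` fast enough with respect
to these data. -/
structure IsPhaseApproximation {d : ℕ} (ε b : ℕ → ℝ) (A : ℕ → Set (Vec d)) (A₀ : Set (Vec d)) :
    Prop where
  domain : ∀ i, IsCkDomain 3 (A i)
  tendsto : TendstoC1 A A₀
  b_pos : ∀ i, 0 < b i
  regular : ∀ i, ContDiffOn ℝ 3 (signedDist (A i)) {x | Metric.infDist x (frontier (A i)) < b i}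
  ratio : Tendsto (fun i => ε i / b i) atTop (𝓝 0)
  tail : Tendsto (fun i => (ε i)⁻¹ * Real.exp (-2 * b i / ε i)) atTop (𝓝 0)
  derivatives : ∀ j : ℕ, j = 2 ∨ j = 3 → ∀ η > 0, ∀ᶠ i in atTop,
    ∀ x, Metric.infDist x (frontier (A i)) < b i →
      ε i ^ (j - 1) * ‖iteratedFDeriv ℝ j (signedDist (A i)) x‖ ≤ η

/-! ### The approximate problem -/

/-- `(∇φ ⊗ ∇φ) * k`, entry by entry. -/
def capillaryStress {d : ℕ} (k φ : Vec d → ℝ) (x : Vec d) : Matrix (Fin d) (Fin d) ℝ :=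
  Matrix.of fun a b =>
    (k ⋆[ContinuousLinearMap.lsmul ℝ ℝ, volume]
      (fun y => fderiv ℝ φ y (unitVec a) * fderiv ℝ φ y (unitVec b))) x

/-- The right-hand side of the momentum equation at a fixed time, tested with the field `w` and
integrated by parts:
`-∫ τ(φ,e(v)) : e(w) - ∫ (v·∇v)·w + (ε/σ) ∫ ((∇φ⊗∇φ) * k) : ∇w`. -/
def momentumForm {d : ℕ} (τp τm : SymMat d → SymMat d) (k : Vec d → ℝ) (ε : ℝ)
    (v : Vec d → Vec d) (φ : Vec d → ℝ) (w : Vec d → Vec d) : ℝ :=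
  -(∫ x, dot (mixedStress τp τm (φ x) (symGrad v x)) (symGrad w x).1 ∂(cell d))
    - innerL2 (fun x => fderiv ℝ v x (v x)) w
    + ε / surfaceConst * ∫ x, dot (capillaryStress k φ x) (grad w x) ∂(cell d)

/-- `f ∈ L^∞([0,∞); C^m(𝕋ᵈ))`. -/
def EssBoundedC {d : ℕ} (m : ℕ) (f : ℝ → Vec d → ℝ) : Prop :=
  ∃ M : ℝ, ∀ᵐ t ∂(volume.restrict (Ici (0 : ℝ))), IsTorusFn (f t) ∧ ContDiff ℝ m (f t) ∧
    ∀ j ≤ m, ∀ x, ‖iteratedFDeriv ℝ j (f t) x‖ ≤ M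

/-- `(u, φ)` is a global weak solution of the approximate problem with parameter `ε`, mollification
kernel `k` and Galerkin space `span {om₀, …, om_N}`, with initial velocity the projection of `u₀` to
that space and initial phase field `φ₀`. -/
structure IsApproxSolution {d : ℕ} (p : ℝ) [Fact (1 ≤ ENNReal.ofReal p)]
    (τp τm : SymMat d → SymMat d) (k : Vec d → ℝ) (ε : ℝ) (om : ℕ → Vec d → Vec d) (N : ℕ)
    (u₀ : Vec d → Vec d) (φ₀ : Vec d → ℝ) (u : ℝ → Vec d → Vec d) (φ : ℝ → Vec d → ℝ) : Prop where
  velocity_mem_span : ∀ t, 0 ≤ t → u t ∈ Submodule.span ℝ (om '' Iic N)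
  velocity_bounded : MemBochnerV d 0 2 ⊤ (Ici 0) u
  velocity_integrable : ∀ T : ℝ, 0 < T →
    MemBochnerV d 1 (ENNReal.ofReal p) (ENNReal.ofReal p) (Icc 0 T) u
  momentum_integrable : ∀ j ≤ N, ∀ T : ℝ, 0 < T →
    IntervalIntegrable (fun r => momentumForm τp τm k ε (u r) (φ r) (om j)) volume 0 T
  momentum : ∀ j ≤ N, ∀ t, 0 ≤ t →
    innerL2 (u t) (om j) = innerL2 u₀ (om j)
      + ∫ r in (0 : ℝ)..t, momentumForm τp τm k ε (u r) (φ r) (om j)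
  phase_periodic : ∀ t, 0 ≤ t → IsTorusFn (φ t)
  phase_le_one : ∀ t, 0 ≤ t → ∀ x, |φ t x| ≤ 1
  phase_regular : EssBoundedC 3 φ
  phase_equation : ∃ φ' : ℝ → Vec d → ℝ, EssBoundedC 1 φ' ∧
    (∀ x, ∀ t, 0 ≤ t → IntervalIntegrable (fun r => φ' r x) volume 0 t ∧
      φ t x = φ₀ x + ∫ r in (0 : ℝ)..t, φ' r x) ∧
    ∀ᵐ t ∂(volume.restrict (Ici (0 : ℝ))), ∀ x,
      φ' t x + fderiv ℝ (φ t) x (mollify k (u t) x)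
        = Laplacian.laplacian (φ t) x - deriv doubleWell (φ t x) / ε ^ 2

end TwoPhaseFlow

end

/-!
The proof has three ingredients: bounds that are uniform in the index, compactness of the
Galerkin coefficients in time, and a passage from coefficients to norms.

*Uniform bounds.* Testing the velocity equation with the velocity and the phase equation with the
chemical potential, the work of the capillary force on the flow cancels the work of the transport
on the interface (`power_balance`), because the same even kernel regularises both. Hence the
sum of kinetic and interfacial energy decreases at least by the viscous dissipation
(`IsApproxSolution.energy_estimate`). The interfacial energy of the initial data is bounded
uniformly, since the profile `tanh` of the signed distance lives in a layer whose volume is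
proportional to its width: a neighbourhood of a `C¹` boundary of width `r` has volume at most a
constant times `r`, with a constant that survives small `C¹` perturbations
(`eventually_measure_infDist_lt_le`, `exists_initial_energy_bound`). The dissipation controls only
the symmetric gradient; Korn's inequality (`korn`) and the Poincaré inequality turn this into a bound
in `L^∞ L² ∩ L^p W^{1,p}`. Korn's inequality in `L^p` on the torus is reduced to the `L^p`
boundedness of second order Riesz transforms. For trigonometric polynomials that follows
from the heat flow and a Bellman function whose Hessian dominates the bilinear form of the gradients
(`bellQ_ge`), so no singular integral theory is used.

*Compactness in time.* For each fixed `j` the coefficients `(u^i(t), ω_j)` are equicontinuous in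
`t`, since the tested right-hand side is bounded by the energy and by the power `p - 1 < p` of the
symmetric gradient (`exists_abs_momentumForm_le`, `exists_isBoundedFamily`). A diagonal subsequence
converges in all coefficients, at all times (`IsBoundedFamily.exists_subsequence`).

*Limits.* Weak convergence of the slices makes their convolution with a fixed kernel converge
pointwise, hence strongly (`tendsto_conv`), while the error of a mollification is at most its radius
times the gradient. Therefore the mollified velocities are Cauchy in `L²` of space-time
(`cauchy_conv`, `exists_strong_limit`); the finite measure `timeWeight` on `[0, ∞)`
treats all time intervals at once. For weak convergence in `L^p W^{1,p}` no reflexivity of Bochner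
spaces is assumed: a functional equivalent to the norm and satisfying Clarkson's inequality
(`IsClarkson`) forces minimising sequences of convex combinations to be Cauchy, which yields a weak
limit of every bounded sequence whose strong limit in a weaker space is known
(`IsClarkson.exists_weak_limit`, `tendstoWeakly`).
-/

noncomputable section

namespace TwoPhaseFlow

/-! ### Integration of periodic functions over the unit cell -/

theorem measurableSet_unitCell (d : ℕ) : MeasurableSet (unitCell d) := by
  have : unitCell d = ⋂ a, (fun x : Vec d => x a) ⁻¹' Ico (0 : ℝ) 1 := by
    ext x; simp [unitCell]
  rw [this]
  exact MeasurableSet.iInter fun a => (by fun_prop : Measurable fun x : Vec d => x a)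
    measurableSet_Ico

theorem unitCell_eq_fundamentalDomain (d : ℕ) :
    unitCell d = ZSpan.fundamentalDomain (EuclideanSpace.basisFun (Fin d) ℝ).toBasis := by
  ext x
  simp [unitCell, ZSpan.mem_fundamentalDomain]

theorem volume_unitCell (d : ℕ) : volume (unitCell d) = 1 := by
  have h : unitCell d = (MeasurableEquiv.toLp 2 (Fin d → ℝ)).symm ⁻¹'
      (Set.pi univ fun _ : Fin d => Ico (0 : ℝ) 1) := by
    ext x; simp [unitCell]
  rw [h, (PiLp.volume_preserving_ofLp (Fin d)).measure_preimage_equiv, Real.volume_pi_Ico]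
  simp

instance (d : ℕ) : IsProbabilityMeasure (cell d) :=
  ⟨by rw [cell, Measure.restrict_apply_univ, volume_unitCell]⟩

/-- The lattice `ℤᵈ` of periods. -/
abbrev lattice (d : ℕ) : AddSubgroup (Vec d) :=
  (Submodule.span ℤ (range (EuclideanSpace.basisFun (Fin d) ℝ).toBasis)).toAddSubgroup

theorem IsTorusFn.add_lattice {d : ℕ} {α : Type*} {f : Vec d → α} (hf : IsTorusFn f)
    (g : lattice d) (x : Vec d) : f (x + g) = f x := by
  obtain ⟨g, hg⟩ := g
  change g ∈ Submodule.span ℤ _ at hg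
  suffices ∀ x, f (x + g) = f x from this x
  induction hg using Submodule.span_induction with
  | mem y hy =>
    obtain ⟨a, rfl⟩ := hy
    intro x
    have := hf a x
    simpa [unitVec] using this
  | zero => simp
  | add y z _ _ hy hz => intro x; rw [← add_assoc, hz, hy]
  | smul n y _ hy =>
    have hn : ∀ (n : ℕ) x, f (x + (n : ℤ) • y) = f x := by
      intro n
      induction n with
      | zero => simp
      | succ n ih => intro x; rw [Nat.cast_succ, add_smul, one_smul, ← add_assoc, hy, ih]
    intro x
    obtain ⟨m, rfl | rfl⟩ := n.eq_nat_or_neg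
    · exact hn m x
    · have := hn m (x + (-(m : ℤ)) • y)
      rw [← this]; congr 1; simp

instance (d : ℕ) : Countable (lattice d) :=
  inferInstanceAs (Countable (Submodule.span ℤ
    (range (EuclideanSpace.basisFun (Fin d) ℝ).toBasis)))

theorem isAddFundamentalDomain_cell (d : ℕ) :
    IsAddFundamentalDomain (lattice d) (unitCell d) (volume : Measure (Vec d)) := by
  rw [unitCell_eq_fundamentalDomain]
  exact ZSpan.isAddFundamentalDomain' _ _

open scoped Pointwise in
theorem isAddFundamentalDomain_vadd_cell (d : ℕ) (z : Vec d) :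
    IsAddFundamentalDomain (lattice d) (z +ᵥ unitCell d) (volume : Measure (Vec d)) :=
  (isAddFundamentalDomain_cell d).vadd_of_comm z

open scoped Pointwise in
theorem IsTorusFn.setIntegral_vadd {d : ℕ} {E : Type*} [NormedAddCommGroup E] [NormedSpace ℝ E]
    {f : Vec d → E} (hf : IsTorusFn f) (z : Vec d) :
    ∫ x in z +ᵥ unitCell d, f x = ∫ x, f x ∂(cell d) := by
  refine (isAddFundamentalDomain_vadd_cell d z).setIntegral_eq (isAddFundamentalDomain_cell d) ?_
  intro g x
  rw [← hf.add_lattice g x, add_comm]; rfl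

open scoped Pointwise in
theorem IsTorusFn.integral_add_right {d : ℕ} {E : Type*} [NormedAddCommGroup E] [NormedSpace ℝ E]
    {f : Vec d → E} (hf : IsTorusFn f) (z : Vec d) :
    ∫ x, f (x + z) ∂(cell d) = ∫ x, f x ∂(cell d) := by
  rw [← hf.setIntegral_vadd z]
  have h := (measurePreserving_add_left (volume : Measure (Vec d)) z).setIntegral_image_emb
    (measurableEmbedding_addLeft z) f (unitCell d)
  have h2 : z +ᵥ unitCell d = (fun x => z + x) '' unitCell d := rfl
  rw [h2, h, cell]
  simp_rw [add_comm z]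

theorem IsTorusFn.exists_mem_unitCell {d : ℕ} (x : Vec d) :
    ∃ g : lattice d, x + g ∈ unitCell d := by
  obtain ⟨g, hg, -⟩ := ZSpan.exist_unique_vadd_mem_fundamentalDomain
    (EuclideanSpace.basisFun (Fin d) ℝ).toBasis x
  refine ⟨g, ?_⟩
  rw [unitCell_eq_fundamentalDomain, add_comm]
  exact hg

theorem IsTorusFn.exists_bound {d : ℕ} {E : Type*} [SeminormedAddCommGroup E]
    {f : Vec d → E} (hf : IsTorusFn f) (hc : Continuous f) : ∃ C, 0 ≤ C ∧ ∀ x, ‖f x‖ ≤ C := by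
  obtain ⟨K, hK, hsub⟩ := unitCell_subset_compact d
  obtain ⟨C, hC⟩ := hK.exists_bound_of_continuousOn hc.continuousOn
  refine ⟨max C 0, le_max_right _ _, fun x => ?_⟩
  obtain ⟨g, hg⟩ := exists_mem_unitCell x
  rw [← hf.add_lattice g x]
  exact (hC _ (hsub hg)).trans (le_max_left _ _)

theorem ae_cell_mem (d : ℕ) : ∀ᵐ x ∂(cell d), x ∈ unitCell d :=
  ae_restrict_mem (measurableSet_unitCell d)

theorem _root_.Continuous.integrable_cell {d : ℕ} {E : Type*} [NormedAddCommGroup E]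
    {f : Vec d → E} (hf : Continuous f) : Integrable f (cell d) := by
  obtain ⟨K, hK, hsub⟩ := unitCell_subset_compact d
  exact (hf.continuousOn.integrableOn_compact hK).mono_set hsub

theorem _root_.Continuous.memLp_cell {d : ℕ} {E : Type*} [NormedAddCommGroup E]
    {f : Vec d → E} (hf : Continuous f) (q : ℝ≥0∞) : MemLp f q (cell d) := by
  obtain ⟨K, hK, hsub⟩ := unitCell_subset_compact d
  obtain ⟨C, hC⟩ := hK.exists_bound_of_continuousOn hf.continuousOn
  refine MemLp.of_bound hf.aestronglyMeasurable C ?_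
  filter_upwards [ae_cell_mem d] with x hx using hC x (hsub hx)

theorem integral_cell_add {d : ℕ} {f g : Vec d → ℝ} (hf : Continuous f) (hg : Continuous g) :
    ∫ x, (f x + g x) ∂(cell d) = ∫ x, f x ∂(cell d) + ∫ x, g x ∂(cell d) :=
  integral_add hf.integrable_cell hg.integrable_cell

theorem integral_cell_sub {d : ℕ} {f g : Vec d → ℝ} (hf : Continuous f) (hg : Continuous g) :
    ∫ x, (f x - g x) ∂(cell d) = ∫ x, f x ∂(cell d) - ∫ x, g x ∂(cell d) :=
  integral_sub hf.integrable_cell hg.integrable_cell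

theorem integral_cell_sum {d : ℕ} {ι : Type*} (s : Finset ι) {f : ι → Vec d → ℝ}
    (hf : ∀ i, Continuous (f i)) :
    ∫ x, ∑ i ∈ s, f i x ∂(cell d) = ∑ i ∈ s, ∫ x, f i x ∂(cell d) :=
  integral_finsetSum _ fun i _ => (hf i).integrable_cell

theorem integral_cell_mono {d : ℕ} {f g : Vec d → ℝ} (hf : Continuous f) (hg : Continuous g)
    (h : ∀ x, f x ≤ g x) : ∫ x, f x ∂(cell d) ≤ ∫ x, g x ∂(cell d) :=
  integral_mono hf.integrable_cell hg.integrable_cell h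

section TorusFn

variable {d : ℕ} {E F : Type*} [NormedAddCommGroup E] [NormedSpace ℝ E]
  [NormedAddCommGroup F] [NormedSpace ℝ F]

theorem isTorusFn_fderiv {f : Vec d → E} (hf : IsTorusFn f) : IsTorusFn (fderiv ℝ f) := by
  intro a x
  have : f = fun y => f (y + unitVec a) := funext fun y => (hf a y).symm
  conv_rhs => rw [this]
  rw [fderiv_comp_add_right]

theorem IsTorusFn.comp {α β : Type*} {f : Vec d → α} (hf : IsTorusFn f) (g : α → β) :
    IsTorusFn fun x => g (f x) := fun a x => by simp only [hf a x]

theorem IsTorusFn.comp₂ {α β δ : Type*} {f : Vec d → α} {g : Vec d → β} (hf : IsTorusFn f)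
    (hg : IsTorusFn g) (h : α → β → δ) : IsTorusFn fun x => h (f x) (g x) :=
  fun a x => by simp only [hf a x, hg a x]

theorem IsTorusFn.comp_add_right {α : Type*} {f : Vec d → α} (hf : IsTorusFn f) (z : Vec d) :
    IsTorusFn fun x => f (x + z) := fun a x => by
  simpa only [add_right_comm] using hf a (x + z)

theorem IsTorusFn.integral_fderiv_apply_eq_zero [CompleteSpace E] {f : Vec d → E}
    (hp : IsTorusFn f) (hf : ContDiff ℝ 1 f) (e : Vec d) :
    ∫ x, fderiv ℝ f x e ∂(cell d) = 0 := by
  have hc : Continuous fun x => fderiv ℝ f x e :=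
    (hf.continuous_fderiv one_ne_zero).clm_apply continuous_const
  have hper : IsTorusFn fun x => fderiv ℝ f x e := (isTorusFn_fderiv hp).comp fun L => L e
  have h1 : ∀ x, ∫ h in (0 : ℝ)..1, fderiv ℝ f (x + h • e) e = f (x + e) - f x := by
    intro x
    have := intervalIntegral.integral_eq_sub_of_hasDerivAt (a := 0) (b := 1)
      (f := fun h : ℝ => f (x + h • e)) (f' := fun h => fderiv ℝ f (x + h • e) e)
      (fun h _ => ?_) ?_
    · simpa using this
    · have h2 : HasDerivAt (fun h : ℝ => x + h • e) e h := by
        simpa using ((hasDerivAt_id h).smul_const e).const_add x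
      exact ((hf.differentiable one_ne_zero _).hasFDerivAt.comp_hasDerivAt h h2)
    · exact (hc.comp (by fun_prop)).intervalIntegrable _ _
  have h2 : ∫ x, (f (x + e) - f x) ∂(cell d) = 0 := by
    rw [integral_sub, hp.integral_add_right, sub_self]
    · exact (hf.continuous.comp (by fun_prop)).integrable_cell
    · exact hf.continuous.integrable_cell
  have h3 : ∫ x, (∫ h in (0 : ℝ)..1, fderiv ℝ f (x + h • e) e) ∂(cell d)
      = ∫ h in (0 : ℝ)..1, ∫ x, fderiv ℝ f (x + h • e) e ∂(cell d) := by
    simp_rw [intervalIntegral.integral_of_le zero_le_one]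
    refine integral_integral_swap ?_
    obtain ⟨C, -, hC⟩ := hper.exists_bound hc
    refine Integrable.of_bound ?_ C (Eventually.of_forall fun z => hC _)
    exact (hc.comp (by fun_prop : Continuous fun z : Vec d × ℝ =>
      z.1 + z.2 • e)).aestronglyMeasurable
  simp_rw [h1] at h3
  rw [h2] at h3
  have h4 : ∀ h : ℝ, ∫ x, fderiv ℝ f (x + h • e) e ∂(cell d)
      = ∫ x, fderiv ℝ f x e ∂(cell d) := fun h => hper.integral_add_right _
  simp_rw [h4] at h3
  simpa using h3.symm

/-- Integration by parts on the torus. -/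
theorem IsTorusFn.integral_mul_fderiv {f g : Vec d → ℝ} (hfp : IsTorusFn f) (hgp : IsTorusFn g)
    (hf : ContDiff ℝ 1 f) (hg : ContDiff ℝ 1 g) (e : Vec d) :
    ∫ x, f x * fderiv ℝ g x e ∂(cell d) = -∫ x, fderiv ℝ f x e * g x ∂(cell d) := by
  have h := (hfp.comp₂ hgp fun a b => a * b).integral_fderiv_apply_eq_zero (hf.mul hg) e
  have h2 : ∀ x, fderiv ℝ (fun x => f x * g x) x e
      = f x * fderiv ℝ g x e + fderiv ℝ f x e * g x := fun x => by
    rw [fderiv_fun_mul (hf.differentiable one_ne_zero _) (hg.differentiable one_ne_zero _)]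
    simp [mul_comm]
  have cf : Continuous fun x => fderiv ℝ f x e :=
    (hf.continuous_fderiv one_ne_zero).clm_apply continuous_const
  have cg : Continuous fun x => fderiv ℝ g x e :=
    (hg.continuous_fderiv one_ne_zero).clm_apply continuous_const
  have i1 : Integrable (fun x => f x * fderiv ℝ g x e) (cell d) :=
    (hf.continuous.mul cg).integrable_cell
  have i2 : Integrable (fun x => fderiv ℝ f x e * g x) (cell d) :=
    (cf.mul hg.continuous).integrable_cell
  simp_rw [h2] at h
  rw [integral_add i1 i2] at h
  linarith

end TorusFn

/-! ### Trigonometric polynomials and their heat flow -/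

section Trig

variable {d : ℕ}

/-- The linear phase `x ↦ 2π k·x`. -/
def freq (k : Fin d → ℤ) : Vec d →L[ℝ] ℝ :=
  ∑ a, (2 * Real.pi * k a) • (EuclideanSpace.proj a : Vec d →L[ℝ] ℝ)

/-- The real trigonometric polynomial `Re ∑_{k ∈ K} c_k e^{2πi k·x}`. -/
def trig (K : Finset (Fin d → ℤ)) (c : (Fin d → ℤ) → ℂ) (x : Vec d) : ℝ :=
  ∑ k ∈ K, (c k * Complex.exp (freq k x * Complex.I)).re

/-- The coefficients of the derivative in the direction `e`. -/
def dcoef (e : Vec d) (c : (Fin d → ℤ) → ℂ) (k : Fin d → ℤ) : ℂ := (freq k e : ℂ) * Complex.I * c k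

/-- The eigenvalue of `-Δ` at the frequency `k`. -/
def eig (k : Fin d → ℤ) : ℝ := ∑ a, freq k (unitVec a) ^ 2

/-- The coefficients of the Laplacian. -/
def lcoef (c : (Fin d → ℤ) → ℂ) (k : Fin d → ℤ) : ℂ := -(eig k : ℂ) * c k

/-- The coefficients of the solution of the heat equation at time `t`. -/
def hcoef (t : ℝ) (c : (Fin d → ℤ) → ℂ) (k : Fin d → ℤ) : ℂ := (Real.exp (-eig k * t) : ℂ) * c k

variable (K K' : Finset (Fin d → ℤ)) (c c' : (Fin d → ℤ) → ℂ)

theorem freq_unitVec (k : Fin d → ℤ) (a : Fin d) : freq k (unitVec a) = 2 * Real.pi * k a := by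
  simp [freq, unitVec]

theorem isTorusFn_trig : IsTorusFn (trig K c) := by
  intro a x
  refine Finset.sum_congr rfl fun k _ => ?_
  rw [map_add, freq_unitVec]
  have : Complex.exp (((freq k x + 2 * Real.pi * k a : ℝ) : ℂ) * Complex.I)
      = Complex.exp (freq k x * Complex.I) := by
    rw [Complex.exp_eq_exp_iff_exists_int]
    exact ⟨k a, by push_cast; ring⟩
  rw [this]

theorem contDiff_trig : ContDiff ℝ ∞ (trig K c) := by
  unfold trig
  refine ContDiff.sum fun k _ => ?_
  refine Complex.reCLM.contDiff.comp (contDiff_const.mul ?_)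
  exact ((Complex.ofRealCLM.contDiff.comp (freq k).contDiff).mul contDiff_const).cexp

theorem hasFDerivAt_trig_dir (x e : Vec d) : fderiv ℝ (trig K c) x e = trig K (dcoef e c) x := by
  have h : HasDerivAt (fun s : ℝ => trig K c (x + s • e)) (trig K (dcoef e c) x) 0 := by
    unfold trig
    refine HasDerivAt.fun_sum fun k _ => ?_
    have h1 : HasDerivAt (fun s : ℝ => ((freq k (x + s • e) : ℝ) : ℂ) * Complex.I)
        ((freq k e : ℂ) * Complex.I) 0 := by
      have : HasDerivAt (fun s : ℝ => freq k (x + s • e)) (freq k e) 0 := by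
        simp only [map_add, map_smul, smul_eq_mul]
        simpa using ((hasDerivAt_id (0 : ℝ)).mul_const (freq k e)).const_add (freq k x)
      exact this.ofReal_comp.mul_const _
    have h2 := (h1.cexp.const_mul (c k))
    have h3 := (Complex.reCLM.hasFDerivAt.comp_hasDerivAt (0 : ℝ) h2)
    simp only [Function.comp_def, Complex.reCLM_apply, zero_smul, add_zero] at h3
    convert h3 using 2
    rw [dcoef]; ring
  have h4 : HasDerivAt (fun s : ℝ => x + s • e) e 0 := by
    simpa using ((hasDerivAt_id (0 : ℝ)).smul_const e).const_add x
  have h5 : HasFDerivAt (trig K c) (fderiv ℝ (trig K c) x) (x + (0 : ℝ) • e) := by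
    simpa using ((contDiff_trig K c).differentiable (by simp) x).hasFDerivAt
  have h6 := HasFDerivAt.comp_hasDerivAt (0 : ℝ) h5 h4
  simp only [Function.comp_def] at h6
  exact h6.unique h

theorem trig_sum {ι : Type*} (s : Finset ι) (b : ι → (Fin d → ℤ) → ℂ) (x : Vec d) :
    trig K (fun k => ∑ i ∈ s, b i k) x = ∑ i ∈ s, trig K (b i) x := by
  simp only [trig, Finset.sum_mul, Complex.re_sum]
  exact Finset.sum_comm

theorem trig_smul (r : ℝ) (x : Vec d) : trig K (fun k => (r : ℂ) * c k) x = r * trig K c x := by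
  simp only [trig, Finset.mul_sum]
  refine Finset.sum_congr rfl fun k _ => ?_
  rw [mul_assoc, Complex.re_ofReal_mul]

theorem lcoef_eq : lcoef c = fun k => ∑ a, dcoef (unitVec a) (dcoef (unitVec a) c) k := by
  funext k
  simp only [lcoef, dcoef, eig]
  push_cast
  rw [neg_mul, Finset.sum_mul, ← Finset.sum_neg_distrib]
  refine Finset.sum_congr rfl fun a _ => ?_
  linear_combination ((freq k (unitVec a) : ℂ)) ^ 2 * c k * (-Complex.I_sq)

theorem dcoef_comm (e e' : Vec d) : dcoef e (dcoef e' c) = dcoef e' (dcoef e c) := by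
  funext k; simp only [dcoef]; ring

theorem dcoef_lcoef (e : Vec d) : dcoef e (lcoef c) = lcoef (dcoef e c) := by
  funext k; simp only [dcoef, lcoef]; ring

theorem hcoef_dcoef (t : ℝ) (e : Vec d) : hcoef t (dcoef e c) = dcoef e (hcoef t c) := by
  funext k; simp only [dcoef, hcoef]; ring

theorem hcoef_lcoef (t : ℝ) : hcoef t (lcoef c) = lcoef (hcoef t c) := by
  funext k; simp only [lcoef, hcoef]; ring

theorem hcoef_zero : hcoef 0 c = c := by
  funext k; simp [hcoef]

theorem trig_lcoef (x : Vec d) :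
    trig K (lcoef c) x = ∑ a, trig K (dcoef (unitVec a) (dcoef (unitVec a) c)) x := by
  rw [lcoef_eq, trig_sum]

theorem integral_trig_mul_dcoef {f : Vec d → ℝ} (hf : ContDiff ℝ 1 f) (hp : IsTorusFn f)
    (e : Vec d) :
    ∫ x, f x * trig K (dcoef e c) x ∂(cell d) = -∫ x, fderiv ℝ f x e * trig K c x ∂(cell d) := by
  rw [← hp.integral_mul_fderiv (isTorusFn_trig K c) hf ((contDiff_trig K c).of_le (by simp)) e]
  simp_rw [hasFDerivAt_trig_dir]

@[fun_prop]
theorem continuous_trig : Continuous (trig K c) := (contDiff_trig K c).continuous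

theorem contDiff_one_trig : ContDiff ℝ 1 (trig K c) := (contDiff_trig K c).of_le (by simp)

/-- Green's second identity. -/
theorem integral_trig_lcoef_comm :
    ∫ x, trig K (lcoef c) x * trig K' c' x ∂(cell d)
      = ∫ x, trig K c x * trig K' (lcoef c') x ∂(cell d) := by
  simp_rw [trig_lcoef, Finset.sum_mul, Finset.mul_sum]
  rw [integral_finsetSum _ fun a _ =>
      Continuous.integrable_cell (by fun_prop),
    integral_finsetSum _ fun a _ =>
      Continuous.integrable_cell (by fun_prop)]
  refine Finset.sum_congr rfl fun a _ => ?_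
  rw [integral_trig_mul_dcoef _ _ (contDiff_one_trig _ _) (isTorusFn_trig _ _)]
  simp_rw [mul_comm (trig K (dcoef (unitVec a) (dcoef (unitVec a) c)) _)]
  rw [integral_trig_mul_dcoef _ _ (contDiff_one_trig _ _) (isTorusFn_trig _ _)]
  simp_rw [hasFDerivAt_trig_dir, mul_comm]

theorem hasDerivAt_trig_hcoef (t : ℝ) (x : Vec d) :
    HasDerivAt (fun t => trig K (hcoef t c) x) (trig K (lcoef (hcoef t c)) x) t := by
  unfold trig
  refine HasDerivAt.fun_sum fun k _ => ?_
  have h1 : HasDerivAt (fun t : ℝ => ((Real.exp (-eig k * t) : ℝ) : ℂ))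
      ((Real.exp (-eig k * t) * (-eig k) : ℝ) : ℂ) t := by
    have := ((hasDerivAt_id t).const_mul (-eig k)).exp
    simp only [id, mul_one] at this
    exact this.ofReal_comp
  have h2 := (h1.mul_const (c k * Complex.exp (freq k x * Complex.I)))
  have h3 := Complex.reCLM.hasFDerivAt.comp_hasDerivAt t h2
  simp only [Function.comp_def, Complex.reCLM_apply] at h3
  convert h3 using 2
  · rw [hcoef]; ring_nf
  · rw [lcoef, hcoef]; push_cast; ring

theorem continuous_trig_hcoef : Continuous fun z : ℝ × Vec d => trig K (hcoef z.1 c) z.2 := by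
  unfold trig hcoef
  refine continuous_finsetSum _ fun k _ => ?_
  have := (freq k).continuous
  fun_prop

theorem abs_trig_le (x : Vec d) : |trig K c x| ≤ ∑ k ∈ K, ‖c k‖ := by
  refine (Finset.abs_sum_le_sum_abs _ _).trans (Finset.sum_le_sum fun k _ => ?_)
  refine (Complex.abs_re_le_norm _).trans ?_
  rw [norm_mul, Complex.norm_exp_ofReal_mul_I, mul_one]

theorem eig_nonneg (k : Fin d → ℤ) : 0 ≤ eig k := Finset.sum_nonneg fun _ _ => sq_nonneg _

theorem norm_hcoef_le {t : ℝ} (ht : 0 ≤ t) (k : Fin d → ℤ) : ‖hcoef t c k‖ ≤ ‖c k‖ := by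
  rw [hcoef, norm_mul, Complex.norm_real, Real.norm_eq_abs, Real.abs_exp]
  refine mul_le_of_le_one_left (norm_nonneg _) (Real.exp_le_one_iff.2 ?_)
  nlinarith [eig_nonneg k]

theorem tendsto_hcoef_dcoef (a : Fin d) (k : Fin d → ℤ) :
    Tendsto (fun t => ‖hcoef t (dcoef (unitVec a) c) k‖) atTop (𝓝 0) := by
  rcases (eig_nonneg k).eq_or_lt with h | h
  · have : freq k (unitVec a) = 0 := by
      have := (Finset.sum_eq_zero_iff_of_nonneg (fun b _ => sq_nonneg (freq k (unitVec b)))).1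
        h.symm a (Finset.mem_univ a)
      exact pow_eq_zero_iff (two_ne_zero) |>.1 this
    simp [hcoef, dcoef, this]
  · simp only [hcoef, norm_mul, Complex.norm_real, Real.norm_eq_abs, Real.abs_exp]
    rw [show (0 : ℝ) = 0 * ‖dcoef (unitVec a) c k‖ by simp]
    refine Tendsto.mul_const _ (Real.tendsto_exp_atBot.comp ?_)
    exact tendsto_id.const_mul_atTop_of_neg (neg_lt_zero.2 h)

/-- Differentiation under the integral over the torus. -/
theorem hasDerivAt_integral_cell {Φ Φ' : ℝ → Vec d → ℝ}
    (h0 : ∀ t, Continuous (Φ t)) (h : ∀ t x, HasDerivAt (fun s => Φ s x) (Φ' t x) t)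
    (hc : Continuous (Function.uncurry Φ')) (t : ℝ) :
    HasDerivAt (fun s => ∫ x, Φ s x ∂(cell d)) (∫ x, Φ' t x ∂(cell d)) t := by
  obtain ⟨L, hL, hsub⟩ := unitCell_subset_compact d
  obtain ⟨C, hC⟩ := ((isCompact_closedBall t 1).prod hL).exists_bound_of_continuousOn
    hc.continuousOn
  refine (hasDerivAt_integral_of_dominated_loc_of_deriv_le (bound := fun _ => C)
    (s := Metric.ball t 1) (Metric.ball_mem_nhds t one_pos) ?_ (h0 t).integrable_cell ?_ ?_
    (integrable_const _) ?_).2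
  · exact Eventually.of_forall fun s => (h0 s).aestronglyMeasurable
  · exact (hc.comp (by fun_prop : Continuous fun x : Vec d => (t, x))).aestronglyMeasurable
  · filter_upwards [ae_cell_mem d] with x hx s hs
    exact hC (s, x) ⟨Metric.ball_subset_closedBall hs, hsub hx⟩
  · exact Eventually.of_forall fun x s _ => h s x

end Trig

/-! ### The Bellman function -/

section Bellman

/-- A regularisation of `|ξ|^r`. -/
def regPow (κ r ξ : ℝ) : ℝ := (ξ ^ 2 + κ) ^ (r / 2)

/-- The derivative of `regPow κ r`. -/
def regPow' (κ r ξ : ℝ) : ℝ := r * ξ * (ξ ^ 2 + κ) ^ (r / 2 - 1)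

def bellS (κ p q ξ η : ℝ) : ℝ := regPow κ p ξ + regPow κ q η

/-- A function `B` with `0 ≤ B ≤ 2 (|ξ|^p + |η|^q)` (up to `κ`) whose Hessian
controls the product `|dξ| |dη|`. -/
def bell (κ p q δ ξ η : ℝ) : ℝ :=
  bellS κ p q ξ η + δ * (ξ ^ 2 * bellS κ p q ξ η ^ (1 - 2 / p))

/-- `∂B/∂ξ`. -/
def bellX (κ p q δ ξ η : ℝ) : ℝ :=
  regPow' κ p ξ + δ * (2 * ξ * bellS κ p q ξ η ^ (1 - 2 / p)
    + ξ ^ 2 * ((1 - 2 / p) * bellS κ p q ξ η ^ (1 - 2 / p - 1) * regPow' κ p ξ))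

/-- `∂B/∂η`. -/
def bellY (κ p q δ ξ η : ℝ) : ℝ :=
  regPow' κ q η + δ * (ξ ^ 2 * ((1 - 2 / p) * bellS κ p q ξ η ^ (1 - 2 / p - 1) * regPow' κ q η))

/-- The second derivative of `regPow κ r`. -/
def regPow'' (κ r ξ : ℝ) : ℝ :=
  r * (ξ ^ 2 + κ) ^ (r / 2 - 1) + r * ξ * ((r / 2 - 1) * (ξ ^ 2 + κ) ^ (r / 2 - 1 - 1) * (2 * ξ))

/-- The Hessian of `B` at `(ξ, η)` on the vector `(α, β)`. -/
def bellQ (κ p q δ ξ η α β : ℝ) : ℝ :=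
  let a := 1 - 2 / p
  let S := bellS κ p q ξ η
  let dS := regPow' κ p ξ * α + regPow' κ q η * β
  (regPow'' κ p ξ * α + δ * (2 * α * S ^ a + 2 * ξ * (a * S ^ (a - 1) * dS)
      + (2 * ξ * α * (a * S ^ (a - 1) * regPow' κ p ξ)
        + ξ ^ 2 * (a * ((a - 1) * S ^ (a - 1 - 1) * dS) * regPow' κ p ξ
          + a * S ^ (a - 1) * (regPow'' κ p ξ * α))))) * α
  + (regPow'' κ q η * β + δ * (2 * ξ * α * (a * S ^ (a - 1) * regPow' κ q η)
      + ξ ^ 2 * (a * ((a - 1) * S ^ (a - 1 - 1) * dS) * regPow' κ q η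
          + a * S ^ (a - 1) * (regPow'' κ q η * β)))) * β

variable {κ p q δ : ℝ}

theorem regPow_pos (hκ : 0 < κ) (r ξ : ℝ) : 0 < regPow κ r ξ :=
  Real.rpow_pos_of_pos (by positivity) _

theorem bellS_pos (hκ : 0 < κ) (ξ η : ℝ) : 0 < bellS κ p q ξ η :=
  add_pos (regPow_pos hκ _ _) (regPow_pos hκ _ _)

theorem hasDerivAt_base (κ : ℝ) {f : ℝ → ℝ} {α s : ℝ} (hf : HasDerivAt f α s) :
    HasDerivAt (fun s => f s ^ 2 + κ) (2 * f s * α) s := by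
  simpa using (hf.pow 2).add_const κ

theorem hasDerivAt_regPow (hκ : 0 < κ) (r : ℝ) {f : ℝ → ℝ} {α s : ℝ} (hf : HasDerivAt f α s) :
    HasDerivAt (fun s => regPow κ r (f s)) (regPow' κ r (f s) * α) s := by
  have := (hasDerivAt_base κ hf).rpow_const (p := r / 2) (Or.inl (by positivity))
  exact this.congr_deriv (by unfold regPow'; ring)

theorem hasDerivAt_regPow' (hκ : 0 < κ) (r : ℝ) {f : ℝ → ℝ} {α s : ℝ} (hf : HasDerivAt f α s) :
    HasDerivAt (fun s => regPow' κ r (f s)) (regPow'' κ r (f s) * α) s := by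
  have := (hf.const_mul r).fun_mul
    ((hasDerivAt_base κ hf).rpow_const (p := r / 2 - 1) (Or.inl (by positivity)))
  exact this.congr_deriv (by unfold regPow''; ring)

theorem hasDerivAt_bellS (hκ : 0 < κ) {f g : ℝ → ℝ} {α β s : ℝ} (hf : HasDerivAt f α s)
    (hg : HasDerivAt g β s) :
    HasDerivAt (fun s => bellS κ p q (f s) (g s))
      (regPow' κ p (f s) * α + regPow' κ q (g s) * β) s :=
  (hasDerivAt_regPow hκ p hf).fun_add (hasDerivAt_regPow hκ q hg)

theorem hasDerivAt_bellS_rpow (hκ : 0 < κ) {f g : ℝ → ℝ} {α β s : ℝ} (hf : HasDerivAt f α s)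
    (hg : HasDerivAt g β s) (b : ℝ) :
    HasDerivAt (fun s => bellS κ p q (f s) (g s) ^ b)
      (b * bellS κ p q (f s) (g s) ^ (b - 1)
        * (regPow' κ p (f s) * α + regPow' κ q (g s) * β)) s := by
  have := (hasDerivAt_bellS (p := p) (q := q) hκ hf hg).rpow_const (p := b)
    (Or.inl (bellS_pos hκ _ _).ne')
  exact this.congr_deriv (by ring)

theorem hasDerivAt_bell (hκ : 0 < κ) {f g : ℝ → ℝ} {α β s : ℝ} (hf : HasDerivAt f α s)
    (hg : HasDerivAt g β s) :
    HasDerivAt (fun s => bell κ p q δ (f s) (g s))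
      (bellX κ p q δ (f s) (g s) * α + bellY κ p q δ (f s) (g s) * β) s := by
  have := (hasDerivAt_bellS (p := p) (q := q) hκ hf hg).fun_add
    (((hf.fun_pow 2).fun_mul (hasDerivAt_bellS_rpow (p := p) (q := q) hκ hf hg (1 - 2 / p))).const_mul δ)
  exact this.congr_deriv (by unfold bellX bellY; push_cast; ring)

/-- Along a curve, `dB_ξ · dξ + dB_η · dη` is the Hessian. -/
theorem hasDerivAt_bellXY (hκ : 0 < κ) {f g : ℝ → ℝ} {α β s : ℝ} (hf : HasDerivAt f α s)
    (hg : HasDerivAt g β s) :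
    ∃ A B : ℝ, HasDerivAt (fun s => bellX κ p q δ (f s) (g s)) A s ∧
      HasDerivAt (fun s => bellY κ p q δ (f s) (g s)) B s ∧
      A * α + B * β = bellQ κ p q δ (f s) (g s) α β := by
  have h1 := hasDerivAt_bellS_rpow (p := p) (q := q) hκ hf hg (1 - 2 / p)
  have h2 := hasDerivAt_bellS_rpow (p := p) (q := q) hκ hf hg (1 - 2 / p - 1)
  have hx := hasDerivAt_regPow' hκ p hf
  have hy := hasDerivAt_regPow' hκ q hg
  refine ⟨_, _, hx.fun_add ((((hf.const_mul 2).fun_mul h1).fun_add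
      ((hf.fun_pow 2).fun_mul ((h2.const_mul (1 - 2 / p)).fun_mul hx))).const_mul δ),
    hy.fun_add (((hf.fun_pow 2).fun_mul ((h2.const_mul (1 - 2 / p)).fun_mul hy)).const_mul δ), ?_⟩
  simp only [bellQ]
  push_cast
  ring

theorem contDiff_regPow (hκ : 0 < κ) (r : ℝ) : ContDiff ℝ 1 (regPow κ r) := by
  unfold regPow
  exact (by fun_prop : ContDiff ℝ 1 fun ξ : ℝ => ξ ^ 2 + κ).rpow_const_of_ne
    fun ξ => by positivity

theorem contDiff_regPow' (hκ : 0 < κ) (r : ℝ) : ContDiff ℝ 1 (regPow' κ r) := by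
  unfold regPow'
  exact (by fun_prop : ContDiff ℝ 1 fun ξ : ℝ => r * ξ).mul
    ((by fun_prop : ContDiff ℝ 1 fun ξ : ℝ => ξ ^ 2 + κ).rpow_const_of_ne fun ξ => by positivity)

theorem contDiff_bellS (hκ : 0 < κ) :
    ContDiff ℝ 1 fun z : ℝ × ℝ => bellS κ p q z.1 z.2 :=
  ((contDiff_regPow hκ p).comp contDiff_fst).add ((contDiff_regPow hκ q).comp contDiff_snd)

theorem contDiff_bellX (hκ : 0 < κ) :
    ContDiff ℝ 1 fun z : ℝ × ℝ => bellX κ p q δ z.1 z.2 := by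
  have hS (b : ℝ) : ContDiff ℝ 1 fun z : ℝ × ℝ => bellS κ p q z.1 z.2 ^ b :=
    (contDiff_bellS hκ).rpow_const_of_ne fun z => (bellS_pos hκ _ _).ne'
  have hX : ContDiff ℝ 1 fun z : ℝ × ℝ => regPow' κ p z.1 :=
    (contDiff_regPow' hκ p).comp contDiff_fst
  have h0 := hS (1 - 2 / p)
  have h1 := hS (1 - 2 / p - 1)
  unfold bellX
  fun_prop

theorem contDiff_bellY (hκ : 0 < κ) :
    ContDiff ℝ 1 fun z : ℝ × ℝ => bellY κ p q δ z.1 z.2 := by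
  have hS (b : ℝ) : ContDiff ℝ 1 fun z : ℝ × ℝ => bellS κ p q z.1 z.2 ^ b :=
    (contDiff_bellS hκ).rpow_const_of_ne fun z => (bellS_pos hκ _ _).ne'
  have hY : ContDiff ℝ 1 fun z : ℝ × ℝ => regPow' κ q z.2 :=
    (contDiff_regPow' hκ q).comp contDiff_snd
  have h1 := hS (1 - 2 / p - 1)
  unfold bellY
  fun_prop

theorem sq_le_bellS (hκ : 0 < κ) (hp : 2 ≤ p) (ξ η : ℝ) :
    ξ ^ 2 ≤ bellS κ p q ξ η ^ (2 / p) := by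
  have hN : 0 < ξ ^ 2 + κ := by positivity
  calc ξ ^ 2 ≤ ξ ^ 2 + κ := by linarith
    _ = regPow κ p ξ ^ (2 / p) := by
      rw [regPow, ← Real.rpow_mul hN.le, show p / 2 * (2 / p) = 1 by field_simp, Real.rpow_one]
    _ ≤ _ := Real.rpow_le_rpow (regPow_pos hκ _ _).le
      (by rw [bellS]; linarith [regPow_pos hκ q η]) (by positivity)

theorem bell_le (hκ : 0 < κ) (hp : 2 ≤ p) (hδ : 0 ≤ δ) (hδ1 : δ ≤ 1) (ξ η : ℝ) :
    0 ≤ bell κ p q δ ξ η ∧ bell κ p q δ ξ η ≤ 2 * bellS κ p q ξ η := by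
  have hS := bellS_pos (p := p) (q := q) hκ ξ η
  have h1 : 0 ≤ ξ ^ 2 * bellS κ p q ξ η ^ (1 - 2 / p) := by positivity
  have h2 : ξ ^ 2 * bellS κ p q ξ η ^ (1 - 2 / p) ≤ bellS κ p q ξ η := by
    calc _ ≤ bellS κ p q ξ η ^ (2 / p) * bellS κ p q ξ η ^ (1 - 2 / p) :=
          mul_le_mul_of_nonneg_right (sq_le_bellS hκ hp ξ η) (by positivity)
      _ = _ := by rw [← Real.rpow_add hS]; simp
  unfold bell
  constructor
  · positivity
  · nlinarith

/-- The algebra behind the lower bound for the Hessian of the Bellman function. Here `X₁, X₂` and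
`Y₁, Y₂` are the first and second derivatives of the regularised `p`-th and `q`-th powers, `S` is the
sum of these powers and the `σᵢ` are successive powers of `S` with exponents lowered by one; the
hypotheses are the growth bounds that hold for them. -/
theorem hessian_algebra {a S σ₀ σ₁ σ₂ ξ X₁ X₂ Y₁ Y₂ y : ℝ} (hδ : 0 < δ) (hqδ : 21 * δ = q - 1)
    (hq2 : q ≤ 2) (ha0 : 0 ≤ a) (ha1 : a ≤ 1) (hap : (1 - a) * p = 2) (hσ₁ : 0 < σ₁)
    (hσ₂ : 0 < σ₂) (hS : S * σ₂ = σ₁) (hX₂ : 0 ≤ X₂) (hX0 : 0 ≤ ξ * X₁) (hX1 : ξ * X₁ ≤ p * S)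
    (hy : 0 < y) (hY₂ : q * (q - 1) * y ≤ Y₂) (hY1 : |ξ * Y₁| * σ₁ ≤ q)
    (hY3 : Y₁ ^ 2 * ξ ^ 2 * σ₂ ≤ q ^ 2 * y) (hσ₀ : y⁻¹ ≤ σ₀) (α β : ℝ) :
    δ * (y⁻¹ * α ^ 2 + y * β ^ 2)
      ≤ (X₂ * α + δ * (2 * α * σ₀ + 2 * ξ * (a * σ₁ * (X₁ * α + Y₁ * β))
        + (2 * ξ * α * (a * σ₁ * X₁) + ξ ^ 2 * (a * ((a - 1) * σ₂ * (X₁ * α + Y₁ * β)) * X₁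
          + a * σ₁ * (X₂ * α))))) * α
      + (Y₂ * β + δ * (2 * ξ * α * (a * σ₁ * Y₁)
        + ξ ^ 2 * (a * ((a - 1) * σ₂ * (X₁ * α + Y₁ * β)) * Y₁ + a * σ₁ * (Y₂ * β)))) * β := by
  have hq1 : 1 < q := by linarith
  have hm : (1 - a) * (ξ * X₁) * σ₂ ≤ 2 * σ₁ := by
    calc (1 - a) * (ξ * X₁) * σ₂ ≤ (1 - a) * (p * S) * σ₂ := by gcongr
      _ = ((1 - a) * p) * (S * σ₂) := by ring
      _ = 2 * σ₁ := by rw [hap, hS]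
  have hm0 : 0 ≤ (1 - a) * (ξ * X₁) * σ₂ := by
    have : 0 ≤ 1 - a := by linarith
    positivity
  have hY₂0 : 0 ≤ Y₂ := le_trans (by have : 0 < q - 1 := by linarith
                                     positivity) hY₂
  -- the coefficient of `α²`
  have hA : 2 * δ * y⁻¹ ≤ X₂ + δ * (2 * σ₀ + 4 * a * (ξ * X₁) * σ₁
      - a * (ξ * X₁) * ((1 - a) * (ξ * X₁) * σ₂) + a * ξ ^ 2 * σ₁ * X₂) := by
    have h1 : a * (ξ * X₁) * ((1 - a) * (ξ * X₁) * σ₂) ≤ a * (ξ * X₁) * (2 * σ₁) := by gcongr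
    have h2 : 0 ≤ a * (ξ * X₁) * σ₁ := by positivity
    have h3 : 0 ≤ a * ξ ^ 2 * σ₁ * X₂ := by positivity
    have h4 : δ * (2 * y⁻¹) ≤ δ * (2 * σ₀ + 4 * a * (ξ * X₁) * σ₁
      - a * (ξ * X₁) * ((1 - a) * (ξ * X₁) * σ₂) + a * ξ ^ 2 * σ₁ * X₂) := by
      gcongr; linarith
    linarith
  -- the coefficient of `β²`
  have hB : 17 * δ * y ≤ Y₂ + δ * (a * ξ ^ 2 * σ₁ * Y₂)
      - δ * (a * (1 - a) * (Y₁ ^ 2 * ξ ^ 2 * σ₂)) := by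
    have h1 : a * (1 - a) * (Y₁ ^ 2 * ξ ^ 2 * σ₂) ≤ 1 * (2 ^ 2 * y) := by
      refine mul_le_mul (by nlinarith) (hY3.trans ?_) (by positivity) zero_le_one
      gcongr
    have h2 : 0 ≤ δ * (a * ξ ^ 2 * σ₁ * Y₂) := by positivity
    have h3 : 21 * δ * y ≤ q * (q - 1) * y := by
      rw [hqδ]; gcongr; nlinarith
    have h4 := mul_le_mul_of_nonneg_left h1 hδ.le
    linarith
  -- the mixed coefficient
  have hC : |2 * δ * a * (ξ * Y₁) * (2 * σ₁ - (1 - a) * (ξ * X₁) * σ₂)| ≤ 8 * δ := by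
    rw [abs_mul, abs_mul, abs_of_nonneg (by positivity : 0 ≤ 2 * δ * a),
      abs_of_nonneg (by linarith : 0 ≤ 2 * σ₁ - (1 - a) * (ξ * X₁) * σ₂)]
    calc 2 * δ * a * |ξ * Y₁| * (2 * σ₁ - (1 - a) * (ξ * X₁) * σ₂)
        ≤ 2 * δ * 1 * |ξ * Y₁| * (2 * σ₁) := by gcongr; linarith
      _ = 4 * δ * (|ξ * Y₁| * σ₁) := by ring
      _ ≤ 4 * δ * 2 := by gcongr; linarith
      _ = 8 * δ := by ring
  have hAB := neg_le_of_abs_le (le_of_eq (abs_mul (2 * δ * a * (ξ * Y₁)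
    * (2 * σ₁ - (1 - a) * (ξ * X₁) * σ₂)) (α * β)))
  have hAB2 := mul_le_mul_of_nonneg_right hC (abs_nonneg (α * β))
  have hyy : y⁻¹ * y = 1 := inv_mul_cancel₀ hy.ne'
  have h8 : 8 * |α * β| ≤ y⁻¹ * α ^ 2 + 16 * y * β ^ 2 := by
    have h := mul_nonneg (inv_pos.2 hy).le (sq_nonneg (|α| - 4 * y * |β|))
    have h' : y⁻¹ * (|α| - 4 * y * |β|) ^ 2
        = y⁻¹ * |α| ^ 2 - 8 * (y⁻¹ * y) * (|α| * |β|) + 16 * (y⁻¹ * y) * y * |β| ^ 2 := by ring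
    rw [h', hyy, sq_abs, sq_abs, ← abs_mul] at h
    linarith
  have h9 := mul_le_mul_of_nonneg_left h8 hδ.le
  have hA' := mul_le_mul_of_nonneg_right hA (sq_nonneg α)
  have hB' := mul_le_mul_of_nonneg_right hB (sq_nonneg β)
  linarith

/-- The lower bound for the Hessian of the Bellman function. -/
theorem bellQ_ge (hκ : 0 < κ) (hp : 2 ≤ p) (hpq : 1 / p + 1 / q = 1) (ξ η : ℝ) :
    ∃ w : ℝ, 0 < w ∧ ∀ α β : ℝ,
      (q - 1) / 21 * (w * α ^ 2 + w⁻¹ * β ^ 2) ≤ bellQ κ p q ((q - 1) / 21) ξ η α β := by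
  have hp0 : 0 < p := by linarith
  have hq0 : q ≠ 0 := by
    rintro rfl
    have : 1 / p ≤ 1 / 2 := one_div_le_one_div_of_le two_pos hp
    norm_num at hpq; rw [hpq] at hp; norm_num at hp
  have hq' : q = p / (p - 1) := by
    have : p - 1 ≠ 0 := by linarith
    field_simp at hpq ⊢; linarith
  have hp1 : 0 < p - 1 := by linarith
  have hq1 : 1 < q := by rw [hq', lt_div_iff₀ hp1]; linarith
  have hq2 : q ≤ 2 := by rw [hq', div_le_iff₀ hp1]; linarith
  have hN : 0 < ξ ^ 2 + κ := by positivity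
  have hM : 0 < η ^ 2 + κ := by positivity
  have hS := bellS_pos (p := p) (q := q) hκ ξ η
  have hX := regPow_pos hκ p ξ
  have hY := regPow_pos hκ q η
  have hXS : regPow κ p ξ ≤ bellS κ p q ξ η := by rw [bellS]; linarith
  have hYS : regPow κ q η ≤ bellS κ p q ξ η := by rw [bellS]; linarith
  set S := bellS κ p q ξ η with hSdef
  set y := (η ^ 2 + κ) ^ (q / 2 - 1) with hy
  have hy0 : 0 < y := Real.rpow_pos_of_pos hM _
  set x := (ξ ^ 2 + κ) ^ (p / 2 - 1) with hx
  have hx0 : 0 < x := Real.rpow_pos_of_pos hN _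
  have hxN : (ξ ^ 2 + κ) * x = regPow κ p ξ := by
    rw [hx, regPow, Real.rpow_sub_one hN.ne']; field_simp
  have hyM : (η ^ 2 + κ) * y = regPow κ q η := by
    rw [hy, regPow, Real.rpow_sub_one hM.ne']; field_simp
  have ha : 2 / p ≤ 1 := by rw [div_le_one hp0]; exact hp
  have ha0 : 0 < 2 / p := by positivity
  have hσ2 : S ^ (1 - 2 / p - 1 - 1) = S ^ (1 - 2 / p - 1) / S := Real.rpow_sub_one hS.ne' _
  have hσ1' : S ^ (1 - 2 / p - 1) * S ^ (2 / p) = 1 := by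
    rw [← Real.rpow_add hS]; simp
  have hξ := sq_le_bellS (q := q) hκ hp ξ η
  rw [← hSdef] at hξ
  -- `η² y² ≤ S^{2/p}`
  have hηy : η ^ 2 * y ^ 2 ≤ S ^ (2 / p) := by
    calc η ^ 2 * y ^ 2 ≤ (η ^ 2 + κ) * y ^ 2 := by gcongr; linarith
      _ = regPow κ q η ^ (2 / p) := by
        rw [hy, regPow, ← Real.rpow_mul_natCast hM.le, ← Real.rpow_mul hM.le]
        nth_rewrite 1 [← Real.rpow_one (η ^ 2 + κ)]
        rw [← Real.rpow_add hM]
        congr 1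
        have : 1 / p = 1 - 1 / q := by linarith
        rw [show q / 2 * (2 / p) = q * (1 / p) by ring, this]
        push_cast
        field_simp
        ring
      _ ≤ _ := Real.rpow_le_rpow hY.le hYS ha0.le
  have hY₁ : regPow' κ q η = q * η * y := rfl
  have hX₁ : regPow' κ p ξ = p * ξ * x := rfl
  refine ⟨y⁻¹, by positivity, fun α β => ?_⟩
  rw [inv_inv]
  refine hessian_algebra (a := 1 - 2 / p) (S := S) (p := p) (q := q) (y := y)
    (σ₀ := S ^ (1 - 2 / p)) (σ₁ := S ^ (1 - 2 / p - 1)) (σ₂ := S ^ (1 - 2 / p - 1 - 1))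
    (by linarith) (by ring) hq2 (by linarith) (by linarith) (by field_simp; try ring)
    (Real.rpow_pos_of_pos hS _) (Real.rpow_pos_of_pos hS _) (by rw [hσ2]; field_simp) ?_ ?_ ?_ hy0
    ?_ ?_ ?_ ?_ α β
  · rw [regPow'', show p * ξ * ((p / 2 - 1) * (ξ ^ 2 + κ) ^ (p / 2 - 1 - 1) * (2 * ξ))
      = p * (p - 2) * ξ ^ 2 * (ξ ^ 2 + κ) ^ (p / 2 - 1 - 1) by ring]
    have : 0 ≤ p - 2 := by linarith
    positivity
  · rw [hX₁, show ξ * (p * ξ * x) = p * ξ ^ 2 * x by ring]; positivity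
  · rw [hX₁, show ξ * (p * ξ * x) = p * (ξ ^ 2 * x) by ring]
    refine mul_le_mul_of_nonneg_left (le_trans ?_ hXS) hp0.le
    rw [← hxN]; gcongr; linarith
  · have h1 : (η ^ 2 + κ) * (η ^ 2 + κ) ^ (q / 2 - 1 - 1) = y := by
      rw [hy, Real.rpow_sub_one hM.ne' (q / 2 - 1)]; field_simp
    have h2 : 0 < (η ^ 2 + κ) ^ (q / 2 - 1 - 1) := Real.rpow_pos_of_pos hM _
    have h3 : η ^ 2 * (η ^ 2 + κ) ^ (q / 2 - 1 - 1) ≤ y := by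
      rw [← h1]; gcongr; linarith
    rw [regPow'', show q * η * ((q / 2 - 1) * (η ^ 2 + κ) ^ (q / 2 - 1 - 1) * (2 * η))
      = -(q * (2 - q)) * (η ^ 2 * (η ^ 2 + κ) ^ (q / 2 - 1 - 1)) by ring]
    have h4 : 0 ≤ q * (2 - q) := mul_nonneg (by linarith) (by linarith)
    nlinarith
  · rw [hY₁]
    refine abs_le_of_sq_le_sq' (a := |ξ * (q * η * y)| * S ^ (1 - 2 / p - 1)) ?_ (by linarith) |>.2
    rw [mul_pow, sq_abs]
    calc (ξ * (q * η * y)) ^ 2 * (S ^ (1 - 2 / p - 1)) ^ 2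
        = q ^ 2 * (ξ ^ 2 * (η ^ 2 * y ^ 2) * (S ^ (1 - 2 / p - 1)) ^ 2) := by ring
      _ ≤ q ^ 2 * (S ^ (2 / p) * S ^ (2 / p) * (S ^ (1 - 2 / p - 1)) ^ 2) := by gcongr
      _ = q ^ 2 * (S ^ (1 - 2 / p - 1) * S ^ (2 / p)) ^ 2 := by ring
      _ = q ^ 2 := by rw [hσ1']; ring
  · rw [hY₁, hσ2]
    have h1 : η ^ 2 * y ≤ S := by
      refine le_trans ?_ hYS
      rw [← hyM]; gcongr; linarith
    calc (q * η * y) ^ 2 * ξ ^ 2 * (S ^ (1 - 2 / p - 1) / S)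
        = q ^ 2 * y * ((η ^ 2 * y) * ξ ^ 2 * (S ^ (1 - 2 / p - 1) / S)) := by ring
      _ ≤ q ^ 2 * y * (S * S ^ (2 / p) * (S ^ (1 - 2 / p - 1) / S)) := by gcongr
      _ = q ^ 2 * y * ((S ^ (1 - 2 / p - 1) * S ^ (2 / p)) * (S / S)) := by ring
      _ = q ^ 2 * y := by rw [hσ1', div_self hS.ne']; ring
  · calc y⁻¹ = regPow κ q η ^ (1 - 2 / p) := by
          rw [hy, regPow, ← Real.rpow_neg hM.le, ← Real.rpow_mul hM.le]
          congr 1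
          have : 1 / p = 1 - 1 / q := by linarith
          rw [show (2 : ℝ) / p = 2 * (1 / p) by ring, this]
          field_simp
          ring
      _ ≤ _ := Real.rpow_le_rpow hY.le hYS (by linarith)

end Bellman

/-! ### Second-order Riesz transforms of trigonometric polynomials -/

section Riesz

variable {d : ℕ}

theorem hasDerivAt_line (x e : Vec d) : HasDerivAt (fun s : ℝ => x + s • e) e 0 := by
  simpa using ((hasDerivAt_id (0 : ℝ)).smul_const e).const_add x

theorem fderiv_apply_eq_of_line {E : Type*} [NormedAddCommGroup E] [NormedSpace ℝ E]
    {f : Vec d → E} {x e : Vec d} {A : E} (hf : DifferentiableAt ℝ f x)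
    (h : HasDerivAt (fun s : ℝ => f (x + s • e)) A 0) : fderiv ℝ f x e = A := by
  have h5 : HasFDerivAt f (fderiv ℝ f x) (x + (0 : ℝ) • e) := by simpa using hf.hasFDerivAt
  have h6 := HasFDerivAt.comp_hasDerivAt (0 : ℝ) h5 (hasDerivAt_line x e)
  simp only [Function.comp_def] at h6
  exact h6.unique h

theorem hasDerivAt_line_of_differentiableAt {E : Type*} [NormedAddCommGroup E] [NormedSpace ℝ E]
    {f : Vec d → E} {x e : Vec d} (hf : DifferentiableAt ℝ f x) :
    HasDerivAt (fun s : ℝ => f (x + s • e)) (fderiv ℝ f x e) 0 := by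
  have h5 : HasFDerivAt f (fderiv ℝ f x) (x + (0 : ℝ) • e) := by simpa using hf.hasFDerivAt
  exact HasFDerivAt.comp_hasDerivAt (0 : ℝ) h5 (hasDerivAt_line x e)

variable (K K' : Finset (Fin d → ℤ)) (c c' : (Fin d → ℤ) → ℂ) {κ p q : ℝ}

/-- Dissipation of the Bellman functional along the heat flow. -/
theorem integral_bell_lcoef_le (hκ : 0 < κ) (hp : 2 ≤ p) (hpq : 1 / p + 1 / q = 1) (hq : 1 < q)
    (i j : Fin d) :
    ∫ x, (bellX κ p q ((q - 1) / 21) (trig K c x) (trig K' c' x) * trig K (lcoef c) x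
      + bellY κ p q ((q - 1) / 21) (trig K c x) (trig K' c' x) * trig K' (lcoef c') x) ∂(cell d)
    ≤ -∫ x, 2 * ((q - 1) / 21) * |trig K (dcoef (unitVec i) c) x * trig K' (dcoef (unitVec j) c') x|
        ∂(cell d) := by
  set δ := (q - 1) / 21 with hδ
  have hδ0 : 0 < δ := by rw [hδ]; linarith
  set f : Vec d → ℝ := fun x => bellX κ p q δ (trig K c x) (trig K' c' x) with hf
  set g : Vec d → ℝ := fun x => bellY κ p q δ (trig K c x) (trig K' c' x) with hg
  have hfc : ContDiff ℝ 1 f := (contDiff_bellX hκ).comp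
    ((contDiff_one_trig K c).prodMk (contDiff_one_trig K' c'))
  have hgc : ContDiff ℝ 1 g := (contDiff_bellY hκ).comp
    ((contDiff_one_trig K c).prodMk (contDiff_one_trig K' c'))
  have hfp : IsTorusFn f := (isTorusFn_trig K c).comp₂ (isTorusFn_trig K' c') _
  have hgp : IsTorusFn g := (isTorusFn_trig K c).comp₂ (isTorusFn_trig K' c') _
  have hf0 := hfc.continuous
  have hg0 := hgc.continuous
  have hf1 (e : Vec d) : Continuous fun x => fderiv ℝ f x e :=
    (hfc.continuous_fderiv one_ne_zero).clm_apply continuous_const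
  have hg1 (e : Vec d) : Continuous fun x => fderiv ℝ g x e :=
    (hgc.continuous_fderiv one_ne_zero).clm_apply continuous_const
  have h1 : ∫ x, (f x * trig K (lcoef c) x + g x * trig K' (lcoef c') x) ∂(cell d)
      = -∫ x, ∑ a, (fderiv ℝ f x (unitVec a) * trig K (dcoef (unitVec a) c) x
        + fderiv ℝ g x (unitVec a) * trig K' (dcoef (unitVec a) c') x) ∂(cell d) := by
    rw [integral_add (Continuous.integrable_cell (by fun_prop))
      (Continuous.integrable_cell (by fun_prop)),
      integral_finsetSum _ fun a _ => Continuous.integrable_cell (by fun_prop)]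
    simp_rw [trig_lcoef, Finset.mul_sum]
    rw [integral_finsetSum _ fun a _ => Continuous.integrable_cell (by fun_prop),
      integral_finsetSum _ fun a _ => Continuous.integrable_cell (by fun_prop),
      ← Finset.sum_add_distrib, ← Finset.sum_neg_distrib]
    refine Finset.sum_congr rfl fun a _ => ?_
    rw [integral_trig_mul_dcoef _ _ hfc hfp, integral_trig_mul_dcoef _ _ hgc hgp, integral_add
      (Continuous.integrable_cell (by fun_prop)) (Continuous.integrable_cell (by fun_prop))]
    ring
  rw [h1, neg_le_neg_iff]
  refine integral_mono (Continuous.integrable_cell (by fun_prop))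
    (Continuous.integrable_cell (by fun_prop)) fun x => ?_
  obtain ⟨w, hw, hQ⟩ := bellQ_ge (q := q) hκ hp hpq (trig K c x) (trig K' c' x)
  rw [← hδ] at hQ
  have hterm (a : Fin d) : δ * (w * trig K (dcoef (unitVec a) c) x ^ 2
      + w⁻¹ * trig K' (dcoef (unitVec a) c') x ^ 2)
      ≤ fderiv ℝ f x (unitVec a) * trig K (dcoef (unitVec a) c) x
        + fderiv ℝ g x (unitVec a) * trig K' (dcoef (unitVec a) c') x := by
    have l1 := hasDerivAt_line_of_differentiableAt (e := unitVec a)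
      ((contDiff_one_trig K c).differentiable one_ne_zero x)
    have l2 := hasDerivAt_line_of_differentiableAt (e := unitVec a)
      ((contDiff_one_trig K' c').differentiable one_ne_zero x)
    obtain ⟨A, B, hA, hB, hAB⟩ := hasDerivAt_bellXY (p := p) (q := q) (δ := δ) hκ l1 l2
    simp only [zero_smul, add_zero, hasFDerivAt_trig_dir] at hAB
    rw [fderiv_apply_eq_of_line (hfc.differentiable one_ne_zero x) hA,
      fderiv_apply_eq_of_line (hgc.differentiable one_ne_zero x) hB, hAB]
    exact hQ _ _
  refine le_trans ?_ (Finset.sum_le_sum fun a _ => hterm a)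
  rw [← Finset.mul_sum, Finset.sum_add_distrib, ← Finset.mul_sum, ← Finset.mul_sum]
  have hi := Finset.single_le_sum (f := fun a => trig K (dcoef (unitVec a) c) x ^ 2)
    (fun a _ => sq_nonneg _) (Finset.mem_univ i)
  have hj := Finset.single_le_sum (f := fun a => trig K' (dcoef (unitVec a) c') x ^ 2)
    (fun a _ => sq_nonneg _) (Finset.mem_univ j)
  have hi' := mul_le_mul_of_nonneg_left hi hw.le
  have hj' := mul_le_mul_of_nonneg_left hj (inv_pos.2 hw).le
  set u := trig K (dcoef (unitVec i) c) x
  set v := trig K' (dcoef (unitVec j) c') x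
  have h2 : 2 * |u * v| ≤ w * u ^ 2 + w⁻¹ * v ^ 2 := by
    have h := mul_nonneg (inv_pos.2 hw).le (sq_nonneg (w * |u| - |v|))
    have h' : w⁻¹ * (w * |u| - |v|) ^ 2
        = (w⁻¹ * w) * w * |u| ^ 2 - 2 * (w⁻¹ * w) * (|u| * |v|) + w⁻¹ * |v| ^ 2 := by ring
    rw [h', inv_mul_cancel₀ hw.ne', sq_abs, sq_abs, ← abs_mul] at h
    linarith
  calc 2 * δ * |u * v| = δ * (2 * |u * v|) := by ring
    _ ≤ _ := mul_le_mul_of_nonneg_left (by linarith) hδ0.le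

theorem continuous_bell (hκ : 0 < κ) (δ : ℝ) :
    Continuous fun z : ℝ × ℝ => bell κ p q δ z.1 z.2 := by
  have h1 := (contDiff_bellS (p := p) (q := q) hκ).continuous
  have h2 : Continuous fun z : ℝ × ℝ => bellS κ p q z.1 z.2 ^ (1 - 2 / p) :=
    h1.rpow_const fun z => Or.inl (bellS_pos hκ _ _).ne'
  unfold bell
  fun_prop

/-- The regularised bilinear estimate. -/
theorem abs_integral_dcoef_le_reg (hκ : 0 < κ) (hp : 2 ≤ p) (hpq : 1 / p + 1 / q = 1)
    (hq : 1 < q) (hq2 : q ≤ 2) (i j : Fin d) :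
    |∫ x, trig K (dcoef (unitVec i) c) x * trig K' (dcoef (unitVec j) c') x ∂(cell d)|
      ≤ 42 / (q - 1) * ∫ x, bellS κ p q (trig K c x) (trig K' (lcoef c') x) ∂(cell d) := by
  set δ := (q - 1) / 21 with hδ
  have hδ0 : 0 < δ := by rw [hδ]; linarith
  set F : ℝ → Vec d → ℝ := fun t x => trig K (hcoef t c) x with hF
  set G : ℝ → Vec d → ℝ := fun t x => trig K' (hcoef t (lcoef c')) x with hG
  set I : ℝ → ℝ := fun t => ∫ x, trig K (hcoef t (dcoef (unitVec i) c)) x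
    * trig K' (hcoef t (dcoef (unitVec j) c')) x ∂(cell d) with hI
  set b : ℝ → ℝ := fun t => ∫ x, bell κ p q δ (F t x) (G t x) ∂(cell d) with hb
  have cX := (contDiff_bellX (p := p) (q := q) (δ := δ) hκ).continuous
  have cY := (contDiff_bellY (p := p) (q := q) (δ := δ) hκ).continuous
  have cB := continuous_bell (p := p) (q := q) hκ δ
  have cF := continuous_trig_hcoef K c
  have cG := continuous_trig_hcoef K' (lcoef c')
  have hb' (t : ℝ) : HasDerivAt b (∫ x, (bellX κ p q δ (F t x) (G t x)
      * trig K (lcoef (hcoef t c)) x + bellY κ p q δ (F t x) (G t x)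
      * trig K' (lcoef (hcoef t (lcoef c'))) x) ∂(cell d)) t := by
    refine hasDerivAt_integral_cell (Φ := fun t x => bell κ p q δ (F t x) (G t x))
      (Φ' := fun t x => bellX κ p q δ (F t x) (G t x) * trig K (lcoef (hcoef t c)) x
        + bellY κ p q δ (F t x) (G t x) * trig K' (lcoef (hcoef t (lcoef c'))) x)
      (fun s => ?_) (fun s x => ?_) ?_ t
    · exact cB.comp ((continuous_trig K _).prodMk (continuous_trig K' _))
    · exact hasDerivAt_bell hκ (hasDerivAt_trig_hcoef K c s x)
        (hasDerivAt_trig_hcoef K' (lcoef c') s x)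
    · have l1 := continuous_trig_hcoef K (lcoef c)
      have l2 := continuous_trig_hcoef K' (lcoef (lcoef c'))
      simp only [hcoef_lcoef] at l1 l2 cG
      exact ((cX.comp (cF.prodMk (continuous_trig_hcoef K' (lcoef c')))).mul l1).add
        ((cY.comp (cF.prodMk (continuous_trig_hcoef K' (lcoef c')))).mul
          (by simpa only [Function.comp_def, Function.uncurry, hcoef_lcoef] using l2))
  have hI' (t : ℝ) : HasDerivAt I (2 * ∫ x, trig K (dcoef (unitVec i) (hcoef t c)) x
      * trig K' (dcoef (unitVec j) (hcoef t (lcoef c'))) x ∂(cell d)) t := by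
    have h := hasDerivAt_integral_cell
      (Φ := fun t x => trig K (hcoef t (dcoef (unitVec i) c)) x
        * trig K' (hcoef t (dcoef (unitVec j) c')) x) (fun s => by fun_prop)
      (fun s x => (hasDerivAt_trig_hcoef K (dcoef (unitVec i) c) s x).mul
        (hasDerivAt_trig_hcoef K' (dcoef (unitVec j) c') s x)) ?_ t
    · refine h.congr_deriv ?_
      rw [integral_add (Continuous.integrable_cell (by fun_prop))
        (Continuous.integrable_cell (by fun_prop)), integral_trig_lcoef_comm]
      simp only [← hcoef_dcoef, dcoef_lcoef, ← hcoef_lcoef]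
      ring
    · have l1 := continuous_trig_hcoef K (dcoef (unitVec i) c)
      have l2 := continuous_trig_hcoef K' (dcoef (unitVec j) c')
      have l3 := continuous_trig_hcoef K (lcoef (dcoef (unitVec i) c))
      have l4 := continuous_trig_hcoef K' (lcoef (dcoef (unitVec j) c'))
      simp only [hcoef_lcoef] at l3 l4
      exact (l3.mul l2).add (l1.mul l4)
  -- `b / (2δ) ± I / 2` decreases along the heat flow
  have key (s : ℝ) (hs : |s| ≤ 1) (T : ℝ) (hT : 0 ≤ T) :
      b T + δ * (s * I T) ≤ b 0 + δ * (s * I 0) := by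
    have hd (t : ℝ) := (hb' t).fun_add (((hI' t).const_mul s).const_mul δ)
    refine antitone_of_deriv_nonpos (fun t => (hd t).differentiableAt) (fun t => ?_) hT
    rw [(hd t).deriv]
    have h1 := integral_bell_lcoef_le K K' (hcoef t c) (hcoef t (lcoef c')) hκ hp hpq hq i j
    rw [integral_const_mul] at h1
    have h2 : |s * ∫ x, trig K (dcoef (unitVec i) (hcoef t c)) x
      * trig K' (dcoef (unitVec j) (hcoef t (lcoef c'))) x ∂(cell d)|
      ≤ ∫ x, |trig K (dcoef (unitVec i) (hcoef t c)) x
      * trig K' (dcoef (unitVec j) (hcoef t (lcoef c'))) x| ∂(cell d) := by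
      rw [abs_mul]
      refine le_trans (mul_le_of_le_one_left (abs_nonneg _) hs) ?_
      simpa only [Real.norm_eq_abs] using norm_integral_le_integral_norm (μ := cell d)
        fun x => trig K (dcoef (unitVec i) (hcoef t c)) x
          * trig K' (dcoef (unitVec j) (hcoef t (lcoef c'))) x
    have h3 := mul_le_mul_of_nonneg_left ((le_abs_self _).trans h2)
      (by positivity : 0 ≤ 2 * δ)
    rw [← hδ] at h1
    linarith
  have hItend : Tendsto I atTop (𝓝 0) := by
    have h1 : ∀ t : ℝ, 0 ≤ t → ‖I t‖ ≤ (∑ k ∈ K, ‖dcoef (unitVec i) c k‖)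
        * ∑ k ∈ K', ‖hcoef t (dcoef (unitVec j) c') k‖ := by
      intro t ht
      refine (norm_integral_le_of_norm_le_const (C := (∑ k ∈ K, ‖dcoef (unitVec i) c k‖)
        * ∑ k ∈ K', ‖hcoef t (dcoef (unitVec j) c') k‖)
        (Eventually.of_forall fun x => ?_)).trans (by simp)
      rw [norm_mul, Real.norm_eq_abs, Real.norm_eq_abs]
      refine mul_le_mul ((abs_trig_le _ _ _).trans ?_) (abs_trig_le _ _ _) (abs_nonneg _)
        (by positivity)
      exact Finset.sum_le_sum fun k _ => norm_hcoef_le _ ht k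
    refine squeeze_zero_norm' ((eventually_ge_atTop 0).mono h1) ?_
    have h2 : Tendsto (fun t => ∑ k ∈ K', ‖hcoef t (dcoef (unitVec j) c') k‖) atTop (𝓝 0) := by
      simpa using tendsto_finsetSum K' fun k _ => tendsto_hcoef_dcoef c' j k
    simpa using h2.const_mul (∑ k ∈ K, ‖dcoef (unitVec i) c k‖)
  have hb0 (T : ℝ) : 0 ≤ b T := integral_nonneg fun x => (bell_le hκ hp hδ0.le
    (by rw [hδ]; linarith) _ _).1
  have hlim (s : ℝ) (hs : |s| ≤ 1) : 0 ≤ b 0 + δ * (s * I 0) := by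
    have h1 : Tendsto (fun T => δ * (s * I T)) atTop (𝓝 0) := by
      simpa using (hItend.const_mul s).const_mul δ
    refine le_of_tendsto h1 ((eventually_ge_atTop 0).mono fun T hT => ?_)
    linarith [key s hs T hT, hb0 T]
  have hI0 : I 0 = ∫ x, trig K (dcoef (unitVec i) c) x * trig K' (dcoef (unitVec j) c') x
      ∂(cell d) := by simp only [hI, hcoef_zero]
  have hb1 : b 0 ≤ 2 * ∫ x, bellS κ p q (trig K c x) (trig K' (lcoef c') x) ∂(cell d) := by
    rw [← integral_const_mul]
    have cS := (contDiff_bellS (p := p) (q := q) hκ).continuous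
    simp only [hb, hF, hG, hcoef_zero]
    refine integral_mono ?_ ?_ fun x => (bell_le hκ hp hδ0.le (by rw [hδ]; linarith) _ _).2
    · exact (cB.comp ((continuous_trig K _).prodMk (continuous_trig K' _))).integrable_cell
    · exact (continuous_const.mul
        (cS.comp ((continuous_trig K _).prodMk (continuous_trig K' _)))).integrable_cell
  rw [← hI0]
  have e1 := hlim 1 (by simp)
  have e2 := hlim (-1) (by simp)
  have e3 : δ * |I 0| ≤ b 0 := by
    rcases abs_cases (I 0) with ⟨h, -⟩ | ⟨h, -⟩ <;> rw [h] <;> linarith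
  have e4 : |I 0| ≤ b 0 / δ := by rw [le_div_iff₀ hδ0]; linarith
  refine e4.trans ?_
  rw [div_le_iff₀ hδ0, hδ]
  have : q - 1 ≠ 0 := by linarith
  calc b 0 ≤ _ := hb1
    _ = _ := by field_simp; ring

theorem tendsto_integral_bellS (hp : 0 < p) (hq : 0 < q) {f g : Vec d → ℝ} (hf : Continuous f)
    (hg : Continuous g) :
    Tendsto (fun κ => ∫ x, bellS κ p q (f x) (g x) ∂(cell d)) (𝓝[>] 0)
      (𝓝 (∫ x, (|f x| ^ p + |g x| ^ q) ∂(cell d))) := by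
  have hr (r ξ : ℝ) : regPow 0 r ξ = |ξ| ^ r := by
    rw [regPow, add_zero, ← sq_abs, ← Real.rpow_natCast, ← Real.rpow_mul (abs_nonneg _)]
    congr 1; push_cast; ring
  refine tendsto_integral_filter_of_dominated_convergence
    (fun x => bellS 1 p q (f x) (g x)) ?_ ?_ ?_ ?_
  · filter_upwards [self_mem_nhdsWithin] with κ hκ
    exact (((contDiff_bellS hκ).continuous).comp (hf.prodMk hg)).aestronglyMeasurable
  · filter_upwards [Ioc_mem_nhdsGT zero_lt_one] with κ hκ
    refine Eventually.of_forall fun x => ?_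
    rw [Real.norm_eq_abs, abs_of_pos (bellS_pos hκ.1 _ _)]
    unfold bellS regPow
    have := hκ.1
    gcongr <;> exact hκ.2
  · exact (((contDiff_bellS one_pos).continuous).comp (hf.prodMk hg)).integrable_cell
  · refine Eventually.of_forall fun x => tendsto_nhdsWithin_of_tendsto_nhds ?_
    rw [← hr, ← hr]
    have h (r ξ : ℝ) (h : 0 < r) : Continuous fun κ => regPow κ r ξ :=
      (by fun_prop : Continuous fun κ : ℝ => ξ ^ 2 + κ).rpow_const fun _ => Or.inr (by positivity)
    exact ((h p (f x) hp).add (h q (g x) hq)).tendsto 0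

theorem abs_integral_dcoef_le_add (hp : 2 ≤ p) (hpq : 1 / p + 1 / q = 1)
    (hq : 1 < q) (hq2 : q ≤ 2) (i j : Fin d) :
    |∫ x, trig K (dcoef (unitVec i) c) x * trig K' (dcoef (unitVec j) c') x ∂(cell d)|
      ≤ 42 / (q - 1) * ∫ x, (|trig K c x| ^ p + |trig K' (lcoef c') x| ^ q) ∂(cell d) := by
  refine ge_of_tendsto ((tendsto_integral_bellS (by linarith) (by linarith)
    (continuous_trig K c) (continuous_trig K' (lcoef c'))).const_mul _) ?_
  filter_upwards [self_mem_nhdsWithin] with κ hκ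
  exact abs_integral_dcoef_le_reg K K' c c' hκ hp hpq hq hq2 i j

end Riesz

/-! ### Uniform approximation by trigonometric polynomials -/

section Density

variable {d : ℕ}

/-- The projection `ℝᵈ → (ℝ/ℤ)ᵈ`. -/
def toTorus (x : Vec d) : UnitAddTorus (Fin d) := fun a => (x a : UnitAddCircle)

theorem isOpenQuotientMap_toTorus : IsOpenQuotientMap (toTorus (d := d)) := by
  have h1 : IsOpenQuotientMap (Pi.map fun (_ : Fin d) (r : ℝ) => (r : UnitAddCircle)) :=
    IsOpenQuotientMap.piMap fun _ => QuotientAddGroup.isOpenQuotientMap_mk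
  exact h1.comp (PiLp.homeomorph 2 fun _ : Fin d => ℝ).isOpenQuotientMap

theorem IsTorusFn.eq_of_toTorus_eq {α : Type*} {f : Vec d → α} (hf : IsTorusFn f) {x y : Vec d}
    (h : toTorus x = toTorus y) : f x = f y := by
  have h1 (a : Fin d) : ∃ n : ℤ, (n : ℝ) = x a - y a := by
    have h2 : ((x a - y a : ℝ) : UnitAddCircle) = 0 := by
      rw [AddCircle.coe_sub]; exact sub_eq_zero.2 (congrFun h a)
    obtain ⟨n, hn⟩ := (AddCircle.coe_eq_zero_iff 1).1 h2
    exact ⟨n, by simpa using hn⟩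
  choose n hn using h1
  have h3 : x - y ∈ lattice d := by
    have : x - y = ∑ a, n a • (EuclideanSpace.basisFun (Fin d) ℝ).toBasis a := by
      ext a
      simp [hn, Pi.single_apply]
    rw [this]
    change _ ∈ Submodule.span ℤ _
    exact Submodule.sum_mem _ fun a _ => Submodule.smul_mem _ _ (Submodule.subset_span ⟨a, rfl⟩)
  rw [← hf.add_lattice ⟨x - y, h3⟩ y]
  simp

/-- Trigonometric polynomials are uniformly dense in the continuous functions on the torus. Real
functions suffice, because the real part of a complex trigonometric polynomial is of the form
`trig K c`. -/
theorem exists_trig_approx {f : Vec d → ℝ} (hf : IsTorusFn f) (hc : Continuous f) {η : ℝ}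
    (hη : 0 < η) : ∃ K c, ∀ x, |f x - trig K c x| < η := by
  have hs := (isOpenQuotientMap_toTorus (d := d)).surjective
  choose r hr using hs
  have hfr (x : Vec d) : f (r (toTorus x)) = f x := hf.eq_of_toTorus_eq (hr _)
  have hFc : Continuous fun θ => ((f (r θ) : ℝ) : ℂ) := by
    refine Complex.continuous_ofReal.comp ?_
    rw [isOpenQuotientMap_toTorus.isQuotientMap.continuous_iff]
    simpa only [Function.comp_def, hfr] using hc
  let F : C(UnitAddTorus (Fin d), ℂ) := ⟨fun θ => ((f (r θ) : ℝ) : ℂ), hFc⟩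
  have hF : F ∈ closure ((Submodule.span ℂ (range UnitAddTorus.mFourier) :
      Submodule ℂ C(UnitAddTorus (Fin d), ℂ)) : Set C(UnitAddTorus (Fin d), ℂ)) := by
    rw [← Submodule.topologicalClosure_coe, UnitAddTorus.span_mFourier_closure_eq_top]
    trivial
  obtain ⟨P, hP, hFP⟩ := Metric.mem_closure_iff.1 hF η hη
  obtain ⟨c, hcP⟩ := Finsupp.mem_span_range_iff_exists_finsupp.1 hP
  refine ⟨c.support, c, fun x => ?_⟩
  have h1 : trig c.support c x = (P (toTorus x)).re := by
    rw [← hcP, Finsupp.sum]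
    simp only [ContinuousMap.coe_sum, ContinuousMap.coe_smul, Finset.sum_apply, Pi.smul_apply,
      Complex.re_sum, trig, smul_eq_mul]
    refine Finset.sum_congr rfl fun k _ => ?_
    congr 2
    simp only [UnitAddTorus.mFourier, ContinuousMap.coe_mk, toTorus, fourier_coe_apply]
    rw [← Complex.exp_sum]
    congr 1
    simp only [freq]
    simp
    rw [Finset.sum_mul]
    refine Finset.sum_congr rfl fun a _ => by ring
  have h2 : f x = (F (toTorus x)).re := by simp [F, hfr]
  rw [h1, h2, ← Complex.sub_re]
  refine (Complex.abs_re_le_norm _).trans_lt ?_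
  rw [← ContinuousMap.sub_apply]
  refine (ContinuousMap.norm_coe_le_norm _ _).trans_lt ?_
  rwa [← dist_eq_norm]

/-- A continuous function on the torus orthogonal to all trigonometric polynomials vanishes. -/
theorem eq_zero_of_integral_mul_trig {f : Vec d → ℝ} (hf : IsTorusFn f) (hc : Continuous f)
    (h : ∀ K c, ∫ x, f x * trig K c x ∂(cell d) = 0) : ∀ᵐ x ∂(cell d), f x = 0 := by
  have h1 : ∫ x, f x ^ 2 ∂(cell d) = 0 := by
    obtain ⟨C, hC0, hC⟩ := hf.exists_bound hc
    refine le_antisymm (le_of_forall_pos_le_add fun η hη => ?_)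
      (integral_nonneg fun x => sq_nonneg _)
    obtain ⟨K, c, hKc⟩ := exists_trig_approx hf hc (show 0 < η / (C + 1) by positivity)
    have h2 : ∫ x, f x ^ 2 ∂(cell d) = ∫ x, f x * (f x - trig K c x) ∂(cell d) := by
      simp_rw [mul_sub]
      rw [integral_sub (Continuous.integrable_cell (by fun_prop))
        (Continuous.integrable_cell (by fun_prop)), h K c, sub_zero]
      simp_rw [sq]
    rw [h2, zero_add]
    suffices h4 : ∀ x, ‖f x * (f x - trig K c x)‖ ≤ η by
      have h5 := norm_integral_le_of_norm_le_const (μ := cell d) (Eventually.of_forall h4)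
      rw [probReal_univ, mul_one] at h5
      exact (le_abs_self _).trans h5
    intro x
    rw [norm_mul]
    calc ‖f x‖ * ‖f x - trig K c x‖ ≤ (C + 1) * (η / (C + 1)) :=
          mul_le_mul ((hC x).trans (by linarith)) (hKc x).le (norm_nonneg _) (by positivity)
      _ = η := by field_simp
  have h3 := (integral_eq_zero_iff_of_nonneg (fun x => sq_nonneg (f x))
    (Continuous.integrable_cell (by fun_prop))).1 h1
  filter_upwards [h3] with x hx
  simpa using hx

end Density

/-! ### Korn's inequality in `L^p` -/

section Korn

variable {d : ℕ} {p q : ℝ}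

/-- Optimisation over scalings turns an additive bound into a product bound. -/
theorem le_rpow_mul_rpow_of_scaling {I A B C : ℝ} (hp : 1 < p) (hpq : 1 / p + 1 / q = 1)
    (hq : 1 < q) (hC : 0 ≤ C) (hA : 0 ≤ A) (hB : 0 ≤ B)
    (h : ∀ s : ℝ, 0 < s → I ≤ C * (s ^ p * A + s⁻¹ ^ q * B)) :
    I ≤ 2 * C * (A ^ (1 / p) * B ^ (1 / q)) := by
  have hp0 : 0 < p := by linarith
  have hq0 : 0 < q := by linarith
  have key : ∀ η : ℝ, 0 < η → I ≤ 2 * C * ((A + η) ^ (1 / p) * (B + η) ^ (1 / q)) := by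
    intro η hη
    have hA' : 0 < A + η := by linarith
    have hB' : 0 < B + η := by linarith
    set t := (A + η) ^ (-(1 / p * (1 / q))) * (B + η) ^ (1 / p * (1 / q)) with ht
    have ht0 : 0 < t := by positivity
    have hpp : 1 / p * (1 / q) * p = 1 / q := by field_simp
    have hqq : 1 / p * (1 / q) * q = 1 / p := by field_simp
    have e1 : t ^ p * (A + η) = (A + η) ^ (1 / p) * (B + η) ^ (1 / q) := by
      rw [ht, Real.mul_rpow (by positivity) (by positivity), ← Real.rpow_mul hA'.le,
        ← Real.rpow_mul hB'.le, hpp, neg_mul, hpp, mul_right_comm]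
      congr 1
      nth_rewrite 2 [← Real.rpow_one (A + η)]
      rw [← Real.rpow_add hA']
      congr 1; linarith
    have e2 : t⁻¹ ^ q * (B + η) = (A + η) ^ (1 / p) * (B + η) ^ (1 / q) := by
      rw [ht, mul_inv, ← Real.rpow_neg hA'.le, ← Real.rpow_neg hB'.le, neg_neg,
        Real.mul_rpow (by positivity) (by positivity), ← Real.rpow_mul hA'.le,
        ← Real.rpow_mul hB'.le, hqq, neg_mul, hqq, mul_assoc]
      congr 1
      nth_rewrite 2 [← Real.rpow_one (B + η)]
      rw [← Real.rpow_add hB']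
      congr 1; linarith
    calc I ≤ C * (t ^ p * A + t⁻¹ ^ q * B) := h t ht0
      _ ≤ C * (t ^ p * (A + η) + t⁻¹ ^ q * (B + η)) := by gcongr <;> linarith
      _ = _ := by rw [e1, e2]; ring
  have hcont : Tendsto (fun η => 2 * C * ((A + η) ^ (1 / p) * (B + η) ^ (1 / q))) (𝓝[>] 0)
      (𝓝 (2 * C * (A ^ (1 / p) * B ^ (1 / q)))) := by
    refine tendsto_nhdsWithin_of_tendsto_nhds ?_
    have h1 : Continuous fun η : ℝ => (A + η) ^ (1 / p) :=
      (by fun_prop : Continuous fun η : ℝ => A + η).rpow_const fun _ => Or.inr (by positivity)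
    have h2 : Continuous fun η : ℝ => (B + η) ^ (1 / q) :=
      (by fun_prop : Continuous fun η : ℝ => B + η).rpow_const fun _ => Or.inr (by positivity)
    have := ((h1.mul h2).const_mul (2 * C)).tendsto 0
    simpa using this
  refine ge_of_tendsto hcont ?_
  filter_upwards [self_mem_nhdsWithin] with η hη using key η hη

theorem dcoef_smul (r : ℝ) (e : Vec d) (c : (Fin d → ℤ) → ℂ) :
    dcoef e (fun k => (r : ℂ) * c k) = fun k => (r : ℂ) * dcoef e c k := by
  funext k; simp only [dcoef]; ring

theorem lcoef_smul (r : ℝ) (c : (Fin d → ℤ) → ℂ) :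
    lcoef (fun k => (r : ℂ) * c k) = fun k => (r : ℂ) * lcoef c k := by
  funext k; simp only [lcoef]; ring

/-- The bilinear form of the Riesz transforms is bounded on `L^p × L^q`. The additive form of the
estimate is optimised over the scalings `(s f, s⁻¹ g)`, which leave the bilinear form invariant. -/
theorem abs_integral_dcoef_le (hp : 2 ≤ p) (hpq : 1 / p + 1 / q = 1) (hq : 1 < q) (hq2 : q ≤ 2)
    (i j : Fin d) (K K' : Finset (Fin d → ℤ)) (c c' : (Fin d → ℤ) → ℂ) :
    |∫ x, trig K (dcoef (unitVec i) c) x * trig K' (dcoef (unitVec j) c') x ∂(cell d)|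
      ≤ 2 * (42 / (q - 1)) * ((∫ x, |trig K c x| ^ p ∂(cell d)) ^ (1 / p)
        * (∫ x, |trig K' (lcoef c') x| ^ q ∂(cell d)) ^ (1 / q)) := by
  have cont (r : ℝ) (hr : 0 < r) (K : Finset (Fin d → ℤ)) (c : (Fin d → ℤ) → ℂ) :
      Continuous fun x => |trig K c x| ^ r :=
    (continuous_trig K c).abs.rpow_const fun _ => Or.inr hr.le
  refine le_rpow_mul_rpow_of_scaling (by linarith) hpq hq (by
    have : 0 < q - 1 := by linarith
    positivity) (integral_nonneg fun x => by positivity) (integral_nonneg fun x => by positivity)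
    fun s hs => ?_
  have h := abs_integral_dcoef_le_add K K' (fun k => (s : ℂ) * c k)
    (fun k => ((s⁻¹ : ℝ) : ℂ) * c' k) hp hpq hq hq2 i j
  rw [dcoef_smul, dcoef_smul, lcoef_smul] at h
  simp_rw [trig_smul] at h
  have e1 : ∀ x, s * trig K (dcoef (unitVec i) c) x * (s⁻¹ * trig K' (dcoef (unitVec j) c') x)
      = trig K (dcoef (unitVec i) c) x * trig K' (dcoef (unitVec j) c') x := fun x => by
    field_simp
  simp_rw [e1] at h
  refine h.trans (le_of_eq ?_)
  congr 1
  rw [integral_add]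
  · simp_rw [abs_mul, abs_of_pos hs, abs_of_pos (inv_pos.2 hs),
      Real.mul_rpow hs.le (abs_nonneg _), Real.mul_rpow (inv_pos.2 hs).le (abs_nonneg _),
      integral_const_mul]
  · simp_rw [← trig_smul]
    exact (cont p (by linarith) _ _).integrable_cell
  · simp_rw [← trig_smul]
    exact (cont q (by linarith) _ _).integrable_cell

/-- Uniform convergence passes through `∫ Φ(·, x)` on the torus. -/
theorem tendsto_integral_of_uniform {f : Vec d → ℝ} {g : ℕ → Vec d → ℝ} (hg : ∀ n, Continuous (g n))
    (hf : IsTorusFn f) (hfc : Continuous f) (h : ∀ n x, |f x - g n x| < 1 / ((n : ℝ) + 1))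
    {Φ : ℝ → Vec d → ℝ} (hΦ : Continuous (Function.uncurry Φ)) :
    Tendsto (fun n => ∫ x, Φ (g n x) x ∂(cell d)) atTop (𝓝 (∫ x, Φ (f x) x ∂(cell d))) := by
  obtain ⟨C, hC0, hC⟩ := hf.exists_bound hfc
  obtain ⟨L, hL, hsub⟩ := unitCell_subset_compact d
  obtain ⟨M, hM⟩ := ((isCompact_Icc (a := -(C + 1)) (b := C + 1)).prod hL).exists_bound_of_continuousOn
    hΦ.continuousOn
  refine tendsto_integral_of_dominated_convergence (fun _ => M) ?_ (integrable_const _) ?_ ?_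
  · intro n
    exact (hΦ.comp ((hg n).prodMk continuous_id)).aestronglyMeasurable
  · intro n
    filter_upwards [ae_cell_mem d] with x hx
    refine hM (g n x, x) ⟨?_, hsub hx⟩
    have h1 := abs_lt.1 (h n x)
    have h2 := abs_le.1 (hC x)
    have h3 : 1 / ((n : ℝ) + 1) ≤ 1 := by
      rw [div_le_one (by positivity)]; linarith [(Nat.cast_nonneg n : (0 : ℝ) ≤ n)]
    constructor <;> simp only <;> linarith
  · refine Eventually.of_forall fun x => ?_
    have h1 : Tendsto (fun n => g n x) atTop (𝓝 (f x)) := by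
      rw [tendsto_iff_dist_tendsto_zero]
      refine squeeze_zero (fun _ => dist_nonneg) (fun n => ?_)
        (tendsto_one_div_add_atTop_nhds_zero_nat (𝕜 := ℝ))
      rw [dist_comm, Real.dist_eq]; exact (h n x).le
    exact ((hΦ.comp (by fun_prop : Continuous fun r : ℝ => (r, x))).tendsto _).comp h1

/-- `L^p` boundedness of `∂_i ∂_j Δ⁻¹` in dual form. -/
theorem abs_integral_mul_dcoef_dcoef_le (hp : 2 ≤ p) (hpq : 1 / p + 1 / q = 1) (hq : 1 < q)
    (hq2 : q ≤ 2) (i j : Fin d) {f : Vec d → ℝ} (hf : IsTorusFn f) (hfc : Continuous f)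
    (K : Finset (Fin d → ℤ)) (c : (Fin d → ℤ) → ℂ) :
    |∫ x, f x * trig K (dcoef (unitVec i) (dcoef (unitVec j) c)) x ∂(cell d)|
      ≤ 2 * (42 / (q - 1)) * ((∫ x, |f x| ^ p ∂(cell d)) ^ (1 / p)
        * (∫ x, |trig K (lcoef c) x| ^ q ∂(cell d)) ^ (1 / q)) := by
  have hη (n : ℕ) : 0 < 1 / ((n : ℝ) + 1) := by positivity
  choose K' c' hKc using fun n : ℕ => exists_trig_approx hf hfc (hη n)
  have l1 := tendsto_integral_of_uniform (fun n => continuous_trig (K' n) (c' n)) hf hfc hKc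
    (Φ := fun r x => r * trig K (dcoef (unitVec i) (dcoef (unitVec j) c)) x) (by
      unfold Function.uncurry; fun_prop)
  have l2 := tendsto_integral_of_uniform (fun n => continuous_trig (K' n) (c' n)) hf hfc hKc
    (Φ := fun r _ => |r| ^ p) (by
      unfold Function.uncurry
      exact (by fun_prop : Continuous fun z : ℝ × Vec d => |z.1|).rpow_const
        fun _ => Or.inr (by linarith))
  have l3 := (l2.rpow_const (p := 1 / p) (Or.inr (by positivity))).mul_const
    ((∫ x, |trig K (lcoef c) x| ^ q ∂(cell d)) ^ (1 / q)) |>.const_mul (2 * (42 / (q - 1)))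
  refine le_of_tendsto_of_tendsto' l1.abs l3 fun n => ?_
  rw [integral_trig_mul_dcoef K _ (contDiff_one_trig _ _) (isTorusFn_trig _ _), abs_neg]
  simp_rw [hasFDerivAt_trig_dir]
  exact abs_integral_dcoef_le hp hpq hq hq2 i j _ _ _ _

theorem integral_fderiv_mul_dcoef_comm {f : Vec d → ℝ} (hf : ContDiff ℝ 1 f) (hp : IsTorusFn f)
    (e e' : Vec d) (K : Finset (Fin d → ℤ)) (c : (Fin d → ℤ) → ℂ) :
    ∫ x, fderiv ℝ f x e * trig K (dcoef e' c) x ∂(cell d)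
      = ∫ x, fderiv ℝ f x e' * trig K (dcoef e c) x ∂(cell d) := by
  have h1 := integral_trig_mul_dcoef K (dcoef e' c) hf hp e
  have h2 := integral_trig_mul_dcoef K (dcoef e c) hf hp e'
  rw [dcoef_comm] at h1
  linarith

/-- Mean-zero trigonometric polynomials are Laplacians. -/
theorem exists_trig_lcoef (K : Finset (Fin d → ℤ)) (c : (Fin d → ℤ) → ℂ) :
    ∃ (c' : (Fin d → ℤ) → ℂ) (m : ℝ), ∀ x, trig K c x = trig K (lcoef c') x + m := by
  classical
  refine ⟨fun k => -(c k / eig k), ∑ k ∈ K, if eig k = 0 then (c k).re else 0, fun x => ?_⟩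
  rw [trig, trig, ← Finset.sum_add_distrib]
  refine Finset.sum_congr rfl fun k _ => ?_
  split_ifs with hk
  · have : freq k = 0 := by
      have h0 (a : Fin d) : k a = 0 := by
        have := (Finset.sum_eq_zero_iff_of_nonneg (fun b _ => sq_nonneg (freq k (unitVec b)))).1
          hk a (Finset.mem_univ a)
        rw [freq_unitVec] at this
        have := pow_eq_zero_iff (two_ne_zero) |>.1 this
        have hpi := Real.pi_ne_zero
        simpa [hpi] using this
      ext x; simp [freq, h0]
    simp [lcoef, this, hk]
  · have : (eig k : ℂ) ≠ 0 := by exact_mod_cast hk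
    rw [add_zero, lcoef]
    congr 2
    field_simp

end Korn

section Korn

variable {d : ℕ} {p q : ℝ}

theorem norm_integral_rpow_le {α E : Type*} [MeasurableSpace α] {μ : Measure α}
    [IsProbabilityMeasure μ] [NormedAddCommGroup E] [NormedSpace ℝ E] {r : ℝ} (hr : 1 ≤ r)
    {f : α → E} (hf : Integrable f μ) (hfr : Integrable (fun x => ‖f x‖ ^ r) μ) :
    ‖∫ x, f x ∂μ‖ ^ r ≤ ∫ x, ‖f x‖ ^ r ∂μ := by
  refine (Real.rpow_le_rpow (norm_nonneg _) (norm_integral_le_integral_norm f)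
    (by linarith)).trans ?_
  exact (convexOn_rpow hr).map_integral_le
    (continuousOn_id.rpow_const fun _ _ => Or.inr (by linarith)) isClosed_Ici
    (Eventually.of_forall fun x => norm_nonneg _) hf.norm hfr

theorem add_rpow_le {r a b : ℝ} (hr : 1 ≤ r) (ha : 0 ≤ a) (hb : 0 ≤ b) :
    (a + b) ^ r ≤ 2 ^ (r - 1) * (a ^ r + b ^ r) := by
  have := NNReal.rpow_add_le_mul_rpow_add_rpow ⟨a, ha⟩ ⟨b, hb⟩ hr
  exact_mod_cast this

/-- Continuously differentiable divergence-free vector fields on the torus. -/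
structure IsSolenoidalC1 (u : Vec d → Vec d) : Prop where
  contDiff : ContDiff ℝ 1 u
  periodic : IsTorusFn u
  div_eq_zero : ∀ x, ∑ a, fderiv ℝ u x (unitVec a) a = 0

theorem fderiv_component {u : Vec d → Vec d} {x : Vec d} (hu : DifferentiableAt ℝ u x)
    (e : Vec d) (k : Fin d) : fderiv ℝ (fun y => u y k) x e = fderiv ℝ u x e k := by
  have := ((EuclideanSpace.proj k : Vec d →L[ℝ] ℝ).hasFDerivAt.comp x hu.hasFDerivAt).fderiv
  have h2 : (fun y => u y k) = (EuclideanSpace.proj k : Vec d →L[ℝ] ℝ) ∘ u := rfl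
  rw [h2, this]; rfl

theorem contDiff_component {n : WithTop ℕ∞} {u : Vec d → Vec d} (hu : ContDiff ℝ n u) (k : Fin d) :
    ContDiff ℝ n fun y => u y k :=
  (EuclideanSpace.proj k : Vec d →L[ℝ] ℝ).contDiff.comp hu

theorem continuous_component {α : Type*} [TopologicalSpace α] {f : α → Vec d} (hf : Continuous f)
    (k : Fin d) : Continuous fun y => f y k :=
  (EuclideanSpace.proj k : Vec d →L[ℝ] ℝ).continuous.comp hf

theorem continuous_fderiv_entry {u : Vec d → Vec d} (hu : ContDiff ℝ 1 u) (e : Vec d) (k : Fin d) :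
    Continuous fun x => fderiv ℝ u x e k :=
  continuous_component ((hu.continuous_fderiv one_ne_zero).clm_apply continuous_const) k

theorem dot_self_eq (A : Matrix (Fin d) (Fin d) ℝ) (hA : A.IsSymm) :
    dot A A = ∑ a, ∑ b, A a b ^ 2 := by
  rw [dot, Matrix.trace]
  refine Finset.sum_congr rfl fun a _ => ?_
  rw [Matrix.diag_apply, Matrix.mul_apply]
  refine Finset.sum_congr rfl fun b _ => ?_
  rw [← hA.apply b a, sq]

theorem matNorm_sq (A : SymMat d) : matNorm A.1 ^ 2 = ∑ a, ∑ b, A.1 a b ^ 2 := by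
  rw [matNorm, dot_self_eq _ A.2, Real.sq_sqrt]
  positivity

theorem abs_entry_le_matNorm (A : SymMat d) (a b : Fin d) : |A.1 a b| ≤ matNorm A.1 := by
  refine abs_le_of_sq_le_sq' ?_ (Real.sqrt_nonneg _) |> abs_le.2
  rw [matNorm_sq]
  refine le_trans ?_ (Finset.single_le_sum (f := fun a => ∑ b, A.1 a b ^ 2)
    (fun a _ => by positivity) (Finset.mem_univ a))
  exact Finset.single_le_sum (f := fun b => A.1 a b ^ 2) (fun b _ => sq_nonneg _)
    (Finset.mem_univ b)

theorem symGrad_apply (u : Vec d → Vec d) (x : Vec d) (a b : Fin d) :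
    (symGrad u x).1 a b
      = (1 / 2) * (fderiv ℝ u x (unitVec a) b + fderiv ℝ u x (unitVec b) a) := by
  simp [symGrad, grad, Matrix.smul_apply, Matrix.add_apply]
  ring

theorem continuous_matNorm : Continuous fun A : SymMat d => matNorm A.1 := by
  unfold matNorm dot
  fun_prop

theorem continuous_symGrad {u : Vec d → Vec d} (hu : ContDiff ℝ 1 u) :
    Continuous (symGrad u) := by
  refine Continuous.subtype_mk ?_ _
  refine continuous_matrix fun a b => ?_
  have := continuous_fderiv_entry hu
  simp only [grad, Matrix.smul_apply, Matrix.add_apply, Matrix.transpose_apply, Matrix.of_apply,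
    smul_eq_mul]
  exact continuous_const.mul ((this _ _).add (this _ _))

/-- For divergence-free `u`, the field `∂_j u_k` is `∂_j ∂_i Δ⁻¹` applied to `2 e(u)_{ik}`. -/
theorem IsSolenoidalC1.integral_fderiv_mul_lcoef {u : Vec d → Vec d} (hu : IsSolenoidalC1 u)
    (j k : Fin d) (K : Finset (Fin d → ℤ)) (c : (Fin d → ℤ) → ℂ) :
    ∫ x, fderiv ℝ u x (unitVec j) k * trig K (lcoef c) x ∂(cell d)
      = 2 * ∑ i, ∫ x, (symGrad u x).1 i k
        * trig K (dcoef (unitVec i) (dcoef (unitVec j) c)) x ∂(cell d) := by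
  have hd (x : Vec d) := hu.contDiff.differentiable one_ne_zero x
  have hcomp (b : Fin d) := contDiff_component hu.contDiff b
  have hper (b : Fin d) : IsTorusFn fun x => u x b := hu.periodic.comp fun v => v b
  have cE := continuous_fderiv_entry hu.contDiff
  have swap (b : Fin d) (e e' : Vec d) (c : (Fin d → ℤ) → ℂ) :
      ∫ x, fderiv ℝ u x e b * trig K (dcoef e' c) x ∂(cell d)
        = ∫ x, fderiv ℝ u x e' b * trig K (dcoef e c) x ∂(cell d) := by
    have := integral_fderiv_mul_dcoef_comm (hcomp b) (hper b) e e' K c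
    simpa only [fderiv_component (hd _)] using this
  have h1 : ∫ x, fderiv ℝ u x (unitVec j) k * trig K (lcoef c) x ∂(cell d)
      = ∑ i, ∫ x, fderiv ℝ u x (unitVec i) k
        * trig K (dcoef (unitVec i) (dcoef (unitVec j) c)) x ∂(cell d) := by
    simp_rw [trig_lcoef, Finset.mul_sum]
    rw [integral_finsetSum _ fun a _ => Continuous.integrable_cell
      ((cE _ _).fun_mul (continuous_trig _ _))]
    refine Finset.sum_congr rfl fun i _ => ?_
    rw [swap, dcoef_comm]
  have h2 : ∑ i, ∫ x, fderiv ℝ u x (unitVec k) i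
        * trig K (dcoef (unitVec i) (dcoef (unitVec j) c)) x ∂(cell d) = 0 := by
    simp_rw [swap _ (unitVec k)]
    rw [← integral_cell_sum _ fun i => (cE (unitVec i) i).fun_mul (continuous_trig _ _)]
    simp_rw [← Finset.sum_mul, hu.div_eq_zero]
    simp
  have h3 : ∀ i, ∫ x, (symGrad u x).1 i k
        * trig K (dcoef (unitVec i) (dcoef (unitVec j) c)) x ∂(cell d)
      = (1 / 2) * (∫ x, fderiv ℝ u x (unitVec i) k
        * trig K (dcoef (unitVec i) (dcoef (unitVec j) c)) x ∂(cell d)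
        + ∫ x, fderiv ℝ u x (unitVec k) i
        * trig K (dcoef (unitVec i) (dcoef (unitVec j) c)) x ∂(cell d)) := by
    intro i
    rw [← integral_add (Continuous.integrable_cell ((cE _ _).fun_mul (continuous_trig _ _)))
      (Continuous.integrable_cell ((cE _ _).fun_mul (continuous_trig _ _))), ← integral_const_mul]
    refine integral_congr_ae (Eventually.of_forall fun x => ?_)
    simp only [symGrad_apply]; ring
  simp_rw [h3]
  rw [← Finset.mul_sum, Finset.sum_add_distrib, h2, h1]
  ring

/-- The duality map `r ↦ |r|^{p-2} r`. -/
def dualPow (p r : ℝ) : ℝ := |r| ^ (p - 2) * r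

theorem mul_dualPow (hp : 2 ≤ p) (r : ℝ) : r * dualPow p r = |r| ^ p := by
  rcases eq_or_ne r 0 with rfl | hr
  · rw [zero_mul, abs_zero, Real.zero_rpow (by linarith)]
  · have h : 0 < |r| := abs_pos.2 hr
    rw [dualPow, mul_left_comm, ← sq, ← sq_abs, ← Real.rpow_natCast, ← Real.rpow_add h]
    congr 1; push_cast; ring

theorem abs_dualPow_rpow (hp : 2 ≤ p) (hpq : 1 / p + 1 / q = 1) (hq : 1 < q) (r : ℝ) :
    |dualPow p r| ^ q = |r| ^ p := by
  rcases eq_or_ne r 0 with rfl | hr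
  · rw [dualPow, mul_zero, abs_zero, Real.zero_rpow (by linarith), Real.zero_rpow (by linarith)]
  · have h : 0 < |r| := abs_pos.2 hr
    rw [dualPow, abs_mul, abs_of_pos (Real.rpow_pos_of_pos h _)]
    nth_rewrite 2 [← Real.rpow_one |r|]
    rw [← Real.rpow_add h, ← Real.rpow_mul h.le]
    congr 1
    have : (p - 1) * q = p := by
      have hp0 : p ≠ 0 := by linarith
      have hq0 : q ≠ 0 := by linarith
      field_simp at hpq
      linarith
    linarith

theorem continuous_dualPow (hp : 2 ≤ p) : Continuous (dualPow p) :=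
  (continuous_abs.rpow_const fun _ => Or.inr (by linarith)).mul continuous_id

/-- Korn's inequality for one entry of the gradient. For a divergence-free field the Laplacian of
`∂ⱼuₖ` is `2 ∑ᵢ ∂ᵢ∂ⱼ eᵢₖ(u)`, so that the pairing of `∂ⱼuₖ` with a Laplacian is a sum of Riesz
transforms of the symmetric gradient. It is tested with the dual power of `∂ⱼuₖ` itself. -/
theorem korn_entry (hp : 2 ≤ p) : ∃ C, 0 ≤ C ∧ ∀ u : Vec d → Vec d, IsSolenoidalC1 u →
    ∀ j k : Fin d, ∫ x, |fderiv ℝ u x (unitVec j) k| ^ p ∂(cell d)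
      ≤ C * ∫ x, matNorm (symGrad u x).1 ^ p ∂(cell d) := by
  set q := p / (p - 1) with hq
  have hp1 : 0 < p - 1 := by linarith
  have hp0 : 0 < p := by linarith
  have hq1 : 1 < q := by rw [hq, lt_div_iff₀ hp1]; linarith
  have hq2 : q ≤ 2 := by rw [hq, div_le_iff₀ hp1]; linarith
  have hq0 : 0 < q := by linarith
  have hpq : 1 / p + 1 / q = 1 := by rw [hq]; field_simp; ring
  set C₁ := 2 * (42 / (q - 1)) with hC₁
  have hC₁0 : 0 ≤ C₁ := by
    have : 0 < q - 1 := by linarith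
    positivity
  refine ⟨(2 * d * C₁ * 2) ^ p, by positivity, fun u hu j k => ?_⟩
  set D : Vec d → ℝ := fun x => fderiv ℝ u x (unitVec j) k with hD
  have cD : Continuous D := continuous_fderiv_entry hu.contDiff _ _
  have pD : IsTorusFn D := (isTorusFn_fderiv hu.periodic).comp fun L => L (unitVec j) k
  have hD0 : ∫ x, D x ∂(cell d) = 0 := by
    have := IsTorusFn.integral_fderiv_apply_eq_zero (hu.periodic.comp fun v => v k)
      (contDiff_component hu.contDiff k) (unitVec j)
    simpa only [fderiv_component (hu.contDiff.differentiable one_ne_zero _)] using this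
  set E := ∫ x, matNorm (symGrad u x).1 ^ p ∂(cell d) with hE
  have hE0 : 0 ≤ E := integral_nonneg fun x => Real.rpow_nonneg (Real.sqrt_nonneg _) _
  have cE : Continuous fun x => matNorm (symGrad u x).1 :=
    continuous_matNorm.comp (continuous_symGrad hu.contDiff)
  have hEik (i : Fin d) : ∫ x, |(symGrad u x).1 i k| ^ p ∂(cell d) ≤ E := by
    refine integral_mono_of_nonneg (Eventually.of_forall fun x => by positivity)
      ((cE.rpow_const fun _ => Or.inr hp0.le).integrable_cell) (Eventually.of_forall fun x => ?_)
    exact Real.rpow_le_rpow (abs_nonneg _) (abs_entry_le_matNorm _ _ _) hp0.le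
  -- the estimate against Laplacians of trigonometric polynomials
  have step (K : Finset (Fin d → ℤ)) (c : (Fin d → ℤ) → ℂ) :
      ∫ x, D x * trig K (lcoef c) x ∂(cell d)
        ≤ 2 * d * C₁ * (E ^ (1 / p) * (∫ x, |trig K (lcoef c) x| ^ q ∂(cell d)) ^ (1 / q)) := by
    rw [hu.integral_fderiv_mul_lcoef j k K c, mul_assoc 2, mul_assoc 2]
    refine mul_le_mul_of_nonneg_left ?_ zero_le_two
    have h1 : ∀ i ∈ Finset.univ, ∫ x, (symGrad u x).1 i k
        * trig K (dcoef (unitVec i) (dcoef (unitVec j) c)) x ∂(cell d)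
        ≤ C₁ * (E ^ (1 / p) * (∫ x, |trig K (lcoef c) x| ^ q ∂(cell d)) ^ (1 / q)) := by
      intro i _
      refine (le_abs_self _).trans ((abs_integral_mul_dcoef_dcoef_le hp hpq hq1 hq2 i j
        (f := fun x => (symGrad u x).1 i k) ?_ ?_ K c).trans ?_)
      · intro a x
        simp only [symGrad_apply, isTorusFn_fderiv hu.periodic a x]
      · exact (continuous_subtype_val.comp (continuous_symGrad hu.contDiff)).matrix_elem _ _
      · have : 0 ≤ ∫ x, |trig K (lcoef c) x| ^ q ∂(cell d) :=
          integral_nonneg fun x => by positivity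
        have h2 : (∫ x, |(symGrad u x).1 i k| ^ p ∂(cell d)) ^ (1 / p) ≤ E ^ (1 / p) :=
          Real.rpow_le_rpow (integral_nonneg fun x => by positivity) (hEik i) (by positivity)
        gcongr
    have h2 := Finset.sum_le_card_nsmul _ _ _ h1
    rw [Finset.card_univ, Fintype.card_fin, nsmul_eq_mul] at h2
    rw [mul_assoc]; exact h2
  -- the dual function, with its mean removed
  set m := ∫ x, dualPow p (D x) ∂(cell d) with hm
  set g : Vec d → ℝ := fun x => dualPow p (D x) - m with hg
  have cg : Continuous g := ((continuous_dualPow hp).comp cD).sub continuous_const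
  have pg : IsTorusFn g := pD.comp fun r => dualPow p r - m
  set Y := ∫ x, |D x| ^ p ∂(cell d) with hY
  have hY0 : 0 ≤ Y := integral_nonneg fun x => by positivity
  have hDg : ∫ x, D x * g x ∂(cell d) = Y := by
    simp_rw [hg, mul_sub, mul_dualPow hp]
    rw [integral_sub, integral_mul_const, hD0, zero_mul, sub_zero]
    · exact (cD.abs.rpow_const fun _ => Or.inr hp0.le).integrable_cell
    · exact (cD.mul continuous_const).integrable_cell
  have hg0 : ∫ x, g x ∂(cell d) = 0 := by
    rw [integral_cell_sub ((continuous_dualPow hp).comp' cD) continuous_const]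
    simp [hm]
  have hη (n : ℕ) : 0 < 1 / ((n : ℝ) + 1) := by positivity
  choose K c hKc using fun n : ℕ => exists_trig_approx pg cg (hη n)
  choose c' μ hc' using fun n => exists_trig_lcoef (K n) (c n)
  have hlc (n : ℕ) (x : Vec d) : trig (K n) (lcoef (c' n)) x = trig (K n) (c n) x - μ n := by
    rw [hc' n x]; ring
  have hμ : Tendsto μ atTop (𝓝 0) := by
    have h1 := tendsto_integral_of_uniform (fun n => continuous_trig (K n) (c n)) pg cg hKc
      (Φ := fun r _ => r) (by unfold Function.uncurry; fun_prop)
    rw [hg0] at h1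
    convert h1 using 2 with n
    simp_rw [hc' n]
    rw [integral_add (Continuous.integrable_cell (by fun_prop)) (integrable_const _)]
    have h2 : ∫ x, trig (K n) (lcoef (c' n)) x ∂(cell d) = 0 := by
      simp_rw [trig_lcoef]
      rw [integral_finsetSum _ fun a _ => Continuous.integrable_cell (by fun_prop)]
      refine Finset.sum_eq_zero fun a _ => ?_
      simp_rw [← hasFDerivAt_trig_dir]
      exact (isTorusFn_trig _ _).integral_fderiv_apply_eq_zero (contDiff_one_trig _ _) _
    rw [h2]; simp
  have l1 : Tendsto (fun n => ∫ x, D x * trig (K n) (lcoef (c' n)) x ∂(cell d)) atTop (𝓝 Y) := by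
    have h1 := tendsto_integral_of_uniform (fun n => continuous_trig (K n) (c n)) pg cg hKc
      (Φ := fun r x => D x * r) (by unfold Function.uncurry; fun_prop)
    rw [hDg] at h1
    convert h1 using 2 with n
    simp_rw [hlc, mul_sub]
    rw [integral_cell_sub (cD.fun_mul (continuous_trig _ _)) (cD.fun_mul continuous_const),
      integral_mul_const, hD0, zero_mul, sub_zero]
  have l2 : ∀ η : ℝ, 0 < η → ∀ᶠ n in atTop, ∫ x, |trig (K n) (lcoef (c' n)) x| ^ q ∂(cell d)
      ≤ ∫ x, (|g x| + η) ^ q ∂(cell d) := by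
    intro η hη'
    have h1 : ∀ᶠ n in atTop, |μ n| < η / 2 := by
      have := hμ.abs; rw [abs_zero] at this
      exact this.eventually_lt_const (by linarith)
    have h2 := (tendsto_one_div_add_atTop_nhds_zero_nat (𝕜 := ℝ)).eventually_lt_const
      (show (0 : ℝ) < η / 2 by linarith)
    filter_upwards [h1, h2] with n hn1 hn2
    refine integral_mono_of_nonneg (Eventually.of_forall fun x => by positivity)
      ((((cg.abs).add continuous_const).rpow_const fun _ => Or.inr hq0.le).integrable_cell)
      (Eventually.of_forall fun x => Real.rpow_le_rpow (abs_nonneg _) ?_ hq0.le)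
    rw [hlc]
    have h3 := hKc n x
    calc |trig (K n) (c n) x - μ n| = |g x - (g x - trig (K n) (c n) x) - μ n| := by ring_nf
      _ ≤ |g x| + |g x - trig (K n) (c n) x| + |μ n| :=
        (abs_sub _ _).trans (add_le_add_left (abs_sub _ _) _)
      _ ≤ |g x| + η := by linarith
  have l3 : ∀ η : ℝ, 0 < η → Y ≤ 2 * d * C₁ * (E ^ (1 / p)
      * (∫ x, (|g x| + η) ^ q ∂(cell d)) ^ (1 / q)) := by
    intro η hη'
    refine le_of_tendsto l1 ((l2 η hη').mono fun n hn => (step (K n) (c' n)).trans ?_)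
    have h1 : (∫ x, |trig (K n) (lcoef (c' n)) x| ^ q ∂(cell d)) ^ (1 / q)
        ≤ (∫ x, (|g x| + η) ^ q ∂(cell d)) ^ (1 / q) :=
      Real.rpow_le_rpow (integral_nonneg fun x => by positivity) hn (by positivity)
    have h2 : 0 ≤ E ^ (1 / p) := by positivity
    gcongr
  have l4 : Y ≤ 2 * d * C₁ * (E ^ (1 / p) * (∫ x, |g x| ^ q ∂(cell d)) ^ (1 / q)) := by
    have h1 : Tendsto (fun η : ℝ => ∫ x, (|g x| + η) ^ q ∂(cell d)) (𝓝[>] 0)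
        (𝓝 (∫ x, |g x| ^ q ∂(cell d))) := by
      have cη (η : ℝ) : Continuous fun x => (|g x| + η) ^ q :=
        ((cg.abs).add continuous_const).rpow_const fun _ => Or.inr hq0.le
      refine tendsto_integral_filter_of_dominated_convergence (fun x => (|g x| + 1) ^ q)
        (Eventually.of_forall fun η => (cη η).aestronglyMeasurable) ?_ (cη 1).integrable_cell
        (Eventually.of_forall fun x => tendsto_nhdsWithin_of_tendsto_nhds ?_)
      · filter_upwards [Ioc_mem_nhdsGT zero_lt_one] with η hη'
        refine Eventually.of_forall fun x => ?_
        have h0 : 0 ≤ |g x| + η := add_nonneg (abs_nonneg _) hη'.1.le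
        rw [Real.norm_eq_abs, abs_of_nonneg (Real.rpow_nonneg h0 _)]
        exact Real.rpow_le_rpow h0 (by linarith [hη'.2]) hq0.le
      · have : Continuous fun η : ℝ => (|g x| + η) ^ q :=
          (continuous_const.add continuous_id).rpow_const fun _ => Or.inr hq0.le
        simpa using this.tendsto 0
    have h2 := ((h1.rpow_const (p := 1 / q) (Or.inr (by positivity))).const_mul
      (E ^ (1 / p))).const_mul (2 * d * C₁)
    refine ge_of_tendsto h2 ?_
    filter_upwards [self_mem_nhdsWithin] with η hη' using l3 η hη'
  have l5 : (∫ x, |g x| ^ q ∂(cell d)) ^ (1 / q) ≤ 2 * Y ^ (1 / q) := by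
    have c1 : Continuous fun x => |dualPow p (D x)| ^ q :=
      ((continuous_dualPow hp).comp cD).abs.rpow_const fun _ => Or.inr hq0.le
    have h0 : ∫ x, |dualPow p (D x)| ^ q ∂(cell d) = Y := by
      simp_rw [abs_dualPow_rpow hp hpq hq1]; rfl
    have h1 : |m| ^ q ≤ Y := by
      rw [← h0]
      exact norm_integral_rpow_le hq1.le ((continuous_dualPow hp).comp cD).integrable_cell
        c1.integrable_cell
    have h2 (x : Vec d) : |g x| ^ q ≤ 2 ^ (q - 1) * (|dualPow p (D x)| ^ q + |m| ^ q) := by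
      have h3 : |g x| ≤ |dualPow p (D x)| + |m| := abs_sub _ _
      exact (Real.rpow_le_rpow (abs_nonneg _) h3 hq0.le).trans
        (add_rpow_le hq1.le (abs_nonneg _) (abs_nonneg _))
    have h3 : ∫ x, |g x| ^ q ∂(cell d) ≤ 2 ^ q * Y := by
      calc _ ≤ ∫ x, 2 ^ (q - 1) * (|dualPow p (D x)| ^ q + |m| ^ q) ∂(cell d) :=
            integral_mono ((cg.abs.rpow_const fun _ => Or.inr hq0.le).integrable_cell)
              ((continuous_const.mul (c1.add continuous_const)).integrable_cell) h2
        _ = 2 ^ (q - 1) * (Y + |m| ^ q) := by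
            rw [integral_const_mul, integral_add c1.integrable_cell (integrable_const _), h0]
            simp
        _ ≤ 2 ^ (q - 1) * (2 * Y) := by gcongr; linarith
        _ = 2 ^ q * Y := by rw [Real.rpow_sub_one two_ne_zero]; ring
    refine (Real.rpow_le_rpow (integral_nonneg fun x => by positivity) h3 (by positivity)).trans ?_
    rw [Real.mul_rpow (by positivity) hY0, ← Real.rpow_mul zero_le_two, mul_one_div_cancel hq0.ne',
      Real.rpow_one]
  have l6 : Y ≤ 2 * d * C₁ * 2 * E ^ (1 / p) * Y ^ (1 / q) := by
    have h2 : 0 ≤ E ^ (1 / p) := by positivity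
    calc Y ≤ _ := l4
      _ ≤ 2 * d * C₁ * (E ^ (1 / p) * (2 * Y ^ (1 / q))) := by gcongr
      _ = _ := by ring
  rcases hY0.eq_or_lt with h | h
  · rw [← h]; positivity
  · have h1 : Y ^ (1 / p) ≤ 2 * d * C₁ * 2 * E ^ (1 / p) := by
      have h3 : Y ^ (1 / p) * Y ^ (1 / q) = Y := by rw [← Real.rpow_add h, hpq, Real.rpow_one]
      have h4 : 0 < Y ^ (1 / q) := by positivity
      exact le_of_mul_le_mul_right (h3.trans_le l6) h4
    have h5 := Real.rpow_le_rpow (by positivity) h1 hp0.le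
    rw [Real.mul_rpow (by positivity) (by positivity), ← Real.rpow_mul hY0, ← Real.rpow_mul hE0,
      one_div_mul_cancel hp0.ne', Real.rpow_one, Real.rpow_one] at h5
    exact h5

theorem norm_clm_le_sum_entries (L : Vec d →L[ℝ] Vec d) :
    ‖L‖ ≤ ∑ jk : Fin d × Fin d, |L (unitVec jk.1) jk.2| := by
  refine L.opNorm_le_bound (by positivity) fun v => ?_
  have hv : v = ∑ j, v j • unitVec j := by
    ext a; simp [unitVec, Pi.single_apply]
  have h1 : ∀ w : Vec d, ‖w‖ ≤ ∑ k, |w k| := fun w => by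
    have hw : w = ∑ j, w j • unitVec j := by
      ext a; simp [unitVec, Pi.single_apply]
    nth_rewrite 1 [hw]
    refine (norm_sum_le _ _).trans (Finset.sum_le_sum fun k _ => ?_)
    simp [norm_smul, unitVec]
  rw [Fintype.sum_prod_type, Finset.sum_mul]
  nth_rewrite 1 [hv]
  rw [map_sum]
  refine (norm_sum_le _ _).trans (Finset.sum_le_sum fun j _ => ?_)
  rw [map_smul, norm_smul, mul_comm]
  exact mul_le_mul (h1 _) (PiLp.norm_apply_le v j) (norm_nonneg _) (by positivity)

/-- **Korn's inequality** for divergence-free fields on the torus. -/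
theorem korn (hp : 2 ≤ p) : ∃ C, 0 ≤ C ∧ ∀ u : Vec d → Vec d, IsSolenoidalC1 u →
    ∫ x, ‖fderiv ℝ u x‖ ^ p ∂(cell d) ≤ C * ∫ x, matNorm (symGrad u x).1 ^ p ∂(cell d) := by
  obtain ⟨C, hC, h⟩ := korn_entry (d := d) hp
  set n : ℝ := (((Finset.univ : Finset (Fin d × Fin d)).card : ℕ) : ℝ) with hn
  refine ⟨n ^ (p - 1) * (n * C), by positivity, fun u hu => ?_⟩
  have cE (jk : Fin d × Fin d) : Continuous fun x => |fderiv ℝ u x (unitVec jk.1) jk.2| ^ p :=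
    (continuous_fderiv_entry hu.contDiff _ _).abs.rpow_const fun _ => Or.inr (by linarith)
  calc ∫ x, ‖fderiv ℝ u x‖ ^ p ∂(cell d)
      ≤ ∫ x, n ^ (p - 1) * ∑ jk : Fin d × Fin d, |fderiv ℝ u x (unitVec jk.1) jk.2| ^ p
          ∂(cell d) := by
        refine integral_cell_mono ((hu.contDiff.continuous_fderiv one_ne_zero).norm.rpow_const
          fun _ => Or.inr (by linarith)) (continuous_const.mul
            (continuous_finsetSum _ fun jk _ => cE jk)) fun x => ?_
        refine (Real.rpow_le_rpow (norm_nonneg _) (norm_clm_le_sum_entries _) (by linarith)).trans ?_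
        exact Real.rpow_sum_le_const_mul_sum_rpow_of_nonneg _ (by linarith) fun _ _ => abs_nonneg _
    _ = n ^ (p - 1) * ∑ jk : Fin d × Fin d, ∫ x, |fderiv ℝ u x (unitVec jk.1) jk.2| ^ p
          ∂(cell d) := by rw [integral_const_mul, integral_cell_sum _ cE]
    _ ≤ n ^ (p - 1) * ∑ jk : Fin d × Fin d, C * ∫ x, matNorm (symGrad u x).1 ^ p ∂(cell d) := by
        gcongr with jk
        exact h u hu _ _
    _ = _ := by rw [Finset.sum_const, nsmul_eq_mul]; ring

end Korn

/-! ### Mollification of periodic fields -/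

section Mollify

theorem integrable_of_bounded_sm {E : Type*} [NormedAddCommGroup E] {Ω : Type*} [MeasurableSpace Ω] {π : Measure Ω}
    [IsFiniteMeasure π] {f : Ω → E} (hf : StronglyMeasurable f) {C : ℝ} (hC : ∀ x, ‖f x‖ ≤ C) :
    Integrable f π :=
  Integrable.of_bound hf.aestronglyMeasurable C (Eventually.of_forall hC)

variable {d : ℕ} {E : Type*} [NormedAddCommGroup E] [NormedSpace ℝ E] {p : ℝ}

/-- Averages of fields over a probability space do not increase the `L^p` norm. -/
theorem integral_norm_integral_rpow_le {Ω : Type*} [MeasurableSpace Ω] {π : Measure Ω}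
    [IsProbabilityMeasure π] {h : Vec d → Ω → E} (hm : StronglyMeasurable (Function.uncurry h))
    {C A : ℝ} (hC : ∀ x y, ‖h x y‖ ≤ C) (hp : 1 ≤ p)
    (hA : ∀ᵐ y ∂π, ∫ x, ‖h x y‖ ^ p ∂(cell d) ≤ A) :
    ∫ x, ‖∫ y, h x y ∂π‖ ^ p ∂(cell d) ≤ A := by
  have hp0 : 0 ≤ p := by linarith
  have hm' : StronglyMeasurable fun z : Vec d × Ω => ‖h z.1 z.2‖ ^ p :=
    (continuous_id.rpow_const fun _ => Or.inr hp0).comp_stronglyMeasurable hm.norm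
  have hb (x : Vec d) (y : Ω) : ‖‖h x y‖ ^ p‖ ≤ C ^ p := by
    rw [Real.norm_eq_abs, abs_of_nonneg (by positivity)]
    exact Real.rpow_le_rpow (norm_nonneg _) (hC x y) hp0
  have hprod : Integrable (fun z : Vec d × Ω => ‖h z.1 z.2‖ ^ p) ((cell d).prod π) :=
    integrable_of_bounded_sm hm' fun z => hb z.1 z.2
  calc ∫ x, ‖∫ y, h x y ∂π‖ ^ p ∂(cell d) ≤ ∫ x, ∫ y, ‖h x y‖ ^ p ∂π ∂(cell d) := by
        refine integral_mono_of_nonneg (Eventually.of_forall fun x => by positivity)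
          hprod.integral_prod_left (Eventually.of_forall fun x => ?_)
        refine norm_integral_rpow_le hp ?_ ?_
        · exact integrable_of_bounded_sm (hm.comp_measurable measurable_prodMk_left) (hC x)
        · exact integrable_of_bounded_sm (hm'.comp_measurable measurable_prodMk_left) (hb x)
    _ = ∫ y, ∫ x, ‖h x y‖ ^ p ∂(cell d) ∂π := integral_integral_swap hprod
    _ ≤ ∫ _y, A ∂π := integral_mono_ae hprod.integral_prod_right (integrable_const _) hA
    _ = A := by simp

/-- Even smooth probability densities supported in the ball of radius `r`. -/
structure IsKernel (k : Vec d → ℝ) (r : ℝ) : Prop where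
  contDiff : ContDiff ℝ ∞ k
  nonneg : ∀ x, 0 ≤ k x
  even : ∀ x, k (-x) = k x
  support : ∀ x, k x ≠ 0 → ‖x‖ ≤ r
  integral_eq_one : ∫ x, k x = 1

/-- The probability measure with density `k`. -/
def kernelMeasure (k : Vec d → ℝ) : Measure (Vec d) :=
  volume.withDensity fun x => ENNReal.ofReal (k x)

variable {k : Vec d → ℝ} {r : ℝ}

theorem IsKernel.hasCompactSupport (hk : IsKernel k r) : HasCompactSupport k := by
  refine HasCompactSupport.of_support_subset_isCompact (isCompact_closedBall (0 : Vec d) r) ?_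
  intro x hx
  rw [mem_closedBall_zero_iff]
  exact hk.support x hx

theorem IsKernel.integrable (hk : IsKernel k r) : Integrable k :=
  hk.contDiff.continuous.integrable_of_hasCompactSupport hk.hasCompactSupport

theorem IsKernel.isProbabilityMeasure (hk : IsKernel k r) :
    IsProbabilityMeasure (kernelMeasure k) := by
  constructor
  rw [kernelMeasure, withDensity_apply _ MeasurableSet.univ, Measure.restrict_univ,
    ← ofReal_integral_eq_lintegral_ofReal hk.integrable (Eventually.of_forall hk.nonneg),
    hk.integral_eq_one, ENNReal.ofReal_one]

theorem IsKernel.integral_kernelMeasure (hk : IsKernel k r) (f : Vec d → E) :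
    ∫ t, f t ∂(kernelMeasure k) = ∫ t, k t • f t := by
  rw [kernelMeasure, integral_withDensity_eq_integral_toReal_smul
    (by exact hk.contDiff.continuous.measurable.ennreal_ofReal)
    (Eventually.of_forall fun _ => ENNReal.ofReal_lt_top)]
  refine integral_congr_ae (Eventually.of_forall fun t => ?_)
  simp only [ENNReal.toReal_ofReal (hk.nonneg t)]

theorem IsKernel.ae_norm_le (hk : IsKernel k r) : ∀ᵐ t ∂(kernelMeasure k), ‖t‖ ≤ r := by
  rw [kernelMeasure, ae_withDensity_iff hk.contDiff.continuous.measurable.ennreal_ofReal]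
  refine Eventually.of_forall fun t ht => hk.support t fun h0 => ?_
  simp [h0] at ht

/-- Convolution of the kernel `k` with a periodic field. -/
abbrev conv (k : Vec d → ℝ) (v : Vec d → E) : Vec d → E :=
  k ⋆[ContinuousLinearMap.lsmul ℝ ℝ, volume] v

theorem IsKernel.conv_apply (hk : IsKernel k r) (v : Vec d → E) (x : Vec d) :
    conv k v x = ∫ t, v (x - t) ∂(kernelMeasure k) := by
  rw [hk.integral_kernelMeasure]; rfl

theorem IsTorusFn.conv {v : Vec d → E} (hv : IsTorusFn v) (k : Vec d → ℝ) :
    IsTorusFn (conv k v) := by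
  intro a x
  simp only [TwoPhaseFlow.conv, convolution]
  refine integral_congr_ae (Eventually.of_forall fun t => ?_)
  simp only [add_sub_right_comm, hv a]

theorem IsKernel.contDiff_conv [CompleteSpace E] (hk : IsKernel k r) {v : Vec d → E}
    (hv : Continuous v) : ContDiff ℝ ∞ (conv k v) :=
  hk.hasCompactSupport.contDiff_convolution_left _ hk.contDiff hv.locallyIntegrable

theorem IsKernel.hasFDerivAt_conv (hk : IsKernel k r) {v : Vec d → E}
    (hv : ContDiff ℝ 1 v) (hp : IsTorusFn v) (x : Vec d) :
    HasFDerivAt (conv k v) (conv k (fderiv ℝ v) x) x := by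
  have := hk.isProbabilityMeasure
  have cD := hv.continuous_fderiv one_ne_zero
  obtain ⟨C, -, hC⟩ := (isTorusFn_fderiv hp).exists_bound cD
  obtain ⟨C', -, hC'⟩ := hp.exists_bound hv.continuous
  have e : conv k v = fun x => ∫ t, v (x - t) ∂(kernelMeasure k) :=
    funext fun x => hk.conv_apply v x
  rw [e, hk.conv_apply]
  refine hasFDerivAt_integral_of_dominated_of_fderiv_le (μ := kernelMeasure k)
    (F := fun x t => v (x - t)) (F' := fun x t => fderiv ℝ v (x - t)) (bound := fun _ => C)
    (s := Metric.ball x 1) (Metric.ball_mem_nhds x one_pos) ?_ ?_ ?_ ?_ (integrable_const _) ?_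
  · exact Eventually.of_forall fun y => (hv.continuous.comp (by fun_prop)).aestronglyMeasurable
  · exact Integrable.of_bound (hv.continuous.comp (by fun_prop)).aestronglyMeasurable C'
      (Eventually.of_forall fun t => hC' _)
  · exact (cD.comp (by fun_prop)).aestronglyMeasurable
  · exact Eventually.of_forall fun t y _ => hC _
  · refine Eventually.of_forall fun t y _ => ?_
    have h1 := (hv.differentiable one_ne_zero (y - t)).hasFDerivAt.comp y
      ((hasFDerivAt_id y).sub_const t)
    simpa [Function.comp_def] using h1

theorem IsKernel.integral_norm_conv_rpow_le (hk : IsKernel k r) (hp : 1 ≤ p) {v : Vec d → E}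
    (hv : Continuous v) (hper : IsTorusFn v) :
    ∫ x, ‖conv k v x‖ ^ p ∂(cell d) ≤ ∫ x, ‖v x‖ ^ p ∂(cell d) := by
  have := hk.isProbabilityMeasure
  obtain ⟨C, -, hC⟩ := hper.exists_bound hv
  simp_rw [hk.conv_apply]
  refine integral_norm_integral_rpow_le (h := fun x t => v (x - t)) ?_ (C := C)
    (fun x t => hC _) hp (Eventually.of_forall fun t => ?_)
  · exact (hv.comp (by fun_prop : Continuous fun z : Vec d × Vec d => z.1 - z.2)).stronglyMeasurable
  · have := (hper.comp fun w => ‖w‖ ^ p).integral_add_right (-t)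
    simpa only [sub_eq_add_neg] using this.le

theorem integral_norm_translate_sub_rpow_le [CompleteSpace E] (hp : 1 ≤ p) {v : Vec d → E}
    (hv : ContDiff ℝ 1 v) (hper : IsTorusFn v) (z : Vec d) :
    ∫ x, ‖v (x + z) - v x‖ ^ p ∂(cell d) ≤ ‖z‖ ^ p * ∫ x, ‖fderiv ℝ v x‖ ^ p ∂(cell d) := by
  have hp0 : 0 ≤ p := by linarith
  have cD := hv.continuous_fderiv one_ne_zero
  have pD := isTorusFn_fderiv hper
  obtain ⟨C, hC0, hC⟩ := pD.exists_bound cD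
  let π : Measure ℝ := volume.restrict (Ioc 0 1)
  have : IsProbabilityMeasure π := ⟨by simp [π]⟩
  have h1 (x : Vec d) : v (x + z) - v x = ∫ s, fderiv ℝ v (x + s • z) z ∂π := by
    have := intervalIntegral.integral_eq_sub_of_hasDerivAt (a := 0) (b := 1)
      (f := fun h : ℝ => v (x + h • z)) (f' := fun h => fderiv ℝ v (x + h • z) z)
      (fun h _ => ?_) ?_
    · rw [intervalIntegral.integral_of_le zero_le_one] at this
      simpa using this.symm
    · have h2 : HasDerivAt (fun h : ℝ => x + h • z) z h := by
        simpa using ((hasDerivAt_id h).smul_const z).const_add x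
      exact (hv.differentiable one_ne_zero _).hasFDerivAt.comp_hasDerivAt h h2
    · exact ((cD.comp (by fun_prop)).clm_apply continuous_const).intervalIntegrable _ _
  simp_rw [h1]
  refine integral_norm_integral_rpow_le (h := fun x s => fderiv ℝ v (x + s • z) z) ?_
    (C := C * ‖z‖) ?_ hp (Eventually.of_forall fun s => ?_)
  · exact ((cD.comp (by fun_prop : Continuous fun w : Vec d × ℝ => w.1 + w.2 • z)).clm_apply
      continuous_const).stronglyMeasurable
  · exact fun x s => ((fderiv ℝ v _).le_opNorm z).trans (by gcongr; exact hC _)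
  · rw [← (pD.comp fun L => ‖L‖ ^ p).integral_add_right (s • z), ← integral_const_mul]
    refine integral_cell_mono ?_ ?_ fun x => ?_
    · exact ((cD.comp (by fun_prop)).clm_apply continuous_const).norm.rpow_const
        fun _ => Or.inr hp0
    · exact continuous_const.mul ((cD.comp (by fun_prop)).norm.rpow_const fun _ => Or.inr hp0)
    · rw [← Real.mul_rpow (norm_nonneg _) (norm_nonneg _), mul_comm]
      exact Real.rpow_le_rpow (norm_nonneg _) ((fderiv ℝ v _).le_opNorm z) hp0

theorem IsKernel.integral_norm_conv_sub_rpow_le [CompleteSpace E] (hk : IsKernel k r)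
    (hp : 1 ≤ p) {v : Vec d → E} (hv : ContDiff ℝ 1 v) (hper : IsTorusFn v) :
    ∫ x, ‖conv k v x - v x‖ ^ p ∂(cell d) ≤ r ^ p * ∫ x, ‖fderiv ℝ v x‖ ^ p ∂(cell d) := by
  have := hk.isProbabilityMeasure
  obtain ⟨C, -, hC⟩ := hper.exists_bound hv.continuous
  have h1 (x : Vec d) : conv k v x - v x = ∫ t, (v (x - t) - v x) ∂(kernelMeasure k) := by
    rw [integral_sub, hk.conv_apply]
    · simp
    · exact Integrable.of_bound (hv.continuous.comp (by fun_prop)).aestronglyMeasurable C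
        (Eventually.of_forall fun t => hC _)
    · exact integrable_const _
  simp_rw [h1]
  refine integral_norm_integral_rpow_le (h := fun x t => v (x - t) - v x) ?_ (C := C + C)
    (fun x t => (norm_sub_le _ _).trans (add_le_add (hC _) (hC _))) hp ?_
  · exact ((hv.continuous.comp (by fun_prop : Continuous fun z : Vec d × Vec d => z.1 - z.2)).sub
      (hv.continuous.comp continuous_fst)).stronglyMeasurable
  · filter_upwards [hk.ae_norm_le] with t ht
    have h2 := integral_norm_translate_sub_rpow_le hp hv hper (-t)
    simp only [← sub_eq_add_neg, norm_neg] at h2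
    refine h2.trans (mul_le_mul_of_nonneg_right ?_ (integral_nonneg fun x => by positivity))
    exact Real.rpow_le_rpow (norm_nonneg _) ht (by linarith)

theorem norm_le_of_mem_unitCell {z : Vec d} (hz : z ∈ unitCell d) : ‖z‖ ≤ d := by
  have hw : z = ∑ j, z j • unitVec j := by
    ext a; simp [unitVec, Pi.single_apply]
  rw [hw]
  refine (norm_sum_le _ _).trans ?_
  calc ∑ j, ‖z j • (unitVec j : Vec d)‖ ≤ ∑ _j : Fin d, (1 : ℝ) := by
        refine Finset.sum_le_sum fun j _ => ?_
        have := hz j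
        rw [norm_smul, unitVec, PiLp.norm_single, norm_one, mul_one, Real.norm_eq_abs,
          abs_of_nonneg this.1]
        exact this.2.le
    _ = d := by simp

/-- A Poincaré inequality in `L^p`. -/
theorem integral_norm_rpow_le_poincare [CompleteSpace E] (hp : 2 ≤ p) {v : Vec d → E}
    (hv : ContDiff ℝ 1 v) (hper : IsTorusFn v) :
    ∫ x, ‖v x‖ ^ p ∂(cell d) ≤ 2 ^ (p - 1) * ((d : ℝ) ^ p * ∫ x, ‖fderiv ℝ v x‖ ^ p ∂(cell d)
      + (∫ x, ‖v x‖ ^ (2 : ℝ) ∂(cell d)) ^ (p / 2)) := by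
  have hp0 : 0 ≤ p := by linarith
  have hp1 : 1 ≤ p := by linarith
  obtain ⟨C, -, hC⟩ := hper.exists_bound hv.continuous
  set m := ∫ x, v x ∂(cell d) with hm
  have h1 : ∫ x, ‖v x - m‖ ^ p ∂(cell d)
      ≤ (d : ℝ) ^ p * ∫ x, ‖fderiv ℝ v x‖ ^ p ∂(cell d) := by
    have e (x : Vec d) : v x - m = ∫ z, -(v (x + z) - v x) ∂(cell d) := by
      rw [integral_neg, integral_sub, integral_const]
      · have h2 := hper.integral_add_right x
        simp_rw [add_comm _ x] at h2
        rw [h2, hm]; simp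
      · exact (hv.continuous.comp (by fun_prop)).integrable_cell
      · exact integrable_const _
    simp_rw [e]
    refine integral_norm_integral_rpow_le (h := fun x z => -(v (x + z) - v x)) ?_ (C := C + C)
      (fun x t => by rw [norm_neg]; exact (norm_sub_le _ _).trans (add_le_add (hC _) (hC _)))
      hp1 ?_
    · exact ((hv.continuous.comp
        (by fun_prop : Continuous fun z : Vec d × Vec d => z.1 + z.2)).sub
        (hv.continuous.comp continuous_fst)).neg.stronglyMeasurable
    · filter_upwards [ae_cell_mem d] with z hz
      simp only [norm_neg]
      refine (integral_norm_translate_sub_rpow_le hp1 hv hper z).trans ?_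
      refine mul_le_mul_of_nonneg_right ?_ (integral_nonneg fun x => by positivity)
      exact Real.rpow_le_rpow (norm_nonneg _) (norm_le_of_mem_unitCell hz) hp0
  have h2 : ‖m‖ ^ p ≤ (∫ x, ‖v x‖ ^ (2 : ℝ) ∂(cell d)) ^ (p / 2) := by
    have h3 := norm_integral_rpow_le (μ := cell d) (r := 2) one_le_two hv.continuous.integrable_cell
      ((hv.continuous.norm.rpow_const fun _ => Or.inr zero_le_two).integrable_cell)
    have h4 := Real.rpow_le_rpow (by positivity) h3 (by positivity : 0 ≤ p / 2)
    rwa [← Real.rpow_mul (norm_nonneg _), mul_div_cancel₀ p two_ne_zero] at h4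
  have c1 : Continuous fun x => ‖v x - m‖ ^ p :=
    (hv.continuous.sub continuous_const).norm.rpow_const fun _ => Or.inr hp0
  calc ∫ x, ‖v x‖ ^ p ∂(cell d) ≤ ∫ x, 2 ^ (p - 1) * (‖v x - m‖ ^ p + ‖m‖ ^ p) ∂(cell d) := by
        refine integral_cell_mono (hv.continuous.norm.rpow_const fun _ => Or.inr hp0)
          (continuous_const.mul (c1.add continuous_const)) fun x => ?_
        refine (Real.rpow_le_rpow (norm_nonneg _) ?_ hp0).trans
          (add_rpow_le hp1 (norm_nonneg _) (norm_nonneg _))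
        simpa using norm_add_le (v x - m) m
    _ = 2 ^ (p - 1) * (∫ x, ‖v x - m‖ ^ p ∂(cell d) + ‖m‖ ^ p) := by
        rw [integral_const_mul, integral_cell_add c1 continuous_const]; simp
    _ ≤ _ := by gcongr

/-- Convolution with an even kernel is symmetric. -/
theorem IsKernel.integral_conv_mul (hk : IsKernel k r) {g h : Vec d → ℝ} (hg : Continuous g)
    (hgp : IsTorusFn g) (hh : Continuous h) (hhp : IsTorusFn h) :
    ∫ x, conv k g x * h x ∂(cell d) = ∫ x, g x * conv k h x ∂(cell d) := by
  have := hk.isProbabilityMeasure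
  obtain ⟨C, hC0, hC⟩ := hgp.exists_bound hg
  obtain ⟨C', -, hC'⟩ := hhp.exists_bound hh
  have e1 : ∫ x, conv k g x * h x ∂(cell d)
      = ∫ t, ∫ x, g (x - t) * h x ∂(cell d) ∂(kernelMeasure k) := by
    simp_rw [hk.conv_apply, ← integral_mul_const]
    refine integral_integral_swap ?_
    refine Integrable.of_bound (Continuous.aestronglyMeasurable ?_) (C * C')
      (Eventually.of_forall fun z => ?_)
    · unfold Function.uncurry; fun_prop
    · rw [Function.uncurry, norm_mul]
      exact mul_le_mul (hC _) (hC' _) (norm_nonneg _) hC0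
  have e2 : ∫ x, g x * conv k h x ∂(cell d)
      = ∫ t, ∫ x, g x * h (x - t) ∂(cell d) ∂(kernelMeasure k) := by
    simp_rw [hk.conv_apply, ← integral_const_mul]
    refine integral_integral_swap ?_
    refine Integrable.of_bound (Continuous.aestronglyMeasurable ?_) (C * C')
      (Eventually.of_forall fun z => ?_)
    · unfold Function.uncurry; fun_prop
    · rw [Function.uncurry, norm_mul]
      exact mul_le_mul (hC _) (hC' _) (norm_nonneg _) hC0
  have e3 (t : Vec d) : ∫ x, g (x - t) * h x ∂(cell d) = ∫ x, g x * h (x - -t) ∂(cell d) := by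
    have := ((hgp.comp_add_right (-t)).comp₂ hhp fun a b => a * b).integral_add_right t
    simp only [← sub_eq_add_neg] at this
    rw [← this]; simp
  rw [e1, e2]
  simp_rw [e3]
  rw [hk.integral_kernelMeasure, hk.integral_kernelMeasure,
    ← integral_neg_eq_self (fun t => k t • ∫ x, g x * h (x - t) ∂(cell d))]
  simp_rw [hk.even]

theorem isKernel_rescale {γ : ℝ} {ζ : Vec d → ℝ} (hζ : IsMollifier ζ) (hd : 0 < d)
    {ε : ℝ} (hε : 0 < ε) : IsKernel (rescale γ ζ ε) (ε ^ (γ / (d : ℝ))) := by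
  have hr : 0 < ε ^ (γ / (d : ℝ)) := Real.rpow_pos_of_pos hε _
  refine ⟨?_, fun x => ?_, fun x => ?_, fun x hx => ?_, ?_⟩
  · unfold rescale
    exact contDiff_const.mul (hζ.smooth.comp (contDiff_const_smul _))
  · exact mul_nonneg (by positivity) (hζ.nonneg _)
  · rw [rescale, rescale, hζ.radial _ ((1 / ε ^ (γ / (d : ℝ))) • x) (by rw [smul_neg, norm_neg])]
  · have h1 : ζ ((1 / ε ^ (γ / (d : ℝ))) • x) ≠ 0 := fun h => hx (by rw [rescale, h, mul_zero])
    have h2 := hζ.support (subset_tsupport _ h1)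
    rw [mem_ball_zero_iff, norm_smul, Real.norm_eq_abs, abs_of_pos (by positivity),
      one_div_mul_eq_div, div_lt_one hr] at h2
    exact h2.le
  · unfold rescale
    rw [integral_const_mul, Measure.integral_comp_smul, hζ.integral_one]
    simp only [finrank_euclideanSpace, Fintype.card_fin, smul_eq_mul, mul_one]
    have h3 : (1 / ε ^ (γ / (d : ℝ))) ^ d = 1 / ε ^ γ := by
      rw [div_pow, one_pow, ← Real.rpow_natCast, ← Real.rpow_mul hε.le,
        div_mul_cancel₀ γ (by positivity)]
    rw [h3, abs_of_pos (by positivity)]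
    field_simp

end Mollify

/-! ### Functional analysis of the Sobolev spaces -/

section LpTools

variable {α : Type*} [MeasurableSpace α] {μ : Measure α} {E : Type*} [NormedAddCommGroup E]
  [NormedSpace ℝ E] {q : ℝ≥0∞} [hq : Fact (1 ≤ q)]

/-- The inclusion `L^q ⊂ L¹` over a finite measure space. -/
def lpIncl (E : Type*) [NormedAddCommGroup E] [NormedSpace ℝ E] (q : ℝ≥0∞) [hq : Fact (1 ≤ q)]
    (μ : Measure α) [IsFiniteMeasure μ] : Lp E q μ →L[ℝ] Lp E 1 μ :=
  LinearMap.mkContinuous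
    { toFun := fun f => ((Lp.memLp f).mono_exponent hq.out).toLp f
      map_add' := fun f g => by
        ext1
        filter_upwards [MemLp.coeFn_toLp ((Lp.memLp (f + g)).mono_exponent hq.out),
          MemLp.coeFn_toLp ((Lp.memLp f).mono_exponent hq.out),
          MemLp.coeFn_toLp ((Lp.memLp g).mono_exponent hq.out), Lp.coeFn_add f g,
          Lp.coeFn_add (((Lp.memLp f).mono_exponent hq.out).toLp f)
            (((Lp.memLp g).mono_exponent hq.out).toLp g)] with x h1 h2 h3 h4 h5
        rw [h1, h5, h4, Pi.add_apply, Pi.add_apply, h2, h3]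
      map_smul' := fun c f => by
        ext1
        filter_upwards [MemLp.coeFn_toLp ((Lp.memLp (c • f)).mono_exponent hq.out),
          MemLp.coeFn_toLp ((Lp.memLp f).mono_exponent hq.out), Lp.coeFn_smul c f,
          Lp.coeFn_smul c (((Lp.memLp f).mono_exponent hq.out).toLp f)] with x h1 h2 h4 h5
        rw [h1, RingHom.id_apply, h5, h4, Pi.smul_apply, Pi.smul_apply, h2] }
    ((μ Set.univ ^ (1 / (1 : ℝ≥0∞).toReal - 1 / q.toReal)).toReal) (fun f => by
      rw [LinearMap.coe_mk, AddHom.coe_mk, Lp.norm_toLp, Lp.norm_def, ← ENNReal.toReal_mul,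
        mul_comm]
      refine ENNReal.toReal_mono ?_
        (eLpNorm_le_eLpNorm_mul_rpow_measure_univ hq.out (Lp.aestronglyMeasurable f))
      refine ENNReal.mul_ne_top (Lp.eLpNorm_ne_top f) ?_
      refine ENNReal.rpow_ne_top_of_nonneg ?_ (measure_ne_top μ _)
      by_cases hT : q = ⊤
      · simp [hT]
      · have h1 := ENNReal.toReal_mono hT hq.out
        rw [ENNReal.toReal_one] at h1 ⊢
        rw [sub_nonneg]
        exact one_div_le_one_div_of_le one_pos h1)

theorem coeFn_lpIncl [IsFiniteMeasure μ] (f : Lp E q μ) : lpIncl E q μ f =ᵐ[μ] f :=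
  MemLp.coeFn_toLp ((Lp.memLp f).mono_exponent hq.out)

/-- The pairing `f ↦ ∫ η f` with a bounded weight. -/
def l1Pair [CompleteSpace E] (η : α → ℝ) (C : ℝ) (hη : AEStronglyMeasurable η μ)
    (hC : ∀ x, ‖η x‖ ≤ C) : Lp E 1 μ →L[ℝ] E :=
  LinearMap.mkContinuous
    { toFun := fun f => ∫ x, η x • f x ∂μ
      map_add' := fun f g => by
        rw [← integral_add]
        · refine integral_congr_ae ?_
          filter_upwards [Lp.coeFn_add f g] with x hx
          rw [hx, Pi.add_apply, smul_add]
        · exact (L1.integrable_coeFn f).bdd_smul C hη (Eventually.of_forall hC)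
        · exact (L1.integrable_coeFn g).bdd_smul C hη (Eventually.of_forall hC)
      map_smul' := fun c f => by
        rw [RingHom.id_apply, ← integral_smul]
        refine integral_congr_ae ?_
        filter_upwards [Lp.coeFn_smul c f] with x hx
        rw [hx, Pi.smul_apply, smul_comm] } C (fun f => by
      rw [LinearMap.coe_mk, AddHom.coe_mk, L1.norm_eq_integral_norm, ← integral_const_mul]
      refine norm_integral_le_of_norm_le ((L1.integrable_coeFn f).norm.const_mul C)
        (Eventually.of_forall fun x => ?_)
      rw [norm_smul]
      exact mul_le_mul_of_nonneg_right (hC x) (norm_nonneg _))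

end LpTools

section Sobolev

variable {d s : ℕ} {q : ℝ≥0∞} [hq : Fact (1 ≤ q)]

/-- The component `x ↦ G_j(x) m` of a jet, as an `L¹` field. -/
def jetEntry (j : Fin (s + 1)) (m : Fin (j : ℕ) → Vec d) :
    JetSpace d s q →L[ℝ] Lp (Vec d) 1 (cell d) :=
  (lpIncl (Vec d) q (cell d)).comp
    (((ContinuousMultilinearMap.apply ℝ (fun _ : Fin (j : ℕ) => Vec d) (Vec d) m).compLpL q
      (cell d)).comp (PiLp.proj q
        (fun j : Fin (s + 1) => Lp ((Vec d) [×(j : ℕ)]→L[ℝ] (Vec d)) q (cell d)) j))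

theorem coeFn_jetEntry (j : Fin (s + 1)) (m : Fin (j : ℕ) → Vec d) (G : JetSpace d s q) :
    ∀ᵐ x ∂(cell d), jetEntry j m G x = (G j x) m := by
  filter_upwards [coeFn_lpIncl (μ := cell d)
    ((ContinuousMultilinearMap.apply ℝ (fun _ : Fin (j : ℕ) => Vec d) (Vec d) m).compLpL q
      (cell d) (G j)),
    ContinuousLinearMap.coeFn_compLpL
      (ContinuousMultilinearMap.apply ℝ (fun _ : Fin (j : ℕ) => Vec d) (Vec d) m) (G j)]
    with x h1 h2
  exact h1.trans h2

/-- The class in `L¹` of an element of a Sobolev space. -/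
def sobVal : SobolevSpace d s q →L[ℝ] Lp (Vec d) 1 (cell d) :=
  (jetEntry 0 0).comp (sobolev d s q).subtypeL

theorem coeFn_sobVal (w : SobolevSpace d s q) :
    ∀ᵐ x ∂(cell d), sobVal w x = (w.1 0 x) 0 := coeFn_jetEntry 0 0 w.1

/-- The pairing of `L¹` fields on the torus with a continuous function. -/
def cellPair (η : Vec d → ℝ) (hη : Continuous η) (hp : IsTorusFn η) :
    Lp (Vec d) 1 (cell d) →L[ℝ] Vec d :=
  l1Pair η (hp.exists_bound hη).choose hη.aestronglyMeasurable
    (hp.exists_bound hη).choose_spec.2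

theorem cellPair_apply {η : Vec d → ℝ} (hη : Continuous η) (hp : IsTorusFn η)
    (f : Lp (Vec d) 1 (cell d)) : cellPair η hη hp f = ∫ x, η x • f x ∂(cell d) := rfl

theorem isTorusFn_iteratedFDeriv {F : Type*} [NormedAddCommGroup F] [NormedSpace ℝ F]
    {f : Vec d → F} (hf : IsTorusFn f) (j : ℕ) : IsTorusFn (iteratedFDeriv ℝ j f) := by
  intro a x
  rw [← iteratedFDeriv_comp_add_right]
  congr 1
  exact funext fun y => hf a y

theorem continuous_iteratedFDeriv_apply {η : Vec d → ℝ} (hη : ContDiff ℝ ∞ η) (j : ℕ)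
    (m : Fin j → Vec d) : Continuous fun x => iteratedFDeriv ℝ j η x m :=
  (ContinuousMultilinearMap.apply ℝ (fun _ : Fin j => Vec d) ℝ m).continuous.comp
    (hη.continuous_iteratedFDeriv (by exact_mod_cast le_top))

theorem isWeakJet_iff (G : JetSpace d s q) : IsWeakJet G ↔
    ∀ (j : Fin (s + 1)) (m : Fin (j : ℕ) → Vec d) (η : Vec d → ℝ) (h : ContDiff ℝ ∞ η)
      (hp : IsTorusFn η), cellPair η h.continuous hp (jetEntry j m G)
        = (-1 : ℝ) ^ (j : ℕ) • cellPair (fun x => iteratedFDeriv ℝ (j : ℕ) η x m)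
          (continuous_iteratedFDeriv_apply h j m)
          ((isTorusFn_iteratedFDeriv hp j).comp fun L => L m) (jetEntry 0 0 G) := by
  refine forall_congr' fun j => forall_congr' fun m => forall_congr' fun η =>
    forall_congr' fun h => forall_congr' fun hp => ?_
  rw [cellPair_apply, cellPair_apply]
  have e1 : ∫ x, η x • (jetEntry j m G) x ∂(cell d) = ∫ x, η x • (G j x) m ∂(cell d) := by
    refine integral_congr_ae ?_
    filter_upwards [coeFn_jetEntry j m G] with x hx
    rw [hx]
  have e2 : ∫ x, (iteratedFDeriv ℝ (j : ℕ) η x m) • (jetEntry 0 0 G) x ∂(cell d)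
      = ∫ x, (iteratedFDeriv ℝ (j : ℕ) η x m) • (G 0 x) 0 ∂(cell d) := by
    refine integral_congr_ae ?_
    filter_upwards [coeFn_jetEntry 0 0 G] with x hx
    rw [hx]
  rw [e1, e2]

theorem isClosed_sobolev : IsClosed (sobolev d s q : Set (JetSpace d s q)) := by
  have e : (sobolev d s q : Set (JetSpace d s q)) = {G | IsWeakJet G} := rfl
  rw [e]
  simp only [isWeakJet_iff, ofPred_forall]
  refine isClosed_iInter fun j => isClosed_iInter fun m => isClosed_iInter fun η =>
    isClosed_iInter fun h => isClosed_iInter fun hp => ?_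
  exact isClosed_eq
    (((cellPair η h.continuous hp).comp (jetEntry (s := s) (q := q) j m)).continuous)
    (((-1 : ℝ) ^ (j : ℕ) • (cellPair (fun x => iteratedFDeriv ℝ (j : ℕ) η x m)
      (continuous_iteratedFDeriv_apply h j m)
      ((isTorusFn_iteratedFDeriv hp j).comp fun L => L m)).comp
      (jetEntry (s := s) (q := q) 0 0)).continuous)

instance : CompleteSpace (SobolevSpace d s q) :=
  (isClosed_sobolev (d := d) (s := s) (q := q)).completeSpace_coe

/-- The open unit cube. -/
def openCell (d : ℕ) : Set (Vec d) := {x | ∀ a, x a ∈ Ioo (0 : ℝ) 1}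

theorem isOpen_openCell (d : ℕ) : IsOpen (openCell d) := by
  have : openCell d = ⋂ a, (fun x : Vec d => x a) ⁻¹' Ioo (0 : ℝ) 1 := by
    ext x; simp [openCell]
  rw [this]
  exact isOpen_iInter_of_finite fun a => isOpen_Ioo.preimage (by fun_prop)

theorem ae_cell_mem_openCell (d : ℕ) : ∀ᵐ x ∂(cell d), x ∈ openCell d := by
  have h0 (a : Fin d) : ∀ᵐ x ∂(cell d), x a ≠ 0 := by
    refine ae_restrict_of_ae ?_
    have h1 : ∀ᵐ y ∂(volume : Measure (Fin d → ℝ)), y a ≠ 0 := by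
      have h2 := Measure.pi_hyperplane (fun _ : Fin d => (volume : Measure ℝ)) a 0
      rw [ae_iff]
      simpa only [not_not, volume_pi] using h2
    exact (PiLp.volume_preserving_ofLp (Fin d)).quasiMeasurePreserving.ae h1
  filter_upwards [ae_cell_mem d, ae_all_iff.2 h0] with x h1 h2 a
  exact ⟨lt_of_le_of_ne (h1 a).1 (h2 a).symm, (h1 a).2⟩

end Sobolev

/-! ### Uniqueness of weak derivatives and classical fields in the Sobolev spaces -/

section Sobolev

variable {d s : ℕ} {q : ℝ≥0∞} [hq : Fact (1 ≤ q)]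

/-- A smooth function with support in the open unit cube extends periodically. -/
theorem exists_periodic_extension {η : Vec d → ℝ} (hη : ContDiff ℝ ∞ η)
    (hc : HasCompactSupport η) (hs : tsupport η ⊆ openCell d) :
    ∃ θ : Vec d → ℝ, ContDiff ℝ ∞ θ ∧ IsTorusFn θ ∧ ∀ x ∈ unitCell d, θ x = η x := by
  have hfin : LocallyFinite fun g : lattice d => Function.support fun x => η (x + g) := by
    intro x
    refine ⟨Metric.ball x 1, Metric.ball_mem_nhds x one_pos, ?_⟩
    obtain ⟨R, hR⟩ := hc.isBounded.subset_closedBall 0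
    have hf := ZSpan.setFinite_inter (EuclideanSpace.basisFun (Fin d) ℝ).toBasis
      (Metric.isBounded_closedBall (x := (0 : Vec d)) (r := R + (‖x‖ + 1)))
    refine (hf.preimage (f := ((↑) : lattice d → Vec d))
      Subtype.coe_injective.injOn).subset ?_
    rintro g ⟨y, hy, hyx⟩
    refine ⟨?_, g.2⟩
    have h1 := hR (subset_tsupport _ hy)
    rw [mem_closedBall_zero_iff] at h1 ⊢
    have h2 : ‖y‖ ≤ ‖x‖ + 1 := by
      have h3 := norm_add_le x (y - x)
      rw [add_sub_cancel] at h3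
      rw [mem_ball_iff_norm] at hyx
      linarith
    have h4 := norm_sub_le (y + (g : Vec d)) y
    rw [add_sub_cancel_left] at h4
    linarith
  refine ⟨fun x => ∑ᶠ g : lattice d, η (x + g), ?_, fun a x => ?_, fun x hx => ?_⟩
  · rw [← contMDiff_iff_contDiff]
    refine contMDiff_finsum (fun g => ?_) hfin
    exact (hη.comp (contDiff_id.add contDiff_const)).contMDiff
  · have ha : (unitVec a : Vec d) ∈ lattice d := by
      refine Submodule.subset_span ⟨a, ?_⟩
      simp [unitVec]
    refine (finsum_congr fun g => ?_).trans (finsum_comp_equiv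
      (Equiv.addLeft (⟨unitVec a, ha⟩ : lattice d)) (f := fun g : lattice d => η (x + g)))
    simp [add_assoc]
  · beta_reduce
    rw [finsum_eq_single _ (0 : lattice d), ZeroMemClass.coe_zero, add_zero]
    intro g hg
    by_contra h
    refine hg ?_
    have h1 : x + g ∈ unitCell d := fun a =>
      ⟨(hs (subset_tsupport _ h) a).1.le, (hs (subset_tsupport _ h) a).2⟩
    rw [unitCell_eq_fundamentalDomain] at hx h1
    obtain ⟨v, -, hv⟩ := ZSpan.exist_unique_vadd_mem_fundamentalDomain
      (EuclideanSpace.basisFun (Fin d) ℝ).toBasis x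
    have h2 := hv g (by rw [add_comm] at h1; exact h1)
    have h3 := hv 0 (by beta_reduce; rw [zero_vadd]; exact hx)
    exact h2.trans h3.symm

/-- An integrable field on the torus that is orthogonal to all smooth functions vanishes. -/
theorem l1_eq_zero_of_cellPair (f : Lp (Vec d) 1 (cell d))
    (h : ∀ (η : Vec d → ℝ) (hη : ContDiff ℝ ∞ η) (hp : IsTorusFn η),
      cellPair η hη.continuous hp f = 0) : f = 0 := by
  have h1 : ∀ᵐ x ∂(cell d), x ∈ openCell d → f x = 0 := by
    refine (isOpen_openCell d).ae_eq_zero_of_integral_contDiff_smul_eq_zero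
      ((L1.integrable_coeFn f).locallyIntegrable.locallyIntegrableOn _) fun g hg hc hs => ?_
    obtain ⟨θ, hθ, hp, he⟩ := exists_periodic_extension hg hc hs
    rw [← h θ hθ hp, cellPair_apply]
    refine integral_congr_ae ?_
    filter_upwards [ae_cell_mem d] with x hx
    rw [he x hx]
  rw [Lp.eq_zero_iff_ae_eq_zero]
  filter_upwards [h1, ae_cell_mem_openCell d] with x h2 h3
  exact h2 h3

theorem sobVal_injective : Function.Injective (sobVal (d := d) (s := s) (q := q)) := by
  rw [injective_iff_map_eq_zero]
  intro w hw
  have h0 : jetEntry 0 0 w.1 = 0 := hw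
  have h1 (j : Fin (s + 1)) (m : Fin (j : ℕ) → Vec d) : jetEntry j m w.1 = 0 := by
    refine l1_eq_zero_of_cellPair _ fun η hη hp => ?_
    rw [(isWeakJet_iff w.1).1 w.2 j m η hη hp, h0, map_zero, smul_zero]
  ext1
  refine PiLp.ext fun j => ?_
  have h2 : w.1 j = 0 := by
    rw [Lp.eq_zero_iff_ae_eq_zero]
    have h3 (m : Fin (j : ℕ) → Fin d) : ∀ᵐ x ∂(cell d),
        (w.1 j x) (fun i => EuclideanSpace.basisFun (Fin d) ℝ (m i)) = 0 := by
      have h4 := h1 j fun i => EuclideanSpace.basisFun (Fin d) ℝ (m i)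
      rw [Lp.eq_zero_iff_ae_eq_zero] at h4
      filter_upwards [h4, coeFn_jetEntry j
        (fun i => EuclideanSpace.basisFun (Fin d) ℝ (m i)) w.1] with x h5 h6
      rw [← h6, h5]; rfl
    filter_upwards [ae_all_iff.2 h3] with x hx
    apply ContinuousMultilinearMap.toMultilinearMap_injective
    refine Module.Basis.ext_multilinear (fun _ => (EuclideanSpace.basisFun (Fin d) ℝ).toBasis) ?_
    intro m
    simpa using hx m
  rw [h2]; rfl

theorem represents_iff (w : SobolevSpace d s q) (f : Vec d → Vec d) :
    Represents w f ↔ sobVal w =ᵐ[cell d] f := by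
  constructor
  · intro h
    filter_upwards [coeFn_sobVal w, h] with x h1 h2
    rw [h1, h2]
  · intro h
    filter_upwards [coeFn_sobVal w, h] with x h1 h2
    rw [← h1, h2]

theorem Represents.unique {w w' : SobolevSpace d s q} {f : Vec d → Vec d} (h : Represents w f)
    (h' : Represents w' f) : w = w' := by
  rw [represents_iff] at h h'
  exact sobVal_injective (Lp.ext (h.trans h'.symm))

theorem Represents.add {w w' : SobolevSpace d s q} {f f' : Vec d → Vec d} (h : Represents w f)
    (h' : Represents w' f') : Represents (w + w') (f + f') := by
  rw [represents_iff] at h h' ⊢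
  rw [map_add]
  filter_upwards [Lp.coeFn_add (sobVal w) (sobVal w'), h, h'] with x h1 h2 h3
  rw [h1, Pi.add_apply, Pi.add_apply, h2, h3]

theorem Represents.smul {w : SobolevSpace d s q} {f : Vec d → Vec d} (h : Represents w f)
    (c : ℝ) : Represents (c • w) (c • f) := by
  rw [represents_iff] at h ⊢
  rw [map_smul]
  filter_upwards [Lp.coeFn_smul c (sobVal w), h] with x h1 h2
  rw [h1, Pi.smul_apply, Pi.smul_apply, h2]

theorem represents_zero : Represents (0 : SobolevSpace d s q) (0 : Vec d → Vec d) := by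
  rw [represents_iff, map_zero]
  exact Lp.coeFn_zero _ _ _

theorem Represents.sum {ι : Type*} (I : Finset ι) {w : ι → SobolevSpace d s q}
    {f : ι → Vec d → Vec d} (h : ∀ i, Represents (w i) (f i)) :
    Represents (∑ i ∈ I, w i) (∑ i ∈ I, f i) := by
  classical
  induction I using Finset.induction_on with
  | empty => exact represents_zero
  | insert i I hi ih =>
    rw [Finset.sum_insert hi, Finset.sum_insert hi]
    exact (h i).add ih

variable (d s q) in
/-- The smooth solenoidal fields, as a subspace of a Sobolev space. -/
def smoothSub : Submodule ℝ (SobolevSpace d s q) where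
  carrier := {w | ∃ v ∈ SmoothSolenoidal d, Represents w v}
  zero_mem' := ⟨0, ⟨contDiff_const, fun _ _ => rfl, fun x => by
    rw [show (0 : Vec d → Vec d) = fun _ => 0 from rfl]; simp⟩, represents_zero⟩
  add_mem' := by
    rintro w w' ⟨v, ⟨h1, h2, h3⟩, hv⟩ ⟨v', ⟨h1', h2', h3'⟩, hv'⟩
    refine ⟨v + v', ⟨h1.add h1', fun a x => ?_, fun x => ?_⟩, hv.add hv'⟩
    · rw [Pi.add_apply, Pi.add_apply, h2, h2']
    · rw [fderiv_add (h1.differentiable (by simp) x) (h1'.differentiable (by simp) x)]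
      simp [Finset.sum_add_distrib, h3, h3']
  smul_mem' := by
    rintro c w ⟨v, ⟨h1, h2, h3⟩, hv⟩
    refine ⟨c • v, ⟨h1.const_smul c, fun a x => ?_, fun x => ?_⟩, hv.smul c⟩
    · rw [Pi.smul_apply, Pi.smul_apply, h2]
    · rw [fderiv_const_smul (h1.differentiable (by simp) x)]
      simp [← Finset.mul_sum, h3]

theorem V_eq : V d s q = ((smoothSub d s q).topologicalClosure : Set (SobolevSpace d s q)) := by
  rw [Submodule.topologicalClosure_coe]; rfl

theorem isClosed_V : IsClosed (V d s q) := isClosed_closure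

theorem convex_V : Convex ℝ (V d s q) := by
  rw [V_eq]
  exact Submodule.convex _

/-- Integration by parts for one component of a vector field. -/
theorem component_integral_fderiv_smul {η : Vec d → ℝ} {v : Vec d → Vec d} (hη : ContDiff ℝ 1 η)
    (hp : IsTorusFn η) (hv : ContDiff ℝ 1 v) (hvp : IsTorusFn v) (a : Fin d) :
    (∫ x, fderiv ℝ η x (unitVec a) • v x ∂(cell d)) a
      = -∫ x, fderiv ℝ v x (unitVec a) a * η x ∂(cell d) := by
  have c1 : Continuous fun x => fderiv ℝ η x (unitVec a) :=
    (hη.continuous_fderiv one_ne_zero).clm_apply continuous_const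
  refine ((EuclideanSpace.proj (𝕜 := ℝ) a : Vec d →L[ℝ] ℝ).integral_comp_comm
    (c1.smul hv.continuous).integrable_cell).symm.trans ?_
  have e3 := IsTorusFn.integral_mul_fderiv (hvp.comp fun y => y a) hp (contDiff_component hv a)
    hη (unitVec a)
  simp only [fderiv_component (hv.differentiable one_ne_zero _)] at e3
  rw [← e3]
  refine integral_congr_ae (Eventually.of_forall fun x => ?_)
  simp [mul_comm]

/-- Elements of `V` are weakly divergence free. -/
theorem sum_cellPair_eq_zero_of_mem_V {w : SobolevSpace d s q} (hw : w ∈ V d s q) {η : Vec d → ℝ}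
    (hη : ContDiff ℝ ∞ η) (hp : IsTorusFn η) :
    ∑ a, (cellPair (fun x => fderiv ℝ η x (unitVec a))
      ((hη.continuous_fderiv (by simp)).clm_apply continuous_const)
      ((isTorusFn_fderiv hp).comp fun L => L (unitVec a)) (sobVal w)) a = 0 := by
  have cη (a : Fin d) : Continuous fun x => fderiv ℝ η x (unitVec a) :=
    (hη.continuous_fderiv (by simp)).clm_apply continuous_const
  have pη (a : Fin d) : IsTorusFn fun x => fderiv ℝ η x (unitVec a) :=
    (isTorusFn_fderiv hp).comp fun L => L (unitVec a)
  have hc : IsClosed {w : SobolevSpace d s q | ∑ a, (cellPair _ (cη a) (pη a) (sobVal w)) a = 0} :=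
    isClosed_eq (continuous_finsetSum _ fun a _ => continuous_component
      ((cellPair _ (cη a) (pη a)).continuous.comp sobVal.continuous) a) continuous_const
  refine closure_minimal ?_ hc hw
  rintro w ⟨v, ⟨h1, h2, h3⟩, hv⟩
  rw [represents_iff] at hv
  have hv1 : ContDiff ℝ 1 v := h1.of_le (by simp)
  have hη1 : ContDiff ℝ 1 η := hη.of_le (by simp)
  have e (a : Fin d) : (cellPair _ (cη a) (pη a) (sobVal w)) a
      = -∫ x, fderiv ℝ v x (unitVec a) a * η x ∂(cell d) := by
    rw [cellPair_apply]
    have e1 : ∫ x, fderiv ℝ η x (unitVec a) • sobVal w x ∂(cell d)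
        = ∫ x, fderiv ℝ η x (unitVec a) • v x ∂(cell d) := by
      refine integral_congr_ae ?_
      filter_upwards [hv] with x hx
      rw [hx]
    rw [e1, component_integral_fderiv_smul hη1 hp hv1 h2]
  change ∑ a, _ = (0 : ℝ)
  simp only [e]
  rw [Finset.sum_neg_distrib, ← integral_cell_sum Finset.univ
    (f := fun a x => fderiv ℝ v x (unitVec a) a * η x) fun a =>
      (continuous_fderiv_entry hv1 _ _).fun_mul hη1.continuous]
  simp [← Finset.sum_mul, h3]

end Sobolev

section Classical

variable {d s : ℕ} {q : ℝ≥0∞} [hq : Fact (1 ≤ q)]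

/-- The class of a continuously differentiable field in a Sobolev space of order at most one. -/
def toSob (s : ℕ) (q : ℝ≥0∞) [hq : Fact (1 ≤ q)] (hs : s ≤ 1) {f : Vec d → Vec d}
    (hf : ContDiff ℝ 1 f) (hp : IsTorusFn f) : SobolevSpace d s q :=
  ⟨WithLp.toLp q fun j => ((hf.continuous_iteratedFDeriv (m := (j : ℕ))
      (by exact_mod_cast (Nat.lt_succ_iff.1 j.2).trans hs)).memLp_cell q).toLp _, by
    intro j m η hη hηp
    have e (i : Fin (s + 1)) := MemLp.coeFn_toLp ((hf.continuous_iteratedFDeriv (m := (i : ℕ))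
      (by exact_mod_cast (Nat.lt_succ_iff.1 i.2).trans hs)).memLp_cell q)
    have e1 : ∀ᵐ x ∂(cell d), η x • iteratedFDeriv ℝ (j : ℕ) f x m = η x • ((WithLp.toLp q
        fun j : Fin (s + 1) => ((hf.continuous_iteratedFDeriv (m := (j : ℕ))
        (by exact_mod_cast (Nat.lt_succ_iff.1 j.2).trans hs)).memLp_cell q).toLp _ :
        JetSpace d s q) j x) m := by
      filter_upwards [e j] with x hx
      simp only [hx]
    have e2 : ∀ᵐ x ∂(cell d), (iteratedFDeriv ℝ (j : ℕ) η x m) • f x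
        = (iteratedFDeriv ℝ (j : ℕ) η x m) • ((WithLp.toLp q
        fun j : Fin (s + 1) => ((hf.continuous_iteratedFDeriv (m := (j : ℕ))
        (by exact_mod_cast (Nat.lt_succ_iff.1 j.2).trans hs)).memLp_cell q).toLp _ :
        JetSpace d s q) 0 x) 0 := by
      filter_upwards [e 0] with x hx
      simp only [hx]
      rfl
    rw [← integral_congr_ae e1, ← integral_congr_ae e2]
    obtain ⟨j, hj⟩ := j
    have hj' : j = 0 ∨ j = 1 := by omega
    obtain rfl | rfl := hj'
    · have hm : m = 0 := Subsingleton.elim _ _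
      simp
    · have hη1 : ContDiff ℝ 1 η := hη.of_le (by simp)
      simp only [iteratedFDeriv_one_apply, pow_one, neg_smul, one_smul]
      have h1 : ContDiff ℝ 1 fun x => η x • f x := hη1.smul hf
      have h2 := IsTorusFn.integral_fderiv_apply_eq_zero (hηp.comp₂ hp fun a b => a • b) h1 (m 0)
      have c1 : Continuous fun x => η x • fderiv ℝ f x (m 0) :=
        hη1.continuous.smul ((hf.continuous_fderiv one_ne_zero).clm_apply continuous_const)
      have c2 : Continuous fun x => fderiv ℝ η x (m 0) • f x :=
        ((hη1.continuous_fderiv one_ne_zero).clm_apply continuous_const).smul hf.continuous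
      have h3 (x : Vec d) : fderiv ℝ (fun x => η x • f x) x (m 0)
          = η x • fderiv ℝ f x (m 0) + fderiv ℝ η x (m 0) • f x := by
        rw [fderiv_fun_smul (hη1.differentiable one_ne_zero x) (hf.differentiable one_ne_zero x)]
        rfl
      simp only [h3] at h2
      rw [integral_add c1.integrable_cell c2.integrable_cell] at h2
      exact eq_neg_of_add_eq_zero_left h2⟩

theorem represents_toSob (hs : s ≤ 1) {f : Vec d → Vec d} (hf : ContDiff ℝ 1 f)
    (hp : IsTorusFn f) : Represents (toSob s q hs hf hp) f := by
  filter_upwards [MemLp.coeFn_toLp ((hf.continuous_iteratedFDeriv (m := ((0 : Fin (s + 1)) : ℕ))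
      (by simp)).memLp_cell q)] with x hx
  have : (toSob s q hs hf hp).1 0 x = iteratedFDeriv ℝ ((0 : Fin (s + 1)) : ℕ) f x := hx
  rw [this]
  rfl

theorem norm_toSob_rpow (hs : s ≤ 1) {f : Vec d → Vec d} (hf : ContDiff ℝ 1 f)
    (hp : IsTorusFn f) (hqT : q ≠ ⊤) :
    ‖toSob s q hs hf hp‖ ^ q.toReal
      = ∑ j : Fin (s + 1), ∫ x, ‖iteratedFDeriv ℝ (j : ℕ) f x‖ ^ q.toReal ∂(cell d) := by
  have hq0 : 0 < q.toReal := ENNReal.toReal_pos (zero_lt_one.trans_le hq.out).ne' hqT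
  have hn : ‖toSob s q hs hf hp‖ = ‖(toSob s q hs hf hp).1‖ := rfl
  rw [hn, PiLp.norm_eq_sum hq0, ← Real.rpow_mul
    (Finset.sum_nonneg fun i _ => by positivity), one_div, inv_mul_cancel₀ hq0.ne', Real.rpow_one]
  refine Finset.sum_congr rfl fun j _ => ?_
  have hm := (hf.continuous_iteratedFDeriv (m := (j : ℕ))
      (by exact_mod_cast (Nat.lt_succ_iff.1 j.2).trans hs)).memLp_cell (d := d) q
  have h1 : ‖(toSob s q hs hf hp).1 j‖ = (∫ x, ‖iteratedFDeriv ℝ (j : ℕ) f x‖ ^ q.toReal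
      ∂(cell d)) ^ q.toReal⁻¹ := by
    refine (Lp.norm_toLp _ hm).trans ?_
    rw [hm.eLpNorm_eq_integral_rpow_norm (zero_lt_one.trans_le hq.out).ne' hqT,
      ENNReal.toReal_ofReal]
    exact Real.rpow_nonneg (integral_nonneg fun x => by positivity) _
  rw [h1, ← Real.rpow_mul (integral_nonneg fun x => by positivity), inv_mul_cancel₀ hq0.ne',
    Real.rpow_one]

theorem norm_toSob_zero_sq {f : Vec d → Vec d} (hf : ContDiff ℝ 1 f) (hp : IsTorusFn f) :
    ‖toSob 0 2 zero_le_one hf hp‖ ^ 2 = ∫ x, ‖f x‖ ^ 2 ∂(cell d) := by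
  have h := norm_toSob_rpow (q := 2) zero_le_one hf hp (by simp)
  simpa using h

theorem norm_toSob_one_rpow {p : ℝ} [Fact (1 ≤ ENNReal.ofReal p)] (hp1 : 1 ≤ p)
    {f : Vec d → Vec d} (hf : ContDiff ℝ 1 f) (hp : IsTorusFn f) :
    ‖toSob 1 (ENNReal.ofReal p) le_rfl hf hp‖ ^ p
      = ∫ x, ‖f x‖ ^ p ∂(cell d) + ∫ x, ‖fderiv ℝ f x‖ ^ p ∂(cell d) := by
  have h := norm_toSob_rpow (q := ENNReal.ofReal p) le_rfl hf hp (by simp)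
  rw [ENNReal.toReal_ofReal (by linarith), Fin.sum_univ_two] at h
  rw [h]
  congr 1
  · simp
  · simp only [Fin.val_one, norm_iteratedFDeriv_one]

/-- A continuous function on the torus that vanishes almost everywhere vanishes. -/
theorem IsTorusFn.eq_zero_of_ae {f : Vec d → ℝ} (hf : IsTorusFn f) (hc : Continuous f)
    (h : ∀ᵐ x ∂(cell d), f x = 0) (x : Vec d) : f x = 0 := by
  set c : Vec d := WithLp.toLp 2 fun _ => 1 / 2 with hcdef
  have h1 : ∫ y, (f (y + (x - c))) ^ 2 ∂(cell d) = 0 := by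
    rw [(hf.comp fun r => r ^ 2).integral_add_right (x - c)]
    refine integral_eq_zero_of_ae ?_
    filter_upwards [h] with y hy
    simp [hy]
  have c1 : Continuous fun y => f (y + (x - c)) := hc.comp (by fun_prop)
  rw [integral_eq_zero_iff_of_nonneg (fun y => sq_nonneg _) (c1.pow 2).integrable_cell] at h1
  have h2 : (fun y => (f (y + (x - c))) ^ 2) =ᵐ[volume.restrict (openCell d)] 0 :=
    ae_restrict_of_ae_restrict_of_subset
      (fun y hy a => ⟨(hy a).1.le, (hy a).2⟩ : openCell d ⊆ unitCell d) h1
  have h3 := Measure.eqOn_open_of_ae_eq h2 (isOpen_openCell d) (c1.pow 2).continuousOn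
    continuousOn_const
  have h4 : c ∈ openCell d := fun a => by simp [hcdef]; norm_num
  have h5 := h3 h4
  simpa using h5

theorem IsSolenoidalC1.add {u v : Vec d → Vec d} (hu : IsSolenoidalC1 u) (hv : IsSolenoidalC1 v) :
    IsSolenoidalC1 (u + v) := by
  refine ⟨hu.contDiff.add hv.contDiff, fun a x => ?_, fun x => ?_⟩
  · rw [Pi.add_apply, Pi.add_apply, hu.periodic, hv.periodic]
  · rw [fderiv_add (hu.contDiff.differentiable one_ne_zero x)
      (hv.contDiff.differentiable one_ne_zero x)]
    simp [Finset.sum_add_distrib, hu.div_eq_zero, hv.div_eq_zero]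

theorem IsSolenoidalC1.smul {u : Vec d → Vec d} (hu : IsSolenoidalC1 u) (c : ℝ) :
    IsSolenoidalC1 (c • u) := by
  refine ⟨hu.contDiff.const_smul c, fun a x => ?_, fun x => ?_⟩
  · rw [Pi.smul_apply, Pi.smul_apply, hu.periodic]
  · rw [fderiv_const_smul (hu.contDiff.differentiable one_ne_zero x)]
    simp [← Finset.mul_sum, hu.div_eq_zero]

theorem isSolenoidalC1_zero : IsSolenoidalC1 (0 : Vec d → Vec d) :=
  ⟨contDiff_const, fun _ _ => rfl, fun x => by
    rw [show (0 : Vec d → Vec d) = fun _ => 0 from rfl]; simp⟩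

theorem isSolenoidalC1_sum {ι : Type*} (I : Finset ι) {f : ι → Vec d → Vec d}
    (h : ∀ i, IsSolenoidalC1 (f i)) : IsSolenoidalC1 (∑ i ∈ I, f i) := by
  classical
  induction I using Finset.induction_on with
  | empty => exact isSolenoidalC1_zero
  | insert i I hi ih =>
    rw [Finset.sum_insert hi]
    exact (h i).add ih

theorem IsSolenoidalC1.of_mem_V {w : SobolevSpace d s q} (hw : w ∈ V d s q) {f : Vec d → Vec d}
    (hf : ContDiff ℝ 1 f) (hp : IsTorusFn f) (hr : Represents w f) : IsSolenoidalC1 f := by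
  have cf : Continuous fun x => ∑ a, fderiv ℝ f x (unitVec a) a :=
    continuous_finsetSum _ fun a _ => continuous_fderiv_entry hf _ _
  have pf : IsTorusFn fun x => ∑ a, fderiv ℝ f x (unitVec a) a :=
    (isTorusFn_fderiv hp).comp fun L => ∑ a, L (unitVec a) a
  refine ⟨hf, hp, pf.eq_zero_of_ae cf (eq_zero_of_integral_mul_trig pf cf fun K c => ?_)⟩
  have h := sum_cellPair_eq_zero_of_mem_V hw (contDiff_trig K c) (isTorusFn_trig K c)
  have h1 : ContDiff ℝ 1 (trig K c) := contDiff_one_trig K c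
  have e (a : Fin d) : (∫ x, fderiv ℝ (trig K c) x (unitVec a) • sobVal w x ∂(cell d)) a
      = -∫ x, fderiv ℝ f x (unitVec a) a * trig K c x ∂(cell d) := by
    have e1 : ∫ x, fderiv ℝ (trig K c) x (unitVec a) • sobVal w x ∂(cell d)
        = ∫ x, fderiv ℝ (trig K c) x (unitVec a) • f x ∂(cell d) := by
      refine integral_congr_ae ?_
      filter_upwards [(represents_iff w f).1 hr] with x hx
      rw [hx]
    rw [e1, component_integral_fderiv_smul h1 (isTorusFn_trig K c) hf hp]
  simp only [cellPair_apply, e] at h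
  rw [Finset.sum_neg_distrib, neg_eq_zero, ← integral_cell_sum Finset.univ
    (f := fun a x => fderiv ℝ f x (unitVec a) a * trig K c x) fun a =>
      (continuous_fderiv_entry hf _ _).fun_mul h1.continuous] at h
  simpa only [Finset.sum_mul] using h

/-- Mollification maps solenoidal fields to smooth solenoidal fields. -/
theorem IsSolenoidalC1.conv {k : Vec d → ℝ} {r : ℝ} (hk : IsKernel k r) {v : Vec d → Vec d}
    (hv : IsSolenoidalC1 v) : TwoPhaseFlow.conv k v ∈ SmoothSolenoidal d := by
  have := hk.isProbabilityMeasure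
  refine ⟨hk.contDiff_conv hv.contDiff.continuous, hv.periodic.conv k, fun x => ?_⟩
  have cD := hv.contDiff.continuous_fderiv one_ne_zero
  obtain ⟨C, -, hC⟩ := (isTorusFn_fderiv hv.periodic).exists_bound cD
  have hi : Integrable (fun t => fderiv ℝ v (x - t)) (kernelMeasure k) :=
    Integrable.of_bound (cD.comp (by fun_prop)).aestronglyMeasurable C
      (Eventually.of_forall fun t => hC _)
  rw [(hk.hasFDerivAt_conv hv.contDiff hv.periodic x).fderiv, hk.conv_apply]
  let Λ : (Vec d →L[ℝ] Vec d) →L[ℝ] ℝ := ∑ a, (EuclideanSpace.proj (𝕜 := ℝ) a : Vec d →L[ℝ] ℝ).comp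
    (ContinuousLinearMap.apply ℝ (Vec d) (unitVec a))
  have hΛ (L : Vec d →L[ℝ] Vec d) : Λ L = ∑ a, L (unitVec a) a := by
    simp [Λ]
  rw [← hΛ, ← Λ.integral_comp_comm hi]
  simp [hΛ, hv.div_eq_zero]

theorem isSolenoidalC1_of_mem {v : Vec d → Vec d} (hv : v ∈ SmoothSolenoidal d) :
    IsSolenoidalC1 v := ⟨hv.1.of_le (by simp), hv.2.1, hv.2.2⟩

theorem toSob_mem_V (hs : s ≤ 1) {v : Vec d → Vec d} (hv : v ∈ SmoothSolenoidal d)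
    (hf : ContDiff ℝ 1 v) (hp : IsTorusFn v) : toSob s q hs hf hp ∈ V d s q :=
  subset_closure ⟨v, hv, represents_toSob hs hf hp⟩

end Classical

/-! ### Galerkin expansions -/

section Galerkin

variable {d s : ℕ}

theorem innerL2_self {f : Vec d → Vec d} : innerL2 f f = ∫ x, ‖f x‖ ^ 2 ∂(cell d) := by
  simp [innerL2]

theorem innerL2_comm (f g : Vec d → Vec d) : innerL2 f g = innerL2 g f := by
  simp only [innerL2, real_inner_comm]

theorem innerL2_sum_left {ι : Type*} (I : Finset ι) (a : ι → ℝ) {f : ι → Vec d → Vec d}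
    (hf : ∀ i, Continuous (f i)) {g : Vec d → Vec d} (hg : Continuous g) :
    innerL2 (∑ i ∈ I, a i • f i) g = ∑ i ∈ I, a i * innerL2 (f i) g := by
  simp only [innerL2, Finset.sum_apply, Pi.smul_apply, sum_inner, inner_smul_left, RCLike.conj_to_real]
  rw [integral_cell_sum I fun i => continuous_const.fun_mul ((hf i).inner hg)]
  simp only [integral_const_mul]

theorem inner_toLp_toLp {f g : Vec d → Vec d} (hf : MemLp f 2 (cell d)) (hg : MemLp g 2 (cell d)) :
    inner ℝ (hf.toLp f) (hg.toLp g) = innerL2 f g := by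
  rw [L2.inner_def, innerL2]
  refine integral_congr_ae ?_
  filter_upwards [hf.coeFn_toLp, hg.coeFn_toLp] with x h1 h2
  rw [h1, h2]

/-- The functions that matter in a Galerkin scheme: an orthonormal family of solenoidal fields. -/
structure IsSolenoidalFrame (om : ℕ → Vec d → Vec d) : Prop where
  solenoidal : ∀ k, IsSolenoidalC1 (om k)
  orthonormal : ∀ k l, innerL2 (om k) (om l) = if k = l then 1 else 0

theorem IsGalerkinBasis.isSolenoidalFrame {om : ℕ → Vec d → Vec d} (h : IsGalerkinBasis s om) :
    IsSolenoidalFrame om := by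
  obtain ⟨w, hw, hV⟩ := h.basis
  refine ⟨fun k => IsSolenoidalC1.of_mem_V ?_ (h.contDiff k) (h.periodic k) (hw k), h.orthonormal⟩
  rw [← hV]
  exact subset_closure (Submodule.subset_span ⟨k, rfl⟩)

variable {om : ℕ → Vec d → Vec d}

theorem IsSolenoidalFrame.continuous (h : IsSolenoidalFrame om) (k : ℕ) : Continuous (om k) :=
  (h.solenoidal k).contDiff.continuous

/-- Bessel's inequality. -/
theorem IsSolenoidalFrame.sum_sq_le (h : IsSolenoidalFrame om) {f : Vec d → Vec d}
    (hf : MemLp f 2 (cell d)) (I : Finset ℕ) :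
    ∑ j ∈ I, innerL2 f (om j) ^ 2 ≤ ∫ x, ‖f x‖ ^ 2 ∂(cell d) := by
  have ho : Orthonormal ℝ fun k => ((h.continuous k).memLp_cell 2).toLp (om k) := by
    rw [orthonormal_iff_ite]
    intro k l
    rw [inner_toLp_toLp, h.orthonormal]
  have h1 := ho.sum_inner_products_le (hf.toLp f) (s := I)
  simp only [inner_toLp_toLp, Real.norm_eq_abs, sq_abs] at h1
  rw [← real_inner_self_eq_norm_sq, inner_toLp_toLp, innerL2_self] at h1
  simpa only [innerL2_comm f] using h1

theorem IsSolenoidalFrame.innerL2_sum (h : IsSolenoidalFrame om) (I : Finset ℕ) (c : ℕ → ℝ)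
    (k : ℕ) : innerL2 (∑ j ∈ I, c j • om j) (om k) = if k ∈ I then c k else 0 := by
  rw [innerL2_sum_left I c h.continuous (h.continuous k)]
  simp [h.orthonormal]

theorem IsSolenoidalFrame.exists_eq_sum (h : IsSolenoidalFrame om) {N : ℕ} {v : Vec d → Vec d}
    (hv : v ∈ Submodule.span ℝ (om '' Iic N)) :
    v = ∑ j ∈ Finset.range (N + 1), innerL2 v (om j) • om j := by
  have e : (Iic N : Set ℕ) = ↑(Finset.range (N + 1)) := by
    ext; simp
  rw [e, Submodule.mem_span_image_finset_iff_exists_fun'] at hv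
  obtain ⟨c, hc⟩ := hv
  conv_lhs => rw [← hc]
  refine Finset.sum_congr rfl fun j hj => ?_
  rw [← hc, h.innerL2_sum, if_pos hj]

theorem IsSolenoidalFrame.innerL2_eq_zero (h : IsSolenoidalFrame om) {N : ℕ} {v : Vec d → Vec d}
    (hv : v ∈ Submodule.span ℝ (om '' Iic N)) {k : ℕ} (hk : N < k) : innerL2 v (om k) = 0 := by
  rw [h.exists_eq_sum hv, h.innerL2_sum, if_neg]
  simp; omega

theorem IsSolenoidalFrame.solenoidal_sum (h : IsSolenoidalFrame om) (I : Finset ℕ) (c : ℕ → ℝ) :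
    IsSolenoidalC1 (∑ j ∈ I, c j • om j) :=
  isSolenoidalC1_sum I fun j => (h.solenoidal j).smul (c j)

theorem IsSolenoidalFrame.solenoidal_of_mem (h : IsSolenoidalFrame om) {N : ℕ} {v : Vec d → Vec d}
    (hv : v ∈ Submodule.span ℝ (om '' Iic N)) : IsSolenoidalC1 v := by
  rw [h.exists_eq_sum hv]
  exact h.solenoidal_sum _ _

/-- Parseval's identity in the Galerkin spaces. -/
theorem IsSolenoidalFrame.integral_norm_sq (h : IsSolenoidalFrame om) {N : ℕ} {v : Vec d → Vec d}
    (hv : v ∈ Submodule.span ℝ (om '' Iic N)) :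
    ∫ x, ‖v x‖ ^ 2 ∂(cell d) = ∑ j ∈ Finset.range (N + 1), innerL2 v (om j) ^ 2 := by
  have hc := (h.solenoidal_of_mem hv).contDiff.continuous
  rw [← innerL2_self]
  trans innerL2 (∑ j ∈ Finset.range (N + 1), innerL2 v (om j) • om j) v
  · rw [← h.exists_eq_sum hv]
  rw [innerL2_sum_left _ _ h.continuous hc]
  refine Finset.sum_congr rfl fun j _ => ?_
  rw [innerL2_comm (om j), sq]

theorem IsKernel.conv_sum {k : Vec d → ℝ} {r : ℝ} (hk : IsKernel k r) {ι : Type*} (I : Finset ι)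
    (c : ι → ℝ) {f : ι → Vec d → Vec d} (hf : ∀ i, Continuous (f i))
    (hp : ∀ i, IsTorusFn (f i)) :
    conv k (∑ i ∈ I, c i • f i) = ∑ i ∈ I, c i • conv k (f i) := by
  have := hk.isProbabilityMeasure
  funext x
  simp only [Finset.sum_apply, Pi.smul_apply, hk.conv_apply]
  rw [integral_finsetSum]
  · simp only [integral_smul]
  · intro i _
    obtain ⟨C, -, hC⟩ := (hp i).exists_bound (hf i)
    exact (Integrable.of_bound ((hf i).comp (by fun_prop)).aestronglyMeasurable C
      (Eventually.of_forall fun t => hC _)).smul (c i)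

/-- Square-integrable functions are mapped to bounded functions by a fixed mollification. -/
theorem IsKernel.norm_conv_sq_le {k : Vec d → ℝ} {r : ℝ} (hk : IsKernel k r) (hr : r < 1 / 2) :
    ∃ C, 0 ≤ C ∧ ∀ v : Vec d → Vec d, Continuous v → IsTorusFn v → ∀ x,
      ‖conv k v x‖ ^ 2 ≤ C * ∫ y, ‖v y‖ ^ 2 ∂(cell d) := by
  have := hk.isProbabilityMeasure
  obtain ⟨C, hC⟩ := hk.contDiff.continuous.bounded_above_of_compact_support hk.hasCompactSupport
  have hC0 : 0 ≤ C := (norm_nonneg _).trans (hC 0)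
  refine ⟨C, hC0, fun v hv hp x => ?_⟩
  obtain ⟨B, -, hB⟩ := hp.exists_bound hv
  set c : Vec d := WithLp.toLp 2 fun _ => -(1 / 2) with hcdef
  have hcv : Continuous fun t => v (x - t) := hv.comp (by fun_prop)
  have h1 : ‖conv k v x‖ ^ (2 : ℝ) ≤ ∫ t, ‖v (x - t)‖ ^ (2 : ℝ) ∂(kernelMeasure k) := by
    rw [hk.conv_apply]
    refine norm_integral_rpow_le one_le_two
      (Integrable.of_bound hcv.aestronglyMeasurable B (Eventually.of_forall fun t => hB _)) ?_
    refine Integrable.of_bound (hcv.norm.rpow_const fun _ => Or.inr zero_le_two).aestronglyMeasurable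
      (B ^ (2 : ℝ)) (Eventually.of_forall fun t => ?_)
    rw [Real.norm_of_nonneg (by positivity)]
    exact Real.rpow_le_rpow (norm_nonneg _) (hB _) zero_le_two
  simp only [Real.rpow_two] at h1
  refine h1.trans ?_
  rw [hk.integral_kernelMeasure, ← integral_neg_eq_self]
  simp only [smul_eq_mul, hk.even, sub_neg_eq_add]
  -- the kernel lives in a translate of the unit cell
  have h2 : ∫ t, k t * ‖v (x + t)‖ ^ 2
      = ∫ t in (fun y => c + y) '' unitCell d, k t * ‖v (x + t)‖ ^ 2 := by
    refine (setIntegral_eq_integral_of_forall_compl_eq_zero fun t ht => ?_).symm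
    have : k t = 0 := by
      by_contra h0
      have h3 := hk.support t h0
      refine ht ⟨t - c, fun a => ?_, by simp⟩
      have h4 := (PiLp.norm_apply_le t a).trans h3
      rw [Real.norm_eq_abs, abs_le] at h4
      have h5 : (t - c) a = t a + 1 / 2 := by simp [hcdef]
      rw [h5]
      constructor <;> linarith
    rw [this, zero_mul]
  rw [h2, (measurePreserving_add_left (volume : Measure (Vec d)) c).setIntegral_image_emb
    (measurableEmbedding_addLeft c)]
  change ∫ y, k (c + y) * ‖v (x + (c + y))‖ ^ 2 ∂(cell d) ≤ _
  have h6 : ∫ y, ‖v y‖ ^ 2 ∂(cell d) = ∫ y, ‖v (x + (c + y))‖ ^ 2 ∂(cell d) := by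
    rw [← (hp.comp fun w => ‖w‖ ^ 2).integral_add_right (x + c)]
    refine integral_congr_ae (Eventually.of_forall fun y => ?_)
    simp only [add_comm y, add_assoc]
  rw [h6, ← integral_const_mul]
  have hck : Continuous k := hk.contDiff.continuous
  refine integral_cell_mono (by fun_prop) (by fun_prop) fun y => ?_
  exact mul_le_mul_of_nonneg_right ((le_abs_self _).trans (hC _)) (by positivity)

/-- Weak convergence in `ℓ²`: bounded coefficient sequences that converge coefficientwise may be
paired with a square-summable sequence. -/
theorem exists_tendsto_sum_mul {β : ℕ → ℝ} {B : ℝ} (hβ : ∀ I : Finset ℕ, ∑ j ∈ I, β j ^ 2 ≤ B)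
    {c : ℕ → ℕ → ℝ} {M : ℝ} (hM : ∀ n, ∀ I : Finset ℕ, ∑ j ∈ I, c n j ^ 2 ≤ M)
    (hc : ∀ j, ∃ l, Tendsto (fun n => c n j) atTop (𝓝 l)) {N : ℕ → ℕ}
    (hN : ∀ n j, N n ≤ j → c n j = 0) :
    ∃ L, Tendsto (fun n => ∑ j ∈ Finset.range (N n), c n j * β j) atTop (𝓝 L) := by
  have hsum : Summable fun j => β j ^ 2 := summable_of_sum_le (fun j => sq_nonneg _) hβ
  have hM0 : 0 ≤ M := by simpa using hM 0 ∅
  have htail := hsum.hasSum.tendsto_sum_nat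
  have key (J n : ℕ) : |∑ j ∈ Finset.range (N n), c n j * β j - ∑ j ∈ Finset.range J, c n j * β j|
      ≤ √ M * √ (∑' j, β j ^ 2 - ∑ j ∈ Finset.range J, β j ^ 2) := by
    have e1 : ∑ j ∈ Finset.range (N n), c n j * β j
        = ∑ j ∈ Finset.range (max (N n) J), c n j * β j := by
      refine Finset.sum_subset (Finset.range_mono (le_max_left _ _)) fun j _ hj => ?_
      rw [hN n j (by simpa using hj), zero_mul]
    rw [e1, ← Finset.sum_Ico_eq_sub _ (le_max_right _ _)]
    have h1 : ∑ j ∈ Finset.Ico J (max (N n) J), β j ^ 2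
        ≤ ∑' j, β j ^ 2 - ∑ j ∈ Finset.range J, β j ^ 2 := by
      rw [Finset.sum_Ico_eq_sub _ (le_max_right _ _)]
      exact sub_le_sub_right (hsum.sum_le_tsum _ fun j _ => sq_nonneg _) _
    rw [← Real.sqrt_mul hM0]
    refine Real.abs_le_sqrt ((Finset.sum_mul_sq_le_sq_mul_sq _ _ _).trans ?_)
    exact mul_le_mul (hM n _) h1 (Finset.sum_nonneg fun j _ => sq_nonneg _) hM0
  refine cauchySeq_tendsto_of_complete (Metric.cauchySeq_iff'.2 fun η hη => ?_)
  have h2 : Tendsto (fun J => √ M * √ (∑' j, β j ^ 2 - ∑ j ∈ Finset.range J, β j ^ 2)) atTop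
      (𝓝 0) := by
    have h3 := (((tendsto_const_nhds (x := ∑' j, β j ^ 2)).sub htail).sqrt).const_mul (√ M)
    simpa using h3
  obtain ⟨J, hJ⟩ := (h2.eventually (gt_mem_nhds (by positivity : 0 < η / 3))).exists
  choose l hl using hc
  have h4 : CauchySeq fun n => ∑ j ∈ Finset.range J, c n j * β j :=
    (tendsto_finsetSum _ fun j _ => (hl j).mul_const (β j)).cauchySeq
  obtain ⟨n₀, hn₀⟩ := Metric.cauchySeq_iff'.1 h4 (η / 3) (by positivity)
  refine ⟨n₀, fun n hn => ?_⟩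
  have h5 := hn₀ n hn
  rw [Real.dist_eq] at h5 ⊢
  have h6 := (key J n).trans_lt hJ
  have h7 := (key J n₀).trans_lt hJ
  rw [abs_lt] at *
  constructor <;> linarith [h5.1, h5.2, h6.1, h6.2, h7.1, h7.2]

end Galerkin

/-! ### Tubular neighbourhoods of a hypersurface -/

section Tube

variable {d : ℕ}

/-- The set of points within distance `r` of a small piece of a `C¹` boundary has volume `O(r)`:
its translates in a transversal direction `e` have bounded overlap. -/
theorem exists_volume_thickening_le {A : Set (Vec d)} (hA : IsOpen A) (hb : HasCkBoundary 1 A)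
    {x₀ : Vec d} (hx : x₀ ∈ frontier A) :
    ∃ δ > 0, ∃ r₀ > 0, ∃ C : ℝ, 0 ≤ C ∧ ∀ r, 0 < r → r < r₀ →
      volume (Metric.thickening r (frontier A ∩ Metric.ball x₀ δ)) ≤ ENNReal.ofReal (C * r) := by
  obtain ⟨U, hU, hxU, g, hg, hg', hAU⟩ := hb x₀ hx
  have hg0 : ∀ y ∈ frontier A ∩ U, g y = 0 := by
    rintro y ⟨hy, hyU⟩
    have hyA : y ∉ A := fun h => by
      rw [hA.frontier_eq] at hy
      exact hy.2 h
    refine le_antisymm ?_ ?_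
    · by_contra! h
      have : y ∈ A ∩ U := by rw [hAU]; exact ⟨hyU, h⟩
      exact hyA this.1
    · have hc : ContinuousAt g y := hg.continuousOn.continuousAt (hU.mem_nhds hyU)
      have hcl : y ∈ closure (A ∩ U) := by
        rw [inter_comm]
        exact hU.inter_closure ⟨hyU, frontier_subset_closure hy⟩
      refine isClosed_Ici.mem_of_frequently_of_tendsto (b := 𝓝 y) (f := g)
        (s := Ici 0) ?_ hc
      refine (mem_closure_iff_frequently.1 hcl).mono fun z hz => ?_
      rw [hAU] at hz
      exact hz.2.le
  set L := fderiv ℝ g x₀ with hL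
  obtain ⟨e₀, he₀⟩ : ∃ e, L e ≠ 0 := by
    by_contra! h
    exact hg' (ContinuousLinearMap.ext h)
  set e : Vec d := (L e₀)⁻¹ • e₀ with he
  have hLe : L e = 1 := by rw [he, map_smul, smul_eq_mul, inv_mul_cancel₀ he₀]
  have hen : 0 < ‖e‖ := by
    rw [norm_pos_iff]
    rintro h
    rw [h, map_zero] at hLe
    exact zero_ne_one hLe
  have hstrict : HasStrictFDerivAt g L x₀ :=
    (hg.contDiffAt (hU.mem_nhds hxU)).hasStrictFDerivAt one_ne_zero
  set c : NNReal := ⟨1 / (2 * ‖e‖), by positivity⟩ with hcdef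
  have hc : 0 < c := by
    rw [← NNReal.coe_pos]; change 0 < 1 / (2 * ‖e‖); positivity
  have hce : (c : ℝ) * ‖e‖ = 1 / 2 := by
    change 1 / (2 * ‖e‖) * ‖e‖ = 1 / 2
    field_simp
  obtain ⟨s, hs, happ⟩ := hstrict.approximates_deriv_on_nhds (c := c) (Or.inr hc)
  obtain ⟨ρ, hρ, hρs⟩ := Metric.mem_nhds_iff.1 (inter_mem hs (hU.mem_nhds hxU))
  have hg1 : ∀ x ∈ Metric.ball x₀ ρ, ∀ y ∈ Metric.ball x₀ ρ,
      ‖g x - g y - L (x - y)‖ ≤ c * ‖x - y‖ := fun x hx y hy =>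
    happ x (hρs hx).1 y (hρs hy).1
  set K : ℝ := ‖L‖ + c with hK
  have hK0 : 0 ≤ K := by positivity
  have hgK : ∀ x ∈ Metric.ball x₀ ρ, ∀ y ∈ Metric.ball x₀ ρ, |g x - g y| ≤ K * ‖x - y‖ := by
    intro x hx y hy
    have h1 := hg1 x hx y hy
    have h2 := L.le_opNorm (x - y)
    have h3 := norm_add_le (g x - g y - L (x - y)) (L (x - y))
    rw [sub_add_cancel, Real.norm_eq_abs (g x - g y)] at h3
    rw [hK, add_mul]
    linarith
  set S : ℝ := ρ / (2 * ‖e‖) with hS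
  have hS0 : 0 < S := by positivity
  have hSe : S * ‖e‖ = ρ / 2 := by rw [hS]; field_simp
  have hV : volume (Metric.ball x₀ ρ) ≠ ⊤ := Metric.isBounded_ball.measure_lt_top.ne
  refine ⟨ρ / 4, by positivity, ρ / 4, by positivity,
    8 * K / S * (volume (Metric.ball x₀ ρ)).toReal, by positivity, fun r hr hr' => ?_⟩
  set T := Metric.thickening r (frontier A ∩ Metric.ball x₀ (ρ / 4)) with hT
  have hTball : ∀ x ∈ T, x ∈ Metric.ball x₀ (ρ / 2) := by
    intro x hx
    obtain ⟨y, ⟨-, hy⟩, hxy⟩ := Metric.mem_thickening_iff.1 hx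
    rw [Metric.mem_ball] at hy ⊢
    linarith [dist_triangle x y x₀]
  have hTg : ∀ x ∈ T, |g x| ≤ K * r := by
    intro x hx
    obtain ⟨y, ⟨hyA, hy⟩, hxy⟩ := Metric.mem_thickening_iff.1 hx
    have hy' : y ∈ Metric.ball x₀ ρ := Metric.ball_subset_ball (by linarith) hy
    have hx' : x ∈ Metric.ball x₀ ρ := Metric.ball_subset_ball (by linarith) (hTball x hx)
    have h1 := hgK x hx' y hy'
    rw [hg0 y ⟨hyA, (hρs hy').2⟩, sub_zero] at h1
    rw [dist_eq_norm] at hxy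
    exact h1.trans (mul_le_mul_of_nonneg_left hxy.le hK0)
  have hTm : MeasurableSet T := Metric.isOpen_thickening.measurableSet
  have hm : MeasurableSet {z : Vec d × ℝ | z.1 - z.2 • e ∈ T} :=
    hTm.preimage (by fun_prop : Measurable fun z : Vec d × ℝ => z.1 - z.2 • e)
  -- integrate the indicator of the translates of `T` in both orders
  have hswap : ∫⁻ z, ∫⁻ t in Ioo 0 S, {z : Vec d × ℝ | z.1 - z.2 • e ∈ T}.indicator 1 (z, t)
      = ∫⁻ t in Ioo 0 S, ∫⁻ z, {z : Vec d × ℝ | z.1 - z.2 • e ∈ T}.indicator 1 (z, t) :=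
    lintegral_lintegral_swap (f := fun z t =>
      {z : Vec d × ℝ | z.1 - z.2 • e ∈ T}.indicator (1 : Vec d × ℝ → ℝ≥0∞) (z, t))
      ((measurable_one.indicator hm).aemeasurable)
  have hleft (t : ℝ) : ∫⁻ z, {z : Vec d × ℝ | z.1 - z.2 • e ∈ T}.indicator 1 (z, t)
      = volume T := by
    have h1 (z : Vec d) : {z : Vec d × ℝ | z.1 - z.2 • e ∈ T}.indicator
        (1 : Vec d × ℝ → ℝ≥0∞) (z, t) = T.indicator 1 (z - t • e) := rfl
    simp_rw [h1]
    rw [lintegral_sub_right_eq_self (fun z => T.indicator (1 : Vec d → ℝ≥0∞) z) (t • e),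
      lintegral_indicator_one hTm]
  have hright (z : Vec d) : ∫⁻ t in Ioo 0 S, {z : Vec d × ℝ | z.1 - z.2 • e ∈ T}.indicator 1 (z, t)
      ≤ (Metric.ball x₀ ρ).indicator (fun _ => ENNReal.ofReal (8 * K * r)) z := by
    have h1 : ∫⁻ t in Ioo 0 S, {z : Vec d × ℝ | z.1 - z.2 • e ∈ T}.indicator 1 (z, t)
        = volume ({t : ℝ | z - t • e ∈ T} ∩ Ioo 0 S) := by
      have hm' : MeasurableSet {t : ℝ | z - t • e ∈ T} :=
        hTm.preimage (by fun_prop : Measurable fun t : ℝ => z - t • e)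
      rw [← Measure.restrict_apply hm', ← lintegral_indicator_one hm']
      rfl
    rw [h1]
    rcases ({t : ℝ | z - t • e ∈ T} ∩ Ioo 0 S).eq_empty_or_nonempty with h0 | ⟨t₁, ht₁, ht₁S⟩
    · rw [h0, measure_empty]; exact zero_le
    have hz : z ∈ Metric.ball x₀ ρ := by
      have h2 := hTball _ ht₁
      rw [mem_ball_iff_norm] at h2 ⊢
      have h3 : z - x₀ = (z - t₁ • e - x₀) + t₁ • e := by abel
      have h4 := norm_add_le (z - t₁ • e - x₀) (t₁ • e)
      rw [← h3, norm_smul, Real.norm_of_nonneg ht₁S.1.le] at h4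
      have h5 : t₁ * ‖e‖ ≤ S * ‖e‖ := mul_le_mul_of_nonneg_right ht₁S.2.le hen.le
      linarith
    rw [indicator_of_mem hz]
    have h6 : {t : ℝ | z - t • e ∈ T} ∩ Ioo 0 S ⊆ Icc (t₁ - 4 * K * r) (t₁ + 4 * K * r) := by
      rintro t ⟨ht, -⟩
      have b1 := Metric.ball_subset_ball (by linarith : ρ / 2 ≤ ρ) (hTball _ ht)
      have b2 := Metric.ball_subset_ball (by linarith : ρ / 2 ≤ ρ) (hTball _ ht₁)
      have h7 := hg1 _ b1 _ b2
      have h8 : z - t • e - (z - t₁ • e) = (t₁ - t) • e := by rw [sub_smul]; abel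
      rw [h8, map_smul, hLe, norm_smul, Real.norm_eq_abs, Real.norm_eq_abs, smul_eq_mul, mul_one,
        mul_left_comm, hce] at h7
      have h9 := abs_le.1 (hTg _ ht)
      have h10 := abs_le.1 (hTg _ ht₁)
      have h11 := abs_le.1 h7
      rcases abs_cases (t₁ - t) with ⟨ha, _⟩ | ⟨ha, _⟩ <;> rw [ha] at h11 <;>
        constructor <;> linarith [h9.1, h9.2, h10.1, h10.2, h11.1, h11.2]
    refine (measure_mono h6).trans (le_of_eq ?_)
    rw [Real.volume_Icc]
    congr 1; ring
  have hfin : ENNReal.ofReal S * volume T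
      ≤ ENNReal.ofReal (8 * K * r) * volume (Metric.ball x₀ ρ) := by
    have h1 := lintegral_mono (μ := volume) hright
    rw [hswap] at h1
    simp only [hleft] at h1
    rw [lintegral_const, Measure.restrict_apply_univ, Real.volume_Ioo, sub_zero,
      lintegral_indicator_const Metric.isOpen_ball.measurableSet, mul_comm] at h1
    exact h1
  have hSne : ENNReal.ofReal S ≠ 0 := by simpa using hS0
  rw [← ENNReal.ofReal_toReal hV, ← ENNReal.ofReal_mul (by positivity), mul_comm,
    ← ENNReal.le_div_iff_mul_le (Or.inl hSne) (Or.inl ENNReal.ofReal_ne_top),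
    ← ENNReal.ofReal_div_of_pos hS0] at hfin
  refine hfin.trans (le_of_eq ?_)
  congr 1; ring

theorem exists_volume_thickening_compact_le {A : Set (Vec d)} (hA : IsOpen A)
    (hb : HasCkBoundary 1 A) {K : Set (Vec d)} (hK : IsCompact K) (hKA : K ⊆ frontier A) :
    ∃ r₀ > 0, ∃ C : ℝ, 0 ≤ C ∧ ∀ r, 0 < r → r < r₀ →
      volume (Metric.thickening r K) ≤ ENNReal.ofReal (C * r) := by
  refine hK.induction_on (p := fun S => ∃ r₀ > 0, ∃ C : ℝ, 0 ≤ C ∧ ∀ r, 0 < r → r < r₀ →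
      volume (Metric.thickening r S) ≤ ENNReal.ofReal (C * r)) ?_ ?_ ?_ ?_
  · exact ⟨1, one_pos, 0, le_rfl, by simp⟩
  · rintro S S' hS ⟨r₀, hr₀, C, hC, h⟩
    exact ⟨r₀, hr₀, C, hC, fun r hr hr' =>
      (measure_mono (Metric.thickening_subset_of_subset r hS)).trans (h r hr hr')⟩
  · rintro S S' ⟨r₀, hr₀, C, hC, h⟩ ⟨r₁, hr₁, C', hC', h'⟩
    refine ⟨min r₀ r₁, lt_min hr₀ hr₁, C + C', by positivity, fun r hr hr' => ?_⟩
    rw [Metric.thickening_union, add_mul, ENNReal.ofReal_add (by positivity) (by positivity)]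
    exact (measure_union_le _ _).trans (add_le_add (h r hr (hr'.trans_le (min_le_left _ _)))
      (h' r hr (hr'.trans_le (min_le_right _ _))))
  · intro x hx
    obtain ⟨δ, hδ, r₀, hr₀, C, hC, h⟩ := exists_volume_thickening_le hA hb (hKA hx)
    exact ⟨frontier A ∩ Metric.ball x δ, mem_nhdsWithin.2 ⟨Metric.ball x δ, Metric.isOpen_ball,
      Metric.mem_ball_self hδ, fun y hy => ⟨hKA hy.2, hy.1⟩⟩, r₀, hr₀, C, hC, h⟩

/-- The volume of the tubular neighbourhoods of the approximating interfaces is controlled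
uniformly in the approximation index. -/
theorem eventually_measure_infDist_lt_le {A₀ : Set (Vec d)} (hA₀ : IsCkDomain 1 A₀)
    {A : ℕ → Set (Vec d)} (hA : TendstoC1 A A₀) :
    ∃ C : ℝ, 0 ≤ C ∧ ∀ᶠ i in atTop, ∀ r, 0 < r →
      (cell d).real {x | Metric.infDist x (frontier (A i)) < r} ≤ C * r := by
  obtain ⟨ψ, hψ, hsmall, hAψ⟩ := hA
  obtain ⟨r₀, hr₀, C, hC, hvol⟩ := exists_volume_thickening_compact_le hA₀.isOpen hA₀.boundary
    ((isCompact_closedBall (0 : Vec d) (√ d + 2)).inter_left isClosed_frontier) inter_subset_left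
  have hdet : ENNReal.ofReal |(ContinuousLinearMap.id ℝ (Vec d)).det| < (2 : NNReal) := by
    have : (ContinuousLinearMap.id ℝ (Vec d)).det = 1 := LinearMap.det_id
    simp [this]
  obtain ⟨δ, hδ, hδ0, hδ1⟩ := ((addHaar_image_le_mul_of_det_lt volume _ hdet).and
    (Ioo_mem_nhdsGT (show (0 : NNReal) < 1 / 2 by norm_num))).exists
  refine ⟨max (4 * C) (max (2 / r₀) 1), by positivity, ?_⟩
  filter_upwards [hAψ, hsmall δ (by exact_mod_cast hδ0)] with i hi hs r hr
  set Φ : Vec d → Vec d := fun x => x + ψ i x with hΦ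
  have hlip : LipschitzWith δ (ψ i) := lipschitzWith_of_nnnorm_fderiv_le
    ((hψ i).1.differentiable one_ne_zero) fun x => (hs x).2
  have happ : ApproximatesLinearOn Φ (ContinuousLinearMap.id ℝ (Vec d)) univ δ := by
    intro x _ y _
    have h1 := hlip.norm_sub_le x y
    simpa [hΦ, add_sub_add_comm] using h1
  have happ' : ApproximatesLinearOn Φ
      ((ContinuousLinearEquiv.refl ℝ (Vec d) : Vec d ≃L[ℝ] Vec d) : Vec d →L[ℝ] Vec d) univ δ := happ
  have hd' : (δ : ℝ) ≤ 1 / 2 := by exact_mod_cast hδ1.le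
  have hsub : Subsingleton (Vec d) ∨ δ < ‖((ContinuousLinearEquiv.refl ℝ (Vec d)).symm :
      Vec d →L[ℝ] Vec d)‖₊⁻¹ := by
    rcases subsingleton_or_nontrivial (Vec d) with h | h
    · exact Or.inl h
    · right
      have : ‖((ContinuousLinearEquiv.refl ℝ (Vec d)).symm : Vec d →L[ℝ] Vec d)‖₊ = 1 :=
        ContinuousLinearMap.nnnorm_id
      rw [this, inv_one]
      exact hδ1.trans (by norm_num)
  let H := happ'.toHomeomorph Φ hsub
  have hfr : frontier (A i) = Φ '' frontier A₀ := by
    rw [hi]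
    exact (H.image_frontier A₀).symm
  by_cases hrr : 2 * r < r₀ ∧ r < 1
  · have hsubset : {x | Metric.infDist x (frontier (A i)) < r} ∩ unitCell d
        ⊆ Φ '' Metric.thickening (2 * r) (frontier A₀ ∩ Metric.closedBall 0 (√ d + 2)) := by
      rintro x ⟨hx, hxc⟩
      have hne : (frontier (A i)).Nonempty := by
        rw [hfr]; exact hA₀.boundary_nonempty.image _
      obtain ⟨y, hy, hxy⟩ := (Metric.infDist_lt_iff hne).1 hx
      rw [hfr] at hy
      obtain ⟨y₀, hy₀, rfl⟩ := hy
      obtain ⟨x₁, rfl⟩ := H.surjective x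
      change dist (Φ x₁) (Φ y₀) < r at hxy
      have h1 : ‖x₁ - y₀‖ ≤ 2 * dist (Φ x₁) (Φ y₀) := by
        have h2 := hlip.norm_sub_le x₁ y₀
        have h3 : x₁ - y₀ = (Φ x₁ - Φ y₀) - (ψ i x₁ - ψ i y₀) := by simp [hΦ]; abel
        have h4 := norm_sub_le (Φ x₁ - Φ y₀) (ψ i x₁ - ψ i y₀)
        rw [← h3] at h4
        rw [dist_eq_norm]
        nlinarith [norm_nonneg (x₁ - y₀)]
      have hΦx : ‖Φ x₁‖ ≤ √ d := by
        have hxc' : ∀ a, Φ x₁ a ∈ Ico (0 : ℝ) 1 := hxc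
        rw [EuclideanSpace.norm_eq]
        refine Real.sqrt_le_sqrt ?_
        calc ∑ a, ‖Φ x₁ a‖ ^ 2 ≤ ∑ _a : Fin d, (1 : ℝ) := by
              refine Finset.sum_le_sum fun a _ => ?_
              have h := hxc' a
              rw [Real.norm_eq_abs, sq_abs]
              nlinarith [h.1, h.2]
          _ = d := by simp
      refine ⟨x₁, Metric.mem_thickening_iff.2 ⟨y₀, ⟨hy₀, ?_⟩, ?_⟩, rfl⟩
      · rw [mem_closedBall_zero_iff]
        have h5 : y₀ = Φ x₁ + (Φ y₀ - Φ x₁) - ψ i y₀ := by simp [hΦ]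
        have h6 := norm_sub_le (Φ x₁ + (Φ y₀ - Φ x₁)) (ψ i y₀)
        rw [← h5] at h6
        have h7 := norm_add_le (Φ x₁) (Φ y₀ - Φ x₁)
        rw [dist_comm, dist_eq_norm] at hxy
        linarith [(hs y₀).1]
      · rw [dist_eq_norm]; linarith
    have h8 : (cell d) {x | Metric.infDist x (frontier (A i)) < r}
        ≤ ENNReal.ofReal (4 * C * r) := by
      rw [cell, Measure.restrict_apply
        (measurableSet_lt (Metric.continuous_infDist_pt _).measurable measurable_const)]
      refine (measure_mono hsubset).trans ((hδ _ _ (happ.mono_set (subset_univ _))).trans ?_)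
      refine (mul_le_mul_right (hvol _ (by positivity) hrr.1) _).trans ?_
      rw [show ((2 : NNReal) : ℝ≥0∞) = ENNReal.ofReal 2 by simp, ← ENNReal.ofReal_mul zero_le_two]
      refine le_of_eq ?_
      congr 1; ring
    refine (ENNReal.toReal_le_of_le_ofReal (by positivity) h8).trans ?_
    exact mul_le_mul_of_nonneg_right (le_max_left _ _) hr.le
  · refine (measureReal_le_one).trans ?_
    rw [not_and_or, not_lt, not_lt] at hrr
    rcases hrr with h | h
    · calc (1 : ℝ) ≤ 2 / r₀ * r := by rw [div_mul_eq_mul_div, one_le_div hr₀]; exact h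
        _ ≤ _ := by
          gcongr
          exact (le_max_left _ _).trans (le_max_right _ _)
    · calc (1 : ℝ) ≤ 1 * r := by linarith
        _ ≤ _ := by
          gcongr
          exact (le_max_right _ _).trans (le_max_right _ _)

end Tube

/-! ### The initial energy -/

section InitialEnergy

variable {d : ℕ}

/-- The signed distance is Lipschitz with constant one: a segment that joins the two phases meets
the interface. -/
theorem lipschitzWith_signedDist {A : Set (Vec d)} (hA : IsOpen A) :
    LipschitzWith 1 (signedDist A) := by
  have hsame (x y : Vec d) :
      |Metric.infDist x (frontier A) - Metric.infDist y (frontier A)| ≤ dist x y := by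
    have := (Metric.lipschitz_infDist_pt (frontier A)).dist_le_mul x y
    simpa [Real.dist_eq] using this
  have hdiff (x y : Vec d) (hx : x ∈ A) (hy : y ∉ A) :
      Metric.infDist x (frontier A) + Metric.infDist y (frontier A) ≤ dist x y := by
    obtain ⟨z, hz, hzA⟩ : ∃ z ∈ segment ℝ x y, z ∈ frontier A := by
      by_contra! h
      have h1 := (convex_segment (𝕜 := ℝ) x y).isPreconnected A (closure A)ᶜ hA
        isClosed_closure.isOpen_compl ?_ ⟨x, left_mem_segment ℝ x y, hx⟩
        ⟨y, right_mem_segment ℝ x y, fun hyc => ?_⟩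
      · obtain ⟨z, -, hz1, hz2⟩ := h1
        exact hz2 (subset_closure hz1)
      · intro z hz
        by_cases hzA : z ∈ A
        · exact Or.inl hzA
        · refine Or.inr fun hzc => h z hz ?_
          rw [hA.frontier_eq]
          exact ⟨hzc, hzA⟩
      · refine h y (right_mem_segment ℝ x y) ?_
        rw [hA.frontier_eq]
        exact ⟨hyc, hy⟩
    rw [← dist_add_dist_of_mem_segment hz]
    refine add_le_add (Metric.infDist_le_dist_of_mem hzA) ?_
    rw [dist_comm]
    exact Metric.infDist_le_dist_of_mem hzA
  refine LipschitzWith.of_dist_le_mul fun x y => ?_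
  rw [NNReal.coe_one, one_mul, Real.dist_eq, signedDist, signedDist]
  have hn (z : Vec d) : 0 ≤ Metric.infDist z (frontier A) := Metric.infDist_nonneg
  split_ifs with hx hy hy
  · exact hsame x y
  · rw [sub_neg_eq_add, abs_of_nonneg (add_nonneg (hn x) (hn y))]
    exact hdiff x y hx hy
  · have h1 := hdiff y x hy hx
    rw [dist_comm] at h1
    rw [abs_le]
    constructor <;> linarith [hn x, hn y]
  · have h1 := hsame y x
    rw [dist_comm] at h1
    rw [neg_sub_neg]
    exact h1

theorem abs_signedDist (A : Set (Vec d)) (x : Vec d) :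
    |signedDist A x| = Metric.infDist x (frontier A) := by
  have : 0 ≤ Metric.infDist x (frontier A) := Metric.infDist_nonneg
  rw [signedDist]
  split_ifs
  · exact abs_of_nonneg this
  · rw [abs_neg, abs_of_nonneg this]

/-- The chain rule, as an inequality, for the composition with a map that is merely Lipschitz. -/
theorem norm_fderiv_comp_lipschitz_le {T : ℝ → ℝ} {s : Vec d → ℝ} (hs : LipschitzWith 1 s)
    {x : Vec d} {T' : ℝ} (hT : HasDerivAt T T' (s x)) (hφ : DifferentiableAt ℝ (fun y => T (s y)) x) :
    ‖fderiv ℝ (fun y => T (s y)) x‖ ≤ |T'| := by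
  refine le_of_forall_pos_le_add fun η hη => ?_
  refine hφ.hasFDerivAt.le_of_lip' (by positivity) ?_
  have h1 := (hasDerivAt_iff_isLittleO.1 hT).def hη
  filter_upwards [hs.continuous.continuousAt.eventually h1] with y hy
  have h2 : |s y - s x| ≤ ‖y - x‖ := by
    have := hs.dist_le_mul y x
    simpa [Real.dist_eq, dist_eq_norm] using this
  rw [Real.norm_eq_abs, Real.norm_eq_abs, smul_eq_mul] at hy
  have h3 := abs_add_le (T (s y) - T (s x) - (s y - s x) * T') ((s y - s x) * T')
  rw [sub_add_cancel, abs_mul] at h3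
  rw [Real.norm_eq_abs, add_mul]
  nlinarith [abs_nonneg T']

theorem hasDerivAt_tanh (x : ℝ) : HasDerivAt Real.tanh (1 - Real.tanh x ^ 2) x := by
  have hc : Real.cosh x ≠ 0 := (Real.cosh_pos x).ne'
  have h := (Real.hasDerivAt_sinh x).div (Real.hasDerivAt_cosh x) hc
  have e : Real.tanh = Real.sinh / Real.cosh := funext fun y => Real.tanh_eq_sinh_div_cosh y
  rw [e]
  refine h.congr_deriv ?_
  rw [Pi.div_apply]
  field_simp

theorem one_sub_tanh_sq_le (x : ℝ) : 1 - Real.tanh x ^ 2 ≤ 4 * Real.exp (-(2 * |x|)) := by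
  have hc := Real.cosh_pos x
  have e : 1 - Real.tanh x ^ 2 = (Real.cosh x ^ 2)⁻¹ := by
    rw [Real.tanh_eq_sinh_div_cosh, div_pow, Real.sinh_sq]
    field_simp
    ring
  have h1 : Real.exp |x| / 2 ≤ Real.cosh x := by
    rw [← Real.cosh_abs, Real.cosh_eq]
    linarith [Real.exp_pos (-|x|)]
  have h2 : (Real.exp |x| / 2) ^ 2 ≤ Real.cosh x ^ 2 := pow_le_pow_left₀ (by positivity) h1 2
  rw [e]
  refine (inv_anti₀ (by positivity) h2).trans (le_of_eq ?_)
  rw [Real.exp_neg, two_mul, Real.exp_add]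
  field_simp
  norm_num

theorem one_sub_tanh_sq_nonneg (x : ℝ) : 0 ≤ 1 - Real.tanh x ^ 2 := by
  linarith [Real.tanh_sq_lt_one x]

namespace IsProfile

variable {h : ℝ → ℝ}

theorem exists_deriv_bound (hh : IsProfile h) : ∃ H, 0 ≤ H ∧ ∀ r, |deriv h r| ≤ H := by
  have hc : Continuous (deriv h) := hh.smooth.continuous_deriv (by simp)
  obtain ⟨H, hH⟩ := (isCompact_Icc (a := -(1 : ℝ)) (b := 1)).exists_bound_of_continuousOn
    hc.continuousOn
  refine ⟨max H 0, le_max_right _ _, fun r => ?_⟩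
  by_cases h1 : r ∈ Icc (-1 : ℝ) 1
  · exact (hH r h1).trans (le_max_left _ _)
  have h0 : deriv h r = 0 := by
    rw [mem_Icc, not_and_or, not_le, not_le] at h1
    rcases h1 with h1 | h1
    · have : h =ᶠ[𝓝 r] fun _ => -(1 / 2) := by
        filter_upwards [gt_mem_nhds h1] with y hy
        have := hh.odd (-y)
        rw [neg_neg, hh.eq_half (-y) (by linarith)] at this
        exact this
      rw [this.deriv_eq]; simp
    · have : h =ᶠ[𝓝 r] fun _ => 1 / 2 := by
        filter_upwards [lt_mem_nhds h1] with y hy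
        exact hh.eq_half y (by linarith)
      rw [this.deriv_eq]; simp
  rw [h0, abs_zero]
  exact le_max_right _ _

theorem min_le_abs (hh : IsProfile h) (r : ℝ) : min (|r| / 2) (1 / 2) ≤ |h r| := by
  wlog hr : 0 ≤ r generalizing r
  · have := this (-r) (by linarith)
    rwa [hh.odd, abs_neg, abs_neg] at this
  have h0 : h 0 = 0 := hh.eq_self 0 le_rfl (by norm_num)
  have h1 : 0 ≤ h r := h0 ▸ hh.monotone hr
  rw [abs_of_nonneg hr, abs_of_nonneg h1]
  by_cases h2 : r ≤ 1 / 4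
  · rw [hh.eq_self r hr h2]
    exact (min_le_left _ _).trans (by linarith)
  by_cases h3 : r ≤ 1 / 2
  · have h4 := hh.monotone (le_of_lt (not_le.1 h2))
    rw [hh.eq_self (1 / 4) (by norm_num) le_rfl] at h4
    exact (min_le_left _ _).trans (by linarith)
  · rw [hh.eq_half r (not_le.1 h3)]
    exact min_le_right _ _

end IsProfile

/-- The profile of the phase field decays exponentially up to the cut-off distance. -/
theorem sech_sq_sq_le {h : ℝ → ℝ} (hh : IsProfile h) {ε b : ℝ} (hε : 0 < ε) (hb : 0 < b) (s : ℝ) :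
    (1 - Real.tanh (b * h (s / b) / ε) ^ 2) ^ 2
      ≤ 16 * (Real.exp (-(2 * |s| / ε)) + Real.exp (-2 * b / ε)) := by
  set z := b * h (s / b) / ε with hz
  have h1 := one_sub_tanh_sq_le z
  have h2 := pow_le_pow_left₀ (one_sub_tanh_sq_nonneg z) h1 2
  refine h2.trans ?_
  rw [mul_pow, ← Real.exp_nat_mul]
  have h3 : |z| = b * |h (s / b)| / ε := by
    rw [hz, abs_div, abs_mul, abs_of_pos hb, abs_of_pos hε]
  have h4 := hh.min_le_abs (s / b)
  have h5 : Real.exp (((2 : ℕ) : ℝ) * -(2 * |z|))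
      ≤ Real.exp (-(2 * |s| / ε)) + Real.exp (-2 * b / ε) := by
    rcases le_total (|s / b| / 2) (1 / 2) with h6 | h6
    · rw [min_eq_left h6, abs_div, abs_of_pos hb] at h4
      refine le_add_of_le_of_nonneg (Real.exp_le_exp.2 ?_) (Real.exp_pos _).le
      rw [h3]
      have h7 : |s| / 2 ≤ b * |h (s / b)| := by
        calc |s| / 2 = b * (|s| / b / 2) := by field_simp
          _ ≤ _ := by gcongr
      have h8 : |s| / 2 / ε ≤ b * |h (s / b)| / ε := by gcongr
      have h9 : 2 * |s| / ε = 4 * (|s| / 2 / ε) := by ring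
      push_cast
      linarith
    · rw [min_eq_right h6] at h4
      refine le_add_of_nonneg_of_le (Real.exp_pos _).le (Real.exp_le_exp.2 ?_)
      rw [h3]
      have h8 : b * (1 / 2) / ε ≤ b * |h (s / b)| / ε := by gcongr
      have h9 : -2 * b / ε = -(4 * (b * (1 / 2) / ε)) := by ring
      push_cast
      linarith
  nlinarith

/-- Integrals of `exp (-2 D / ε)` for a distance function `D` whose sublevel sets have volume at
most linear in the level. -/
theorem integral_exp_neg_le {D : Vec d → ℝ} (hD : Continuous D) (hD0 : ∀ x, 0 ≤ D x) {C ε : ℝ}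
    (hC : 0 ≤ C) (hε : 0 < ε) (hvol : ∀ r, 0 < r → (cell d).real {x | D x < r} ≤ C * r) :
    ∫ x, Real.exp (-(2 * D x / ε)) ∂(cell d) ≤ C * ε / 2 := by
  have hcont : Continuous fun x => Real.exp (-(2 * D x / ε)) := by fun_prop
  rw [hcont.integrable_cell.integral_eq_integral_meas_lt
    (Eventually.of_forall fun x => (Real.exp_pos _).le)]
  have h1 (t : ℝ) (ht : t ∈ Ioi (0 : ℝ)) : (cell d).real {x | t < Real.exp (-(2 * D x / ε))}
      ≤ (Ioc (0 : ℝ) 1).indicator (fun t => C * ε / 2 * -Real.log t) t := by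
    rw [mem_Ioi] at ht
    have h2 (x : Vec d) : t < Real.exp (-(2 * D x / ε)) ↔ D x < ε / 2 * -Real.log t := by
      rw [← Real.log_lt_iff_lt_exp ht, lt_neg, div_lt_iff₀ hε]
      constructor <;> intro h <;> linarith
    simp only [h2]
    by_cases ht1 : t < 1
    · rw [indicator_of_mem (show t ∈ Ioc (0 : ℝ) 1 from ⟨ht, ht1.le⟩)]
      have h3 : 0 < -Real.log t := by linarith [Real.log_neg ht ht1]
      exact (hvol _ (by positivity)).trans (le_of_eq (by ring))
    · have h3 : {x : Vec d | D x < ε / 2 * -Real.log t} = ∅ := by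
        ext x
        have := Real.log_nonneg (not_lt.1 ht1)
        simp only [mem_ofPred_eq, mem_empty_iff_false, iff_false, not_lt]
        nlinarith [hD0 x]
      rw [h3, measureReal_empty]
      refine indicator_nonneg (fun t ht => ?_) t
      have := Real.log_nonpos ht.1.le ht.2
      have : 0 ≤ -Real.log t := by linarith
      positivity
  have hint : IntegrableOn (fun t => C * ε / 2 * -Real.log t) (Ioc 0 1) := by
    rw [← intervalIntegrable_iff_integrableOn_Ioc_of_le zero_le_one]
    exact intervalIntegral.intervalIntegrable_log'.neg.const_mul _
  have h4 : ∫ t in Ioi (0 : ℝ), (Ioc (0 : ℝ) 1).indicator (fun t => C * ε / 2 * -Real.log t) t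
      = C * ε / 2 := by
    rw [setIntegral_indicator measurableSet_Ioc, inter_eq_right.2 fun t ht => ht.1,
      ← intervalIntegral.integral_of_le zero_le_one, intervalIntegral.integral_const_mul,
      intervalIntegral.integral_neg, integral_log]
    simp
  rw [← h4]
  refine integral_mono_of_nonneg (Eventually.of_forall fun t => measureReal_nonneg)
    ((integrable_indicator_iff measurableSet_Ioc).2 hint).integrableOn ?_
  exact (ae_restrict_iff' measurableSet_Ioi).2 (Eventually.of_forall h1)

/-- The energy density of the phase field. -/
def energyDensity (ε : ℝ) (φ : Vec d → ℝ) (x : Vec d) : ℝ :=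
  ε / 2 * ∑ a, fderiv ℝ φ x (unitVec a) ^ 2 + doubleWell (φ x) / ε

theorem norm_unitVec (a : Fin d) : ‖(unitVec a : Vec d)‖ = 1 := by
  rw [unitVec, PiLp.norm_single, norm_one]

theorem doubleWell_nonneg (r : ℝ) : 0 ≤ doubleWell r := by unfold doubleWell; positivity

theorem energyDensity_nonneg {ε : ℝ} (hε : 0 < ε) (φ : Vec d → ℝ) (x : Vec d) :
    0 ≤ energyDensity ε φ x := by
  have := doubleWell_nonneg (φ x)
  unfold energyDensity
  positivity

/-- The energy of the initial phase fields is bounded. -/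
theorem exists_initial_energy_bound {ε b : ℕ → ℝ} (hε : ∀ i, 0 < ε i) {A : ℕ → Set (Vec d)}
    {A₀ : Set (Vec d)} (hA₀ : IsCkDomain 1 A₀) (hA : IsPhaseApproximation ε b A A₀) {h : ℝ → ℝ}
    (hh : IsProfile h) :
    ∃ C : ℝ, ∀ᶠ i in atTop, Differentiable ℝ (initialPhase h (ε i) (b i) (A i)) →
      ∫ x, energyDensity (ε i) (initialPhase h (ε i) (b i) (A i)) x ∂(cell d) ≤ C := by
  obtain ⟨C, hC, hvol⟩ := eventually_measure_infDist_lt_le hA₀ hA.tendsto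
  obtain ⟨H, hH, hH'⟩ := hh.exists_deriv_bound
  refine ⟨8 * (d * H ^ 2 + 1) * (C / 2 + 1), ?_⟩
  filter_upwards [hvol, hA.tail.eventually (gt_mem_nhds one_pos)] with i hi htail hdiff
  have hεi := hε i
  have hbi := hA.b_pos i
  set φ := initialPhase h (ε i) (b i) (A i) with hφ
  have hlip := lipschitzWith_signedDist (hA.domain i).isOpen
  have hpt (x : Vec d) : energyDensity (ε i) φ x ≤ 8 * (d * H ^ 2 + 1) * ((ε i)⁻¹ *
      (Real.exp (-(2 * Metric.infDist x (frontier (A i)) / ε i)) + Real.exp (-2 * b i / ε i))) := by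
    set s := signedDist (A i) x with hs
    set z := b i * h (s / b i) / ε i with hz
    have hT : HasDerivAt (fun r => Real.tanh (b i * h (r / b i) / ε i))
        ((1 - Real.tanh z ^ 2) * (deriv h (s / b i) / ε i)) s := by
      have h1 : HasDerivAt (fun r => b i * h (r / b i) / ε i)
          (b i * (deriv h (s / b i) * (1 / b i)) / ε i) s := by
        have h2 : HasDerivAt (fun r => r / b i) (1 / b i) s := (hasDerivAt_id s).div_const _
        have h3 := (hh.smooth.differentiable (by simp) (s / b i)).hasDerivAt.comp s h2
        exact (h3.const_mul (b i)).div_const (ε i)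
      refine ((hasDerivAt_tanh z).comp s h1).congr_deriv ?_
      field_simp
    have h4 := norm_fderiv_comp_lipschitz_le hlip hT (hdiff x)
    change ‖fderiv ℝ φ x‖ ≤ _ at h4
    set q := 1 - Real.tanh z ^ 2 with hq
    have hq0 : 0 ≤ q := one_sub_tanh_sq_nonneg z
    have h5 : ‖fderiv ℝ φ x‖ ≤ q * H / ε i := by
      refine h4.trans ?_
      rw [abs_mul, abs_div, abs_of_nonneg hq0, abs_of_pos hεi, mul_div_assoc]
      gcongr
      exact hH' _
    have h6 : ∑ a, fderiv ℝ φ x (unitVec a) ^ 2 ≤ d * (q * H / ε i) ^ 2 := by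
      calc ∑ a, fderiv ℝ φ x (unitVec a) ^ 2 ≤ ∑ _a : Fin d, (q * H / ε i) ^ 2 := by
            refine Finset.sum_le_sum fun a _ => ?_
            rw [← sq_abs]
            refine pow_le_pow_left₀ (abs_nonneg _) ?_ 2
            have h7 := (fderiv ℝ φ x).le_opNorm (unitVec a)
            rw [norm_unitVec, mul_one] at h7
            exact h7.trans h5
        _ = _ := by simp
    have h8 : doubleWell (φ x) = q ^ 2 / 2 := rfl
    have h9 := sech_sq_sq_le hh hεi hbi s
    rw [hs, abs_signedDist, ← hs, ← hz, ← hq] at h9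
    calc energyDensity (ε i) φ x
        ≤ ε i / 2 * (d * (q * H / ε i) ^ 2) + q ^ 2 / 2 / ε i := by
          rw [energyDensity, h8]; gcongr
      _ = (d * H ^ 2 + 1) / 2 * (ε i)⁻¹ * q ^ 2 := by field_simp
      _ ≤ (d * H ^ 2 + 1) / 2 * (ε i)⁻¹ * (16 * (Real.exp (-(2 * Metric.infDist x
          (frontier (A i)) / ε i)) + Real.exp (-2 * b i / ε i))) := by gcongr
      _ = _ := by ring
  have hcD : Continuous fun x : Vec d => Metric.infDist x (frontier (A i)) :=
    Metric.continuous_infDist_pt _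
  have hc1 : Continuous fun x : Vec d =>
      Real.exp (-(2 * Metric.infDist x (frontier (A i)) / ε i)) := by fun_prop
  have hexp := integral_exp_neg_le hcD (fun x => Metric.infDist_nonneg) hC hεi hi
  calc ∫ x, energyDensity (ε i) φ x ∂(cell d)
      ≤ ∫ x, 8 * (d * H ^ 2 + 1) * ((ε i)⁻¹ * (Real.exp (-(2 * Metric.infDist x
        (frontier (A i)) / ε i)) + Real.exp (-2 * b i / ε i))) ∂(cell d) :=
        integral_mono_of_nonneg (Eventually.of_forall fun x => energyDensity_nonneg hεi φ x)
          (by fun_prop : Continuous _).integrable_cell (Eventually.of_forall hpt)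
    _ = 8 * (d * H ^ 2 + 1) * ((ε i)⁻¹ * (∫ x, Real.exp (-(2 * Metric.infDist x
        (frontier (A i)) / ε i)) ∂(cell d)) + (ε i)⁻¹ * Real.exp (-2 * b i / ε i)) := by
        rw [integral_const_mul, integral_const_mul, integral_cell_add hc1 continuous_const]
        simp [mul_add]
    _ ≤ 8 * (d * H ^ 2 + 1) * ((ε i)⁻¹ * (C * ε i / 2) + 1) := by gcongr
    _ = _ := by field_simp

end InitialEnergy

/-! ### Time regularity of the phase field -/

section Time

variable {d : ℕ}

/-- The chain rule for the square of an absolutely continuous function. -/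
theorem sq_eq_add_integral {f g : ℝ → ℝ} {f₀ t : ℝ} (ht : 0 ≤ t)
    (hg : IntervalIntegrable g volume 0 t) (hf : ∀ s ∈ Icc 0 t, f s = f₀ + ∫ r in (0 : ℝ)..s, g r) :
    f t ^ 2 = f₀ ^ 2 + ∫ r in (0 : ℝ)..t, 2 * f r * g r := by
  have hac : AbsolutelyContinuousOnInterval (fun s => f₀ + ∫ r in (0 : ℝ)..s, g r) 0 t := by
    refine AbsolutelyContinuousOnInterval.fun_add ?_
      (hg.absolutelyContinuousOnInterval_intervalIntegral left_mem_uIcc)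
    exact ((LipschitzWith.const f₀).lipschitzOnWith (s := uIcc 0 t)).absolutelyContinuousOnInterval
  have h1 := hac.integral_deriv_mul_eq_sub hac
  have h2 : ∫ r in (0 : ℝ)..t, 2 * f r * g r = f t * f t - f₀ * f₀ := by
    rw [intervalIntegral.integral_same, add_zero, ← hf t ⟨ht, le_rfl⟩] at h1
    rw [← h1]
    refine intervalIntegral.integral_congr_ae ?_
    filter_upwards [hg.ae_hasDerivAt_integral] with s hs hs'
    have hs2 : s ∈ uIcc 0 t := uIoc_subset_uIcc hs'
    have h3 := ((hs hs2 0 left_mem_uIcc).const_add f₀).deriv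
    rw [uIcc_of_le ht] at hs2
    rw [h3, ← hf s hs2]
    ring
  rw [h2]; ring

/-- Bounded velocities of a path of functions on the torus. -/
structure IsRate (q : ℝ → Vec d → ℝ) (M : ℝ) : Prop where
  measurable : Measurable (Function.uncurry q)
  periodic : ∀ r, IsTorusFn (q r)
  contDiff : ∀ r, ContDiff ℝ 1 (q r)
  bound : ∀ r x, |q r x| ≤ M
  bound_fderiv : ∀ r x, ‖fderiv ℝ (q r) x‖ ≤ M

/-- A field that is bounded in `C¹` for almost every time and integrable in time at every point may
be modified on a null set of times so as to be jointly measurable. -/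
theorem exists_isRate {φ' : ℝ → Vec d → ℝ} (h : EssBoundedC 1 φ')
    (hi : ∀ x t, 0 ≤ t → IntervalIntegrable (fun r => φ' r x) volume 0 t) :
    ∃ q M, IsRate q M ∧ ∀ᵐ r ∂(volume.restrict (Ici (0 : ℝ))), q r = φ' r := by
  obtain ⟨M, hM⟩ := h
  have hmeas (x : Vec d) : AEStronglyMeasurable (fun r => φ' r x) (volume.restrict (Ici 0)) := by
    rw [← Measure.restrict_congr_set (Ioi_ae_eq_Ici (μ := volume) (a := (0 : ℝ)))]
    have e : Ioi (0 : ℝ) = ⋃ n : ℕ, Ioc (0 : ℝ) n := by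
      ext y
      simp only [mem_Ioi, mem_iUnion, mem_Ioc, exists_and_left, iff_self_and]
      exact fun _ => exists_nat_ge y
    rw [e, aestronglyMeasurable_iUnion_iff]
    exact fun n => ((intervalIntegrable_iff_integrableOn_Ioc_of_le n.cast_nonneg).1
      (hi x n n.cast_nonneg)).aestronglyMeasurable
  set g : ℕ → ℝ → ℝ := fun n => (hmeas (TopologicalSpace.denseSeq (Vec d) n)).mk _ with hg
  have hgm (n : ℕ) : Measurable (g n) := (hmeas _).stronglyMeasurable_mk.measurable
  have hgood : ∀ᵐ r ∂(volume.restrict (Ici (0 : ℝ))),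
      (IsTorusFn (φ' r) ∧ ContDiff ℝ 1 (φ' r) ∧ ∀ j ≤ 1, ∀ x, ‖iteratedFDeriv ℝ j (φ' r) x‖ ≤ M) ∧
      ∀ n, φ' r (TopologicalSpace.denseSeq (Vec d) n) = g n r :=
    hM.and (ae_all_iff.2 fun n => (hmeas _).ae_eq_mk)
  obtain ⟨N, hN, hNm, hN0⟩ := exists_measurable_superset_of_null hgood
  have hgood' : ∀ r ∉ N,
      (IsTorusFn (φ' r) ∧ ContDiff ℝ 1 (φ' r) ∧ ∀ j ≤ 1, ∀ x, ‖iteratedFDeriv ℝ j (φ' r) x‖ ≤ M) ∧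
      ∀ n, φ' r (TopologicalSpace.denseSeq (Vec d) n) = g n r := by
    intro r hr
    by_contra h
    exact hr (hN h)
  have hM0 : 0 ≤ max M 0 := le_max_right _ _
  classical
  set q : ℝ → Vec d → ℝ := fun r => if r ∈ N then 0 else φ' r with hq
  have hq1 (r : ℝ) : IsTorusFn (q r) ∧ ContDiff ℝ 1 (q r) ∧ (∀ x, |q r x| ≤ max M 0) ∧
      ∀ x, ‖fderiv ℝ (q r) x‖ ≤ max M 0 := by
    by_cases hr : r ∈ N
    · have e : q r = fun _ => 0 := by simp only [hq, if_pos hr]; rfl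
      rw [e]
      exact ⟨fun _ _ => rfl, contDiff_const, fun x => by simp, fun x => by simp⟩
    · have e : q r = φ' r := by simp only [hq, if_neg hr]
      obtain ⟨⟨h1, h2, h3⟩, -⟩ := hgood' r hr
      rw [e]
      refine ⟨h1, h2, fun x => ?_, fun x => ?_⟩
      · have h4 := h3 0 (by norm_num) x
        rw [norm_iteratedFDeriv_zero] at h4
        exact h4.trans (le_max_left _ _)
      · have h4 := h3 1 le_rfl x
        rw [norm_iteratedFDeriv_one] at h4
        exact h4.trans (le_max_left _ _)
  have hqd (n : ℕ) : Measurable fun r => q r (TopologicalSpace.denseSeq (Vec d) n) := by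
    have e : (fun r => q r (TopologicalSpace.denseSeq (Vec d) n))
        = fun r => if r ∈ N then 0 else g n r := by
      funext r
      by_cases hr : r ∈ N
      · simp only [hq, if_pos hr]; rfl
      · simp only [hq, if_neg hr]
        exact (hgood' r hr).2 n
    rw [e]
    exact Measurable.ite hNm measurable_const (hgm n)
  have hqm (x : Vec d) : Measurable fun r => q r x := by
    obtain ⟨z, hz, hzx⟩ := mem_closure_iff_seq_limit.1
      ((TopologicalSpace.denseRange_denseSeq (Vec d)).closure_range ▸ mem_univ x)
    choose n hn using hz
    refine measurable_of_tendsto_metrizable (f := fun k r => q r (z k)) (fun k => ?_)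
      (tendsto_pi_nhds.2 fun r => ?_)
    · simp only [← hn k]
      exact hqd (n k)
    · exact ((hq1 r).2.1.continuous.tendsto x).comp hzx
  refine ⟨q, max M 0, ⟨?_, fun r => (hq1 r).1, fun r => (hq1 r).2.1, fun r => (hq1 r).2.2.1,
    fun r => (hq1 r).2.2.2⟩, ?_⟩
  · exact (measurable_uncurry_of_continuous_of_measurable (u := fun x r => q r x)
      (fun r => (hq1 r).2.1.continuous) hqm).comp measurable_swap
  · rw [ae_iff]
    refine measure_mono_null (fun r hr => ?_) hN0
    by_contra h
    exact hr (by simp only [hq, if_neg h])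

/-- The primitive in time. -/
def prim (f : ℝ → Vec d → ℝ) (t : ℝ) (x : Vec d) : ℝ := ∫ r in (0 : ℝ)..t, f r x

/-- The partial derivative in direction `a` of a time-dependent function. -/
def pderiv (a : Fin d) (f : ℝ → Vec d → ℝ) (t : ℝ) (x : Vec d) : ℝ := fderiv ℝ (f t) x (unitVec a)

section Primitive

variable {f : ℝ → Vec d → ℝ} {M : ℝ}

theorem intervalIntegrable_of_measurable (hf : Measurable (Function.uncurry f))
    (hM : ∀ r x, |f r x| ≤ M) (x : Vec d) (s t : ℝ) :
    IntervalIntegrable (fun r => f r x) volume s t :=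
  intervalIntegrable_const.mono_fun' (g := fun _ => M)
    (hf.comp measurable_prodMk_right).aestronglyMeasurable
    (Eventually.of_forall fun r => hM r x)

theorem abs_prim_sub_le (hf : Measurable (Function.uncurry f)) (hM : ∀ r x, |f r x| ≤ M)
    (x : Vec d) (s t : ℝ) : |prim f t x - prim f s x| ≤ M * |t - s| := by
  rw [prim, prim, intervalIntegral.integral_interval_sub_left
    (intervalIntegrable_of_measurable hf hM x _ _) (intervalIntegrable_of_measurable hf hM x _ _)]
  exact intervalIntegral.norm_integral_le_of_norm_le_const (f := fun r => f r x) (C := M)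
    fun r _ => hM r x

theorem abs_prim_le (hf : Measurable (Function.uncurry f)) (hM : ∀ r x, |f r x| ≤ M)
    (t : ℝ) (x : Vec d) : |prim f t x| ≤ M * |t| := by
  have := abs_prim_sub_le hf hM x 0 t
  simpa [prim] using this

theorem measurable_prim (hf : Measurable (Function.uncurry f)) (hM : ∀ r x, |f r x| ≤ M) :
    Measurable (Function.uncurry (prim f)) := by
  refine measurable_uncurry_of_continuous_of_measurable (fun x => ?_) fun t => ?_
  · exact intervalIntegral.continuous_primitive
      (fun a b => intervalIntegrable_of_measurable hf hM x a b) 0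
  · have h (I : Set ℝ) : Measurable fun x => ∫ r in I, f r x :=
      (StronglyMeasurable.integral_prod_left (μ := volume.restrict I)
        hf.stronglyMeasurable).measurable
    unfold prim
    simp only [intervalIntegral]
    exact (h _).sub (h _)

theorem IsRate.measurable_pderiv (hf : IsRate f M) (a : Fin d) :
    Measurable (Function.uncurry (pderiv a f)) := by
  refine measurable_of_tendsto_metrizable
    (f := fun (n : ℕ) (z : ℝ × Vec d) =>
      ((n : ℝ) + 1) * (f z.1 (z.2 + (1 / ((n : ℝ) + 1)) • unitVec a) - f z.1 z.2))
    (fun n => ?_) (tendsto_pi_nhds.2 fun z => ?_)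
  · have h1 : Measurable fun z : ℝ × Vec d => f z.1 (z.2 + (1 / ((n : ℝ) + 1)) • unitVec a) :=
      hf.measurable.comp (measurable_fst.prodMk (measurable_snd.add_const _))
    exact (h1.sub hf.measurable).const_mul _
  · have h1 := ((hf.contDiff z.1).differentiable one_ne_zero z.2).hasFDerivAt.hasLineDerivAt
      (unitVec a)
    have h2 := (hasDerivAt_iff_tendsto_slope_zero.1 h1)
    have h3 : Tendsto (fun n : ℕ => 1 / ((n : ℝ) + 1)) atTop (𝓝[≠] 0) :=
      tendsto_nhdsWithin_iff.2 ⟨tendsto_one_div_add_atTop_nhds_zero_nat,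
        Eventually.of_forall fun n => by
          have : (0 : ℝ) < 1 / ((n : ℝ) + 1) := by positivity
          exact this.ne'⟩
    refine (h2.comp h3).congr fun n => ?_
    simp

theorem IsRate.abs_pderiv_le (hf : IsRate f M) (a : Fin d) (r : ℝ) (x : Vec d) :
    |pderiv a f r x| ≤ M := by
  have h7 := (fderiv ℝ (f r) x).le_opNorm (unitVec a)
  rw [norm_unitVec, mul_one] at h7
  exact h7.trans (hf.bound_fderiv r x)

theorem clm_eq_sum (L : Vec d →L[ℝ] ℝ) :
    L = ∑ a, L (unitVec a) • (EuclideanSpace.proj a : Vec d →L[ℝ] ℝ) := by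
  ext z
  have hw : z = ∑ j, z j • unitVec j := by
    ext a; simp [unitVec, Pi.single_apply]
  conv_lhs => rw [hw]
  simp [mul_comm]

theorem IsRate.measurable_fderiv (hf : IsRate f M) (x : Vec d) :
    Measurable fun r => fderiv ℝ (f r) x := by
  have e : (fun r => fderiv ℝ (f r) x)
      = fun r => ∑ a, pderiv a f r x • (EuclideanSpace.proj a : Vec d →L[ℝ] ℝ) :=
    funext fun r => clm_eq_sum _
  rw [e]
  exact Finset.measurable_fun_sum _ fun a _ =>
    ((hf.measurable_pderiv a).comp measurable_prodMk_right).smul_const _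

theorem IsRate.hasFDerivAt_prim (hf : IsRate f M) (t : ℝ) (x : Vec d) :
    HasFDerivAt (prim f t) (∫ r in (0 : ℝ)..t, fderiv ℝ (f r) x) x := by
  refine intervalIntegral.hasFDerivAt_integral_of_dominated_of_fderiv_le
    (F := fun x r => f r x) (F' := fun x r => fderiv ℝ (f r) x) (bound := fun _ => M)
    (s := Metric.ball x 1) (Metric.ball_mem_nhds x one_pos) ?_ ?_ ?_ ?_
    intervalIntegrable_const ?_
  · exact Eventually.of_forall fun y =>
      (hf.measurable.comp measurable_prodMk_right).aestronglyMeasurable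
  · exact intervalIntegrable_of_measurable hf.measurable hf.bound x 0 t
  · exact (hf.measurable_fderiv x).aestronglyMeasurable
  · exact Eventually.of_forall fun r _ y _ => hf.bound_fderiv r y
  · exact Eventually.of_forall fun r _ y _ =>
      ((hf.contDiff r).differentiable one_ne_zero y).hasFDerivAt

theorem IsRate.contDiff_prim (hf : IsRate f M) (t : ℝ) : ContDiff ℝ 1 (prim f t) := by
  rw [contDiff_one_iff_fderiv]
  refine ⟨fun x => (hf.hasFDerivAt_prim t x).differentiableAt, ?_⟩
  rw [show fderiv ℝ (prim f t) = fun x => ∫ r in (0 : ℝ)..t, fderiv ℝ (f r) x from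
    funext fun x => (hf.hasFDerivAt_prim t x).fderiv]
  refine intervalIntegral.continuous_of_dominated_interval (bound := fun _ => M) (fun x => ?_)
    (fun x => Eventually.of_forall fun r _ => hf.bound_fderiv r x) intervalIntegrable_const
    (Eventually.of_forall fun r _ => (hf.contDiff r).continuous_fderiv one_ne_zero)
  exact (hf.measurable_fderiv x).aestronglyMeasurable

theorem IsRate.pderiv_prim (hf : IsRate f M) (a : Fin d) (t : ℝ) (x : Vec d) :
    pderiv a (prim f) t x = prim (pderiv a f) t x := by
  rw [pderiv, (hf.hasFDerivAt_prim t x).fderiv, prim,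
    ContinuousLinearMap.intervalIntegral_apply]
  · rfl
  · exact intervalIntegrable_const.mono_fun' (g := fun _ => M)
      (hf.measurable_fderiv x).aestronglyMeasurable
      (Eventually.of_forall fun r => hf.bound_fderiv r x)

end Primitive

end Time

/-! ### Evolution of the phase energy -/

section PhaseEnergy

variable {d : ℕ}

theorem hasDerivAt_doubleWell (r : ℝ) : HasDerivAt doubleWell (-2 * r * (1 - r ^ 2)) r := by
  have h := (((hasDerivAt_pow 2 r).const_sub 1).fun_pow 2).div_const 2
  refine h.congr_deriv ?_
  norm_num
  ring

theorem deriv_doubleWell (r : ℝ) : deriv doubleWell r = -2 * r * (1 - r ^ 2) :=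
  (hasDerivAt_doubleWell r).deriv

/-- The rate of change of the energy density along a variation `χ` of `φ`. -/
def energyRate (ε : ℝ) (φ χ : Vec d → ℝ) (x : Vec d) : ℝ :=
  ε * ∑ a, fderiv ℝ φ x (unitVec a) * fderiv ℝ χ x (unitVec a)
    + deriv doubleWell (φ x) * χ x / ε

variable {q : ℝ → Vec d → ℝ} {M : ℝ} {φ₀ : Vec d → ℝ}

/-- The path that starts in `φ₀` with velocity `q`. -/
def path (φ₀ : Vec d → ℝ) (q : ℝ → Vec d → ℝ) (t : ℝ) (x : Vec d) : ℝ := φ₀ x + prim q t x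

theorem fderiv_path (hq : IsRate q M) (h₀ : ContDiff ℝ 1 φ₀) (t : ℝ) (x : Vec d) (a : Fin d) :
    fderiv ℝ (path φ₀ q t) x (unitVec a)
      = fderiv ℝ φ₀ x (unitVec a) + prim (pderiv a q) t x := by
  rw [← hq.pderiv_prim, pderiv]
  have := fderiv_fun_add (h₀.differentiable one_ne_zero x)
    ((hq.contDiff_prim t).differentiable one_ne_zero x)
  unfold path
  rw [this]; rfl

theorem contDiff_path (hq : IsRate q M) (h₀ : ContDiff ℝ 1 φ₀) (t : ℝ) :
    ContDiff ℝ 1 (path φ₀ q t) := h₀.add (hq.contDiff_prim t)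

/-- The chain rule in integral form. It holds at every point, since the phase field and its
gradient are primitives in time. -/
theorem energyDensity_path (hq : IsRate q M) (h₀ : ContDiff ℝ 1 φ₀) {ε t : ℝ} (ht : 0 ≤ t)
    (x : Vec d) : energyDensity ε (path φ₀ q t) x
      = energyDensity ε φ₀ x + ∫ r in (0 : ℝ)..t, energyRate ε (path φ₀ q r) (q r) x := by
  have ia (a : Fin d) (s t : ℝ) : IntervalIntegrable (fun r => pderiv a q r x) volume s t :=
    intervalIntegrable_of_measurable (hq.measurable_pderiv a) (hq.abs_pderiv_le a) x s t
  have ca (a : Fin d) : Continuous fun r => fderiv ℝ (path φ₀ q r) x (unitVec a) := by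
    simp only [fderiv_path hq h₀]
    exact continuous_const.add (intervalIntegral.continuous_primitive (ia a) 0)
  have iq (s t : ℝ) : IntervalIntegrable (fun r => q r x) volume s t :=
    intervalIntegrable_of_measurable hq.measurable hq.bound x s t
  have cφ : Continuous fun r => path φ₀ q r x :=
    continuous_const.add (intervalIntegral.continuous_primitive iq 0)
  have h1 (a : Fin d) := sq_eq_add_integral (f := fun r => fderiv ℝ (path φ₀ q r) x (unitVec a)) ht
    (ia a 0 t) (fun s _ => fderiv_path hq h₀ s x a)
  have h2 := sq_eq_add_integral (f := fun r => path φ₀ q r x) (f₀ := φ₀ x)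
    (g := fun r => q r x) ht (iq 0 t) (fun s _ => rfl)
  have iW (t : ℝ) : IntervalIntegrable (fun r => -(2 * path φ₀ q r x * q r x)) volume 0 t :=
    ((iq 0 t).continuousOn_mul (continuous_const.mul cφ).continuousOn).neg
  have h3 := sq_eq_add_integral (f := fun r => 1 - path φ₀ q r x ^ 2) (f₀ := 1 - φ₀ x ^ 2)
    (g := fun r => -(2 * path φ₀ q r x * q r x)) ht (iW t) (fun s hs => by
      have h4 := sq_eq_add_integral (f := fun r => path φ₀ q r x) (f₀ := φ₀ x)
        (g := fun r => q r x) hs.1 (iq 0 s) (fun s _ => rfl)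
      rw [h4, intervalIntegral.integral_neg]; ring)
  have e : (fun r => energyRate ε (path φ₀ q r) (q r) x) = fun r =>
      ε / 2 * ∑ a, 2 * fderiv ℝ (path φ₀ q r) x (unitVec a) * pderiv a q r x
        + 1 / (2 * ε) * (2 * (1 - path φ₀ q r x ^ 2) * -(2 * path φ₀ q r x * q r x)) := by
    funext r
    rw [energyRate, deriv_doubleWell]
    simp only [pderiv, mul_assoc, ← Finset.mul_sum]
    field_simp
  have i1 (a : Fin d) : IntervalIntegrable
      (fun r => 2 * fderiv ℝ (path φ₀ q r) x (unitVec a) * pderiv a q r x) volume 0 t :=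
    (ia a 0 t).continuousOn_mul (continuous_const.mul (ca a)).continuousOn
  have i2 : IntervalIntegrable
      (fun r => 2 * (1 - path φ₀ q r x ^ 2) * -(2 * path φ₀ q r x * q r x)) volume 0 t :=
    (iW t).continuousOn_mul (by fun_prop)
  have i3 : IntervalIntegrable
      (fun r => ∑ a, 2 * fderiv ℝ (path φ₀ q r) x (unitVec a) * pderiv a q r x) volume 0 t := by
    have := IntervalIntegrable.sum Finset.univ fun a _ => i1 a
    exact this.congr fun r _ => by simp
  rw [e, intervalIntegral.integral_add (i3.const_mul _) (i2.const_mul _),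
    intervalIntegral.integral_const_mul, intervalIntegral.integral_const_mul,
    intervalIntegral.integral_finsetSum fun a _ => i1 a, energyDensity, energyDensity, doubleWell,
    doubleWell, h3]
  simp only [h1, Finset.sum_add_distrib]
  field_simp
  ring

/-- The energy identity for a path of phase fields. -/
theorem integral_energyDensity_path (hq : IsRate q M) (h₀ : ContDiff ℝ 1 φ₀) (hp : IsTorusFn φ₀)
    {ε t : ℝ} (ht : 0 ≤ t) :
    IntervalIntegrable (fun r => ∫ x, energyRate ε (path φ₀ q r) (q r) x ∂(cell d)) volume 0 t ∧
    ∫ x, energyDensity ε (path φ₀ q t) x ∂(cell d) = ∫ x, energyDensity ε φ₀ x ∂(cell d)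
      + ∫ r in (0 : ℝ)..t, ∫ x, energyRate ε (path φ₀ q r) (q r) x ∂(cell d) := by
  obtain ⟨B, hB, hB'⟩ := hp.exists_bound h₀.continuous
  obtain ⟨B₁, hB₁, hB₁'⟩ := (isTorusFn_fderiv hp).exists_bound (h₀.continuous_fderiv one_ne_zero)
  have hM : 0 ≤ M := (abs_nonneg _).trans (hq.bound 0 0)
  have mφ : Measurable fun z : ℝ × Vec d => path φ₀ q z.1 z.2 :=
    (h₀.continuous.measurable.comp measurable_snd).add (measurable_prim hq.measurable hq.bound)
  have ma (a : Fin d) : Measurable fun z : ℝ × Vec d => fderiv ℝ (path φ₀ q z.1) z.2 (unitVec a) := by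
    simp only [fderiv_path hq h₀]
    refine Measurable.add ?_ (measurable_prim (hq.measurable_pderiv a) (hq.abs_pderiv_le a))
    exact ((h₀.continuous_fderiv one_ne_zero).clm_apply continuous_const).measurable.comp
      measurable_snd
  have mR : Measurable fun z : ℝ × Vec d => energyRate ε (path φ₀ q z.1) (q z.1) z.2 := by
    unfold energyRate
    simp only [deriv_doubleWell]
    have hm := hq.measurable
    have m1 := Finset.measurable_fun_sum (Finset.univ : Finset (Fin d)) fun a _ =>
      (ma a).mul (hq.measurable_pderiv a)
    exact (m1.const_mul ε).add (((((mφ.const_mul _).mul ((mφ.pow_const 2).const_sub 1))).mul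
      hm).div_const ε)
  have hbound : ∀ r ∈ Ioc 0 t, ∀ x, ‖energyRate ε (path φ₀ q r) (q r) x‖
      ≤ |ε| * (d * ((B₁ + M * t) * M)) + 2 * (B + M * t) * (1 + (B + M * t) ^ 2) * M / |ε| := by
    intro r hr x
    have b0 : |path φ₀ q r x| ≤ B + M * t := by
      refine (abs_add_le _ _).trans (add_le_add (hB' x) ?_)
      refine (abs_prim_le hq.measurable hq.bound r x).trans ?_
      rw [abs_of_pos hr.1]
      exact mul_le_mul_of_nonneg_left hr.2 hM
    have b1 (a : Fin d) : |fderiv ℝ (path φ₀ q r) x (unitVec a)| ≤ B₁ + M * t := by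
      rw [fderiv_path hq h₀]
      refine (abs_add_le _ _).trans (add_le_add ?_ ?_)
      · have h7 := (fderiv ℝ φ₀ x).le_opNorm (unitVec a)
        rw [norm_unitVec, mul_one] at h7
        exact h7.trans (hB₁' x)
      · refine (abs_prim_le (hq.measurable_pderiv a) (hq.abs_pderiv_le a) r x).trans ?_
        rw [abs_of_pos hr.1]
        exact mul_le_mul_of_nonneg_left hr.2 hM
    rw [Real.norm_eq_abs, energyRate, deriv_doubleWell]
    refine (abs_add_le _ _).trans (add_le_add ?_ ?_)
    · rw [abs_mul]
      refine mul_le_mul_of_nonneg_left ((Finset.abs_sum_le_sum_abs _ _).trans ?_) (abs_nonneg ε)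
      calc ∑ a, |fderiv ℝ (path φ₀ q r) x (unitVec a) * fderiv ℝ (q r) x (unitVec a)|
          ≤ ∑ _a : Fin d, (B₁ + M * t) * M := by
            refine Finset.sum_le_sum fun a _ => ?_
            rw [abs_mul]
            exact mul_le_mul (b1 a) (hq.abs_pderiv_le a r x) (abs_nonneg _) (by positivity)
        _ = _ := by simp
    · have b2 : |1 - path φ₀ q r x ^ 2| ≤ 1 + (B + M * t) ^ 2 := by
        refine (abs_sub _ _).trans ?_
        rw [abs_one, abs_pow]
        gcongr
      rw [abs_div, abs_mul, abs_mul, abs_mul]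
      norm_num
      gcongr
      exact hq.bound r x
  have hint : Integrable (fun z : Vec d × ℝ => energyRate ε (path φ₀ q z.2) (q z.2) z.1)
      ((cell d).prod (volume.restrict (Ioc 0 t))) := by
    refine Integrable.of_bound (mR.comp measurable_swap).aestronglyMeasurable
      (|ε| * (d * ((B₁ + M * t) * M)) + 2 * (B + M * t) * (1 + (B + M * t) ^ 2) * M / |ε|) ?_
    rw [cell, Measure.prod_restrict]
    filter_upwards [ae_restrict_mem ((measurableSet_unitCell d).prod measurableSet_Ioc)] with z hz
    exact hbound z.2 hz.2 z.1
  refine ⟨(intervalIntegrable_iff_integrableOn_Ioc_of_le ht).2 hint.integral_prod_right, ?_⟩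
  have hD : Continuous fun x => energyDensity ε φ₀ x := by
    have := h₀.continuous_fderiv one_ne_zero
    have h2 : Continuous φ₀ := h₀.continuous
    unfold energyDensity doubleWell
    fun_prop
  simp only [energyDensity_path hq h₀ ht]
  rw [integral_add hD.integrable_cell]
  · congr 1
    simp only [intervalIntegral.integral_of_le ht]
    exact integral_integral_swap hint
  · simp only [intervalIntegral.integral_of_le ht]
    exact hint.integral_prod_left

end PhaseEnergy

/-! ### Integral identities for the transport terms -/

section Transport

variable {d : ℕ}

theorem fderiv_apply_eq_sum {φ : Vec d → ℝ} (x z : Vec d) :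
    fderiv ℝ φ x z = ∑ a, z a * fderiv ℝ φ x (unitVec a) := by
  conv_lhs => rw [clm_eq_sum (fderiv ℝ φ x)]
  simp [mul_comm]

/-- Transport by a solenoidal field preserves integrals. -/
theorem IsSolenoidalC1.integral_transport_eq_zero {v : Vec d → Vec d} (hv : IsSolenoidalC1 v)
    {g : Vec d → ℝ} (hg : ContDiff ℝ 1 g) (hp : IsTorusFn g) :
    ∫ x, fderiv ℝ g x (v x) ∂(cell d) = 0 := by
  have cg (a : Fin d) : Continuous fun x => fderiv ℝ g x (unitVec a) :=
    (hg.continuous_fderiv one_ne_zero).clm_apply continuous_const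
  simp_rw [fun x => fderiv_apply_eq_sum (φ := g) x (v x)]
  rw [integral_cell_sum _ fun a => (continuous_component hv.contDiff.continuous a).fun_mul (cg a)]
  have h1 (a : Fin d) : ∫ x, v x a * fderiv ℝ g x (unitVec a) ∂(cell d)
      = -∫ x, fderiv ℝ v x (unitVec a) a * g x ∂(cell d) := by
    have e3 := IsTorusFn.integral_mul_fderiv (hv.periodic.comp fun y => y a) hp
      (contDiff_component hv.contDiff a) hg (unitVec a)
    simpa only [fderiv_component (hv.contDiff.differentiable one_ne_zero _)] using e3
  simp only [h1, Finset.sum_neg_distrib]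
  rw [← integral_cell_sum _ fun a =>
    (continuous_fderiv_entry hv.contDiff _ _).fun_mul hg.continuous]
  simp [← Finset.sum_mul, hv.div_eq_zero]

theorem laplacian_eq_sum {φ : Vec d → ℝ} (hφ : ContDiff ℝ 2 φ) (x : Vec d) :
    Laplacian.laplacian φ x
      = ∑ a, fderiv ℝ (fun y => fderiv ℝ φ y (unitVec a)) x (unitVec a) := by
  have h1 : DifferentiableAt ℝ (fderiv ℝ φ) x :=
    (hφ.fderiv_right (m := 1) (by norm_num)).differentiable one_ne_zero x
  have h2 := congrFun (InnerProductSpace.laplacian_eq_iteratedFDeriv_orthonormalBasis φ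
    (EuclideanSpace.basisFun (Fin d) ℝ)) x
  refine h2.trans (Finset.sum_congr rfl fun a _ => ?_)
  rw [iteratedFDeriv_two_apply, fderiv_clm_apply h1 (differentiableAt_const _)]
  simp [unitVec]

theorem contDiff_fderiv_apply {φ : Vec d → ℝ} (hφ : ContDiff ℝ 2 φ) (e : Vec d) :
    ContDiff ℝ 1 fun y => fderiv ℝ φ y e :=
  (hφ.fderiv_right (m := 1) (by norm_num)).clm_apply contDiff_const

theorem integral_laplacian_mul {φ χ : Vec d → ℝ} (hφ : ContDiff ℝ 2 φ) (hφp : IsTorusFn φ)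
    (hχ : ContDiff ℝ 1 χ) (hχp : IsTorusFn χ) :
    ∫ x, Laplacian.laplacian φ x * χ x ∂(cell d)
      = -∫ x, ∑ a, fderiv ℝ φ x (unitVec a) * fderiv ℝ χ x (unitVec a) ∂(cell d) := by
  have c1 (a : Fin d) := contDiff_fderiv_apply hφ (unitVec a : Vec d)
  have c2 (a : Fin d) : Continuous fun x =>
      fderiv ℝ (fun y => fderiv ℝ φ y (unitVec a)) x (unitVec a) :=
    ((c1 a).continuous_fderiv one_ne_zero).clm_apply continuous_const
  have c3 (a : Fin d) : Continuous fun x => fderiv ℝ χ x (unitVec a) :=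
    (hχ.continuous_fderiv one_ne_zero).clm_apply continuous_const
  simp only [laplacian_eq_sum hφ, Finset.sum_mul]
  rw [integral_cell_sum _ fun a => (c2 a).fun_mul hχ.continuous,
    integral_cell_sum _ fun a => (c1 a).continuous.fun_mul (c3 a), ← Finset.sum_neg_distrib]
  refine Finset.sum_congr rfl fun a _ => ?_
  rw [IsTorusFn.integral_mul_fderiv ((isTorusFn_fderiv hφp).comp fun L => L (unitVec a)) hχp (c1 a)
    hχ (unitVec a), neg_neg]

/-- The work of the transport term against the Laplacian is the work of the tensor `∇φ ⊗ ∇φ`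
against the velocity gradient. -/
theorem IsSolenoidalC1.integral_laplacian_mul_transport {v : Vec d → Vec d}
    (hv : IsSolenoidalC1 v) {φ : Vec d → ℝ} (hφ : ContDiff ℝ 2 φ) (hp : IsTorusFn φ) :
    ∫ x, Laplacian.laplacian φ x * fderiv ℝ φ x (v x) ∂(cell d)
      = -∫ x, ∑ a, ∑ b, fderiv ℝ φ x (unitVec a) * fderiv ℝ φ x (unitVec b)
        * fderiv ℝ v x (unitVec a) b ∂(cell d) := by
  have hφ1 : ContDiff ℝ 1 φ := hφ.of_le one_le_two
  have c1 (a : Fin d) := contDiff_fderiv_apply hφ (unitVec a : Vec d)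
  have hS : ContDiff ℝ 1 fun x => fderiv ℝ φ x (v x) :=
    (hφ.fderiv_right (m := 1) (by norm_num)).clm_apply hv.contDiff
  have pS : IsTorusFn fun x => fderiv ℝ φ x (v x) :=
    (isTorusFn_fderiv hp).comp₂ hv.periodic fun L z => L z
  rw [integral_laplacian_mul hφ hp hS pS]
  congr 1
  -- the second derivatives of `φ` enter through the gradient of `|∇φ|² / 2`
  set g : Vec d → ℝ := fun x => 1 / 2 * ∑ a, fderiv ℝ φ x (unitVec a) ^ 2 with hg
  have hgc : ContDiff ℝ 1 g :=
    contDiff_const.mul (ContDiff.sum fun a _ => (c1 a).pow 2)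
  have hgp : IsTorusFn g :=
    (isTorusFn_fderiv hp).comp fun L => 1 / 2 * ∑ a, L (unitVec a) ^ 2
  have h0 := hv.integral_transport_eq_zero hgc hgp
  have hgd (x z : Vec d) : fderiv ℝ g x z = ∑ a, fderiv ℝ φ x (unitVec a)
      * fderiv ℝ (fun y => fderiv ℝ φ y (unitVec a)) x z := by
    have hd (a : Fin d) : HasFDerivAt (fun y => fderiv ℝ φ y (unitVec a) ^ 2)
        (((2 : ℕ) * fderiv ℝ φ x (unitVec a) ^ (2 - 1)) • fderiv ℝ (fun y => fderiv ℝ φ y (unitVec a)) x)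
        x := by
      exact (hasDerivAt_pow 2 _).comp_hasFDerivAt x
        ((c1 a).differentiable one_ne_zero x).hasFDerivAt
    have h2 := (HasFDerivAt.fun_sum (u := Finset.univ) fun a _ => hd a).const_mul (1 / 2)
    rw [hg, h2.fderiv]
    simp only [_root_.smul_apply, _root_.sum_apply, smul_eq_mul,
      Finset.mul_sum]
    refine Finset.sum_congr rfl fun a _ => ?_
    norm_num
    ring
  have hSd (x : Vec d) (a : Fin d) : fderiv ℝ (fun y => fderiv ℝ φ y (v y)) x (unitVec a)
      = fderiv ℝ (fun y => fderiv ℝ φ y (unitVec a)) x (v x)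
        + ∑ b, fderiv ℝ φ x (unitVec b) * fderiv ℝ v x (unitVec a) b := by
    have h1 : DifferentiableAt ℝ (fderiv ℝ φ) x :=
      (hφ.fderiv_right (m := 1) (by norm_num)).differentiable one_ne_zero x
    have hs : IsSymmSndFDerivAt ℝ φ x := hφ.contDiffAt.isSymmSndFDerivAt (by simp)
    rw [fderiv_clm_apply h1 (hv.contDiff.differentiable one_ne_zero x),
      fderiv_clm_apply h1 (differentiableAt_const _)]
    simp only [_root_.add_apply, ContinuousLinearMap.comp_apply,
      ContinuousLinearMap.flip_apply, fderiv_fun_const, Pi.zero_apply, _root_.zero_apply,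
      map_zero, zero_add]
    rw [fderiv_apply_eq_sum x (fderiv ℝ v x (unitVec a)), hs (unitVec a) (v x), add_comm]
    simp only [mul_comm]
  have cA : Continuous fun x => fderiv ℝ g x (v x) :=
    (hgc.continuous_fderiv one_ne_zero).clm_apply hv.contDiff.continuous
  have cB : Continuous fun x => ∑ a, ∑ b, fderiv ℝ φ x (unitVec a) * fderiv ℝ φ x (unitVec b)
        * fderiv ℝ v x (unitVec a) b :=
    continuous_finsetSum _ fun a _ => continuous_finsetSum _ fun b _ =>
      ((c1 a).continuous.mul (c1 b).continuous).mul (continuous_fderiv_entry hv.contDiff _ _)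
  have e : (fun x => ∑ a, fderiv ℝ φ x (unitVec a)
      * fderiv ℝ (fun y => fderiv ℝ φ y (v y)) x (unitVec a))
      = fun x => fderiv ℝ g x (v x) + ∑ a, ∑ b, fderiv ℝ φ x (unitVec a)
        * fderiv ℝ φ x (unitVec b) * fderiv ℝ v x (unitVec a) b := by
    funext x
    simp only [hSd, hgd, mul_add, Finset.sum_add_distrib, Finset.mul_sum, mul_assoc]
  rw [e, integral_cell_add cA cB, h0, zero_add]

/-- The dissipation identity for the advected Allen-Cahn equation. -/
theorem IsSolenoidalC1.integral_energyRate_le {v : Vec d → Vec d} (hv : IsSolenoidalC1 v)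
    {φ χ : Vec d → ℝ} (hφ : ContDiff ℝ 2 φ) (hp : IsTorusFn φ) (hχ : ContDiff ℝ 1 χ)
    (hχp : IsTorusFn χ) {ε : ℝ} (hε : 0 < ε)
    (heq : ∀ x, χ x + fderiv ℝ φ x (v x)
      = Laplacian.laplacian φ x - deriv doubleWell (φ x) / ε ^ 2) :
    ∫ x, energyRate ε φ χ x ∂(cell d)
      ≤ -(ε * ∫ x, ∑ a, ∑ b, fderiv ℝ φ x (unitVec a) * fderiv ℝ φ x (unitVec b)
        * fderiv ℝ v x (unitVec a) b ∂(cell d)) := by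
  have hφ1 : ContDiff ℝ 1 φ := hφ.of_le one_le_two
  have c1 (a : Fin d) := contDiff_fderiv_apply hφ (unitVec a : Vec d)
  have cS : Continuous fun x => fderiv ℝ φ x (v x) :=
    (hφ1.continuous_fderiv one_ne_zero).clm_apply hv.contDiff.continuous
  have cχ : Continuous χ := hχ.continuous
  have cφ : Continuous φ := hφ1.continuous
  have cL : Continuous fun x => Laplacian.laplacian φ x := by
    simp only [laplacian_eq_sum hφ]
    exact continuous_finsetSum _ fun a _ =>
      ((c1 a).continuous_fderiv one_ne_zero).clm_apply continuous_const
  have cW : Continuous fun x => deriv doubleWell (φ x) := by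
    simp only [deriv_doubleWell]; fun_prop
  have cP : Continuous fun x => ∑ a, fderiv ℝ φ x (unitVec a) * fderiv ℝ χ x (unitVec a) :=
    continuous_finsetSum _ fun a _ => (c1 a).continuous.mul
      ((hχ.continuous_fderiv one_ne_zero).clm_apply continuous_const)
  have hW : ∫ x, deriv doubleWell (φ x) * fderiv ℝ φ x (v x) ∂(cell d) = 0 := by
    have hWc : ContDiff ℝ 1 fun x => doubleWell (φ x) := by unfold doubleWell; fun_prop
    rw [← hv.integral_transport_eq_zero hWc (hp.comp doubleWell)]
    refine integral_congr_ae (Eventually.of_forall fun x => ?_)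
    have h1 := (hasDerivAt_doubleWell (φ x)).comp_hasFDerivAt x
      (hφ1.differentiable one_ne_zero x).hasFDerivAt
    have h2 : fderiv ℝ (fun y => doubleWell (φ y)) x = _ := h1.fderiv
    simp only [h2, deriv_doubleWell, _root_.smul_apply, smul_eq_mul]
  have h1 : ∫ x, energyRate ε φ χ x ∂(cell d)
      = -∫ x, ε * ((χ x + fderiv ℝ φ x (v x)) * χ x) ∂(cell d) := by
    simp only [heq, energyRate]
    have e : ∀ x, ε * ((Laplacian.laplacian φ x - deriv doubleWell (φ x) / ε ^ 2) * χ x)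
        = ε * (Laplacian.laplacian φ x * χ x) - deriv doubleWell (φ x) * χ x / ε := by
      intro x; field_simp
    simp only [e]
    rw [integral_cell_add (by fun_prop) (by fun_prop), integral_cell_sub (by fun_prop) (by fun_prop),
      integral_const_mul, integral_const_mul, integral_laplacian_mul hφ hp hχ hχp]
    ring
  have h2 : ∫ x, (χ x + fderiv ℝ φ x (v x)) * fderiv ℝ φ x (v x) ∂(cell d)
      = -∫ x, ∑ a, ∑ b, fderiv ℝ φ x (unitVec a) * fderiv ℝ φ x (unitVec b)
        * fderiv ℝ v x (unitVec a) b ∂(cell d) := by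
    simp only [heq]
    have e : ∀ x, (Laplacian.laplacian φ x - deriv doubleWell (φ x) / ε ^ 2) * fderiv ℝ φ x (v x)
        = Laplacian.laplacian φ x * fderiv ℝ φ x (v x)
          - (ε ^ 2)⁻¹ * (deriv doubleWell (φ x) * fderiv ℝ φ x (v x)) := by
      intro x; field_simp
    simp only [e]
    rw [integral_cell_sub (by fun_prop) (by fun_prop), integral_const_mul, hW, mul_zero, sub_zero,
      hv.integral_laplacian_mul_transport hφ hp]
  have h3 : 0 ≤ ∫ x, (χ x + fderiv ℝ φ x (v x)) * χ x ∂(cell d)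
      + ∫ x, (χ x + fderiv ℝ φ x (v x)) * fderiv ℝ φ x (v x) ∂(cell d) := by
    rw [← integral_cell_add (by fun_prop) (by fun_prop)]
    refine integral_nonneg fun x => ?_
    change 0 ≤ _
    rw [← mul_add]
    exact mul_self_nonneg _
  rw [h1, integral_const_mul]
  rw [h2] at h3
  nlinarith

end Transport

/-! ### The power balance -/

section Power

variable {d : ℕ} {p ν₀ : ℝ} {τp τm τ : SymMat d → SymMat d}

theorem dot_eq_sum (A B : Matrix (Fin d) (Fin d) ℝ) : dot A B = ∑ a, ∑ b, A a b * B b a := by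
  simp [dot, Matrix.trace, Matrix.mul_apply]

theorem IsStressLaw.continuous (h : IsStressLaw p ν₀ τ) : Continuous τ := by
  have hsub (s s' : SymMat d) : (s.1 - s'.1).IsSymm := s.2.sub s'.2
  have hdist (s₀ : SymMat d) : Tendsto (fun s : SymMat d => matNorm (s.1 - s₀.1)) (𝓝 s₀) (𝓝 0) := by
    have h1 : Continuous fun s : SymMat d => (⟨s.1 - s₀.1, hsub s s₀⟩ : SymMat d) :=
      (continuous_subtype_val.sub continuous_const).subtype_mk _
    have h2 : Tendsto (fun s : SymMat d => matNorm (s.1 - s₀.1)) (𝓝 s₀)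
        (𝓝 (matNorm (s₀.1 - s₀.1))) := (continuous_matNorm.comp h1).tendsto s₀
    have h3 : matNorm (s₀.1 - s₀.1) = 0 := by simp [matNorm, dot]
    rwa [h3] at h2
  rw [continuous_iff_continuousAt]
  intro s₀
  obtain ⟨r, hr, K, hK⟩ := h.locallyLipschitz s₀
  have h0 : matNorm (s₀.1 - s₀.1) < r := by simpa [matNorm, dot] using hr
  rw [ContinuousAt, tendsto_subtype_rng]
  refine tendsto_pi_nhds.2 fun a => tendsto_pi_nhds.2 fun b => ?_
  rw [tendsto_iff_dist_tendsto_zero]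
  refine squeeze_zero' (Eventually.of_forall fun s => dist_nonneg) ?_
    (by simpa using (hdist s₀).const_mul K)
  filter_upwards [(hdist s₀).eventually (gt_mem_nhds hr)] with s hs
  refine le_trans ?_ (hK s s₀ hs h0)
  exact abs_entry_le_matNorm ⟨_, hsub (τ s) (τ s₀)⟩ a b

theorem continuous_mixedStress (hp : IsStressLaw p ν₀ τp) (hm : IsStressLaw p ν₀ τm)
    {α : Type*} [TopologicalSpace α] {φ : α → ℝ} (hφ : Continuous φ) {e : α → SymMat d}
    (he : Continuous e) : Continuous fun x => mixedStress τp τm (φ x) (e x) := by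
  have h1 : Continuous fun x => (τp (e x)).1 := continuous_subtype_val.comp (hp.continuous.comp he)
  have h2 : Continuous fun x => (τm (e x)).1 := continuous_subtype_val.comp (hm.continuous.comp he)
  unfold mixedStress
  fun_prop

/-- The dissipation of the mixed stress is at least that of the pure phases. -/
theorem le_dot_mixedStress (hp : IsStressLaw p ν₀ τp) (hm : IsStressLaw p ν₀ τm) {φ : ℝ}
    (hφ : |φ| ≤ 1) (e : SymMat d) :
    ν₀ * matNorm e.1 ^ p ≤ dot (mixedStress τp τm φ e) e.1 := by
  have h1 : dot (mixedStress τp τm φ e) e.1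
      = (1 + φ) / 2 * dot (τp e).1 e.1 + (1 - φ) / 2 * dot (τm e).1 e.1 := by
    simp [dot, mixedStress, add_mul]
  have h2 := abs_le.1 hφ
  rw [h1]
  nlinarith [mul_le_mul_of_nonneg_left (hp.coercive e) (by linarith : 0 ≤ (1 + φ) / 2),
    mul_le_mul_of_nonneg_left (hm.coercive e) (by linarith : 0 ≤ (1 - φ) / 2)]

theorem continuous_dot {α : Type*} [TopologicalSpace α] {A B : α → Matrix (Fin d) (Fin d) ℝ}
    (hA : Continuous A) (hB : Continuous B) : Continuous fun x => dot (A x) (B x) := by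
  unfold dot
  fun_prop

theorem continuous_grad {u : Vec d → Vec d} (hu : ContDiff ℝ 1 u) : Continuous (grad u) :=
  continuous_matrix fun a b => continuous_fderiv_entry hu (unitVec a) b

theorem grad_sum {ι : Type*} (I : Finset ι) (c : ι → ℝ) {f : ι → Vec d → Vec d}
    (hf : ∀ i, ContDiff ℝ 1 (f i)) (x : Vec d) :
    grad (∑ i ∈ I, c i • f i) x = ∑ i ∈ I, c i • grad (f i) x := by
  ext a b
  have h := HasFDerivAt.sum (u := I) fun i _ =>
    (((hf i).differentiable one_ne_zero x).hasFDerivAt.const_smul (c i))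
  simp only [grad, Matrix.of_apply, h.fderiv, Matrix.sum_apply, Matrix.smul_apply]
  simp

theorem symGrad_sum {ι : Type*} (I : Finset ι) (c : ι → ℝ) {f : ι → Vec d → Vec d}
    (hf : ∀ i, ContDiff ℝ 1 (f i)) (x : Vec d) :
    (symGrad (∑ i ∈ I, c i • f i) x).1 = ∑ i ∈ I, c i • (symGrad (f i) x).1 := by
  simp only [symGrad, grad_sum I c hf, Matrix.transpose_sum, Matrix.transpose_smul, smul_add,
    Finset.smul_sum, Finset.sum_add_distrib, smul_comm (c _)]

theorem dot_sum_right {ι : Type*} (I : Finset ι) (c : ι → ℝ) (A : Matrix (Fin d) (Fin d) ℝ)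
    (B : ι → Matrix (Fin d) (Fin d) ℝ) : dot A (∑ i ∈ I, c i • B i) = ∑ i ∈ I, c i * dot A (B i) := by
  simp [dot, Finset.mul_sum, Matrix.trace_sum]

theorem continuous_capillaryStress {k : Vec d → ℝ} {r : ℝ} (hk : IsKernel k r) {φ : Vec d → ℝ}
    (hφ : ContDiff ℝ 1 φ) : Continuous (capillaryStress k φ) := by
  refine continuous_matrix fun a b => ?_
  have c1 (a : Fin d) : Continuous fun x => fderiv ℝ φ x (unitVec a) :=
    (hφ.continuous_fderiv one_ne_zero).clm_apply continuous_const
  exact (hk.contDiff_conv ((c1 a).mul (c1 b))).continuous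

/-- The momentum form is linear in the test field. -/
theorem momentumForm_sum (hp : IsStressLaw p ν₀ τp) (hm : IsStressLaw p ν₀ τm) {k : Vec d → ℝ}
    {r : ℝ} (hk : IsKernel k r) (ε : ℝ) {v : Vec d → Vec d} (hv : ContDiff ℝ 1 v) {φ : Vec d → ℝ}
    (hφ : ContDiff ℝ 1 φ) {ι : Type*} (I : Finset ι) (c : ι → ℝ) {f : ι → Vec d → Vec d}
    (hf : ∀ i, ContDiff ℝ 1 (f i)) :
    momentumForm τp τm k ε v φ (∑ i ∈ I, c i • f i)
      = ∑ i ∈ I, c i * momentumForm τp τm k ε v φ (f i) := by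
  have c1 : Continuous fun x => mixedStress τp τm (φ x) (symGrad v x) :=
    continuous_mixedStress hp hm hφ.continuous (continuous_symGrad hv)
  have c2 (i : ι) : Continuous fun x => (symGrad (f i) x).1 :=
    continuous_subtype_val.comp (continuous_symGrad (hf i))
  have c3 : Continuous fun x => fderiv ℝ v x (v x) :=
    (hv.continuous_fderiv one_ne_zero).clm_apply hv.continuous
  have c4 := continuous_capillaryStress hk hφ
  unfold momentumForm
  rw [innerL2_comm, innerL2_sum_left I c (fun i => (hf i).continuous) c3]
  simp only [symGrad_sum I c hf, grad_sum I c hf, dot_sum_right]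
  rw [integral_cell_sum I fun i => continuous_const.fun_mul (continuous_dot c1 (c2 i)),
    integral_cell_sum I fun i => continuous_const.fun_mul (continuous_dot c4 (continuous_grad (hf i)))]
  simp only [integral_const_mul, mul_add, mul_sub, mul_neg, Finset.sum_add_distrib,
    Finset.sum_sub_distrib, Finset.sum_neg_distrib, Finset.mul_sum, innerL2_comm _ (f _)]
  congr 1
  refine Finset.sum_congr rfl fun i _ => ?_
  ring

/-- The convective term does no work. -/
theorem IsSolenoidalC1.innerL2_convection {v : Vec d → Vec d} (hv : IsSolenoidalC1 v) :
    innerL2 (fun x => fderiv ℝ v x (v x)) v = 0 := by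
  have hc := hv.contDiff
  have hg : ContDiff ℝ 1 fun x => 1 / 2 * ‖v x‖ ^ 2 := contDiff_const.mul (hc.norm_sq ℝ)
  rw [← hv.integral_transport_eq_zero hg (hv.periodic.comp fun y => 1 / 2 * ‖y‖ ^ 2), innerL2]
  refine integral_congr_ae (Eventually.of_forall fun x => ?_)
  have h1 := ((hc.differentiable one_ne_zero x).hasFDerivAt.norm_sq).const_mul (1 / 2)
  simp only [h1.fderiv]
  simp [real_inner_comm]

/-- The capillary stress is dual to the mollified velocity. -/
theorem IsSolenoidalC1.integral_dot_capillaryStress {k : Vec d → ℝ} {r : ℝ} (hk : IsKernel k r)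
    {v : Vec d → Vec d} (hv : IsSolenoidalC1 v) {φ : Vec d → ℝ} (hφ : ContDiff ℝ 1 φ)
    (hφp : IsTorusFn φ) :
    ∫ x, dot (capillaryStress k φ x) (grad v x) ∂(cell d)
      = ∫ x, ∑ a, ∑ b, fderiv ℝ φ x (unitVec a) * fderiv ℝ φ x (unitVec b)
        * fderiv ℝ (TwoPhaseFlow.conv k v) x (unitVec a) b ∂(cell d) := by
  have := hk.isProbabilityMeasure
  have c1 (a : Fin d) : Continuous fun x => fderiv ℝ φ x (unitVec a) :=
    (hφ.continuous_fderiv one_ne_zero).clm_apply continuous_const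
  have p1 (a b : Fin d) : IsTorusFn fun x => fderiv ℝ φ x (unitVec a) * fderiv ℝ φ x (unitVec b) :=
    (isTorusFn_fderiv hφp).comp fun L => L (unitVec a) * L (unitVec b)
  have cv (a b : Fin d) := continuous_fderiv_entry hv.contDiff (unitVec a) b
  have pv (a b : Fin d) : IsTorusFn fun x => fderiv ℝ v x (unitVec a) b :=
    (isTorusFn_fderiv hv.periodic).comp fun L => L (unitVec a) b
  have hcv (a b : Fin d) (x : Vec d) : fderiv ℝ (TwoPhaseFlow.conv k v) x (unitVec a) b
      = TwoPhaseFlow.conv k (fun y => fderiv ℝ v y (unitVec a) b) x := by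
    obtain ⟨C, -, hC⟩ := (isTorusFn_fderiv hv.periodic).exists_bound
      (hv.contDiff.continuous_fderiv one_ne_zero)
    have hi : Integrable (fun t => fderiv ℝ v (x - t)) (kernelMeasure k) :=
      Integrable.of_bound ((hv.contDiff.continuous_fderiv one_ne_zero).comp
        (by fun_prop)).aestronglyMeasurable C (Eventually.of_forall fun t => hC _)
    rw [(hk.hasFDerivAt_conv hv.contDiff hv.periodic x).fderiv, hk.conv_apply, hk.conv_apply]
    exact (((EuclideanSpace.proj (𝕜 := ℝ) b : Vec d →L[ℝ] ℝ).comp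
      (ContinuousLinearMap.apply ℝ (Vec d) (unitVec a))).integral_comp_comm hi).symm
  have cc (a b : Fin d) : Continuous (TwoPhaseFlow.conv k fun y => fderiv ℝ v y (unitVec a) b) :=
    (hk.contDiff_conv (cv a b)).continuous
  have cφ (a b : Fin d) : Continuous
      (TwoPhaseFlow.conv k fun y => fderiv ℝ φ y (unitVec a) * fderiv ℝ φ y (unitVec b)) :=
    (hk.contDiff_conv ((c1 a).mul (c1 b))).continuous
  have e (x : Vec d) : dot (capillaryStress k φ x) (grad v x) = ∑ a, ∑ b,
      TwoPhaseFlow.conv k (fun y => fderiv ℝ φ y (unitVec a) * fderiv ℝ φ y (unitVec b)) x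
        * fderiv ℝ v x (unitVec a) b := by
    rw [dot_eq_sum, Finset.sum_comm]
    refine Finset.sum_congr rfl fun a _ => Finset.sum_congr rfl fun b _ => ?_
    simp only [capillaryStress, grad, Matrix.of_apply]
    simp only [mul_comm (fderiv ℝ φ _ (unitVec b))]
  simp only [e, hcv]
  rw [integral_cell_sum _ fun a => continuous_finsetSum _ fun b _ => (cφ a b).fun_mul (cv a b),
    integral_cell_sum _ fun a => continuous_finsetSum _ fun b _ =>
      ((c1 a).fun_mul (c1 b)).fun_mul (cc a b)]
  refine Finset.sum_congr rfl fun a _ => ?_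
  rw [integral_cell_sum _ fun b => (cφ a b).fun_mul (cv a b),
    integral_cell_sum _ fun b => ((c1 a).fun_mul (c1 b)).fun_mul (cc a b)]
  refine Finset.sum_congr rfl fun b _ => ?_
  exact hk.integral_conv_mul ((c1 a).fun_mul (c1 b)) (p1 a b) (cv a b) (pv a b)

theorem surfaceConst_pos : 0 < surfaceConst := by
  unfold surfaceConst
  have hc : Continuous fun r => √ (2 * doubleWell r) := by unfold doubleWell; fun_prop
  refine intervalIntegral.intervalIntegral_pos_of_pos_on (hc.intervalIntegrable _ _)
    (fun r hr => ?_) (by norm_num)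
  refine Real.sqrt_pos.2 ?_
  unfold doubleWell
  have : 0 < 1 - r ^ 2 := by nlinarith [hr.1, hr.2]
  positivity

/-- The kinetic energy and the phase energy together decay at least at the rate of the viscous
dissipation: the work of the capillary stress cancels. -/
theorem power_balance (hτp : IsStressLaw p ν₀ τp) (hτm : IsStressLaw p ν₀ τm) (hp0 : 0 ≤ p)
    {k : Vec d → ℝ} {r : ℝ}
    (hk : IsKernel k r) {ε : ℝ} (hε : 0 < ε) {v : Vec d → Vec d} (hv : IsSolenoidalC1 v)
    {φ χ : Vec d → ℝ} (hφ : ContDiff ℝ 2 φ) (hφp : IsTorusFn φ) (hφ1 : ∀ x, |φ x| ≤ 1)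
    (hχ : ContDiff ℝ 1 χ) (hχp : IsTorusFn χ)
    (heq : ∀ x, χ x + fderiv ℝ φ x (conv k v x)
      = Laplacian.laplacian φ x - deriv doubleWell (φ x) / ε ^ 2) :
    momentumForm τp τm k ε v φ v + surfaceConst⁻¹ * ∫ x, energyRate ε φ χ x ∂(cell d)
      ≤ -(ν₀ * ∫ x, matNorm (symGrad v x).1 ^ p ∂(cell d)) := by
  have hφc : ContDiff ℝ 1 φ := hφ.of_le one_le_two
  have h1 := (isSolenoidalC1_of_mem (hv.conv hk)).integral_energyRate_le hφ hφp hχ hχp hε heq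
  have h2 := mul_le_mul_of_nonneg_left h1 (inv_nonneg.2 surfaceConst_pos.le)
  rw [← hv.integral_dot_capillaryStress hk hφc hφp] at h2
  have h3 : ν₀ * ∫ x, matNorm (symGrad v x).1 ^ p ∂(cell d)
      ≤ ∫ x, dot (mixedStress τp τm (φ x) (symGrad v x)) (symGrad v x).1 ∂(cell d) := by
    rw [← integral_const_mul]
    refine integral_cell_mono ?_ ?_ fun x => le_dot_mixedStress hτp hτm (hφ1 x) _
    · exact continuous_const.mul ((continuous_matNorm.comp (continuous_symGrad hv.contDiff)).rpow_const
        fun _ => Or.inr hp0)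
    · exact continuous_dot (continuous_mixedStress hτp hτm hφc.continuous
        (continuous_symGrad hv.contDiff)) (continuous_subtype_val.comp (continuous_symGrad hv.contDiff))
  rw [momentumForm, hv.innerL2_convection]
  have h4 : ε / surfaceConst * ∫ x, dot (capillaryStress k φ x) (grad v x) ∂(cell d)
      = surfaceConst⁻¹ * (ε * ∫ x, dot (capillaryStress k φ x) (grad v x) ∂(cell d)) := by
    rw [div_eq_inv_mul, mul_assoc]
  rw [h4]
  linarith

end Power

/-! ### The energy estimate -/

section EnergyEstimate

variable {d : ℕ}

theorem continuous_integral_cell {X E : Type*} [TopologicalSpace X] [FirstCountableTopology X]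
    [LocallyCompactSpace X] [NormedAddCommGroup E] [NormedSpace ℝ E] {f : X → Vec d → E}
    (hf : Continuous (Function.uncurry f)) : Continuous fun t => ∫ x, f t x ∂(cell d) := by
  obtain ⟨K, hK, h⟩ := unitCell_subset_compact d
  have e : cell d = (cell d).restrict K := by
    rw [cell, Measure.restrict_restrict hK.measurableSet, inter_eq_self_of_subset_right h]
  have h1 := continuous_parametric_integral_of_continuous (μ := cell d) hf hK
  rwa [← e] at h1

theorem continuous_primitive_max {m : ℝ → ℝ}
    (hm : ∀ T, 0 < T → IntervalIntegrable m volume 0 T) :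
    Continuous fun t => ∫ r in (0 : ℝ)..max t 0, m r := by
  have h1 : ContinuousOn (fun t => ∫ r in (0 : ℝ)..t, m r) (Ici 0) := by
    intro t ht
    have hT : (0 : ℝ) < t + 1 := by linarith [mem_Ici.1 ht]
    have h2 := intervalIntegral.continuousOn_primitive_interval' (hm _ hT) left_mem_uIcc
    rw [uIcc_of_le hT.le] at h2
    refine (h2 t ⟨ht, by linarith⟩).mono_of_mem_nhdsWithin ?_
    rw [← Ici_inter_Iic]
    exact inter_mem self_mem_nhdsWithin (mem_nhdsWithin_of_mem_nhds (Iic_mem_nhds (by linarith)))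
  exact h1.comp_continuous (by fun_prop) fun t => mem_Ici.2 (le_max_right _ _)

theorem continuous_fderiv_sum_mul {om : ℕ → Vec d → Vec d} (hom : IsSolenoidalFrame om)
    (I : Finset ℕ) {c : ℕ → ℝ → ℝ} (hc : ∀ j, Continuous (c j)) :
    Continuous fun z : ℝ × Vec d => fderiv ℝ (∑ j ∈ I, c j z.1 • om j) z.2 := by
  have h (z : ℝ × Vec d) : fderiv ℝ (∑ j ∈ I, c j z.1 • om j) z.2
      = ∑ j ∈ I, c j z.1 • fderiv ℝ (om j) z.2 :=
    (HasFDerivAt.sum fun j _ => (((hom.solenoidal j).contDiff.differentiable one_ne_zero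
      z.2).hasFDerivAt.const_smul (c j z.1))).fderiv
  simp only [h]
  exact continuous_finsetSum _ fun j _ => ((hc j).comp continuous_fst).smul
    (((hom.solenoidal j).contDiff.continuous_fderiv one_ne_zero).comp continuous_snd)

theorem continuous_symGrad_sum_mul {om : ℕ → Vec d → Vec d} (hom : IsSolenoidalFrame om)
    (I : Finset ℕ) {c : ℕ → ℝ → ℝ} (hc : ∀ j, Continuous (c j)) :
    Continuous fun z : ℝ × Vec d => symGrad (∑ j ∈ I, c j z.1 • om j) z.2 := by
  refine Continuous.subtype_mk ?_ _
  have h1 : Continuous fun z : ℝ × Vec d => grad (∑ j ∈ I, c j z.1 • om j) z.2 :=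
    continuous_matrix fun a b => (EuclideanSpace.proj (𝕜 := ℝ) b : Vec d →L[ℝ] ℝ).continuous.comp
      ((continuous_fderiv_sum_mul hom I hc).clm_apply continuous_const)
  fun_prop

variable {p ν₀ : ℝ} [Fact (1 ≤ ENNReal.ofReal p)] {τp τm : SymMat d → SymMat d} {k : Vec d → ℝ}
  {r ε : ℝ} {om : ℕ → Vec d → Vec d} {N : ℕ} {u₀ : Vec d → Vec d} {φ₀ : Vec d → ℝ}
  {u : ℝ → Vec d → Vec d} {φ : ℝ → Vec d → ℝ}

/-- The Galerkin coefficients of the velocity, extended to negative times by their value at `0`. -/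
def coeff (om : ℕ → Vec d → Vec d) (u : ℝ → Vec d → Vec d) (j : ℕ) (t : ℝ) : ℝ :=
  innerL2 (u (max t 0)) (om j)

/-- The velocity with given Galerkin coefficients. -/
def field (om : ℕ → Vec d → Vec d) (N : ℕ) (c : ℕ → ℝ → ℝ) (t : ℝ) : Vec d → Vec d :=
  ∑ j ∈ Finset.range (N + 1), c j t • om j

theorem IsApproxSolution.continuous_coeff (hom : IsSolenoidalFrame om)
    (h : IsApproxSolution p τp τm k ε om N u₀ φ₀ u φ) (j : ℕ) : Continuous (coeff om u j) := by
  unfold coeff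
  rcases le_or_gt j N with hj | hj
  · simp only [h.momentum j hj _ (le_max_right _ _)]
    exact continuous_const.add (continuous_primitive_max (h.momentum_integrable j hj))
  · simp only [hom.innerL2_eq_zero (h.velocity_mem_span _ (le_max_right _ _)) hj]
    exact continuous_const

theorem IsApproxSolution.eq_field (hom : IsSolenoidalFrame om)
    (h : IsApproxSolution p τp τm k ε om N u₀ φ₀ u φ) {t : ℝ} (ht : 0 ≤ t) :
    u t = field om N (coeff om u) t := by
  simp only [field, coeff, max_eq_left ht]
  exact hom.exists_eq_sum (h.velocity_mem_span t ht)

theorem IsSolenoidalFrame.solenoidal_field (hom : IsSolenoidalFrame om) (N : ℕ) (c : ℕ → ℝ → ℝ)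
    (t : ℝ) : IsSolenoidalC1 (field om N c t) :=
  hom.solenoidal_sum _ fun j => c j t

/-- The phase field is the path of its bounded rate, issuing from a continuously differentiable
periodic function. -/
theorem IsApproxSolution.exists_path (h : IsApproxSolution p τp τm k ε om N u₀ φ₀ u φ) :
    ∃ q M, IsRate q M ∧ ContDiff ℝ 1 φ₀ ∧ IsTorusFn φ₀ ∧ (∀ t, 0 ≤ t → φ t = path φ₀ q t) ∧
      ∀ᵐ t ∂(volume.restrict (Ici (0 : ℝ))), ContDiff ℝ 2 (φ t) ∧ ∀ x,
        q t x + fderiv ℝ (φ t) x (conv k (u t) x)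
          = Laplacian.laplacian (φ t) x - deriv doubleWell (φ t x) / ε ^ 2 := by
  obtain ⟨φ', hφ', hpath, heq⟩ := h.phase_equation
  obtain ⟨q, M, hq, hqe⟩ := exists_isRate hφ' fun x t ht => (hpath x t ht).1
  have hp (t : ℝ) (ht : 0 ≤ t) : φ t = path φ₀ q t := by
    funext x
    rw [(hpath x t ht).2, path, prim]
    congr 1
    refine intervalIntegral.integral_congr_ae ?_
    rw [uIoc_of_le ht]
    filter_upwards [(ae_restrict_iff' measurableSet_Ici).1 hqe] with r hr hrt
    rw [hr hrt.1.le]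
  obtain ⟨M', hM'⟩ := h.phase_regular
  have : NeBot (ae (volume.restrict (Ici (0 : ℝ)))) := by
    rw [ae_neBot, Ne, Measure.restrict_eq_zero]
    simp
  obtain ⟨t, ht, ht0⟩ := (hM'.and (ae_restrict_mem measurableSet_Ici)).exists
  have h0 : ContDiff ℝ 1 φ₀ := by
    have e : φ₀ = fun x => φ t x - prim q t x := by
      funext x
      rw [hp t ht0, path]
      ring
    rw [e]
    exact (ht.2.1.of_le (by norm_num)).sub (hq.contDiff_prim t)
  have h1 : IsTorusFn φ₀ := by
    have e : φ 0 = φ₀ := by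
      funext x
      rw [(hpath x 0 le_rfl).2]
      simp
    exact e ▸ h.phase_periodic 0 le_rfl
  refine ⟨q, M, hq, h0, h1, hp, ?_⟩
  filter_upwards [hM', heq, hqe] with r h2 h3 h4
  exact ⟨h2.2.1.of_le (by norm_num), fun x => by rw [h4]; exact h3 x⟩

/-- The integral of the energy inequality over `[0, t]`. -/
theorem IsApproxSolution.energy_estimate (hom : IsSolenoidalFrame om) (hk : IsKernel k r)
    (hε : 0 < ε) (hp0 : 0 ≤ p) (hτp : IsStressLaw p ν₀ τp) (hτm : IsStressLaw p ν₀ τm)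
    (hu₀ : MemLp u₀ 2 (cell d)) (h : IsApproxSolution p τp τm k ε om N u₀ φ₀ u φ) {t : ℝ}
    (ht : 0 ≤ t) :
    1 / 2 * ∑ j ∈ Finset.range (N + 1), coeff om u j t ^ 2
        + surfaceConst⁻¹ * ∫ x, energyDensity ε (φ t) x ∂(cell d)
        + ν₀ * ∫ s in (0 : ℝ)..t,
          ∫ x, matNorm (symGrad (field om N (coeff om u) s) x).1 ^ p ∂(cell d)
      ≤ 1 / 2 * ∫ x, ‖u₀ x‖ ^ 2 ∂(cell d)
        + surfaceConst⁻¹ * ∫ x, energyDensity ε φ₀ x ∂(cell d) := by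
  obtain ⟨q, M, hq, h0, h0p, hpath, hae⟩ := h.exists_path
  obtain ⟨hRi, hR⟩ := integral_energyDensity_path (ε := ε) hq h0 h0p ht
  rw [hpath t ht, hR]
  have hm (j : ℕ) (hj : j ≤ N) : IntervalIntegrable
      (fun s => momentumForm τp τm k ε (u s) (φ s) (om j)) volume 0 t := by
    rcases ht.eq_or_lt with rfl | ht'
    · exact IntervalIntegrable.refl
    · exact h.momentum_integrable j hj t ht'
  have hsq (j : ℕ) (hj : j ≤ N) : coeff om u j t ^ 2 = innerL2 u₀ (om j) ^ 2
      + ∫ s in (0 : ℝ)..t, 2 * coeff om u j s * momentumForm τp τm k ε (u s) (φ s) (om j) := by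
    refine sq_eq_add_integral ht (hm j hj) fun s hs => ?_
    rw [coeff, max_eq_left hs.1]
    exact h.momentum j hj s hs.1
  have hI (j : ℕ) (hj : j ∈ Finset.range (N + 1)) : IntervalIntegrable (fun s => 2 * coeff om u j s
      * momentumForm τp τm k ε (u s) (φ s) (om j)) volume 0 t :=
    (hm j (Finset.mem_range_succ_iff.1 hj)).continuousOn_mul
      (continuous_const.mul (h.continuous_coeff hom j)).continuousOn
  have hsum : ∑ j ∈ Finset.range (N + 1), coeff om u j t ^ 2
      = ∑ j ∈ Finset.range (N + 1), innerL2 u₀ (om j) ^ 2 + ∫ s in (0 : ℝ)..t,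
        ∑ j ∈ Finset.range (N + 1), 2 * coeff om u j s
          * momentumForm τp τm k ε (u s) (φ s) (om j) := by
    rw [intervalIntegral.integral_finsetSum hI, ← Finset.sum_add_distrib]
    exact Finset.sum_congr rfl fun j hj => hsq j (Finset.mem_range_succ_iff.1 hj)
  have hmom (s : ℝ) (hs : 0 ≤ s) : ∑ j ∈ Finset.range (N + 1), 2 * coeff om u j s
      * momentumForm τp τm k ε (u s) (φ s) (om j)
        = 2 * momentumForm τp τm k ε (u s) (φ s) (u s) := by
    have hφs : ContDiff ℝ 1 (φ s) := hpath s hs ▸ contDiff_path hq h0 s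
    have hus : ContDiff ℝ 1 (u s) :=
      (hom.solenoidal_of_mem (h.velocity_mem_span s hs)).contDiff
    have e := momentumForm_sum hτp hτm hk ε hus hφs (Finset.range (N + 1))
      (fun j => coeff om u j s) (fun j => (hom.solenoidal j).contDiff)
    have e' : ∑ j ∈ Finset.range (N + 1), coeff om u j s • om j = u s := (h.eq_field hom hs).symm
    rw [e'] at e
    rw [e, Finset.mul_sum]
    exact Finset.sum_congr rfl fun j _ => by ring
  have hYc : Continuous fun s =>
      ∫ x, matNorm (symGrad (field om N (coeff om u) s) x).1 ^ p ∂(cell d) :=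
    continuous_integral_cell ((continuous_matNorm.comp (continuous_symGrad_sum_mul hom _
      (h.continuous_coeff hom))).rpow_const fun _ => Or.inr hp0)
  have hSi : IntervalIntegrable (fun s => ∑ j ∈ Finset.range (N + 1), 2 * coeff om u j s
      * momentumForm τp τm k ε (u s) (φ s) (om j)) volume 0 t := by
    simpa only [Finset.sum_fn] using IntervalIntegrable.sum _ hI
  have hmono : ∫ s in (0 : ℝ)..t, (1 / 2 * (∑ j ∈ Finset.range (N + 1), 2 * coeff om u j s
        * momentumForm τp τm k ε (u s) (φ s) (om j))
      + surfaceConst⁻¹ * ∫ x, energyRate ε (path φ₀ q s) (q s) x ∂(cell d))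
      ≤ ∫ s in (0 : ℝ)..t,
        -(ν₀ * ∫ x, matNorm (symGrad (field om N (coeff om u) s) x).1 ^ p ∂(cell d)) := by
    refine intervalIntegral.integral_mono_ae_restrict ht ((hSi.const_mul _).add (hRi.const_mul _))
      ((continuous_const.mul hYc).neg.intervalIntegrable 0 t) ?_
    filter_upwards [ae_restrict_of_ae_restrict_of_subset Icc_subset_Ici_self hae,
      ae_restrict_mem measurableSet_Icc] with s hs hst
    have hφs : ContDiff ℝ 2 (φ s) := hs.1
    have hus := hom.solenoidal_of_mem (h.velocity_mem_span s hst.1)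
    rw [hmom s hst.1, ← hpath s hst.1, ← h.eq_field hom hst.1]
    have := power_balance hτp hτm hp0 hk hε hus hφs (h.phase_periodic s hst.1)
      (h.phase_le_one s hst.1) (hq.contDiff s) (hq.periodic s) hs.2
    linarith
  rw [intervalIntegral.integral_add (hSi.const_mul _) (hRi.const_mul _),
    intervalIntegral.integral_const_mul, intervalIntegral.integral_const_mul,
    intervalIntegral.integral_neg, intervalIntegral.integral_const_mul] at hmono
  have hB := hom.sum_sq_le hu₀ (Finset.range (N + 1))
  rw [hsum]
  linarith

end EnergyEstimate

/-! ### Bounds uniform in the approximation -/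

section UniformBounds

variable {d : ℕ} {p ν₀ : ℝ} {τp τm : SymMat d → SymMat d}

theorem MemV.memLp_two {f : Vec d → Vec d} (h : MemV d 0 2 f) : MemLp f 2 (cell d) := by
  obtain ⟨w, -, hw⟩ := h
  exact ((ContinuousMultilinearMap.apply ℝ (fun _ : Fin 0 => Vec d) (Vec d) 0).comp_memLp'
    (Lp.memLp (w.1 0))).ae_eq hw

theorem IsKernel.norm_conv_le {E : Type*} [NormedAddCommGroup E] [NormedSpace ℝ E]
    {k : Vec d → ℝ} {r : ℝ} (hk : IsKernel k r)
    {v : Vec d → E} {B : ℝ} (hB : ∀ x, ‖v x‖ ≤ B) (x : Vec d) : ‖conv k v x‖ ≤ B := by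
  have := hk.isProbabilityMeasure
  rw [hk.conv_apply]
  simpa using norm_integral_le_of_norm_le_const (μ := kernelMeasure k)
    (Eventually.of_forall fun t => hB (x - t))

theorem abs_fderiv_entry_le (v : Vec d → Vec d) (x : Vec d) (a b : Fin d) :
    |fderiv ℝ v x (unitVec a) b| ≤ ‖fderiv ℝ v x‖ := by
  refine (PiLp.norm_apply_le (fderiv ℝ v x (unitVec a)) b).trans ?_
  simpa [norm_unitVec] using (fderiv ℝ v x).le_opNorm (unitVec a)

theorem abs_dot_le {A B : Matrix (Fin d) (Fin d) ℝ} {α β : ℝ} (hα : ∀ a b, |A a b| ≤ α)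
    (hβ : ∀ a b, |B a b| ≤ β) : |dot A B| ≤ d * (d * (α * β)) := by
  rw [dot_eq_sum]
  refine (Finset.abs_sum_le_sum_abs _ _).trans ?_
  have h (a : Fin d) : |∑ b, A a b * B b a| ≤ d * (α * β) := by
    refine (Finset.abs_sum_le_sum_abs _ _).trans ?_
    have h' (b : Fin d) : |A a b * B b a| ≤ α * β := by
      rw [abs_mul]
      exact mul_le_mul (hα a b) (hβ b a) (abs_nonneg _) ((abs_nonneg _).trans (hα a b))
    simpa using Finset.sum_le_sum fun b (_ : b ∈ Finset.univ) => h' b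
  simpa using Finset.sum_le_sum fun a (_ : a ∈ Finset.univ) => h a

theorem abs_mixedStress_le (hp : IsStressLaw p ν₀ τp) (hm : IsStressLaw p ν₀ τm) {φ : ℝ}
    (hφ : |φ| ≤ 1) (e : SymMat d) (a b : Fin d) :
    |mixedStress τp τm φ e a b| ≤ ν₀⁻¹ * (1 + matNorm e.1 ^ (p - 1)) := by
  have h1 := (abs_entry_le_matNorm (τp e) a b).trans (hp.growth e)
  have h2 := (abs_entry_le_matNorm (τm e) a b).trans (hm.growth e)
  have h3 := abs_le.1 hφ
  have e1 : mixedStress τp τm φ e a b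
      = (1 + φ) / 2 * (τp e).1 a b + (1 - φ) / 2 * (τm e).1 a b := by
    simp [mixedStress]
  rw [e1]
  refine (abs_add_le _ _).trans ?_
  rw [abs_mul, abs_mul, abs_of_nonneg (by linarith : 0 ≤ (1 + φ) / 2),
    abs_of_nonneg (by linarith : 0 ≤ (1 - φ) / 2)]
  nlinarith [mul_le_mul_of_nonneg_left h1 (by linarith : 0 ≤ (1 + φ) / 2),
    mul_le_mul_of_nonneg_left h2 (by linarith : 0 ≤ (1 - φ) / 2)]

/-- Convection tested with `w` carries its derivative over to `w`. -/
theorem IsSolenoidalC1.innerL2_convection_eq {v w : Vec d → Vec d} (hv : IsSolenoidalC1 v)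
    (hw : IsSolenoidalC1 w) :
    innerL2 (fun x => fderiv ℝ v x (v x)) w
      = -∫ x, inner ℝ (v x) (fderiv ℝ w x (v x)) ∂(cell d) := by
  have hc := hv.contDiff
  have hg : ContDiff ℝ 1 fun x => inner ℝ (v x) (w x) := hc.inner ℝ hw.contDiff
  have h := hv.integral_transport_eq_zero hg (hv.periodic.comp₂ hw.periodic fun y z => inner ℝ y z)
  have c1 : Continuous fun x => fderiv ℝ v x (v x) :=
    (hc.continuous_fderiv one_ne_zero).clm_apply hc.continuous
  have c2 : Continuous fun x => fderiv ℝ w x (v x) :=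
    (hw.contDiff.continuous_fderiv one_ne_zero).clm_apply hc.continuous
  have e (x : Vec d) : fderiv ℝ (fun x => inner ℝ (v x) (w x)) x (v x)
      = inner ℝ (v x) (fderiv ℝ w x (v x)) + inner ℝ (fderiv ℝ v x (v x)) (w x) :=
    fderiv_inner_apply ℝ (hc.differentiable one_ne_zero x)
      (hw.contDiff.differentiable one_ne_zero x) _
  simp only [e] at h
  rw [integral_cell_add (hc.continuous.inner c2) (c1.inner hw.contDiff.continuous)] at h
  rw [innerL2]
  linarith

/-- The capillary stress tested with `w` is controlled by the Dirichlet energy. -/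
theorem IsSolenoidalC1.abs_integral_dot_capillaryStress_le {w : Vec d → Vec d}
    (hw : IsSolenoidalC1 w) {B : ℝ} (hB : ∀ x, ‖fderiv ℝ w x‖ ≤ B) {k : Vec d → ℝ} {r : ℝ}
    (hk : IsKernel k r) {φ : Vec d → ℝ} (hφ : ContDiff ℝ 1 φ) (hφp : IsTorusFn φ) :
    |∫ x, dot (capillaryStress k φ x) (grad w x) ∂(cell d)|
      ≤ d * B * ∫ x, ∑ a, fderiv ℝ φ x (unitVec a) ^ 2 ∂(cell d) := by
  have c1 (a : Fin d) : Continuous fun x => fderiv ℝ φ x (unitVec a) :=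
    (hφ.continuous_fderiv one_ne_zero).clm_apply continuous_const
  have c2 (a b : Fin d) := continuous_fderiv_entry
    ((hk.contDiff_conv hw.contDiff.continuous).of_le (by norm_num)) (unitVec a) b
  rw [hw.integral_dot_capillaryStress hk hφ hφp, ← integral_const_mul]
  refine abs_integral_le_integral_abs.trans (integral_cell_mono
    (continuous_finsetSum _ fun a _ => continuous_finsetSum _ fun b _ =>
      ((c1 a).fun_mul (c1 b)).fun_mul (c2 a b)).abs
    (continuous_const.fun_mul (continuous_finsetSum _ fun a _ => (c1 a).pow 2)) fun x => ?_)
  have h1 (a b : Fin d) : |fderiv ℝ (TwoPhaseFlow.conv k w) x (unitVec a) b| ≤ B := by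
    refine (abs_fderiv_entry_le _ x a b).trans ?_
    rw [(hk.hasFDerivAt_conv hw.contDiff hw.periodic x).fderiv]
    exact hk.norm_conv_le hB x
  set D : Fin d → ℝ := fun a => fderiv ℝ φ x (unitVec a)
  have h2 (a b : Fin d) : |D a * D b * fderiv ℝ (TwoPhaseFlow.conv k w) x (unitVec a) b|
      ≤ (D a ^ 2 + D b ^ 2) / 2 * B := by
    rw [abs_mul]
    refine mul_le_mul ?_ (h1 a b) (abs_nonneg _) (by positivity)
    rw [abs_mul]
    nlinarith [sq_nonneg (|D a| - |D b|), sq_abs (D a), sq_abs (D b)]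
  calc |∑ a, ∑ b, D a * D b * fderiv ℝ (TwoPhaseFlow.conv k w) x (unitVec a) b|
      ≤ ∑ a, ∑ b, (D a ^ 2 + D b ^ 2) / 2 * B :=
        (Finset.abs_sum_le_sum_abs _ _).trans (Finset.sum_le_sum fun a _ =>
          (Finset.abs_sum_le_sum_abs _ _).trans (Finset.sum_le_sum fun b _ => h2 a b))
    _ = d * B * ∑ a, D a ^ 2 := by
        simp only [add_div, add_mul, Finset.sum_add_distrib, Finset.sum_const, Finset.card_univ,
          Fintype.card_fin, nsmul_eq_mul, ← Finset.sum_mul, ← Finset.mul_sum, ← Finset.sum_div]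
        ring

/-- The momentum form against a fixed test field is controlled by the energy, up to a power of the
dissipation below its natural exponent. -/
theorem exists_abs_momentumForm_le (hτp : IsStressLaw p ν₀ τp) (hτm : IsStressLaw p ν₀ τm)
    (hp1 : 1 ≤ p) {w : Vec d → Vec d} (hw : IsSolenoidalC1 w) :
    ∃ K, 0 ≤ K ∧ ∀ (k : Vec d → ℝ) (r ε : ℝ) (v : Vec d → Vec d) (φ : Vec d → ℝ), IsKernel k r →
      0 < ε → IsSolenoidalC1 v → ContDiff ℝ 1 φ → IsTorusFn φ → (∀ x, |φ x| ≤ 1) →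
      |momentumForm τp τm k ε v φ w| ≤ K * (∫ x, (1 + matNorm (symGrad v x).1 ^ (p - 1)) ∂(cell d)
        + ∫ x, ‖v x‖ ^ 2 ∂(cell d) + surfaceConst⁻¹ * ∫ x, energyDensity ε φ x ∂(cell d)) := by
  obtain ⟨B, hB0, hB⟩ := (isTorusFn_fderiv hw.periodic).exists_bound
    (hw.contDiff.continuous_fderiv one_ne_zero)
  refine ⟨|ν₀⁻¹| * (d * (d * B)) + B + 2 * (d * B), by positivity, ?_⟩
  intro k r ε v φ hk hε hv hφ hφp hφ1
  have cS : Continuous fun x => 1 + matNorm (symGrad v x).1 ^ (p - 1) :=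
    continuous_const.add ((continuous_matNorm.comp (continuous_symGrad hv.contDiff)).rpow_const
      fun _ => Or.inr (by linarith))
  have nS (x : Vec d) : 0 ≤ 1 + matNorm (symGrad v x).1 ^ (p - 1) :=
    add_nonneg zero_le_one (Real.rpow_nonneg (Real.sqrt_nonneg _) _)
  have cE : Continuous (energyDensity ε φ) := by
    have := hφ.continuous_fderiv one_ne_zero
    have := hφ.continuous
    unfold energyDensity doubleWell
    fun_prop
  have hgw (x : Vec d) (a b : Fin d) : |grad w x a b| ≤ B :=
    (abs_fderiv_entry_le w x a b).trans (hB x)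
  have hsw (x : Vec d) (a b : Fin d) : |(symGrad w x).1 a b| ≤ B := by
    have e : (symGrad w x).1 a b = 1 / 2 * (grad w x a b + grad w x b a) := by
      simp [symGrad]; ring
    rw [e, abs_mul, abs_of_nonneg (by norm_num : (0 : ℝ) ≤ 1 / 2)]
    linarith [abs_add_le (grad w x a b) (grad w x b a), hgw x a b, hgw x b a]
  have b1 : |∫ x, dot (mixedStress τp τm (φ x) (symGrad v x)) (symGrad w x).1 ∂(cell d)|
      ≤ |ν₀⁻¹| * (d * (d * B)) * ∫ x, (1 + matNorm (symGrad v x).1 ^ (p - 1)) ∂(cell d) := by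
    rw [← integral_const_mul]
    refine abs_integral_le_integral_abs.trans (integral_cell_mono
      (continuous_dot (continuous_mixedStress hτp hτm hφ.continuous (continuous_symGrad
        hv.contDiff)) (continuous_subtype_val.comp (continuous_symGrad hw.contDiff))).abs
      (continuous_const.fun_mul cS) fun x => ?_)
    refine (abs_dot_le (fun a b => (abs_mixedStress_le hτp hτm (hφ1 x) _ a b).trans
      (mul_le_mul_of_nonneg_right (le_abs_self _) (nS x))) (hsw x)).trans (le_of_eq ?_)
    ring
  have b2 : |innerL2 (fun x => fderiv ℝ v x (v x)) w| ≤ B * ∫ x, ‖v x‖ ^ 2 ∂(cell d) := by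
    rw [hv.innerL2_convection_eq hw, abs_neg, ← integral_const_mul]
    refine abs_integral_le_integral_abs.trans (integral_cell_mono
      (hv.contDiff.continuous.inner ((hw.contDiff.continuous_fderiv one_ne_zero).clm_apply
        hv.contDiff.continuous)).abs (continuous_const.fun_mul
          (hv.contDiff.continuous.norm.pow 2)) fun x => ?_)
    refine (abs_real_inner_le_norm _ _).trans ?_
    have := (fderiv ℝ w x).le_of_opNorm_le (hB x) (v x)
    nlinarith [norm_nonneg (v x)]
  have b3 := hw.abs_integral_dot_capillaryStress_le hB hk hφ hφp
  have b4 : ε * ∫ x, ∑ a, fderiv ℝ φ x (unitVec a) ^ 2 ∂(cell d)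
      ≤ 2 * ∫ x, energyDensity ε φ x ∂(cell d) := by
    rw [← integral_const_mul, ← integral_const_mul]
    have c1 (a : Fin d) : Continuous fun x => fderiv ℝ φ x (unitVec a) :=
      (hφ.continuous_fderiv one_ne_zero).clm_apply continuous_const
    refine integral_cell_mono (continuous_const.fun_mul
      (continuous_finsetSum _ fun a _ => (c1 a).pow 2)) (continuous_const.fun_mul cE) fun x => ?_
    have := div_nonneg (doubleWell_nonneg (φ x)) hε.le
    rw [energyDensity]
    linarith
  have hσ := surfaceConst_pos
  have b5 : |ε / surfaceConst * ∫ x, dot (capillaryStress k φ x) (grad w x) ∂(cell d)|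
      ≤ 2 * (d * B) * (surfaceConst⁻¹ * ∫ x, energyDensity ε φ x ∂(cell d)) := by
    rw [abs_mul, abs_of_pos (div_pos hε hσ)]
    calc _ ≤ ε / surfaceConst * (d * B * ∫ x, ∑ a, fderiv ℝ φ x (unitVec a) ^ 2 ∂(cell d)) := by
          gcongr
      _ = d * B * surfaceConst⁻¹ * (ε * ∫ x, ∑ a, fderiv ℝ φ x (unitVec a) ^ 2 ∂(cell d)) := by
          rw [div_eq_mul_inv]; ring
      _ ≤ d * B * surfaceConst⁻¹ * (2 * ∫ x, energyDensity ε φ x ∂(cell d)) := by gcongr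
      _ = _ := by ring
  have n1 : 0 ≤ ∫ x, (1 + matNorm (symGrad v x).1 ^ (p - 1)) ∂(cell d) :=
    integral_nonneg nS
  have n2 : 0 ≤ ∫ x, ‖v x‖ ^ 2 ∂(cell d) := integral_nonneg fun x => by positivity
  have n3 : 0 ≤ surfaceConst⁻¹ * ∫ x, energyDensity ε φ x ∂(cell d) :=
    mul_nonneg (inv_nonneg.2 hσ.le) (integral_nonneg fun x => energyDensity_nonneg hε φ x)
  set I1 := ∫ x, (1 + matNorm (symGrad v x).1 ^ (p - 1)) ∂(cell d)
  set I2 := ∫ x, ‖v x‖ ^ 2 ∂(cell d)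
  set I3 := surfaceConst⁻¹ * ∫ x, energyDensity ε φ x ∂(cell d)
  have hA : 0 ≤ |ν₀⁻¹| * (d * (d * B)) := by positivity
  have hD : 0 ≤ 2 * (d * B) := by positivity
  calc |momentumForm τp τm k ε v φ w|
      ≤ |ν₀⁻¹| * (d * (d * B)) * I1 + B * I2 + 2 * (d * B) * I3 := by
        rw [momentumForm]
        refine (abs_add_le _ _).trans (add_le_add ((abs_sub _ _).trans (add_le_add ?_ b2)) b5)
        rwa [abs_neg]
    _ ≤ (|ν₀⁻¹| * (d * (d * B)) + B + 2 * (d * B)) * I1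
        + (|ν₀⁻¹| * (d * (d * B)) + B + 2 * (d * B)) * I2
        + (|ν₀⁻¹| * (d * (d * B)) + B + 2 * (d * B)) * I3 := by
        gcongr <;> linarith
    _ = _ := by ring

end UniformBounds

section BoundedFamily

variable {d : ℕ}

/-- A sequence of Galerkin velocities, given by coefficients `c n j t` with respect to the frame
`om`, that is bounded in `L^∞(L²) ∩ L^p(W^{1,p})` and has coefficients equicontinuous in time. -/
structure IsBoundedFamily (p : ℝ) (om : ℕ → Vec d → Vec d) (N : ℕ → ℕ) (c : ℕ → ℕ → ℝ → ℝ) :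
    Prop where
  frame : IsSolenoidalFrame om
  continuous : ∀ n j, Continuous (c n j)
  eq_zero : ∀ n j t, N n < j → c n j t = 0
  sum_sq_le : ∃ M, ∀ n t (I : Finset ℕ), ∑ j ∈ I, c n j t ^ 2 ≤ M
  gradient_le : ∃ C, ∀ n t, 0 ≤ t →
    ∫ s in (0 : ℝ)..t, ∫ x, ‖fderiv ℝ (field om (N n) (c n) s) x‖ ^ p ∂(cell d) ≤ C
  equicontinuous : ∀ j, ∀ η > 0, ∃ δ > 0, ∀ n s t, 0 ≤ s → s ≤ t → t ≤ s + δ →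
    |c n j t - c n j s| ≤ η

theorem rpow_sub_one_le {a δ p : ℝ} (ha : 0 ≤ a) (hδ : 0 < δ) (hp : 1 ≤ p) :
    a ^ (p - 1) ≤ δ * a ^ p + (1 / δ) ^ (p - 1) := by
  rcases le_or_gt a (1 / δ) with h | h
  · have h1 := Real.rpow_le_rpow ha h (by linarith : 0 ≤ p - 1)
    have h2 : 0 ≤ δ * a ^ p := by positivity
    linarith
  · have ha' : 0 < a := lt_trans (by positivity) h
    have h1 : 1 ≤ δ * a := by
      rw [div_lt_iff₀ hδ] at h
      linarith
    have h2 : δ * a ^ p = δ * a * a ^ (p - 1) := by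
      rw [Real.rpow_sub_one ha'.ne']
      field_simp
    have h3 : 0 ≤ (1 / δ) ^ (p - 1) := by positivity
    have h4 : 0 ≤ a ^ (p - 1) := by positivity
    rw [h2]
    nlinarith

/-- The Galerkin coefficients of the approximate solutions obey the energy bounds uniformly, and the
bound on the tested right-hand side makes each of them equicontinuous in time. -/
theorem exists_isBoundedFamily {p ν₀ : ℝ} [Fact (1 ≤ ENNReal.ofReal p)] (hp : 2 ≤ p)
    (hν₀ : 0 < ν₀) {τp τm : SymMat d → SymMat d} (hτp : IsStressLaw p ν₀ τp)
    (hτm : IsStressLaw p ν₀ τm) {om : ℕ → Vec d → Vec d} (hom : IsSolenoidalFrame om)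
    {u₀ : Vec d → Vec d} (hu₀ : MemLp u₀ 2 (cell d)) {ε r : ℕ → ℝ} (hε : ∀ i, 0 < ε i)
    {k : ℕ → Vec d → ℝ} (hk : ∀ i, IsKernel (k i) (r i)) {φ₀ : ℕ → Vec d → ℝ} {C : ℝ}
    (hC : ∀ i, Differentiable ℝ (φ₀ i) → ∫ x, energyDensity (ε i) (φ₀ i) x ∂(cell d) ≤ C)
    {N : ℕ → ℕ} {u : ℕ → ℝ → Vec d → Vec d} {φ : ℕ → ℝ → Vec d → ℝ}
    (h : ∀ i, IsApproxSolution p τp τm (k i) (ε i) om (N i) u₀ (φ₀ i) (u i) (φ i)) :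
    IsBoundedFamily p om N fun i => coeff om (u i) := by
  set E₀ := 1 / 2 * ∫ x, ‖u₀ x‖ ^ 2 ∂(cell d) + surfaceConst⁻¹ * C with hE₀
  have hσ := inv_pos.2 surfaceConst_pos
  set Y : ℕ → ℝ → ℝ := fun i s =>
    ∫ x, matNorm (symGrad (field om (N i) (coeff om (u i)) s) x).1 ^ p ∂(cell d) with hY
  have hY0 (i : ℕ) (s : ℝ) : 0 ≤ Y i s :=
    integral_nonneg fun x => Real.rpow_nonneg (Real.sqrt_nonneg _) _
  have hYc (i : ℕ) : Continuous (Y i) :=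
    continuous_integral_cell ((continuous_matNorm.comp (continuous_symGrad_sum_mul hom _
      ((h i).continuous_coeff hom))).rpow_const fun _ => Or.inr (by linarith))
  have hest (i : ℕ) (t : ℝ) (ht : 0 ≤ t) :
      1 / 2 * ∑ j ∈ Finset.range (N i + 1), coeff om (u i) j t ^ 2
        + surfaceConst⁻¹ * ∫ x, energyDensity (ε i) (φ i t) x ∂(cell d)
        + ν₀ * ∫ s in (0 : ℝ)..t, Y i s ≤ E₀ := by
    have h1 := (h i).energy_estimate hom (hk i) (hε i) (by linarith) hτp hτm hu₀ ht
    obtain ⟨_, _, _, h0, _⟩ := (h i).exists_path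
    have h2 := mul_le_mul_of_nonneg_left (hC i (h0.differentiable one_ne_zero)) hσ.le
    linarith
  have hS0 (i : ℕ) (t : ℝ) : 0 ≤ ∑ j ∈ Finset.range (N i + 1), coeff om (u i) j t ^ 2 :=
    Finset.sum_nonneg fun j _ => sq_nonneg _
  have hF0 (i : ℕ) (t : ℝ) : 0 ≤ surfaceConst⁻¹ * ∫ x, energyDensity (ε i) (φ i t) x ∂(cell d) :=
    mul_nonneg hσ.le (integral_nonneg fun x => energyDensity_nonneg (hε i) _ x)
  have hD0 (i : ℕ) (t : ℝ) (ht : 0 ≤ t) : 0 ≤ ν₀ * ∫ s in (0 : ℝ)..t, Y i s :=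
    mul_nonneg hν₀.le (intervalIntegral.integral_nonneg ht fun s _ => hY0 i s)
  have hE₀0 : 0 ≤ E₀ := by
    linarith [hest 0 0 le_rfl, hS0 0 0, hF0 0 0, hD0 0 0 le_rfl]
  have hS (i : ℕ) (t : ℝ) (ht : 0 ≤ t) :
      ∑ j ∈ Finset.range (N i + 1), coeff om (u i) j t ^ 2 ≤ 2 * E₀ := by
    linarith [hest i t ht, hF0 i t, hD0 i t ht]
  have hD (i : ℕ) (t : ℝ) (ht : 0 ≤ t) : ∫ s in (0 : ℝ)..t, Y i s ≤ E₀ / ν₀ := by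
    rw [le_div_iff₀ hν₀]
    linarith [hest i t ht, hF0 i t, hS0 i t]
  have hzero (i j : ℕ) (t : ℝ) (hj : N i < j) : coeff om (u i) j t = 0 :=
    hom.innerL2_eq_zero ((h i).velocity_mem_span _ (le_max_right _ _)) hj
  refine ⟨hom, fun i => (h i).continuous_coeff hom, hzero, ⟨2 * E₀, fun i t I => ?_⟩, ?_, ?_⟩
  · have e : ∀ j, coeff om (u i) j t = coeff om (u i) j (max t 0) := fun j => by simp [coeff]
    simp only [e]
    refine le_trans ?_ (hS i _ (le_max_right t 0))
    rw [← Finset.sum_filter_add_sum_filter_not I (fun j => j ∈ Finset.range (N i + 1))]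
    rw [Finset.sum_eq_zero (s := I.filter fun j => j ∉ Finset.range (N i + 1)), add_zero]
    · exact Finset.sum_le_sum_of_subset_of_nonneg (fun j hj => (Finset.mem_filter.1 hj).2)
        fun j _ _ => sq_nonneg _
    · intro j hj
      rw [hzero i j _ (by simpa using (Finset.mem_filter.1 hj).2)]
      simp
  · obtain ⟨K, hK, hkorn⟩ := korn (d := d) hp
    refine ⟨K * (E₀ / ν₀), fun i t ht => ?_⟩
    refine le_trans ?_ (mul_le_mul_of_nonneg_left (hD i t ht) hK)
    rw [← intervalIntegral.integral_const_mul]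
    have hG : Continuous fun s =>
        ∫ x, ‖fderiv ℝ (field om (N i) (coeff om (u i)) s) x‖ ^ p ∂(cell d) :=
      continuous_integral_cell (((continuous_fderiv_sum_mul hom _
        ((h i).continuous_coeff hom)).norm).rpow_const fun _ => Or.inr (by linarith))
    exact intervalIntegral.integral_mono_on ht (hG.intervalIntegrable _ _)
      ((continuous_const.mul (hYc i)).intervalIntegrable _ _) fun s _ =>
        hkorn _ (hom.solenoidal_field _ _ _)
  · intro j η hη
    obtain ⟨K, hK, hmom⟩ := exists_abs_momentumForm_le hτp hτm (by linarith) (hom.solenoidal j)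
    -- the weight of the dissipation is taken so small that its total contribution is below `η / 2`
    set θ := η / (2 * (K * (E₀ / ν₀) + 1)) with hθ
    have hden : 0 < K * (E₀ / ν₀) + 1 := by positivity
    have hθ0 : 0 < θ := by positivity
    set B := K * ((1 + (1 / θ) ^ (p - 1)) * (cell d).real univ + 2 * E₀ + E₀) with hB
    have hB0 : 0 ≤ B := by positivity
    have hθe : θ * (K * (E₀ / ν₀) + 1) = η / 2 := by
      rw [hθ]
      field_simp
    clear_value B θ
    refine ⟨η / (2 * (B + 1)), by positivity, fun i s t hs hst htδ => ?_⟩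
    have ht := hs.trans hst
    rcases le_or_gt j (N i) with hj | hj
    swap
    · simp only [hzero i j _ hj, sub_zero, abs_zero]
      exact hη.le
    have hmi (T : ℝ) (hT : 0 ≤ T) : IntervalIntegrable
        (fun s => momentumForm τp τm (k i) (ε i) (u i s) (φ i s) (om j)) volume 0 T := by
      rcases hT.eq_or_lt with rfl | hT'
      · exact IntervalIntegrable.refl
      · exact (h i).momentum_integrable j hj T hT'
    have hdiff : coeff om (u i) j t - coeff om (u i) j s
        = ∫ r in s..t, momentumForm τp τm (k i) (ε i) (u i r) (φ i r) (om j) := by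
      rw [coeff, coeff, max_eq_left hs, max_eq_left ht, (h i).momentum j hj t ht,
        (h i).momentum j hj s hs, ← intervalIntegral.integral_interval_sub_left (hmi t ht)
          (hmi s hs)]
      ring
    have hbound (r : ℝ) (hr : 0 ≤ r) :
        |momentumForm τp τm (k i) (ε i) (u i r) (φ i r) (om j)| ≤ B + K * θ * Y i r := by
      obtain ⟨q, M, hq, h0, h0p, hpath, -⟩ := (h i).exists_path
      have hus := hom.solenoidal_of_mem ((h i).velocity_mem_span r hr)
      refine (hmom (k i) _ (ε i) (u i r) (φ i r) (hk i) (hε i) hus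
        (hpath r hr ▸ contDiff_path hq h0 r) ((h i).phase_periodic r hr)
        ((h i).phase_le_one r hr)).trans ?_
      have b1 : ∫ x, (1 + matNorm (symGrad (u i r) x).1 ^ (p - 1)) ∂(cell d)
          ≤ θ * Y i r + (1 + (1 / θ) ^ (p - 1)) * (cell d).real univ := by
        have cM : Continuous fun x => matNorm (symGrad (u i r) x).1 :=
          continuous_matNorm.comp (continuous_symGrad hus.contDiff)
        have c1 : Continuous fun x => matNorm (symGrad (u i r) x).1 ^ p :=
          cM.rpow_const fun _ => Or.inr (by linarith)
        have e : θ * Y i r + (1 + (1 / θ) ^ (p - 1)) * (cell d).real univ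
            = ∫ x, (θ * matNorm (symGrad (u i r) x).1 ^ p + (1 + (1 / θ) ^ (p - 1))) ∂(cell d) := by
          rw [integral_cell_add (continuous_const.fun_mul c1) continuous_const, integral_const_mul,
            integral_const, smul_eq_mul, mul_comm (1 + _), (h i).eq_field hom hr]
        rw [e]
        refine integral_cell_mono (continuous_const.add (cM.rpow_const
          fun _ => Or.inr (by linarith))) ((continuous_const.fun_mul c1).add continuous_const)
          fun x => ?_
        have := rpow_sub_one_le (a := matNorm (symGrad (u i r) x).1) (Real.sqrt_nonneg _)
          hθ0 (by linarith : 1 ≤ p)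
        linarith
      have b2 : ∫ x, ‖u i r x‖ ^ 2 ∂(cell d) ≤ 2 * E₀ := by
        rw [hom.integral_norm_sq ((h i).velocity_mem_span r hr)]
        have := hS i r hr
        simpa only [coeff, max_eq_left hr] using this
      have b3 : surfaceConst⁻¹ * ∫ x, energyDensity (ε i) (φ i r) x ∂(cell d) ≤ E₀ := by
        linarith [hest i r hr, hS0 i r, hD0 i r hr]
      calc _ ≤ K * (θ * Y i r + (1 + (1 / θ) ^ (p - 1)) * (cell d).real univ + 2 * E₀ + E₀) := by
            gcongr
        _ = B + K * θ * Y i r := by rw [hB]; ring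
    have hgi : IntervalIntegrable (fun r => B + K * θ * Y i r) volume s t :=
      (continuous_const.add (continuous_const.mul (hYc i))).intervalIntegrable _ _
    have hYi (a b : ℝ) : IntervalIntegrable (Y i) volume a b := (hYc i).intervalIntegrable _ _
    have hYst : ∫ r in s..t, Y i r ≤ E₀ / ν₀ := by
      have h1 := intervalIntegral.integral_add_adjacent_intervals (hYi 0 s) (hYi s t)
      have h2 := intervalIntegral.integral_nonneg (μ := volume) hs fun r _ => hY0 i r
      linarith [hD i t ht]
    rw [hdiff]
    calc |∫ r in s..t, momentumForm τp τm (k i) (ε i) (u i r) (φ i r) (om j)|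
        ≤ ∫ r in s..t, (B + K * θ * Y i r) := by
          rw [← Real.norm_eq_abs]
          exact intervalIntegral.norm_integral_le_of_norm_le hst
            (Eventually.of_forall fun r hr => hbound r (hs.trans hr.1.le)) hgi
      _ = B * (t - s) + K * θ * ∫ r in s..t, Y i r := by
          rw [intervalIntegral.integral_add intervalIntegrable_const ((hYi s t).const_mul _),
            intervalIntegral.integral_const_mul, intervalIntegral.integral_const, smul_eq_mul,
            mul_comm B]
      _ ≤ B * (η / (2 * (B + 1))) + K * θ * (E₀ / ν₀) := by
          gcongr
          linarith
      _ ≤ η / 2 + η / 2 := by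
          refine add_le_add ?_ ?_
          · rw [← mul_div_assoc, div_le_div_iff₀ (by positivity) (by positivity)]
            nlinarith
          · linarith [mul_assoc θ K (E₀ / ν₀), mul_comm θ K]
      _ = η := by ring

end BoundedFamily

/-! ### Selection of a subsequence -/

section Selection

variable {d : ℕ} {p : ℝ} {om : ℕ → Vec d → Vec d} {N : ℕ → ℕ} {c : ℕ → ℕ → ℝ → ℝ}

theorem IsBoundedFamily.subsequence (h : IsBoundedFamily p om N c) (κ : ℕ → ℕ) :
    IsBoundedFamily p om (fun n => N (κ n)) (fun n => c (κ n)) where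
  frame := h.frame
  continuous n := h.continuous (κ n)
  eq_zero n := h.eq_zero (κ n)
  sum_sq_le := h.sum_sq_le.imp fun _ hM n => hM (κ n)
  gradient_le := h.gradient_le.imp fun _ hC n => hC (κ n)
  equicontinuous j η hη := by
    obtain ⟨δ, hδ, hc⟩ := h.equicontinuous j η hη
    exact ⟨δ, hδ, fun n => hc (κ n)⟩

theorem IsBoundedFamily.exists_abs_le (h : IsBoundedFamily p om N c) :
    ∃ R, ∀ n j t, |c n j t| ≤ R := by
  obtain ⟨M, hM⟩ := h.sum_sq_le
  refine ⟨√ M, fun n j t => Real.abs_le_sqrt ?_⟩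
  simpa using hM n t {j}

/-- A diagonal argument over rational times, and equicontinuity for the other ones. -/
theorem IsBoundedFamily.exists_subsequence (h : IsBoundedFamily p om N c) :
    ∃ κ : ℕ → ℕ, StrictMono κ ∧
      ∀ j t, 0 ≤ t → ∃ l, Tendsto (fun n => c (κ n) j t) atTop (𝓝 l) := by
  obtain ⟨R, hR⟩ := h.exists_abs_le
  obtain ⟨a, -, κ, hκ, hlim⟩ := (isCompact_univ_pi fun _ : ℚ × ℕ => isCompact_Icc (a := -R)
    (b := R)).tendsto_subseq (x := fun n z => c n z.2 (z.1 : ℝ))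
    fun n z _ => abs_le.1 (hR n z.2 z.1)
  refine ⟨κ, hκ, fun j t ht => cauchySeq_tendsto_of_complete (Metric.cauchySeq_iff.2 ?_)⟩
  intro η hη
  obtain ⟨δ, hδ, hc⟩ := h.equicontinuous j (η / 4) (by positivity)
  obtain ⟨q, hq1, hq2⟩ := exists_rat_btwn (lt_add_of_pos_right t hδ)
  have hq := (tendsto_pi_nhds.1 hlim (q, j)).cauchySeq
  obtain ⟨n₀, hn₀⟩ := Metric.cauchySeq_iff.1 hq (η / 4) (by positivity)
  refine ⟨n₀, fun m hm n hn => ?_⟩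
  have h1 := abs_le.1 (hc (κ m) t q ht hq1.le hq2.le)
  have h2 := abs_le.1 (hc (κ n) t q ht hq1.le hq2.le)
  have h3 := hn₀ m hm n hn
  simp only [Function.comp_apply, Real.dist_eq] at h3
  have h4 := abs_lt.1 h3
  rw [Real.dist_eq, abs_lt]
  constructor <;> linarith [h1.1, h1.2, h2.1, h2.2, h4.1, h4.2]

theorem IsKernel.conv_field {k : Vec d → ℝ} {r : ℝ} (hk : IsKernel k r)
    (hom : IsSolenoidalFrame om) (n : ℕ) (c : ℕ → ℝ → ℝ) (t : ℝ) :
    conv k (field om n c t) = field (fun j => conv k (om j)) n c t :=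
  hk.conv_sum _ _ hom.continuous fun j => (hom.solenoidal j).periodic

theorem continuous_field {f : ℕ → Vec d → Vec d} (hf : ∀ j, Continuous (f j)) (n : ℕ)
    {c : ℕ → ℝ → ℝ} (hc : ∀ j, Continuous (c j)) :
    Continuous fun z : ℝ × Vec d => field f n c z.1 z.2 := by
  have e (z : ℝ × Vec d) : field f n c z.1 z.2 = ∑ j ∈ Finset.range (n + 1), c j z.1 • f j z.2 := by
    simp [field]
  simp only [e]
  exact continuous_finsetSum _ fun j _ => ((hc j).comp continuous_fst).smul
    ((hf j).comp continuous_snd)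

theorem IsBoundedFamily.exists_norm_field_le (h : IsBoundedFamily p om N c)
    {f : ℕ → Vec d → Vec d} (hf : ∀ j, Continuous (f j)) (hp : ∀ j, IsTorusFn (f j)) (n : ℕ) :
    ∃ B, ∀ t x, ‖field f (N n) (c n) t x‖ ≤ B := by
  obtain ⟨R, hR⟩ := h.exists_abs_le
  choose B hB0 hB using fun j => (hp j).exists_bound (hf j)
  refine ⟨∑ j ∈ Finset.range (N n + 1), R * B j, fun t x => ?_⟩
  have e : field f (N n) (c n) t x = ∑ j ∈ Finset.range (N n + 1), c n j t • f j x := by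
    simp [field]
  rw [e]
  refine norm_sum_le_of_le _ fun j _ => ?_
  rw [norm_smul]
  exact mul_le_mul (hR n j t) (hB j x) (norm_nonneg _) ((abs_nonneg _).trans (hR n j t))

/-- For a fixed wide enough kernel, the mollified velocities are bounded uniformly and converge at
every point, since their values are `ℓ²`-products with the coefficients. -/
theorem IsBoundedFamily.tendsto_conv (h : IsBoundedFamily p om N c)
    (hc : ∀ j t, 0 ≤ t → ∃ l, Tendsto (fun n => c n j t) atTop (𝓝 l)) {k : Vec d → ℝ} {r : ℝ}
    (hk : IsKernel k r) (hr : r < 1 / 2) :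
    (∃ B, ∀ n t x, ‖conv k (field om (N n) (c n) t) x‖ ≤ B) ∧
      ∀ t, 0 ≤ t → ∀ x, ∃ z, Tendsto (fun n => conv k (field om (N n) (c n) t) x) atTop (𝓝 z) := by
  obtain ⟨C, hC0, hC⟩ := hk.norm_conv_sq_le hr
  obtain ⟨M, hM⟩ := h.sum_sq_le
  have hsq (I : Finset ℕ) (β : ℕ → ℝ) :
      ∫ y, ‖(∑ j ∈ I, β j • om j) y‖ ^ 2 ∂(cell d) = ∑ j ∈ I, β j ^ 2 := by
    rw [← innerL2_self, innerL2_sum_left I β h.frame.continuous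
      (h.frame.solenoidal_sum I β).contDiff.continuous]
    refine Finset.sum_congr rfl fun j hj => ?_
    rw [innerL2_comm, h.frame.innerL2_sum, if_pos hj, sq]
  refine ⟨⟨√ (C * M), fun n t x => Real.le_sqrt_of_sq_le ?_⟩, fun t ht x => ?_⟩
  · have hs := h.frame.solenoidal_field (N n) (c n) t
    refine (hC _ hs.contDiff.continuous hs.periodic x).trans (mul_le_mul_of_nonneg_left ?_ hC0)
    rw [field, hsq]
    exact hM n t _
  · have hβ (a : Fin d) (I : Finset ℕ) : ∑ j ∈ I, conv k (om j) x a ^ 2 ≤ C := by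
      set β : ℕ → ℝ := fun j => conv k (om j) x a with hβ
      have hs := h.frame.solenoidal_sum I β
      have h1 := hC _ hs.contDiff.continuous hs.periodic x
      rw [hsq, hk.conv_sum I β h.frame.continuous fun j => (h.frame.solenoidal j).periodic] at h1
      have h2 : |(∑ j ∈ I, β j • conv k (om j)) x a| ≤ ‖(∑ j ∈ I, β j • conv k (om j)) x‖ :=
        PiLp.norm_apply_le ((∑ j ∈ I, β j • conv k (om j)) x) a
      have h3 : (∑ j ∈ I, β j • conv k (om j)) x a = ∑ j ∈ I, β j ^ 2 := by
        simp [hβ, sq]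
      rw [h3, abs_of_nonneg (Finset.sum_nonneg fun j _ => sq_nonneg _)] at h2
      have h4 := pow_le_pow_left₀ (Finset.sum_nonneg fun j _ => sq_nonneg (β j)) h2 2
      by_contra hcon
      rw [not_le] at hcon
      nlinarith
    have hlim (a : Fin d) := exists_tendsto_sum_mul (hβ a) (c := fun n j => c n j t)
      (fun n I => hM n t I) (fun j => hc j t ht) (N := fun n => N n + 1)
      (fun n j hj => h.eq_zero n j t hj)
    choose L hL using hlim
    refine ⟨WithLp.toLp 2 L, ?_⟩
    rw [(PiLp.homeomorph 2 fun _ : Fin d => ℝ).isInducing.tendsto_nhds_iff]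
    refine tendsto_pi_nhds.2 fun a => ?_
    refine (hL a).congr fun n => ?_
    change _ = (conv k (field om (N n) (c n) t) x) a
    rw [hk.conv_field h.frame]
    simp [field]

end Selection

/-! ### Strong convergence -/

section TimeWeight

/-- The finite measure `e^{-t} dt` on `[0, ∞)`. Convergence with respect to it entails convergence
on every bounded interval of times. -/
def timeWeight : Measure ℝ :=
  (volume.restrict (Ici 0)).withDensity fun t => ENNReal.ofReal (Real.exp (-t))

instance : IsFiniteMeasure timeWeight := by
  refine isFiniteMeasure_withDensity_ofReal (Integrable.hasFiniteIntegral ?_)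
  have h := exp_neg_integrableOn_Ioi 0 one_pos
  rw [IntegrableOn, Measure.restrict_congr_set Ioi_ae_eq_Ici] at h
  simpa using h

theorem timeWeight_le : timeWeight ≤ volume.restrict (Ici 0) := by
  conv_rhs => rw [← withDensity_one (μ := volume.restrict (Ici (0 : ℝ)))]
  refine withDensity_mono ?_
  filter_upwards [ae_restrict_mem measurableSet_Ici] with t ht
  simpa using ht

theorem ae_timeWeight_nonneg : ∀ᵐ t ∂timeWeight, 0 ≤ t :=
  (Measure.absolutelyContinuous_of_le timeWeight_le).ae_le (ae_restrict_mem measurableSet_Ici)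

theorem restrict_Icc_le_timeWeight (T : ℝ) :
    volume.restrict (Icc 0 T) ≤ ENNReal.ofReal (Real.exp T) • timeWeight := by
  have e : volume.restrict (Icc 0 T)
      = (volume.restrict (Ici (0 : ℝ))).withDensity ((Icc 0 T).indicator 1) := by
    rw [withDensity_indicator_one measurableSet_Icc, Measure.restrict_restrict measurableSet_Icc,
      inter_eq_self_of_subset_left Icc_subset_Ici_self]
  have hm : Measurable fun t : ℝ => ENNReal.ofReal (Real.exp (-t)) := by fun_prop
  rw [e, timeWeight, ← withDensity_smul _ hm]
  refine withDensity_mono (Eventually.of_forall fun t => ?_)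
  by_cases ht : t ∈ Icc 0 T
  · rw [indicator_of_mem ht, Pi.smul_apply, smul_eq_mul, ← ENNReal.ofReal_mul (Real.exp_nonneg _),
      ← Real.exp_add, Pi.one_apply, ENNReal.one_le_ofReal]
    exact Real.one_le_exp (by linarith [ht.2])
  · rw [indicator_of_notMem ht]
    exact zero_le

theorem absolutelyContinuous_timeWeight : volume.restrict (Ici (0 : ℝ)) ≪ timeWeight := by
  refine (withDensity_absolutelyContinuous' (by fun_prop) ?_)
  exact Eventually.of_forall fun t => (ENNReal.ofReal_pos.2 (Real.exp_pos _)).ne'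

end TimeWeight

section StrongConvergence

variable {d : ℕ} {p : ℝ} {om : ℕ → Vec d → Vec d} {N : ℕ → ℕ} {c : ℕ → ℕ → ℝ → ℝ}

theorem integral_norm_add_sq_le {α E : Type*} [MeasurableSpace α] [NormedAddCommGroup E]
    {π : Measure α} {f g : α → E} (hf : MemLp f 2 π) (hg : MemLp g 2 π) :
    ∫ z, ‖f z + g z‖ ^ 2 ∂π ≤ 2 * ∫ z, ‖f z‖ ^ 2 ∂π + 2 * ∫ z, ‖g z‖ ^ 2 ∂π := by
  have i1 := hf.integrable_norm_pow (p := 2) two_ne_zero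
  have i2 := hg.integrable_norm_pow (p := 2) two_ne_zero
  have i3 := (hf.add hg).integrable_norm_pow (p := 2) two_ne_zero
  rw [← integral_const_mul, ← integral_const_mul, ← integral_add (i1.const_mul 2) (i2.const_mul 2)]
  refine integral_mono i3 ((i1.const_mul 2).add (i2.const_mul 2)) fun z => ?_
  have h := norm_add_le (f z) (g z)
  nlinarith [norm_nonneg (f z + g z), sq_nonneg (‖f z‖ - ‖g z‖)]

/-- The product of the weighted time axis and the torus. -/
abbrev spaceTime (d : ℕ) : Measure (ℝ × Vec d) := timeWeight.prod (cell d)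

theorem memLp_spaceTime {f : ℝ × Vec d → Vec d} (hf : Continuous f) {B : ℝ} (hB : ∀ z, ‖f z‖ ≤ B) :
    MemLp f 2 (spaceTime d) :=
  MemLp.of_bound hf.aestronglyMeasurable B (Eventually.of_forall hB)

/-- The velocity gradients are bounded in the weighted `L²`. -/
theorem IsBoundedFamily.exists_integral_gradient_sq_le (h : IsBoundedFamily p om N c)
    (hp : 2 ≤ p) : ∃ G, 0 ≤ G ∧ ∀ n,
      Integrable (fun t => ∫ x, ‖fderiv ℝ (field om (N n) (c n) t) x‖ ^ 2 ∂(cell d)) timeWeight ∧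
      ∫ t, ∫ x, ‖fderiv ℝ (field om (N n) (c n) t) x‖ ^ 2 ∂(cell d) ∂timeWeight ≤ G := by
  obtain ⟨C, hC⟩ := h.gradient_le
  have hC0 : 0 ≤ C := by simpa using hC 0 0 le_rfl
  refine ⟨(cell d).real univ * timeWeight.real univ + C, by positivity, fun n => ?_⟩
  have cD := continuous_fderiv_sum_mul h.frame (Finset.range (N n + 1)) (h.continuous n)
  have c2 : Continuous fun t => ∫ x, ‖fderiv ℝ (field om (N n) (c n) t) x‖ ^ 2 ∂(cell d) :=
    continuous_integral_cell (cD.norm.pow 2)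
  have cp : Continuous fun t => ∫ x, ‖fderiv ℝ (field om (N n) (c n) t) x‖ ^ p ∂(cell d) :=
    continuous_integral_cell (cD.norm.rpow_const fun _ => Or.inr (by linarith))
  set g : ℝ → ℝ := fun t => ∫ x, ‖fderiv ℝ (field om (N n) (c n) t) x‖ ^ p ∂(cell d) with hg
  have hg0 (t : ℝ) : 0 ≤ g t := integral_nonneg fun x => by positivity
  have hgi : IntegrableOn g (Ioi 0) := by
    refine integrableOn_Ioi_of_intervalIntegral_norm_bounded C 0
      (b := fun i : ℕ => (i : ℝ)) (fun i => cp.integrableOn_Icc.mono_set Ioc_subset_Icc_self)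
      tendsto_natCast_atTop_atTop (Eventually.of_forall fun i => ?_)
    simp only [Real.norm_of_nonneg (hg0 _)]
    exact hC n i i.cast_nonneg
  have hgle : ∫ t in Ioi 0, g t ≤ C :=
    le_of_tendsto (intervalIntegral_tendsto_integral_Ioi 0 hgi tendsto_natCast_atTop_atTop)
      (Eventually.of_forall fun i : ℕ => hC n i i.cast_nonneg)
  rw [IntegrableOn, Measure.restrict_congr_set Ioi_ae_eq_Ici] at hgi
  rw [Measure.restrict_congr_set Ioi_ae_eq_Ici] at hgle
  have hgw : Integrable g timeWeight := hgi.mono_measure timeWeight_le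
  have hle (t : ℝ) : ∫ x, ‖fderiv ℝ (field om (N n) (c n) t) x‖ ^ 2 ∂(cell d)
      ≤ (cell d).real univ + g t := by
    have ct : Continuous fun x => ‖fderiv ℝ (field om (N n) (c n) t) x‖ :=
      (cD.comp (Continuous.prodMk_right t)).norm
    have e : (cell d).real univ + g t
        = ∫ x, (1 + ‖fderiv ℝ (field om (N n) (c n) t) x‖ ^ p) ∂(cell d) := by
      rw [integral_cell_add continuous_const (ct.rpow_const fun _ => Or.inr (by linarith))]
      simp [hg]
    rw [e]
    refine integral_cell_mono (ct.pow 2)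
      (continuous_const.add (ct.rpow_const fun _ => Or.inr (by linarith))) fun x => ?_
    set a := ‖fderiv ℝ (field om (N n) (c n) t) x‖ with ha
    have ha0 : 0 ≤ a := norm_nonneg _
    rcases le_or_gt a 1 with h1 | h1
    · have := Real.rpow_nonneg ha0 p
      nlinarith
    · have := Real.rpow_le_rpow_of_exponent_le h1.le hp
      rw [Real.rpow_two] at this
      linarith
  have hi2 : Integrable (fun t => (cell d).real univ + g t) timeWeight :=
    (integrable_const _).add hgw
  have hi : Integrable (fun t => ∫ x, ‖fderiv ℝ (field om (N n) (c n) t) x‖ ^ 2 ∂(cell d))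
      timeWeight := by
    refine hi2.mono' c2.aestronglyMeasurable (Eventually.of_forall fun t => ?_)
    rw [Real.norm_of_nonneg (integral_nonneg fun x => by positivity)]
    exact hle t
  refine ⟨hi, (integral_mono hi hi2 hle).trans ?_⟩
  rw [integral_add (integrable_const _) hgw, integral_const, smul_eq_mul, mul_comm]
  gcongr
  exact (integral_mono_measure timeWeight_le (Eventually.of_forall hg0) hgi).trans hgle

theorem IsBoundedFamily.continuous_conv_field (h : IsBoundedFamily p om N c) {k : Vec d → ℝ}
    {r : ℝ} (hk : IsKernel k r) (n : ℕ) :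
    Continuous fun z : ℝ × Vec d => conv k (field om (N n) (c n) z.1) z.2 := by
  simp only [hk.conv_field h.frame]
  exact continuous_field (fun j => (hk.contDiff_conv (h.frame.continuous j)).continuous) _
    (h.continuous n)

theorem IsBoundedFamily.memLp_conv_field (h : IsBoundedFamily p om N c) {k : Vec d → ℝ}
    {r : ℝ} (hk : IsKernel k r) (n : ℕ) :
    MemLp (fun z : ℝ × Vec d => conv k (field om (N n) (c n) z.1) z.2) 2 (spaceTime d) := by
  obtain ⟨B, hB⟩ := h.exists_norm_field_le (f := fun j => conv k (om j))
    (fun j => (hk.contDiff_conv (h.frame.continuous j)).continuous)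
    (fun j => (h.frame.solenoidal j).periodic.conv k) n
  refine memLp_spaceTime (h.continuous_conv_field hk n) (B := B) fun z => ?_
  rw [hk.conv_field h.frame]
  exact hB _ _

theorem IsBoundedFamily.memLp_field (h : IsBoundedFamily p om N c) (n : ℕ) :
    MemLp (fun z : ℝ × Vec d => field om (N n) (c n) z.1 z.2) 2 (spaceTime d) := by
  obtain ⟨B, hB⟩ := h.exists_norm_field_le h.frame.continuous
    (fun j => (h.frame.solenoidal j).periodic) n
  exact memLp_spaceTime (continuous_field h.frame.continuous _ (h.continuous n)) fun z => hB _ _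

theorem IsBoundedFamily.integral_conv_sub_sq_le (h : IsBoundedFamily p om N c) {G : ℝ} {n : ℕ}
    (hG : Integrable (fun t => ∫ x, ‖fderiv ℝ (field om (N n) (c n) t) x‖ ^ 2 ∂(cell d)) timeWeight
      ∧ ∫ t, ∫ x, ‖fderiv ℝ (field om (N n) (c n) t) x‖ ^ 2 ∂(cell d) ∂timeWeight ≤ G)
    {k : Vec d → ℝ} {r : ℝ} (hk : IsKernel k r) :
    ∫ z, ‖conv k (field om (N n) (c n) z.1) z.2 - field om (N n) (c n) z.1 z.2‖ ^ 2 ∂(spaceTime d)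
      ≤ r ^ 2 * G := by
  have hi := ((h.memLp_conv_field hk n).sub (h.memLp_field n)).integrable_norm_pow (p := 2)
    two_ne_zero
  simp only [Pi.sub_apply] at hi
  rw [integral_prod _ hi]
  refine le_trans ?_ (mul_le_mul_of_nonneg_left hG.2 (sq_nonneg r))
  rw [← integral_const_mul]
  refine integral_mono hi.integral_prod_left (hG.1.const_mul _) fun t => ?_
  have hs := h.frame.solenoidal_field (N n) (c n) t
  have := hk.integral_norm_conv_sub_rpow_le one_le_two hs.contDiff hs.periodic
  simpa only [Real.rpow_two] using this

/-- The mollified velocities form a Cauchy sequence in the weighted `L²`: up to an error that is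
small with the radius of the kernels they may be replaced by mollifications with one fixed kernel,
and these converge pointwise and boundedly. -/
theorem IsBoundedFamily.cauchy_conv (h : IsBoundedFamily p om N c) (hp : 2 ≤ p)
    (hc : ∀ j t, 0 ≤ t → ∃ l, Tendsto (fun n => c n j t) atTop (𝓝 l)) {k : ℕ → Vec d → ℝ}
    {r : ℕ → ℝ} (hk : ∀ n, IsKernel (k n) (r n)) (hr : Tendsto r atTop (𝓝 0)) {η : ℝ} (hη : 0 < η) :
    ∃ n₀, ∀ m ≥ n₀, ∀ n ≥ n₀, ∫ z, ‖conv (k m) (field om (N m) (c m) z.1) z.2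
      - conv (k n) (field om (N n) (c n) z.1) z.2‖ ^ 2 ∂(spaceTime d) ≤ η := by
  obtain ⟨G, hG0, hG⟩ := h.exists_integral_gradient_sq_le hp
  have hr2 : Tendsto (fun n => r n ^ 2 * G) atTop (𝓝 0) := by
    simpa using (hr.pow 2).mul_const G
  have hrG : ∀ᶠ n in atTop, r n ^ 2 * G < η / 64 := hr2.eventually (gt_mem_nhds (by positivity))
  obtain ⟨l, hl1, hl2⟩ := ((hr.eventually (gt_mem_nhds (by norm_num : (0 : ℝ) < 1 / 2))).and
    hrG).exists
  obtain ⟨⟨B, hB⟩, hlim⟩ := h.tendsto_conv hc (hk l) hl1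
  set f : ℕ → ℝ × Vec d → Vec d := fun n z => conv (k l) (field om (N n) (c n) z.1) z.2 with hf
  have hfm (n : ℕ) : MemLp (f n) 2 (spaceTime d) := h.memLp_conv_field (hk l) n
  have hae : ∀ᵐ z ∂(spaceTime d), 0 ≤ z.1 :=
    Measure.quasiMeasurePreserving_fst.ae ae_timeWeight_nonneg
  obtain ⟨Z, hZ, hZlim⟩ := measurable_limit_of_tendsto_metrizable_ae (L := atTop)
    (fun n => (h.continuous_conv_field (hk l) n).measurable.aemeasurable)
    (hae.mono fun z hz => hlim z.1 hz z.2)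
  have hZB : ∀ᵐ z ∂(spaceTime d), ‖Z z‖ ≤ B :=
    hZlim.mono fun z hz => le_of_tendsto hz.norm (Eventually.of_forall fun n => hB n z.1 z.2)
  have hZm : MemLp Z 2 (spaceTime d) := MemLp.of_bound hZ.aestronglyMeasurable B hZB
  have hconv : Tendsto (fun n => ∫ z, ‖f n z - Z z‖ ^ 2 ∂(spaceTime d)) atTop (𝓝 0) := by
    rw [← integral_zero (ℝ × Vec d) ℝ (μ := spaceTime d)]
    refine tendsto_integral_of_dominated_convergence (fun _ => (B + B) ^ 2)
      (fun n => ((hfm n).sub hZm).1.norm.pow 2) (integrable_const _) (fun n => ?_) ?_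
    · filter_upwards [hZB] with z hz
      rw [Real.norm_of_nonneg (by positivity)]
      gcongr
      exact (norm_sub_le _ _).trans (add_le_add (hB n z.1 z.2) hz)
    · filter_upwards [hZlim] with z hz
      have : Tendsto (fun n => ‖f n z - Z z‖ ^ 2) atTop (𝓝 (‖Z z - Z z‖ ^ 2)) :=
        ((hz.sub_const (Z z)).norm.pow 2)
      simpa using this
  obtain ⟨n₀, hn₀⟩ := eventually_atTop.1
    ((hconv.eventually (gt_mem_nhds (by positivity : 0 < η / 64))).and hrG)
  set w : ℕ → ℝ × Vec d → Vec d := fun n z => conv (k n) (field om (N n) (c n) z.1) z.2 with hw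
  set v : ℕ → ℝ × Vec d → Vec d := fun n z => field om (N n) (c n) z.1 z.2 with hv
  have hwm (n : ℕ) : MemLp (w n) 2 (spaceTime d) := h.memLp_conv_field (hk n) n
  have hvm (n : ℕ) : MemLp (v n) 2 (spaceTime d) := h.memLp_field n
  have hnear (n : ℕ) (hn : n₀ ≤ n) : ∫ z, ‖w n z - Z z‖ ^ 2 ∂(spaceTime d) ≤ η / 4 := by
    have h1 : ∫ z, ‖w n z - v n z‖ ^ 2 ∂(spaceTime d) ≤ r n ^ 2 * G :=
      h.integral_conv_sub_sq_le (hG n) (hk n)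
    have h2 : ∫ z, ‖v n z - f n z‖ ^ 2 ∂(spaceTime d) ≤ r l ^ 2 * G := by
      simp only [norm_sub_rev (v n _)]
      exact h.integral_conv_sub_sq_le (hG n) (hk l)
    have h3 := integral_norm_add_sq_le ((hvm n).sub (hfm n)) ((hfm n).sub hZm)
    have h4 := integral_norm_add_sq_le ((hwm n).sub (hvm n)) ((hvm n).sub hZm)
    simp only [Pi.sub_apply, sub_add_sub_cancel] at h3 h4
    have h5 := hn₀ n hn
    linarith [h5.1, h5.2]
  refine ⟨n₀, fun m hm n hn => ?_⟩
  have h3 := integral_norm_add_sq_le ((hwm m).sub hZm) (hZm.sub (hwm n))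
  simp only [Pi.sub_apply, sub_add_sub_cancel] at h3
  have h4 := hnear n hn
  simp only [norm_sub_rev (w n _)] at h4
  linarith [hnear m hm]

end StrongConvergence

section SobolevPath

theorem norm_toLp_rpow {α E : Type*} [MeasurableSpace α] {μ : Measure α} [NormedAddCommGroup E]
    {q : ℝ≥0∞} (hq0 : q ≠ 0) (hqT : q ≠ ⊤) {f : α → E} (hf : MemLp f q μ) :
    ‖hf.toLp f‖ ^ q.toReal = ∫ x, ‖f x‖ ^ q.toReal ∂μ := by
  rw [Lp.norm_toLp, hf.eLpNorm_eq_integral_rpow_norm hq0 hqT,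
    ENNReal.toReal_ofReal (Real.rpow_nonneg (integral_nonneg fun x => by positivity) _),
    ← Real.rpow_mul (integral_nonneg fun x => by positivity),
    inv_mul_cancel₀ (ENNReal.toReal_pos hq0 hqT).ne', Real.rpow_one]

variable {d s : ℕ} {q : ℝ≥0∞} [hq : Fact (1 ≤ q)] {f : ℕ → Vec d → Vec d}

/-- The path in a Sobolev space with given coefficients. -/
def sobField (s : ℕ) (q : ℝ≥0∞) [hq : Fact (1 ≤ q)] (hs : s ≤ 1) (hf : ∀ j, IsSolenoidalC1 (f j))
    (N : ℕ) (c : ℕ → ℝ → ℝ) (t : ℝ) : SobolevSpace d s q :=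
  ∑ j ∈ Finset.range (N + 1), c j t • toSob s q hs (hf j).contDiff (hf j).periodic

variable {hs : s ≤ 1} {hf : ∀ j, IsSolenoidalC1 (f j)} {N : ℕ} {c : ℕ → ℝ → ℝ}

theorem represents_sobField (t : ℝ) :
    Represents (sobField s q hs hf N c t) (field f N c t) :=
  Represents.sum _ fun j => (represents_toSob hs (hf j).contDiff (hf j).periodic).smul (c j t)

theorem continuous_sobField (hc : ∀ j, Continuous (c j)) :
    Continuous (sobField s q hs hf N c) :=
  continuous_finsetSum _ fun j _ => (hc j).smul continuous_const

theorem isSolenoidalC1_field (hf : ∀ j, IsSolenoidalC1 (f j)) (t : ℝ) :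
    IsSolenoidalC1 (field f N c t) :=
  isSolenoidalC1_sum _ fun j => (hf j).smul (c j t)

theorem sobField_eq_toSob (t : ℝ) : sobField s q hs hf N c t
    = toSob s q hs (isSolenoidalC1_field (N := N) (c := c) hf t).contDiff
      (isSolenoidalC1_field (N := N) (c := c) hf t).periodic :=
  (represents_sobField t).unique (represents_toSob _ _ _)

theorem sobField_mem_V (hf' : ∀ j, f j ∈ SmoothSolenoidal d) (t : ℝ) :
    sobField s q hs hf N c t ∈ V d s q := by
  have h (j : ℕ) := toSob_mem_V (q := q) hs (hf' j) (hf j).contDiff (hf j).periodic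
  rw [V_eq] at h ⊢
  exact Submodule.sum_mem _ fun j _ => Submodule.smul_mem _ _ (h j)

theorem memLp_sobField (hc : ∀ j, Continuous (c j)) {R : ℝ} (hR : ∀ j t, |c j t| ≤ R) (r : ℝ≥0∞)
    (μ : Measure ℝ) [IsFiniteMeasure μ] : MemLp (sobField s q hs hf N c) r μ := by
  have := secondCountableTopologyEither_of_left ℝ (SobolevSpace d s q)
  refine MemLp.of_bound (continuous_sobField hc).aestronglyMeasurable
    (∑ j ∈ Finset.range (N + 1), R * ‖toSob s q hs (hf j).contDiff (hf j).periodic‖)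
    (Eventually.of_forall fun t => norm_sum_le_of_le _ fun j _ => ?_)
  rw [norm_smul]
  exact mul_le_mul_of_nonneg_right (hR j t) (norm_nonneg _)

theorem norm_sobField_sub_sq {f' : ℕ → Vec d → Vec d} {hf' : ∀ j, IsSolenoidalC1 (f' j)} {N' : ℕ}
    {c' : ℕ → ℝ → ℝ} (t : ℝ) :
    ‖sobField 0 2 zero_le_one hf N c t - sobField 0 2 zero_le_one hf' N' c' t‖ ^ 2
      = ∫ x, ‖field f N c t x - field f' N' c' t x‖ ^ 2 ∂(cell d) := by
  have h1 := isSolenoidalC1_field (N := N) (c := c) hf t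
  have h2 := (isSolenoidalC1_field (N := N') (c := c') hf' t).smul (-1)
  have h3 := h1.add h2
  have e : sobField 0 2 zero_le_one hf N c t - sobField 0 2 zero_le_one hf' N' c' t
      = toSob 0 2 zero_le_one h3.contDiff h3.periodic := by
    have h4 := (represents_sobField (s := 0) (q := 2) (hs := zero_le_one) (hf := hf) (N := N)
      (c := c) t).add ((represents_sobField (s := 0) (q := 2) (hs := zero_le_one) (hf := hf')
        (N := N') (c := c') t).smul (-1))
    rw [neg_one_smul, ← sub_eq_add_neg] at h4
    exact h4.unique (represents_toSob _ _ _)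
  rw [e, norm_toSob_zero_sq]
  refine integral_congr_ae (Eventually.of_forall fun x => ?_)
  simp [sub_eq_add_neg]

end SobolevPath

section StrongLimit

variable {d : ℕ} {p : ℝ} {om : ℕ → Vec d → Vec d} {N : ℕ → ℕ} {c : ℕ → ℕ → ℝ → ℝ}

theorem IsBoundedFamily.norm_field_sq_le (h : IsBoundedFamily p om N c) : ∃ M, 0 ≤ M ∧ ∀ n t,
    ∫ x, ‖field om (N n) (c n) t x‖ ^ 2 ∂(cell d) ≤ M := by
  obtain ⟨M, hM⟩ := h.sum_sq_le
  refine ⟨M, by simpa using hM 0 0 ∅, fun n t => ?_⟩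
  refine le_trans (le_of_eq ?_) (hM n t (Finset.range (N n + 1)))
  rw [← innerL2_self, field, innerL2_sum_left _ _ h.frame.continuous
    (h.frame.solenoidal_sum _ _).contDiff.continuous]
  refine Finset.sum_congr rfl fun j hj => ?_
  rw [innerL2_comm, h.frame.innerL2_sum, if_pos hj, sq]

theorem eLpNorm_le_of_restrict_Icc {E : Type*} [NormedAddCommGroup E] (f : ℝ → E) (T : ℝ)
    (q : ℝ≥0∞) : eLpNorm f q (volume.restrict (Icc 0 T))
      ≤ ENNReal.ofReal (Real.exp T) ^ (1 / q).toReal * eLpNorm f q timeWeight := by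
  refine (eLpNorm_mono_measure f (restrict_Icc_le_timeWeight T)).trans (le_of_eq ?_)
  rw [eLpNorm_smul_measure_of_ne_zero (ENNReal.ofReal_pos.2 (Real.exp_pos T)).ne', smul_eq_mul]

theorem tendsto_toLp_of_timeWeight {E : Type*} [NormedAddCommGroup E] {q : ℝ≥0∞}
    [hq : Fact (1 ≤ q)] {T : ℝ} {F : ℕ → ℝ → E} (hF : ∀ n, MemLp (F n) q timeWeight)
    (hF' : ∀ n, MemLp (F n) q (volume.restrict (Icc 0 T))) {U : Lp E q timeWeight}
    (hU : MemLp U q (volume.restrict (Icc 0 T)))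
    (h : Tendsto (fun n => (hF n).toLp (F n)) atTop (𝓝 U)) :
    Tendsto (fun n => (hF' n).toLp (F n)) atTop (𝓝 (hU.toLp U)) := by
  rw [Lp.tendsto_Lp_iff_tendsto_eLpNorm'']
  have h1 : Tendsto (fun n => eLpNorm (F n - (U : ℝ → E)) q timeWeight) atTop (𝓝 0) := by
    rw [← Lp.tendsto_Lp_iff_tendsto_eLpNorm'' _ hF _ (Lp.memLp U), Lp.toLp_coeFn]
    exact h
  have h2 := ENNReal.Tendsto.const_mul (a := ENNReal.ofReal (Real.exp T) ^ (1 / q).toReal)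
    h1 (Or.inr (ENNReal.rpow_ne_top_of_nonneg ENNReal.toReal_nonneg ENNReal.ofReal_ne_top))
  rw [mul_zero] at h2
  exact tendsto_of_tendsto_of_tendsto_of_le_of_le tendsto_const_nhds h2 (fun _ => zero_le)
    fun n => eLpNorm_le_of_restrict_Icc _ T q

set_option maxHeartbeats 400000 in
/-- The mollified velocities converge strongly, on every bounded interval of times, to a field in
`L^∞([0,∞); V^{0,2})`. -/
theorem IsBoundedFamily.exists_strong_limit (h : IsBoundedFamily p om N c) (hp : 2 ≤ p)
    (hc : ∀ j t, 0 ≤ t → ∃ l, Tendsto (fun n => c n j t) atTop (𝓝 l)) {k : ℕ → Vec d → ℝ}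
    {r : ℕ → ℝ} (hk : ∀ n, IsKernel (k n) (r n)) (hr : Tendsto r atTop (𝓝 0)) :
    ∃ v : ℝ → Vec d → Vec d, MemBochnerV d 0 2 ⊤ (Ici 0) v ∧
      ∀ T, TendstoStrongly d 0 2 2 (Icc 0 T)
        (fun n t => conv (k n) (field om (N n) (c n) t)) v := by
  obtain ⟨R, hR⟩ := h.exists_abs_le
  obtain ⟨M, hM0, hM⟩ := h.norm_field_sq_le
  have hmem (n j : ℕ) : conv (k n) (om j) ∈ SmoothSolenoidal d := (h.frame.solenoidal j).conv (hk n)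
  have hf (n j : ℕ) : IsSolenoidalC1 (conv (k n) (om j)) := isSolenoidalC1_of_mem (hmem n j)
  set F : ℕ → ℝ → SobolevSpace d 0 2 :=
    fun n => sobField 0 2 zero_le_one (hf n) (N n) (c n) with hF
  have hFm (n : ℕ) (μ : Measure ℝ) [IsFiniteMeasure μ] : MemLp (F n) 2 μ :=
    memLp_sobField (h.continuous n) (hR n) 2 μ
  have hrep (n : ℕ) (t : ℝ) : Represents (F n t) (conv (k n) (field om (N n) (c n) t)) := by
    rw [(hk n).conv_field h.frame]
    exact represents_sobField t
  have hlt {η : ℝ} (hη : 0 < η) (a : ℝ) (ha : a ^ 2 ≤ (η / 2) ^ 2) : a < η := by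
    linarith [abs_le_of_sq_le_sq ha (by positivity), le_abs_self a]
  have hcau : CauchySeq fun n => (hFm n timeWeight).toLp (F n) := by
    refine Metric.cauchySeq_iff.2 fun η hη => ?_
    obtain ⟨n₀, hn₀⟩ := h.cauchy_conv hp hc hk hr (by positivity : 0 < (η / 2) ^ 2)
    refine ⟨n₀, fun m hm n hn => ?_⟩
    have h1 := hn₀ m hm n hn
    have h2 := norm_toLp_rpow two_ne_zero ENNReal.ofNat_ne_top
      ((hFm m timeWeight).sub (hFm n timeWeight))
    rw [MemLp.toLp_sub (hFm m timeWeight) (hFm n timeWeight), ENNReal.toReal_ofNat, Real.rpow_two] at h2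
    simp only [Real.rpow_two, Pi.sub_apply] at h2
    have hi := ((h.memLp_conv_field (hk m) m).sub (h.memLp_conv_field (hk n) n)).integrable_norm_pow
      (p := 2) two_ne_zero
    simp only [Pi.sub_apply] at hi
    rw [integral_prod _ hi] at h1
    simp only [(hk _).conv_field h.frame] at h1
    simp only [hF, norm_sobField_sub_sq] at h2
    rw [← h2] at h1
    rw [dist_eq_norm]
    exact hlt hη _ h1
  obtain ⟨U, hU⟩ := cauchySeq_tendsto_of_complete hcau
  obtain ⟨ns, -, hns⟩ := (tendstoInMeasure_of_tendsto_Lp hU).exists_seq_tendsto_ae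
  have hprop : ∀ᵐ t ∂timeWeight, U t ∈ V d 0 2 ∧ ‖U t‖ ≤ √ M := by
    have hcoe : ∀ᵐ t ∂timeWeight, ∀ n, (hFm n timeWeight).toLp (F n) t = F n t :=
      ae_all_iff.2 fun n => (hFm n timeWeight).coeFn_toLp
    filter_upwards [hns, hcoe] with t ht hcoet
    simp only [hcoet] at ht
    refine ⟨isClosed_V.mem_of_tendsto ht (Eventually.of_forall fun n =>
      sobField_mem_V (hmem _) t), le_of_tendsto ht.norm (Eventually.of_forall fun n => ?_)⟩
    refine Real.le_sqrt_of_sq_le ?_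
    have hs := h.frame.solenoidal_field (N (ns n)) (c (ns n)) t
    have h1 := (hk (ns n)).integral_norm_conv_rpow_le one_le_two hs.contDiff.continuous hs.periodic
    simp only [Real.rpow_two] at h1
    simp only [hF]
    rw [sobField_eq_toSob, norm_toSob_zero_sq, ← (hk (ns n)).conv_field h.frame]
    exact h1.trans (hM _ t)
  refine ⟨fun t x => ((U t).1 0 x) 0, ⟨U, ?_, ?_⟩, fun T => ?_⟩
  · refine memLp_top_of_bound ((Lp.aestronglyMeasurable U).mono_ac
      absolutelyContinuous_timeWeight) (√ M) ?_
    exact absolutelyContinuous_timeWeight.ae_le (hprop.mono fun t ht => ht.2)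
  · exact absolutelyContinuous_timeWeight.ae_le (hprop.mono fun t ht =>
      ⟨ht.1, Eventually.of_forall fun x => rfl⟩)
  · have hUm : MemLp U 2 (volume.restrict (Icc 0 T)) :=
      (Lp.memLp U).of_measure_le_smul ENNReal.ofReal_ne_top (restrict_Icc_le_timeWeight T)
    refine ⟨fun n => (hFm n _).toLp (F n), hUm.toLp U, fun n => ?_, ?_, ?_⟩
    · filter_upwards [(hFm n (volume.restrict (Icc 0 T))).coeFn_toLp] with t ht
      rw [ht]
      exact hrep n t
    · filter_upwards [hUm.coeFn_toLp] with t ht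
      rw [ht]
      exact Eventually.of_forall fun x => rfl
    · exact tendsto_toLp_of_timeWeight _ _ hUm hU

end StrongLimit

/-! ### Weak convergence -/

section Clarkson

theorem clarkson_real {p : ℝ} (hp : 2 ≤ p) (a b : ℝ) :
    |1 / 2 * (a + b)| ^ p + |1 / 2 * (a - b)| ^ p ≤ (|a| ^ p + |b| ^ p) / 2 := by
  have hsq (y : ℝ) : |y| ^ p = (y ^ 2) ^ (p / 2) := by
    rw [← sq_abs y, ← Real.rpow_natCast, ← Real.rpow_mul (abs_nonneg y)]
    congr 1
    push_cast
    ring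
  have hp2 : 1 ≤ p / 2 := by linarith
  rw [hsq, hsq, hsq, hsq]
  refine (Real.add_rpow_le_rpow_add (sq_nonneg _) (sq_nonneg _) hp2).trans ?_
  have h := (convexOn_rpow hp2).2 (mem_Ici.2 (sq_nonneg a)) (mem_Ici.2 (sq_nonneg b))
    (by norm_num : (0 : ℝ) ≤ 1 / 2) (by norm_num : (0 : ℝ) ≤ 1 / 2) (by norm_num)
  simp only [smul_eq_mul] at h
  have e : (1 / 2 * (a + b)) ^ 2 + (1 / 2 * (a - b)) ^ 2 = 1 / 2 * a ^ 2 + 1 / 2 * b ^ 2 := by ring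
  rw [e]
  linarith

/-- A non-negative functional that satisfies Clarkson's inequality and controls the norm. On a
Banach space that carries one, bounded sequences behave as in a uniformly convex space. -/
structure IsClarkson {X : Type*} [NormedAddCommGroup X] [NormedSpace ℝ X] (p : ℝ) (Φ : X → ℝ) :
    Prop where
  nonneg : ∀ F, 0 ≤ Φ F
  clarkson : ∀ F G, Φ ((1 / 2 : ℝ) • (F + G)) + Φ ((1 / 2 : ℝ) • (F - G)) ≤ (Φ F + Φ G) / 2
  coercive : ∃ C, 0 ≤ C ∧ ∀ F, ‖F‖ ^ p ≤ C * Φ F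
  bounded : ∃ C, 0 ≤ C ∧ ∀ F, Φ F ≤ C * ‖F‖ ^ p

variable {X : Type*} [NormedAddCommGroup X] [NormedSpace ℝ X] {p : ℝ} {Φ : X → ℝ}

/-- Almost minimizers of `Φ` on decreasing convex sets form a Cauchy sequence. -/
theorem IsClarkson.nonempty_iInter [CompleteSpace X] (hΦ : IsClarkson p Φ) (hp : 0 < p)
    {K : ℕ → Set X} (hK : Antitone K) (hconv : ∀ m, Convex ℝ (K m)) (hclosed : ∀ m, IsClosed (K m))
    {B : ℝ} (hB : ∀ m, ∃ F ∈ K m, Φ F ≤ B) : (⋂ m, K m).Nonempty := by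
  set α : ℕ → ℝ := fun m => sInf (Φ '' K m) with hα
  have hbdd (m : ℕ) : BddBelow (Φ '' K m) := ⟨0, by rintro _ ⟨F, -, rfl⟩; exact hΦ.nonneg F⟩
  have hle (m : ℕ) {F : X} (hF : F ∈ K m) : α m ≤ Φ F := csInf_le (hbdd m) ⟨F, hF, rfl⟩
  have hmono : Monotone α := fun m n hmn => by
    obtain ⟨F, hF, -⟩ := hB n
    exact csInf_le_csInf (hbdd m) ⟨_, F, hF, rfl⟩ (image_mono (hK hmn))
  have hαB : BddAbove (range α) := ⟨B, by
    rintro _ ⟨m, rfl⟩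
    obtain ⟨F, hF, h⟩ := hB m
    exact (hle m hF).trans h⟩
  have hlim := tendsto_atTop_ciSup hmono hαB
  set β := ⨆ m, α m
  have hαβ (m : ℕ) : α m ≤ β := le_ciSup hαB m
  have hG (m : ℕ) : ∃ G ∈ K m, Φ G < α m + 1 / ((m : ℝ) + 1) := by
    obtain ⟨F, hF, -⟩ := hB m
    obtain ⟨_, ⟨G, hG, rfl⟩, h⟩ := exists_lt_of_csInf_lt (s := Φ '' K m) ⟨Φ F, F, hF, rfl⟩
      (lt_add_of_pos_right (α m) (Nat.one_div_pos_of_nat (α := ℝ) (n := m)))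
    exact ⟨G, hG, h⟩
  choose G hGK hGΦ using hG
  obtain ⟨C, hC0, hC⟩ := hΦ.coercive
  set δ : ℕ → ℝ := fun m => β - α m + 1 / ((m : ℝ) + 1) with hδ
  have hδ0 : Tendsto (fun m => C * δ m) atTop (𝓝 0) := by
    have h1 := ((hlim.const_sub β).add tendsto_one_div_add_atTop_nhds_zero_nat).const_mul C
    rw [sub_self, add_zero, mul_zero] at h1
    exact h1
  have hdiff (m n : ℕ) (hmn : m ≤ n) : ‖(1 / 2 : ℝ) • (G m - G n)‖ ^ p ≤ C * δ m := by
    refine (hC _).trans (mul_le_mul_of_nonneg_left ?_ hC0)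
    have h1 := hΦ.clarkson (G m) (G n)
    have h2 : (1 / 2 : ℝ) • (G m + G n) ∈ K m := by
      rw [smul_add]
      exact hconv m (hGK m) (hK hmn (hGK n)) (by norm_num) (by norm_num) (by norm_num)
    have h3 := hle m h2
    have h4 : 1 / ((n : ℝ) + 1) ≤ 1 / ((m : ℝ) + 1) := Nat.one_div_le_one_div hmn
    simp only [hδ]
    linarith [hGΦ m, hGΦ n, hαβ n, hαβ m]
  have hcau : CauchySeq G := by
    rw [Metric.cauchySeq_iff']
    intro η hη
    obtain ⟨m, hm⟩ := (hδ0.eventually (gt_mem_nhds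
      (by positivity : 0 < (η / 2) ^ p))).exists
    refine ⟨m, fun n hn => ?_⟩
    have h1 := (Real.rpow_lt_rpow_iff (norm_nonneg _) (by positivity) hp).1
      ((hdiff m n hn).trans_lt hm)
    rw [norm_smul, Real.norm_of_nonneg (by norm_num)] at h1
    rw [dist_comm, dist_eq_norm]
    linarith
  obtain ⟨H, hH⟩ := cauchySeq_tendsto_of_complete hcau
  exact ⟨H, mem_iInter.2 fun m => (hclosed m).mem_of_tendsto hH
    ((eventually_ge_atTop m).mono fun n hn => hK hn (hGK n))⟩

/-- A bounded sequence that converges in a weaker norm converges weakly. -/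
theorem IsClarkson.exists_weak_limit [CompleteSpace X] (hΦ : IsClarkson p Φ) (hp : 0 < p)
    {Y : Type*} [NormedAddCommGroup Y] [NormedSpace ℝ Y] {ι : X →L[ℝ] Y}
    (hι : Function.Injective ι) {F : ℕ → X} {B : ℝ} (hF : ∀ n, Φ (F n) ≤ B) {z : Y}
    (hz : Tendsto (fun n => ι (F n)) atTop (𝓝 z)) :
    ∃ H, ι H = z ∧ (∀ C : Set X, Convex ℝ C → IsClosed C → (∀ n, F n ∈ C) → H ∈ C) ∧
      ∀ ℓ : StrongDual ℝ X, Tendsto (fun n => ℓ (F n)) atTop (𝓝 (ℓ H)) := by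
  -- every subsequence has a point in all its closed convex tails, and its image must be `z`
  have key (κ : ℕ → ℕ) (hκ : Tendsto κ atTop atTop) : ∃ H, ι H = z ∧
      ∀ C : Set X, Convex ℝ C → IsClosed C → (∀ n, F (κ n) ∈ C) → H ∈ C := by
    obtain ⟨H, hH⟩ := hΦ.nonempty_iInter hp
      (K := fun m => closedConvexHull ℝ ((fun n => F (κ n)) '' Ici m))
      (fun m n hmn => (closedConvexHull ℝ).monotone (image_mono (Ici_subset_Ici.2 hmn)))
      (fun m => convex_closedConvexHull) (fun m => isClosed_closedConvexHull)
      (fun m => ⟨F (κ m), subset_closedConvexHull ⟨m, self_mem_Ici, rfl⟩, hF _⟩)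
    rw [mem_iInter] at hH
    refine ⟨H, ?_, fun C h1 h2 h3 => ?_⟩
    · refine eq_of_forall_dist_le fun η hη => ?_
      obtain ⟨m, hm⟩ := eventually_atTop.1
        ((hz.comp hκ).eventually (Metric.closedBall_mem_nhds z hη))
      have h1 : closedConvexHull ℝ ((fun n => F (κ n)) '' Ici m) ⊆ ι ⁻¹' Metric.closedBall z η :=
        closedConvexHull_min (by rintro _ ⟨n, hn, rfl⟩; exact hm n hn)
          ((convex_closedBall z η).linear_preimage ι.toLinearMap)
          (Metric.isClosed_closedBall.preimage ι.continuous)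
      exact Metric.mem_closedBall.1 (h1 (hH m))
    · exact closedConvexHull_min (by rintro _ ⟨n, -, rfl⟩; exact h3 n) h1 h2 (hH 0)
  obtain ⟨H, hHz, hHC⟩ := key id tendsto_id
  refine ⟨H, hHz, hHC, fun ℓ => ?_⟩
  by_contra hcon
  rw [Metric.tendsto_atTop] at hcon
  push Not at hcon
  obtain ⟨η, hη, hfar⟩ := hcon
  have hfreq : ∃ᶠ n in atTop, ℓ (F n) ≤ ℓ H - η ∨ ℓ H + η ≤ ℓ (F n) := by
    refine frequently_atTop.2 fun N => ?_
    obtain ⟨n, hn, h⟩ := hfar N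
    refine ⟨n, hn, ?_⟩
    rw [Real.dist_eq, le_abs] at h
    rcases h with h | h
    · exact Or.inr (by linarith)
    · exact Or.inl (by linarith)
  rcases frequently_or_distrib.1 hfreq with h | h
  · obtain ⟨κ, hκ, hκ'⟩ := extraction_of_frequently_atTop h
    obtain ⟨H', h1, h2⟩ := key κ hκ.tendsto_atTop
    have h3 : ℓ H' ≤ ℓ H - η := h2 {G | ℓ G ≤ ℓ H - η}
      (convex_halfSpace_le ℓ.toLinearMap.isLinear _) (isClosed_le ℓ.continuous continuous_const) hκ'
    rw [hι (h1.trans hHz.symm)] at h3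
    linarith
  · obtain ⟨κ, hκ, hκ'⟩ := extraction_of_frequently_atTop h
    obtain ⟨H', h1, h2⟩ := key κ hκ.tendsto_atTop
    have h3 : ℓ H + η ≤ ℓ H' := h2 {G | ℓ H + η ≤ ℓ G}
      (convex_halfSpace_ge ℓ.toLinearMap.isLinear _) (isClosed_le continuous_const ℓ.continuous) hκ'
    rw [hι (h1.trans hHz.symm)] at h3
    linarith

end Clarkson

section LpClarkson

theorem isClarkson_real {p : ℝ} (hp : 2 ≤ p) : IsClarkson p fun a : ℝ => |a| ^ p where
  nonneg a := by positivity
  clarkson a b := by simpa using clarkson_real hp a b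
  coercive := ⟨1, zero_le_one, fun a => by simp⟩
  bounded := ⟨1, zero_le_one, fun a => by simp⟩

/-- A finite family of maps into spaces with a Clarkson functional that controls the norm gives one
on the source. -/
theorem isClarkson_sum {p : ℝ} {ι X : Type*} [Fintype ι] [NormedAddCommGroup X] [NormedSpace ℝ X]
    {E : Type*} [NormedAddCommGroup E] [NormedSpace ℝ E] (hp : 1 ≤ p)
    (hE : IsClarkson p fun f : E => ‖f‖ ^ p) (L : ι → X →L[ℝ] E) {C : ℝ} (hC0 : 0 ≤ C)
    (hC : ∀ w, ‖w‖ ≤ C * ∑ i, ‖L i w‖) : IsClarkson p fun w => ∑ i, ‖L i w‖ ^ p where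
  nonneg w := Finset.sum_nonneg fun i _ => by positivity
  clarkson v w := by
    simp only [map_smul, map_add, map_sub]
    rw [← Finset.sum_add_distrib, ← Finset.sum_add_distrib, Finset.sum_div]
    exact Finset.sum_le_sum fun i _ => hE.clarkson _ _
  coercive := by
    refine ⟨C ^ p * (Fintype.card ι : ℝ) ^ (p - 1), by positivity, fun w => ?_⟩
    calc ‖w‖ ^ p ≤ (C * ∑ i, ‖L i w‖) ^ p :=
          Real.rpow_le_rpow (norm_nonneg w) (hC w) (by linarith)
      _ = C ^ p * (∑ i, ‖L i w‖) ^ p :=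
          Real.mul_rpow hC0 (Finset.sum_nonneg fun i _ => norm_nonneg _)
      _ ≤ C ^ p * ((Fintype.card ι : ℝ) ^ (p - 1) * ∑ i, ‖L i w‖ ^ p) := by
          gcongr
          have h := Real.rpow_sum_le_const_mul_sum_rpow Finset.univ (fun i => ‖L i w‖) hp
          simpa using h
      _ = _ := by ring
  bounded := by
    refine ⟨∑ i, ‖L i‖ ^ p, Finset.sum_nonneg fun i _ => by positivity, fun w => ?_⟩
    rw [Finset.sum_mul]
    refine Finset.sum_le_sum fun i _ => ?_
    rw [← Real.mul_rpow (norm_nonneg _) (norm_nonneg _)]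
    exact Real.rpow_le_rpow (norm_nonneg _) ((L i).le_opNorm w) (by linarith)

variable {p : ℝ} [hq : Fact (1 ≤ ENNReal.ofReal p)]

theorem norm_rpow_eq_integral {α E : Type*} [MeasurableSpace α] {μ : Measure α}
    [NormedAddCommGroup E] (F : Lp E (ENNReal.ofReal p) μ) : ‖F‖ ^ p = ∫ t, ‖F t‖ ^ p ∂μ := by
  have hp1 : 1 ≤ p := by simpa using hq.out
  have h := norm_toLp_rpow (zero_lt_one.trans_le hq.out).ne' ENNReal.ofReal_ne_top (Lp.memLp F)
  rwa [Lp.toLp_coeFn, ENNReal.toReal_ofReal (by linarith)] at h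

theorem integrable_norm_rpow_lp {α E : Type*} [MeasurableSpace α] {μ : Measure α}
    [NormedAddCommGroup E] (F : Lp E (ENNReal.ofReal p) μ) : Integrable (fun t => ‖F t‖ ^ p) μ := by
  have hp1 : 1 ≤ p := by simpa using hq.out
  have h := (Lp.memLp F).integrable_norm_rpow (zero_lt_one.trans_le hq.out).ne' ENNReal.ofReal_ne_top
  rwa [ENNReal.toReal_ofReal (by linarith)] at h

/-- Integration makes a Clarkson functional on `L^p(E)` out of one on `E`. -/
theorem IsClarkson.lp {α E : Type*} [MeasurableSpace α] (μ : Measure α) [NormedAddCommGroup E]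
    [NormedSpace ℝ E] {Ψ : E → ℝ} (hΨ : IsClarkson p Ψ) (hc : Continuous Ψ) :
    IsClarkson p fun F : Lp E (ENNReal.ofReal p) μ => ∫ t, Ψ (F t) ∂μ := by
  obtain ⟨B, hB0, hB⟩ := hΨ.bounded
  obtain ⟨C, hC0, hC⟩ := hΨ.coercive
  have hi (F : Lp E (ENNReal.ofReal p) μ) : Integrable (fun t => Ψ (F t)) μ := by
    refine ((integrable_norm_rpow_lp F).const_mul B).mono'
      (hc.comp_aestronglyMeasurable (Lp.aestronglyMeasurable F))
      (Eventually.of_forall fun t => ?_)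
    rw [Real.norm_of_nonneg (hΨ.nonneg _)]
    exact hB _
  refine ⟨fun F => integral_nonneg fun t => hΨ.nonneg _, fun F G => ?_, ⟨C, hC0, fun F => ?_⟩,
    ⟨B, hB0, fun F => ?_⟩⟩
  · have e1 : ∫ t, Ψ (((1 / 2 : ℝ) • (F + G) : Lp E (ENNReal.ofReal p) μ) t) ∂μ
        = ∫ t, Ψ ((1 / 2 : ℝ) • (F t + G t)) ∂μ := by
      refine integral_congr_ae ?_
      filter_upwards [Lp.coeFn_smul (1 / 2 : ℝ) (F + G), Lp.coeFn_add F G] with t h1 h2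
      rw [h1, Pi.smul_apply, h2, Pi.add_apply]
    have e2 : ∫ t, Ψ (((1 / 2 : ℝ) • (F - G) : Lp E (ENNReal.ofReal p) μ) t) ∂μ
        = ∫ t, Ψ ((1 / 2 : ℝ) • (F t - G t)) ∂μ := by
      refine integral_congr_ae ?_
      filter_upwards [Lp.coeFn_smul (1 / 2 : ℝ) (F - G), Lp.coeFn_sub F G] with t h1 h2
      rw [h1, Pi.smul_apply, h2, Pi.sub_apply]
    have i1 : Integrable (fun t => Ψ ((1 / 2 : ℝ) • (F t + G t))) μ := by
      refine (hi ((1 / 2 : ℝ) • (F + G))).congr ?_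
      filter_upwards [Lp.coeFn_smul (1 / 2 : ℝ) (F + G), Lp.coeFn_add F G] with t h1 h2
      rw [h1, Pi.smul_apply, h2, Pi.add_apply]
    have i2 : Integrable (fun t => Ψ ((1 / 2 : ℝ) • (F t - G t))) μ := by
      refine (hi ((1 / 2 : ℝ) • (F - G))).congr ?_
      filter_upwards [Lp.coeFn_smul (1 / 2 : ℝ) (F - G), Lp.coeFn_sub F G] with t h1 h2
      rw [h1, Pi.smul_apply, h2, Pi.sub_apply]
    simp only [e1, e2]
    rw [← integral_add i1 i2, ← integral_add (hi F) (hi G), ← integral_div]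
    exact integral_mono (i1.add i2) (((hi F).add (hi G)).div_const 2) fun t => hΨ.clarkson _ _
  · rw [norm_rpow_eq_integral, ← integral_const_mul]
    exact integral_mono (integrable_norm_rpow_lp F) ((hi F).const_mul C) fun t => hC _
  · rw [norm_rpow_eq_integral, ← integral_const_mul]
    exact integral_mono (hi F) ((integrable_norm_rpow_lp F).const_mul B) fun t => hB _

theorem isClarkson_lp_real (hp : 2 ≤ p) {α : Type*} [MeasurableSpace α] (μ : Measure α) :
    IsClarkson p fun F : Lp ℝ (ENNReal.ofReal p) μ => ‖F‖ ^ p := by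
  have h := (isClarkson_real hp).lp μ (continuous_abs.rpow_const fun _ => Or.inr (by linarith))
  simpa only [norm_rpow_eq_integral, Real.norm_eq_abs] using h

end LpClarkson

section SobolevClarkson

variable {d s : ℕ} {q : ℝ≥0∞} [hq : Fact (1 ≤ q)]

theorem eq_sum_unitVec (y : Vec d) : y = ∑ b, y b • unitVec b := by
  ext a
  simp [unitVec, Pi.single_apply]

theorem norm_le_sum_abs (y : Vec d) : ‖y‖ ≤ ∑ b, |y b| := by
  calc ‖y‖ = ‖∑ b, y b • (unitVec b : Vec d)‖ := by rw [← eq_sum_unitVec]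
    _ ≤ ∑ b, ‖y b • (unitVec b : Vec d)‖ := norm_sum_le _ _
    _ = ∑ b, |y b| := by simp [norm_smul, norm_unitVec]

/-- A multilinear map is controlled by its coefficients. -/
theorem norm_multilinear_le {j : ℕ} (A : (Vec d) [×j]→L[ℝ] (Vec d)) :
    ‖A‖ ≤ ∑ z : (Fin j → Fin d) × Fin d, |A (fun i => unitVec (z.1 i)) z.2| := by
  refine A.opNorm_le_bound (Finset.sum_nonneg fun _ _ => abs_nonneg _) fun m => ?_
  have e : A m = ∑ f : Fin j → Fin d, (∏ i, m i (f i)) • A fun i => unitVec (f i) := by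
    conv_lhs => rw [show m = fun i => ∑ b, m i b • unitVec b from
      funext fun i => eq_sum_unitVec (m i)]
    rw [A.map_sum]
    exact Finset.sum_congr rfl fun f _ => A.map_smul_univ _ _
  rw [e, Fintype.sum_prod_type, Finset.sum_mul]
  refine norm_sum_le_of_le _ fun f _ => ?_
  rw [norm_smul, mul_comm, norm_prod]
  refine mul_le_mul (norm_le_sum_abs _) ?_ (Finset.prod_nonneg fun _ _ => norm_nonneg _)
    (Finset.sum_nonneg fun _ _ => abs_nonneg _)
  exact Finset.prod_le_prod (fun _ _ => norm_nonneg _) fun i _ => PiLp.norm_apply_le (m i) (f i)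

/-- The indices of the scalar components of a jet. -/
abbrev JetIndex (d s : ℕ) : Type := Σ j : Fin (s + 1), (Fin (j : ℕ) → Fin d) × Fin d

/-- The scalar components of the weak derivatives of an element of a Sobolev space. -/
def jetCoord (z : JetIndex d s) : SobolevSpace d s q →L[ℝ] Lp ℝ q (cell d) :=
  ((((EuclideanSpace.proj (𝕜 := ℝ) z.2.2 : Vec d →L[ℝ] ℝ).comp
    (ContinuousMultilinearMap.apply ℝ (fun _ : Fin (z.1 : ℕ) => Vec d) (Vec d)
      fun i => unitVec (z.2.1 i))).compLpL q (cell d)).comp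
    (PiLp.proj q (fun j : Fin (s + 1) => Lp ((Vec d) [×(j : ℕ)]→L[ℝ] (Vec d)) q (cell d)) z.1)).comp
    (sobolev d s q).subtypeL

theorem coeFn_jetCoord (z : JetIndex d s) (w : SobolevSpace d s q) :
    ∀ᵐ x ∂(cell d), jetCoord z w x = w.1 z.1 x (fun i => unitVec (z.2.1 i)) z.2.2 :=
  ContinuousLinearMap.coeFn_compLpL _ (w.1 z.1)

theorem norm_jet_le (w : SobolevSpace d s q) (j : Fin (s + 1)) :
    ‖w.1 j‖ ≤ ∑ z : (Fin (j : ℕ) → Fin d) × Fin d, ‖jetCoord (⟨j, z⟩ : JetIndex d s) w‖ := by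
  have h1 : ‖w.1 j‖ ≤ ‖∑ z : (Fin (j : ℕ) → Fin d) × Fin d, |jetCoord (⟨j, z⟩ : JetIndex d s) w|‖ := by
    refine Lp.norm_le_norm_of_ae_le ?_
    have h2 : ∀ᵐ x ∂(cell d), ∀ z : (Fin (j : ℕ) → Fin d) × Fin d,
        (|jetCoord (⟨j, z⟩ : JetIndex d s) w| : Lp ℝ q (cell d)) x
          = |w.1 j x (fun i => unitVec (z.1 i)) z.2| := by
      refine ae_all_iff.2 fun z => ?_
      filter_upwards [coeFn_jetCoord (⟨j, z⟩ : JetIndex d s) w,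
        Lp.coeFn_abs (jetCoord (⟨j, z⟩ : JetIndex d s) w)] with x hx hx'
      rw [hx', hx]
    filter_upwards [h2, Lp.coeFn_finsetSum Finset.univ fun z : (Fin (j : ℕ) → Fin d) × Fin d =>
      |jetCoord (⟨j, z⟩ : JetIndex d s) w|] with x hx hx'
    rw [hx', Finset.sum_apply, Finset.sum_congr rfl fun z _ => hx z]
    exact (norm_multilinear_le _).trans (le_abs_self _)
  refine h1.trans ((norm_sum_le _ _).trans (le_of_eq ?_))
  exact Finset.sum_congr rfl fun z _ => norm_abs_eq_norm _

theorem norm_le_sum_jetCoord (hqT : q ≠ ⊤) (w : SobolevSpace d s q) :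
    ‖w‖ ≤ (s + 1) * ∑ z : JetIndex d s, ‖jetCoord z w‖ := by
  have h1 (j : Fin (s + 1)) : ‖w.1 j‖ ≤ ∑ z : JetIndex d s, ‖jetCoord z w‖ := by
    refine (norm_jet_le w j).trans ?_
    rw [Fintype.sum_sigma]
    exact Finset.single_le_sum (f := fun j : Fin (s + 1) =>
      ∑ z : (Fin (j : ℕ) → Fin d) × Fin d, ‖jetCoord (⟨j, z⟩ : JetIndex d s) w‖)
      (fun j _ => Finset.sum_nonneg fun _ _ => norm_nonneg _) (Finset.mem_univ j)
  have hq1 : 1 ≤ q.toReal := by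
    rw [← ENNReal.toReal_one]
    exact ENNReal.toReal_mono hqT hq.out
  set S := ∑ z : JetIndex d s, ‖jetCoord z w‖
  have hS : 0 ≤ S := Finset.sum_nonneg fun _ _ => norm_nonneg _
  have hn : ‖w‖ = ‖w.1‖ := rfl
  rw [hn, PiLp.norm_eq_sum (by linarith)]
  have h2 : ∑ j, ‖w.1 j‖ ^ q.toReal ≤ ((s + 1) * S) ^ q.toReal := by
    refine (Finset.sum_le_sum fun j _ => Real.rpow_le_rpow (norm_nonneg _) (h1 j)
      (by linarith : 0 ≤ q.toReal)).trans ?_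
    rw [Finset.sum_const, Finset.card_univ, Fintype.card_fin, nsmul_eq_mul,
      Real.mul_rpow (by positivity) hS]
    refine mul_le_mul_of_nonneg_right ?_ (by positivity)
    push_cast
    exact Real.self_le_rpow_of_one_le (by linarith [(Nat.cast_nonneg s : (0 : ℝ) ≤ s)]) hq1
  calc _ ≤ (((s + 1) * S) ^ q.toReal) ^ (1 / q.toReal) :=
        Real.rpow_le_rpow (Finset.sum_nonneg fun j _ => by positivity) h2 (by positivity)
    _ = (s + 1) * S := by
        rw [← Real.rpow_mul (by positivity), mul_one_div_cancel (by linarith), Real.rpow_one]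

theorem isClarkson_sobolev {p : ℝ} [Fact (1 ≤ ENNReal.ofReal p)] (hp : 2 ≤ p) :
    IsClarkson p fun w : SobolevSpace d s (ENNReal.ofReal p) =>
      ∑ z : JetIndex d s, ‖jetCoord z w‖ ^ p :=
  isClarkson_sum (by linarith) (isClarkson_lp_real hp (cell d)) _ (by positivity)
    (norm_le_sum_jetCoord ENNReal.ofReal_ne_top)

end SobolevClarkson

section WeakLimit

/-- Membership in a closed convex set at almost every time is a closed convex condition. -/
theorem convex_isClosed_ae_mem {α E : Type*} [MeasurableSpace α] (μ : Measure α)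
    [NormedAddCommGroup E] [NormedSpace ℝ E] {q : ℝ≥0∞} [hq : Fact (1 ≤ q)] {K : Set E}
    (hK : Convex ℝ K) (hc : IsClosed K) :
    Convex ℝ {F : Lp E q μ | ∀ᵐ t ∂μ, F t ∈ K} ∧ IsClosed {F : Lp E q μ | ∀ᵐ t ∂μ, F t ∈ K} := by
  constructor
  · intro F hF G hG a b ha hb hab
    filter_upwards [hF, hG, Lp.coeFn_add (a • F) (b • G), Lp.coeFn_smul a F, Lp.coeFn_smul b G]
      with t h1 h2 h3 h4 h5
    rw [h3, Pi.add_apply, h4, h5]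
    exact hK h1 h2 ha hb hab
  · refine IsSeqClosed.isClosed fun F G hF hG => ?_
    obtain ⟨ns, -, hns⟩ := (tendstoInMeasure_of_tendsto_Lp hG).exists_seq_tendsto_ae
    filter_upwards [hns, ae_all_iff.2 hF] with t h1 h2
    exact hc.mem_of_tendsto h1 (Eventually.of_forall fun n => h2 (ns n))

theorem BochnerRepresents.congr {d s : ℕ} {q r : ℝ≥0∞} [Fact (1 ≤ q)] {T : ℝ}
    {F : Lp (SobolevSpace d s q) r (volume.restrict (Icc 0 T))}
    {f g : ℝ → Vec d → Vec d} (h : BochnerRepresents F f) (hfg : ∀ t, 0 ≤ t → f t = g t) :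
    BochnerRepresents F g := by
  filter_upwards [h, ae_restrict_mem measurableSet_Icc] with t ht htT
  rwa [← hfg t htT.1]

section Values

variable {α E Y : Type*} [MeasurableSpace α] {μ : Measure α} [IsFiniteMeasure μ]
  [NormedAddCommGroup E] [NormedSpace ℝ E] [NormedAddCommGroup Y] [NormedSpace ℝ Y]

/-- Composition with a continuous linear map, followed by the inclusion of `L^r` in `L¹`. -/
def lpMap (L : E →L[ℝ] Y) (r : ℝ≥0∞) [Fact (1 ≤ r)] (μ : Measure α) [IsFiniteMeasure μ] :
    Lp E r μ →L[ℝ] Lp Y 1 μ :=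
  (lpIncl Y r μ).comp (L.compLpL r μ)

theorem coeFn_lpMap (L : E →L[ℝ] Y) {r : ℝ≥0∞} [Fact (1 ≤ r)] (F : Lp E r μ) :
    ∀ᵐ t ∂μ, lpMap L r μ F t = L (F t) := by
  filter_upwards [coeFn_lpIncl (L.compLpL r μ F),
    ContinuousLinearMap.coeFn_compLpL (p := r) (μ := μ) L F] with t h1 h2
  rw [← h2, ← h1]
  rfl

theorem lpMap_injective {L : E →L[ℝ] Y} (hL : Function.Injective L) {r : ℝ≥0∞} [Fact (1 ≤ r)] :
    Function.Injective (lpMap L r μ) := by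
  intro F G h
  refine Lp.ext ?_
  filter_upwards [coeFn_lpMap L F, coeFn_lpMap L G] with t h1 h2
  exact hL (by rw [← h1, ← h2, h])

/-- A sequence bounded in `L^p(E)` with values in a closed convex set of `E` whose images in a
larger space agree with those of a convergent sequence converges weakly. -/
theorem IsClarkson.exists_lp_weak_limit [CompleteSpace E] {p : ℝ} [Fact (1 ≤ ENNReal.ofReal p)]
    (hp : 0 < p) {Ψ : E → ℝ} (hΨ : IsClarkson p Ψ) (hΨc : Continuous Ψ) {L : E →L[ℝ] Y}
    (hL : Function.Injective L) {K : Set E} (hK : Convex ℝ K) (hKc : IsClosed K)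
    {F : ℕ → Lp E (ENNReal.ofReal p) μ} {B : ℝ} (hB : ∀ n, ‖F n‖ ^ p ≤ B)
    (hFK : ∀ n, ∀ᵐ t ∂μ, F n t ∈ K) {E₀ : Type*} [NormedAddCommGroup E₀] [NormedSpace ℝ E₀]
    (L₀ : E₀ →L[ℝ] Y) {r : ℝ≥0∞} [Fact (1 ≤ r)] {F₀ : ℕ → Lp E₀ r μ} {G₀ : Lp E₀ r μ}
    (hF₀ : Tendsto F₀ atTop (𝓝 G₀)) (hFF₀ : ∀ n, ∀ᵐ t ∂μ, L (F n t) = L₀ (F₀ n t)) :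
    ∃ H : Lp E (ENNReal.ofReal p) μ, (∀ᵐ t ∂μ, H t ∈ K) ∧ (∀ᵐ t ∂μ, L (H t) = L₀ (G₀ t)) ∧
      ∀ ℓ : StrongDual ℝ (Lp E (ENNReal.ofReal p) μ), Tendsto (fun n => ℓ (F n)) atTop (𝓝 (ℓ H)) := by
  have hΦ := hΨ.lp μ hΨc
  obtain ⟨C, hC0, hC⟩ := hΦ.bounded
  have hbound (n : ℕ) := (hC (F n)).trans (mul_le_mul_of_nonneg_left (hB n) hC0)
  have hval (n : ℕ) : lpMap L _ μ (F n) = lpMap L₀ r μ (F₀ n) := by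
    refine Lp.ext ?_
    filter_upwards [coeFn_lpMap L (F n), coeFn_lpMap L₀ (F₀ n), hFF₀ n] with t h1 h2 h3
    rw [h1, h2, h3]
  have hz : Tendsto (fun n => lpMap L _ μ (F n)) atTop (𝓝 (lpMap L₀ r μ G₀)) := by
    simp only [hval]
    exact ((lpMap L₀ r μ).continuous.tendsto G₀).comp hF₀
  obtain ⟨H, hH, hHC, hweak⟩ := hΦ.exists_weak_limit hp (lpMap_injective hL) hbound hz
  obtain ⟨hcv, hcl⟩ := convex_isClosed_ae_mem (q := ENNReal.ofReal p) μ hK hKc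
  refine ⟨H, hHC _ hcv hcl hFK, ?_, hweak⟩
  filter_upwards [coeFn_lpMap L H, coeFn_lpMap L₀ G₀] with t h1 h2
  rw [← h1, ← h2, hH]

end Values

variable {d s : ℕ} {q r : ℝ≥0∞} [hq : Fact (1 ≤ q)]

theorem Represents.sobVal_eq {s' : ℕ} {q' : ℝ≥0∞} [Fact (1 ≤ q')] {w : SobolevSpace d s q}
    {w' : SobolevSpace d s' q'} {f : Vec d → Vec d} (h : Represents w f) (h' : Represents w' f) :
    sobVal w = sobVal w' :=
  Lp.ext (((represents_iff w f).1 h).trans ((represents_iff w' f).1 h').symm)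

variable {p : ℝ} {om : ℕ → Vec d → Vec d} {N : ℕ → ℕ} {c : ℕ → ℕ → ℝ → ℝ}

/-- The mollified velocities are bounded in `L^p(W^{1,p})` on bounded intervals of times. -/
theorem IsBoundedFamily.exists_integral_sobField_le [Fact (1 ≤ ENNReal.ofReal p)]
    (h : IsBoundedFamily p om N c) (hp : 2 ≤ p)
    {k : ℕ → Vec d → ℝ} {r : ℕ → ℝ} (hk : ∀ n, IsKernel (k n) (r n))
    (hf : ∀ n j, IsSolenoidalC1 (conv (k n) (om j))) {T : ℝ} (hT : 0 ≤ T) :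
    ∃ B, ∀ n, ∫ t in Icc 0 T,
      ‖sobField 1 (ENNReal.ofReal p) le_rfl (hf n) (N n) (c n) t‖ ^ p ≤ B := by
  obtain ⟨C, hC⟩ := h.gradient_le
  obtain ⟨M, hM0, hM⟩ := h.norm_field_sq_le
  set A : ℝ := 2 ^ (p - 1) * (d : ℝ) ^ p + 1 with hA
  set D : ℝ := 2 ^ (p - 1) * M ^ (p / 2) with hD
  have hA0 : 0 ≤ A := by positivity
  refine ⟨A * C + D * T, fun n => ?_⟩
  set g : ℝ → ℝ := fun t => ∫ x, ‖fderiv ℝ (field om (N n) (c n) t) x‖ ^ p ∂(cell d) with hg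
  have cg : Continuous g := continuous_integral_cell (((continuous_fderiv_sum_mul h.frame
    (Finset.range (N n + 1)) (h.continuous n)).norm).rpow_const fun _ => Or.inr (by linarith))
  have hle (t : ℝ) : ‖sobField 1 (ENNReal.ofReal p) le_rfl (hf n) (N n) (c n) t‖ ^ p
      ≤ A * g t + D := by
    have hs := h.frame.solenoidal_field (N n) (c n) t
    rw [sobField_eq_toSob, norm_toSob_one_rpow (by linarith), ← (hk n).conv_field h.frame]
    have h1 := (hk n).integral_norm_conv_rpow_le (by linarith : 1 ≤ p) hs.contDiff.continuous
      hs.periodic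
    have h2 := integral_norm_rpow_le_poincare hp hs.contDiff hs.periodic
    have h3 := (hk n).integral_norm_conv_rpow_le (by linarith : 1 ≤ p)
      (hs.contDiff.continuous_fderiv one_ne_zero) (isTorusFn_fderiv hs.periodic)
    have h4 : fderiv ℝ (conv (k n) (field om (N n) (c n) t))
        = conv (k n) (fderiv ℝ (field om (N n) (c n) t)) :=
      funext fun x => ((hk n).hasFDerivAt_conv hs.contDiff hs.periodic x).fderiv
    have h5 : (∫ x, ‖field om (N n) (c n) t x‖ ^ (2 : ℝ) ∂(cell d)) ^ (p / 2) ≤ M ^ (p / 2) := by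
      simp only [Real.rpow_two]
      exact Real.rpow_le_rpow (integral_nonneg fun x => by positivity) (hM n t) (by linarith)
    have h6 := mul_le_mul_of_nonneg_left h5 (by positivity : (0 : ℝ) ≤ 2 ^ (p - 1))
    rw [h4]
    have e : A * g t + D = 2 ^ (p - 1) * ((d : ℝ) ^ p * g t) + 2 ^ (p - 1) * M ^ (p / 2) + g t := by
      rw [hA, hD]
      ring
    rw [e]
    linarith
  have cS := (continuous_sobField (s := 1) (q := ENNReal.ofReal p) (hs := le_rfl) (hf := hf n)
    (N := N n) (h.continuous n)).norm.rpow_const (p := p) fun _ => Or.inr (by linarith)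
  calc _ ≤ ∫ t in Icc 0 T, (A * g t + D) :=
        setIntegral_mono cS.integrableOn_Icc
          ((continuous_const.mul cg).add continuous_const).integrableOn_Icc hle
    _ = ∫ t in (0 : ℝ)..T, (A * g t + D) := by
        rw [integral_Icc_eq_integral_Ioc, intervalIntegral.integral_of_le hT]
    _ = A * (∫ t in (0 : ℝ)..T, g t) + D * T := by
        rw [intervalIntegral.integral_add ((cg.intervalIntegrable _ _).const_mul A)
          intervalIntegrable_const, intervalIntegral.integral_const_mul,
          intervalIntegral.integral_const, smul_eq_mul, sub_zero, mul_comm T]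
    _ ≤ A * C + D * T := by
        gcongr
        exact hC n T hT

set_option maxHeartbeats 1000000 in
/-- A sequence bounded in `L^p(W^{1,p})` with values in `V^{1,p}` that converges strongly in
`L²(L²)` converges weakly to the same limit. -/
theorem exists_bochner_weak_limit [Fact (1 ≤ ENNReal.ofReal p)] (hp : 2 ≤ p) {T : ℝ}
    {F : ℕ → Lp (SobolevSpace d 1 (ENNReal.ofReal p)) (ENNReal.ofReal p)
      (volume.restrict (Icc 0 T))} {B : ℝ} (hB : ∀ n, ‖F n‖ ^ p ≤ B)
    (hV : ∀ n, ∀ᵐ t ∂(volume.restrict (Icc 0 T)), F n t ∈ V d 1 (ENNReal.ofReal p))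
    {f : ℕ → ℝ → Vec d → Vec d} (hf : ∀ n, BochnerRepresents (F n) (f n)) {v : ℝ → Vec d → Vec d}
    (hv : TendstoStrongly d 0 2 2 (Icc 0 T) f v) :
    ∃ H : Lp (SobolevSpace d 1 (ENNReal.ofReal p)) (ENNReal.ofReal p) (volume.restrict (Icc 0 T)),
      (∀ᵐ t ∂(volume.restrict (Icc 0 T)), H t ∈ V d 1 (ENNReal.ofReal p)) ∧
      BochnerRepresents H v ∧ ∀ ℓ : StrongDual ℝ (Lp (SobolevSpace d 1 (ENNReal.ofReal p))
        (ENNReal.ofReal p) (volume.restrict (Icc 0 T))),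
          Tendsto (fun n => ℓ (F n)) atTop (𝓝 (ℓ H)) := by
  obtain ⟨F₀, G₀, hF₀, hG₀, hlim⟩ := hv
  obtain ⟨H, hHV, hHL, hweak⟩ := (isClarkson_sobolev hp).exists_lp_weak_limit (by linarith)
    (continuous_finsetSum _ fun z _ => (jetCoord z).continuous.norm.rpow_const
      fun _ => Or.inr (by linarith)) sobVal_injective convex_V isClosed_V hB hV sobVal hlim
    fun n => by
      filter_upwards [hF₀ n, hf n] with t h3 h4
      exact h4.sobVal_eq h3
  refine ⟨H, hHV, ?_, hweak⟩
  filter_upwards [hHL, hG₀] with t h1 h3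
  rw [represents_iff] at h3 ⊢
  rwa [h1]

/-- The strong limit of the mollified velocities is also their weak limit in `L^p(W^{1,p})`, and it
takes its values in `V^{1,p}`. -/
theorem IsBoundedFamily.tendstoWeakly [Fact (1 ≤ ENNReal.ofReal p)]
    (h : IsBoundedFamily p om N c) (hp : 2 ≤ p)
    {k : ℕ → Vec d → ℝ} {r : ℕ → ℝ} (hk : ∀ n, IsKernel (k n) (r n)) {T : ℝ} (hT : 0 ≤ T)
    {v : ℝ → Vec d → Vec d} (hv : TendstoStrongly d 0 2 2 (Icc 0 T)
      (fun n t => conv (k n) (field om (N n) (c n) t)) v) :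
    MemBochnerV d 1 (ENNReal.ofReal p) (ENNReal.ofReal p) (Icc 0 T) v ∧
      TendstoWeakly d 1 (ENNReal.ofReal p) (ENNReal.ofReal p) (Icc 0 T)
        (fun n t => conv (k n) (field om (N n) (c n) t)) v := by
  obtain ⟨R, hR⟩ := h.exists_abs_le
  have hmem (n j : ℕ) : conv (k n) (om j) ∈ SmoothSolenoidal d := (h.frame.solenoidal j).conv (hk n)
  have hf (n j : ℕ) : IsSolenoidalC1 (conv (k n) (om j)) := isSolenoidalC1_of_mem (hmem n j)
  have hfm (n : ℕ) : MemLp (sobField 1 (ENNReal.ofReal p) le_rfl (hf n) (N n) (c n))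
      (ENNReal.ofReal p) (volume.restrict (Icc 0 T)) :=
    memLp_sobField (h.continuous n) (hR n) _ _
  obtain ⟨B, hB⟩ := h.exists_integral_sobField_le hp hk hf hT
  have hrep (n : ℕ) : BochnerRepresents ((hfm n).toLp _)
      (fun t => conv (k n) (field om (N n) (c n) t)) := by
    filter_upwards [(hfm n).coeFn_toLp] with t ht
    rw [ht, (hk n).conv_field h.frame]
    exact represents_sobField t
  have hnorm (n : ℕ) : ‖(hfm n).toLp _‖ ^ p ≤ B := by
    have e := norm_toLp_rpow (zero_lt_one.trans_le Fact.out).ne' ENNReal.ofReal_ne_top (hfm n)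
    rw [ENNReal.toReal_ofReal (by linarith)] at e
    exact e.trans_le (hB n)
  have hFV (n : ℕ) : ∀ᵐ t ∂(volume.restrict (Icc 0 T)),
      (hfm n).toLp _ t ∈ V d 1 (ENNReal.ofReal p) := by
    filter_upwards [(hfm n).coeFn_toLp] with t ht
    rw [ht]
    exact sobField_mem_V (hmem n) t
  obtain ⟨H, hHV, hHrep, hweak⟩ := exists_bochner_weak_limit hp hnorm hFV hrep hv
  exact ⟨⟨H, Lp.memLp H, hHV.and hHrep⟩, _, H, hrep, hHrep, hweak⟩

end WeakLimit

end TwoPhaseFlow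

end

open TwoPhaseFlow

theorem mainTheorem5 (d : ℕ) (hd : d = 2 ∨ d = 3)
    (p : ℝ) (hp : ((d : ℝ) + 2) / 2 < p) [Fact (1 ≤ ENNReal.ofReal p)]
    -- the two stress laws
    (ν₀ : ℝ) (hν₀ : 0 < ν₀) (τp τm : TwoPhaseFlow.SymMat d → TwoPhaseFlow.SymMat d)
    (hτp : TwoPhaseFlow.IsStressLaw p ν₀ τp) (hτm : TwoPhaseFlow.IsStressLaw p ν₀ τm)
    -- the initial velocity and the Galerkin basis
    (u₀ : TwoPhaseFlow.Vec d → TwoPhaseFlow.Vec d) (hu₀ : TwoPhaseFlow.MemV d 0 2 u₀)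
    (s : ℕ) (hs : (d : ℝ) / 2 + 1 < s)
    (om : ℕ → TwoPhaseFlow.Vec d → TwoPhaseFlow.Vec d) (hom : TwoPhaseFlow.IsGalerkinBasis s om)
    -- the phase-field parameters and the mollifier
    (ε : ℕ → ℝ) (hε_pos : ∀ i, 0 < ε i) (hε : Filter.Tendsto ε Filter.atTop (nhds 0))
    (γ : ℝ) (hγ_pos : 0 < γ) (hγ : γ < 1 / 2)
    (ζ : TwoPhaseFlow.Vec d → ℝ) (hζ : TwoPhaseFlow.IsMollifier ζ)
    -- the initial phase, its regular approximations and the initial phase fields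
    (A₀ : Set (TwoPhaseFlow.Vec d)) (hA₀ : TwoPhaseFlow.IsCkDomain 1 A₀)
    (A : ℕ → Set (TwoPhaseFlow.Vec d)) (b : ℕ → ℝ)
    (hA : TwoPhaseFlow.IsPhaseApproximation ε b A A₀)
    (h : ℝ → ℝ) (hh : TwoPhaseFlow.IsProfile h)
    -- the approximate solutions
    (u : ℕ → ℝ → TwoPhaseFlow.Vec d → TwoPhaseFlow.Vec d)
    (φ : ℕ → ℝ → TwoPhaseFlow.Vec d → ℝ)
    (hsol : ∀ i, TwoPhaseFlow.IsApproxSolution p τp τm (TwoPhaseFlow.rescale γ ζ (ε i)) (ε i) om i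
      u₀ (TwoPhaseFlow.initialPhase h (ε i) (b i) (A i)) (u i) (φ i)) :
    ∃ κ : ℕ → ℕ, StrictMono κ ∧ ∃ v : ℝ → TwoPhaseFlow.Vec d → TwoPhaseFlow.Vec d,
      TwoPhaseFlow.MemBochnerV d 0 2 ⊤ (Set.Ici 0) v ∧
      ∀ T : ℝ, 0 < T →
        TwoPhaseFlow.MemBochnerV d 1 (ENNReal.ofReal p) (ENNReal.ofReal p) (Set.Icc 0 T) v ∧
        TwoPhaseFlow.TendstoWeakly d 1 (ENNReal.ofReal p) (ENNReal.ofReal p) (Set.Icc 0 T)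
          (fun n t => TwoPhaseFlow.mollify (TwoPhaseFlow.rescale γ ζ (ε (κ n))) (u (κ n) t)) v ∧
        TwoPhaseFlow.TendstoStrongly d 0 2 2 (Set.Icc 0 T)
          (fun n t => TwoPhaseFlow.mollify (TwoPhaseFlow.rescale γ ζ (ε (κ n))) (u (κ n) t)) v := by
  have hd0 : 0 < d := by omega
  have hp2 : 2 ≤ p := by
    have : (2 : ℝ) ≤ d := by exact_mod_cast (by omega : 2 ≤ d)
    linarith
  obtain ⟨C, hC⟩ := exists_initial_energy_bound hε_pos hA₀ hA hh
  obtain ⟨i₀, hi₀⟩ := eventually_atTop.1 hC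
  have hk (i : ℕ) := isKernel_rescale (γ := γ) hζ hd0 (hε_pos i)
  -- the bound of the initial phase energy holds from some index on
  have hfam := exists_isBoundedFamily hp2 hν₀ hτp hτm hom.isSolenoidalFrame hu₀.memLp_two
    (fun i => hε_pos (i₀ + i)) (fun i => hk (i₀ + i)) (fun i => hi₀ (i₀ + i) (by omega))
    fun i => hsol (i₀ + i)
  obtain ⟨κ, hκ, hconv⟩ := hfam.exists_subsequence
  have hsub := hfam.subsequence κ
  have hκ' : StrictMono fun n => i₀ + κ n := fun m n hmn => by
    simpa using hκ hmn
  have hr : Tendsto (fun n => ε (i₀ + κ n) ^ (γ / (d : ℝ))) atTop (𝓝 0) := by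
    have hγd : 0 < γ / d := by positivity
    have h1 := (hε.comp hκ'.tendsto_atTop).rpow_const (p := γ / d) (Or.inr hγd.le)
    rwa [Real.zero_rpow hγd.ne'] at h1
  have hu (n : ℕ) (t : ℝ) (ht : 0 ≤ t) :
      conv (rescale γ ζ (ε (i₀ + κ n)))
          (field om (i₀ + κ n) (coeff om (u (i₀ + κ n))) t)
        = mollify (rescale γ ζ (ε (i₀ + κ n))) (u (i₀ + κ n) t) := by
    rw [← (hsol (i₀ + κ n)).eq_field hom.isSolenoidalFrame ht]
    rfl
  obtain ⟨v, hv, hstrong⟩ := hsub.exists_strong_limit hp2 hconv (fun n => hk (i₀ + κ n)) hr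
  refine ⟨fun n => i₀ + κ n, hκ', v, hv, fun T hT => ?_⟩
  obtain ⟨hvp, F, G, hF, hG, hweak⟩ :=
    hsub.tendstoWeakly hp2 (fun n => hk (i₀ + κ n)) hT.le (hstrong T)
  obtain ⟨F', G', hF', hG', hlim⟩ := hstrong T
  exact ⟨hvp, ⟨F, G, fun n => (hF n).congr (hu n), hG, hweak⟩,
    F', G', fun n => (hF' n).congr (hu n), hG', hlim⟩
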